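/- Work in the piecewise-linear (PL) category. Let $n\ge 1$, let $\mathcal S=\{\Delta_1,\dots,\Delta_k\}$ be finitely many disjoint copies of the standard $n$-simplex, and let $\mathcal P$ be a face-pairing on $\mathcal S$, i.e. a set of simplicial isomorphisms between codimension-$1$ faces of the $\Delta_i$ such that each such face occurs exactly once as the source or target of an element of $\mathcal P$. Let $X=\mathcal S/\mathcal P$ be the space obtained by glueing the simplices along $\mathcal P$ (not necessarily connected), and let $X^*$ be $X$ minus the projections of the vertices of the $\Delta_i$. Let $\Delta_i^\partial$ be $\Delta_i$ minus the open stars of its vertices in its second barycentric subdivision; the elements of $\mathcal P$ restrict to glueings between the $\Delta_i^\partial$, and $X^\partial$ is the resulting space. All these spaces carry their natural PL structures. Then: (1) $X^*$ is an open PL $n$-manifold (without boundary and without compact components) if and only if $X^\partial$ is a compact PL $n$-manifold with (possibly empty) boundary; and in this case $X^*$ is PL homeomorphic to $X^\partial\setminus\partial X^\partial$, where $\partial X^\partial$ is the manifold boundary. (2) If $n\ge 2$, then $X$ is a closed PL $n$-manifold (compact and without boundary) if and only if $X^\partial$ is a compact PL $n$-manifold with boundary and every connected component of $\partial X^\partial$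 is PL homeomorphic to the sphere $S^{n-1}$. -/

import Mathlib

open Set Filter Topology

/-! ### Piecewise-linear (PL) structures

A PL structure on a topological space is described by its sheaf of real-valued PL functions:
for every function `f` and every point `y` we record whether `f` is piecewise linear on a
neighbourhood of `y`. The only structures used below are built from the one of `ℝ^m` by passing to
subsets, disjoint unions and quotients (glueings). -/

/-- A PL structure on `Y`, given by the germs of real-valued PL functions. -/
class PLStructure (Y : Type*) [TopologicalSpace Y] where
  /-- `PLAt f y`: the function `f` is piecewise linear near `y`. -/
  PLAt : (Y → ℝ) → Y → Prop
  /-- being PL near `y` depends on the germ at `y` only -/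
  congr_germ : ∀ {f g : Y → ℝ} {y : Y}, f =ᶠ[𝓝 y] g → PLAt f y → PLAt g y

open PLStructure (PLAt)

/-- The standard PL structure of `ℝ^ι`: `f` is PL near `x` if a neighbourhood of `x` is covered by
finitely many convex polytopes on each of which `f` agrees with an affine function. -/
instance PLStructure.euclidean (ι : Type*) [Fintype ι] : PLStructure (ι → ℝ) where
  PLAt f x := ∃ T : Set (Finset (ι → ℝ)), T.Finite ∧
    (⋃ V ∈ T, convexHull ℝ (V : Set (ι → ℝ))) ∈ 𝓝 x ∧
    ∃ U ∈ 𝓝 x, ∀ V ∈ T, ∃ a : (ι → ℝ) →ᵃ[ℝ] ℝ, EqOn f a (convexHull ℝ (V : Set (ι → ℝ)) ∩ U)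
  congr_germ := by
    rintro f g x hfg ⟨T, hfin, hcov, U, hU, h⟩
    refine ⟨T, hfin, hcov, U ∩ {z | f z = g z}, inter_mem hU hfg, fun V hV => ?_⟩
    obtain ⟨a, ha⟩ := h V hV
    exact ⟨a, fun z hz => (hz.2.2 : f z = g z).symm.trans (ha ⟨hz.1, hz.2.1⟩)⟩

/-- The PL structure of a subset: a function is PL near `y` if near `y` it is the restriction of a
PL function of the ambient space. -/
instance PLStructure.subtype {Y : Type*} [TopologicalSpace Y] [PLStructure Y] (p : Y → Prop) :
    PLStructure (Subtype p) where
  PLAt f y := ∃ g : Y → ℝ, PLAt g y.1 ∧ f =ᶠ[𝓝 y] fun z => g z.1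
  congr_germ := by
    rintro f f' y h ⟨g, hg, hfg⟩
    exact ⟨g, hg, h.symm.trans hfg⟩

/-- The PL structure of a disjoint union. -/
instance PLStructure.sigma {J : Type*} {Y : J → Type*} [∀ j, TopologicalSpace (Y j)]
    [∀ j, PLStructure (Y j)] : PLStructure (Sigma Y) where
  PLAt f y := PLAt (fun z : Y y.1 => f ⟨y.1, z⟩) y.2
  congr_germ := by
    rintro f g ⟨j, y⟩ h hf
    exact PLStructure.congr_germ
      ((continuous_sigmaMk (σ := Y) (i := j)).continuousAt.eventually h) hf

/-- The PL structure of a quotient: a function is PL near `y` if its pull-back is PL near every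
point of the fibre over `y`. -/
instance PLStructure.quot {Y : Type*} [TopologicalSpace Y] [PLStructure Y] (r : Y → Y → Prop) :
    PLStructure (Quot r) where
  PLAt f y := ∀ x : Y, Quot.mk r x = y → PLAt (fun z => f (Quot.mk r z)) x
  congr_germ := by
    rintro f g y h hf x rfl
    exact PLStructure.congr_germ (continuous_quot_mk.continuousAt.eventually h) (hf x rfl)

section Maps

variable {Y Z : Type*} [TopologicalSpace Y] [PLStructure Y] [TopologicalSpace Z] [PLStructure Z]

/-- A map is PL near `y` if it is continuous at `y` and pulls PL functions near its value back to
PL functions near `y`. -/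
def IsPLMapAt (f : Y → Z) (y : Y) : Prop :=
  ContinuousAt f y ∧ ∀ g : Z → ℝ, PLAt g (f y) → PLAt (g ∘ f) y

/-- A homeomorphism between open subsets is a PL homeomorphism if it and its inverse are PL. -/
def IsPLLocalHomeo (e : OpenPartialHomeomorph Y Z) : Prop :=
  (∀ y ∈ e.source, IsPLMapAt e y) ∧ ∀ z ∈ e.target, IsPLMapAt e.symm z

variable (Y Z) in
/-- `Y` and `Z` are PL homeomorphic. -/
def PLHomeomorphic : Prop :=
  ∃ h : Y ≃ₜ Z, (∀ y, IsPLMapAt h y) ∧ ∀ z, IsPLMapAt h.symm z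

end Maps

/-! ### PL manifolds -/

/-- The closed half-space of `ℝ^n` of the points with non-negative first coordinate. -/
abbrev PLHalfSpace (n : ℕ) [NeZero n] : Type := {x : Fin n → ℝ // 0 ≤ x 0}

/-- The PL sphere of dimension `n - 1`: the boundary of the standard `n`-simplex. -/
abbrev PLSphere (n : ℕ) : Type :=
  {x : Fin (n + 1) → ℝ // x ∈ stdSimplex ℝ (Fin (n + 1)) ∧ ∃ i, x i = 0}

section Manifolds

variable (n : ℕ) (Y : Type*) [TopologicalSpace Y] [PLStructure Y]

/-- PL `n`-manifolds (without boundary). -/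
def IsPLManifold : Prop :=
  T2Space Y ∧ SecondCountableTopology Y ∧
    ∀ y : Y, ∃ e : OpenPartialHomeomorph Y (Fin n → ℝ), y ∈ e.source ∧ IsPLLocalHomeo e

/-- Closed PL `n`-manifolds: compact and without boundary. -/
def IsClosedPLManifold : Prop := CompactSpace Y ∧ IsPLManifold n Y

/-- Open PL `n`-manifolds: without boundary and without compact components. -/
def IsOpenPLManifold : Prop :=
  IsPLManifold n Y ∧ ∀ y : Y, ¬ IsCompact (connectedComponent y)

variable [NeZero n]

/-- Compact PL `n`-manifolds with (possibly empty) boundary. -/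
def IsCompactPLManifoldWithBoundary : Prop :=
  CompactSpace Y ∧ T2Space Y ∧ SecondCountableTopology Y ∧
    ∀ y : Y, ∃ e : OpenPartialHomeomorph Y (PLHalfSpace n), y ∈ e.source ∧ IsPLLocalHomeo e

/-- The boundary of a PL `n`-manifold: the points which some PL chart to the half-space takes to
the bounding hyperplane. -/
def plBoundary : Set Y :=
  {y | ∃ e : OpenPartialHomeomorph Y (PLHalfSpace n),
    y ∈ e.source ∧ IsPLLocalHomeo e ∧ (e y).1 0 = 0}

end Manifolds

/-! ### Barycentric subdivisions and truncated simplices -/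

section Subdivision

variable {E : Type*} [AddCommGroup E] [Module ℝ E]

/-- The barycentric subdivision of a simplicial complex. A complex is given by its simplices, and
a simplex by the finite set of its vertices. -/
def barycentricSubdivision (K : Set (Finset E)) : Set (Finset E) :=
  {t | ∃ c : Set (Finset E), c.Nonempty ∧ c ⊆ K ∧ IsChain (· ⊆ ·) c ∧
    (t : Set E) = (fun s : Finset E => s.centroid ℝ id) '' c}

end Subdivision

/-- The complex consisting of the standard `n`-simplex and all its faces. -/
def stdSimplexComplex (n : ℕ) : Set (Finset (Fin (n + 1) → ℝ)) :=
  {t | t.Nonempty ∧ (t : Set (Fin (n + 1) → ℝ)) ⊆ range fun i => Pi.single i (1 : ℝ)}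

/-- The open star of a vertex: the union of the (relative) interiors of the simplices that
contain it. -/
def openStar {m : ℕ} (K : Set (Finset (Fin m → ℝ))) (v : Fin m → ℝ) : Set (Fin m → ℝ) :=
  ⋃ s ∈ {s ∈ K | v ∈ s}, intrinsicInterior ℝ (convexHull ℝ (s : Set (Fin m → ℝ)))

/-- The truncated `n`-simplex: the open stars of the original vertices in the second barycentric
subdivision are removed from the standard `n`-simplex. -/
def truncatedSimplex (n : ℕ) : Set (Fin (n + 1) → ℝ) :=
  stdSimplex ℝ (Fin (n + 1)) \ ⋃ i : Fin (n + 1),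
    openStar (barycentricSubdivision (barycentricSubdivision (stdSimplexComplex n)))
      (Pi.single i 1)

/-! ### Face-pairings and the resulting spaces -/

/-- A face-pairing on `k` copies of the standard `n`-simplex. The pair `(i, v)` stands for the
codimension-1 face of the `i`-th simplex opposite to its vertex `v`. Faces are matched in pairs of
distinct faces, and the simplicial isomorphism between two matched faces is encoded as a bijection
of the vertices of the two simplices by letting the vertex opposite to the first face correspond
to the vertex opposite to the second one. -/
structure FacePairing (k n : ℕ) where
  /-- the face glued to a given face -/
  partner : Fin k × Fin (n + 1) → Fin k × Fin (n + 1)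
  /-- the vertex bijection that describes the glueing of a face to its partner -/
  vertexMap : Fin k × Fin (n + 1) → Equiv.Perm (Fin (n + 1))
  partner_ne : ∀ F, partner F ≠ F
  partner_partner : ∀ F, partner (partner F) = F
  vertexMap_opposite : ∀ F, vertexMap F F.2 = (partner F).2
  vertexMap_partner : ∀ F, vertexMap (partner F) = (vertexMap F).symm

namespace FacePairing

variable {k n : ℕ} (P : FacePairing k n)

/-- The identifications prescribed by the pairing on the disjoint union of `k` copies of a subset
`A` of the standard simplex: the point `p` lies on some face, and `q` is its image under the
glueing of that face. -/
def Glued (A : Set (Fin (n + 1) → ℝ)) (p q : (_ : Fin k) × A) : Prop :=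
  ∃ v : Fin (n + 1), p.2.1 v = 0 ∧ q.1 = (P.partner (p.1, v)).1 ∧
    ∀ w, q.2.1 (P.vertexMap (p.1, v) w) = p.2.1 w

/-- The space `X` obtained by glueing the simplices. -/
abbrev Space : Type := Quot (P.Glued (stdSimplex ℝ (Fin (n + 1))))

/-- The projections to `X` of the vertices of the simplices. -/
def vertices : Set P.Space :=
  range fun a : Fin k × Fin (n + 1) =>
    Quot.mk _ ⟨a.1, ⟨Pi.single a.2 1, single_mem_stdSimplex ℝ a.2⟩⟩

/-- The space `X^*`: the projections of the vertices are removed from `X`. -/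
abbrev PuncturedSpace : Type := ↥(P.vertices)ᶜ

/-- The space `X^∂` obtained by glueing the truncated simplices. -/
abbrev TruncatedSpace : Type := Quot (P.Glued (truncatedSimplex n))

end FacePairing

/-! A function on `ℝ^m` is PL near a point exactly when, near that point, it is continuous and
everywhere takes the value of one of finitely many affine functions. This notion `IsSel` is closed
under composition, sums, maxima and minima, and it also describes the PL structure of the standard
simplex, which is a local PL retract. It takes the place of triangulations throughout, and whatever
lives on a glued space is checked on the finitely many lifts of a point, because the projection is a
closed map.

Geometry. `gam j` is one minus the barycentric coordinate at the vertex `j` in the second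
barycentric subdivision. It is PL, positively homogeneous about `j` and equivariant under
permutations. Hence the minimum of the `gam j` descends to a PL function `tau` on `X`. The vertices
are `{tau = 0}` and `X^∂` is `{tau ≥ 1}`. On `{tau < starRadius}`, where `starRadius > 1`, the space
is a union of cones over the links `{tau = 1}`, and `rad t` dilates these cones.

Statement (1). Radial pushing is not PL, but reparametrizing the partial sums of the star
coordinates by a PL function of two variables is, and it carries `{tau > 0}` onto `{tau > 1}`. It
remains to see that `∂X^∂ = {tau = 1}`. A point with `tau > 1` is never a boundary point: otherwise
a general position argument gives a nearby boundary point in an open simplex or an open facet, where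
`X` has PL open maps to `ℝ^n`, whereas no PL map from the half-space to `ℝ^n` is open near a point
of the bounding hyperplane (`not_isOpenMap_halfSpace`). If `X^*` is a manifold, a point `z` with
`tau z = 1` is moved slightly towards the vertex. Chart and `tau` are both affine on short segments
ending at `z`, so in the chart there is a direction along which `tau` grows at unit speed. A shear
turns `tau` into a coordinate, and this gives a half-space chart (`exists_isPLChart_tau`). The
absence of compact components is automatic, since every component of `X^*` comes arbitrarily close
to a vertex.

Statement (2). For `n ≥ 2` the components of `{tau = 1}` are the links of the vertices. If `X` is a
manifold, then `tau`, read in a chart at a vertex, and the gauge of a simplex are two positive PL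
germs. Both are linear on the cones of a common complete simplicial fan, so rescaling the rays
carries one to the other (`exists_isPLChart_comp_eq`). Level sets then correspond, and the link is
PL homeomorphic to the boundary of a simplex. Conversely, a PL homeomorphism from the link to that
boundary is coned off to a chart at the vertex. Its inverse is PL away from the vertex because local
inverses of PL maps are PL (`isSel_of_inverse`), and at the vertex by homogeneity. -/

/-! ### Continuous selections of affine functions -/

/-- Near `z`, the function `f` is continuous and selects its values among finitely many affine
functions of the coordinates `j`. -/
def IsSel {Z ι : Type*} [TopologicalSpace Z] (j : Z → ι → ℝ) (f : Z → ℝ) (z : Z) : Prop :=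
  ∃ S : Set ((ι → ℝ) →ᵃ[ℝ] ℝ), S.Finite ∧ ∀ᶠ y in 𝓝 z, ContinuousAt f y ∧ ∃ a ∈ S, f y = a (j y)

theorem continuous_affine {ι : Type*} [Finite ι] (a : (ι → ℝ) →ᵃ[ℝ] ℝ) : Continuous a := by
  have := Fintype.ofFinite ι
  exact a.continuous_of_finiteDimensional

namespace IsSel

variable {Z Z' ι ι' : Type*} [TopologicalSpace Z] [TopologicalSpace Z']
  {j : Z → ι → ℝ} {j' : Z' → ι' → ℝ} {f g : Z → ℝ} {z : Z}

theorem continuousAt (hf : IsSel j f z) : ContinuousAt f z := by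
  obtain ⟨S, -, h⟩ := hf
  exact h.self_of_nhds.1

theorem eventually (hf : IsSel j f z) : ∀ᶠ y in 𝓝 z, IsSel j f y := by
  obtain ⟨S, hS, h⟩ := hf
  filter_upwards [h.eventually_nhds] with y hy using ⟨S, hS, hy⟩

theorem congr (hf : IsSel j f z) (h : f =ᶠ[𝓝 z] g) : IsSel j g z := by
  obtain ⟨S, hS, hS'⟩ := hf
  refine ⟨S, hS, ?_⟩
  filter_upwards [hS', h.eventually_nhds] with y hy hfg
  refine ⟨hy.1.congr hfg, ?_⟩
  rw [← hfg.self_of_nhds]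
  exact hy.2

theorem affine [Finite ι] (hj : Continuous j) (a : (ι → ℝ) →ᵃ[ℝ] ℝ) (z : Z) :
    IsSel j (fun y => a (j y)) z :=
  ⟨{a}, finite_singleton a, Eventually.of_forall fun _ =>
    ⟨((continuous_affine a).comp hj).continuousAt, a, rfl, rfl⟩⟩

theorem const (c : ℝ) (z : Z) : IsSel j (fun _ => c) z :=
  ⟨{AffineMap.const ℝ _ c}, finite_singleton _, Eventually.of_forall fun _ =>
    ⟨continuousAt_const, _, rfl, rfl⟩⟩

theorem coord [Finite ι] (hj : Continuous j) (i : ι) (z : Z) : IsSel j (fun y => j y i) z :=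
  affine hj (LinearMap.proj (R := ℝ) (φ := fun _ : ι => ℝ) i).toAffineMap z

/-- Substituting finitely many affine candidates for the coordinates into finitely many affine
candidates for `h` leaves finitely many composites. -/
theorem comp [Finite ι'] {h : Z' → ℝ} {F : Z → Z'} (hh : IsSel j' h (F z))
    (hF : ∀ᶠ y in 𝓝 z, ContinuousAt F y) (hFj : ∀ i, IsSel j (fun y => j' (F y) i) z) :
    IsSel j (fun y => h (F y)) z := by
  obtain ⟨S, hS, h1⟩ := hh
  choose R hR h2 using hFj
  refine ⟨(fun p : ((ι' → ℝ) →ᵃ[ℝ] ℝ) × (ι' → (ι → ℝ) →ᵃ[ℝ] ℝ) => p.1.comp (AffineMap.pi p.2)) ''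
    (S ×ˢ Set.pi univ R), (hS.prod (Set.Finite.pi' fun i => hR i |>.subset fun _ h => h) |>.subset
      (by rintro ⟨a, b⟩ ⟨ha, hb⟩; exact ⟨ha, fun i => hb i trivial⟩)).image _, ?_⟩
  filter_upwards [hF, hF.self_of_nhds.eventually h1, eventually_all.2 h2] with y hy hy1 hy2
  refine ⟨hy1.1.comp hy, ?_⟩
  obtain ⟨a, ha, ha'⟩ := hy1.2
  choose b hb hb' using fun i => (hy2 i).2
  refine ⟨_, ⟨(a, b), ⟨ha, fun i _ => hb i⟩, rfl⟩, ?_⟩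
  simp only [ha', AffineMap.comp_apply]
  congr 1
  ext i
  simp [hb' i]

/-- Pulling back along a continuous map that preserves the coordinates. -/
theorem pullback {h : Z' → ℝ} {j' : Z' → ι → ℝ} {F : Z → Z'} (hh : IsSel j' h (F z))
    (hF : ∀ᶠ y in 𝓝 z, ContinuousAt F y) (hFj : ∀ᶠ y in 𝓝 z, j' (F y) = j y) :
    IsSel j (fun y => h (F y)) z := by
  obtain ⟨S, hS, h1⟩ := hh
  refine ⟨S, hS, ?_⟩
  filter_upwards [hF, hF.self_of_nhds.eventually h1, hFj] with y hy hy1 hy2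
  refine ⟨hy1.1.comp hy, ?_⟩
  simpa only [hy2] using hy1.2

theorem comp_pi [Finite ι'] {h : (ι' → ℝ) → ℝ} {F : ι' → Z → ℝ} (hF : ∀ i, IsSel j (F i) z)
    (hh : IsSel id h (fun i => F i z)) : IsSel j (fun y => h (fun i => F i y)) z := by
  refine IsSel.comp (j' := id) (F := fun y i => F i y) hh ?_ hF
  filter_upwards [eventually_all.2 fun i => (hF i).eventually] with y hy
  exact continuousAt_pi.2 fun i => (hy i).continuousAt

/-- Candidates of candidates are again finitely many affine candidates. This is how piecewise
definitions enter; continuity has to be supplied separately. -/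
theorem of_selection {κ : Type*} {F : κ → Z → ℝ} {K : Set κ} (hK : K.Finite)
    (hF : ∀ i ∈ K, IsSel j (F i) z)
    (hf : ∀ᶠ y in 𝓝 z, ContinuousAt f y ∧ ∃ i ∈ K, f y = F i y) : IsSel j f z := by
  choose! S hS hS' using hF
  refine ⟨⋃ i ∈ K, S i, hK.biUnion hS, ?_⟩
  filter_upwards [hf, (eventually_all_finite hK).2 hS'] with y hy hy'
  obtain ⟨hc, i, hi, h⟩ := hy
  obtain ⟨-, a, ha, ha'⟩ := hy' i hi
  exact ⟨hc, a, mem_biUnion hi ha, h.trans ha'⟩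

theorem lift₂ {h : ℝ → ℝ → ℝ} (hf : IsSel j f z) (hg : IsSel j g z)
    (hh : ∀ v : Fin 2 → ℝ, IsSel id (fun v : Fin 2 → ℝ => h (v 0) (v 1)) v) :
    IsSel j (fun y => h (f y) (g y)) z := by
  have := comp_pi (h := fun v : Fin 2 → ℝ => h (v 0) (v 1)) (F := ![f, g]) (j := j) (z := z)
    (by intro i; fin_cases i <;> simpa) (hh _)
  simpa using this

theorem add (hf : IsSel j f z) (hg : IsSel j g z) : IsSel j (fun y => f y + g y) z := by
  refine lift₂ (h := fun a b => a + b) hf hg fun v => ?_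
  exact affine continuous_id ((LinearMap.proj (R := ℝ) (φ := fun _ : Fin 2 => ℝ) 0).toAffineMap +
    (LinearMap.proj (R := ℝ) (φ := fun _ : Fin 2 => ℝ) 1).toAffineMap) v

theorem sub (hf : IsSel j f z) (hg : IsSel j g z) : IsSel j (fun y => f y - g y) z := by
  refine lift₂ (h := fun a b => a - b) hf hg fun v => ?_
  exact affine continuous_id ((LinearMap.proj (R := ℝ) (φ := fun _ : Fin 2 => ℝ) 0).toAffineMap -
    (LinearMap.proj (R := ℝ) (φ := fun _ : Fin 2 => ℝ) 1).toAffineMap) v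

theorem const_mul (c : ℝ) (hf : IsSel j f z) : IsSel j (fun y => c * f y) z := by
  refine lift₂ (h := fun a _ => c * a) hf hf fun v => ?_
  exact affine continuous_id
    (c • (LinearMap.proj (R := ℝ) (φ := fun _ : Fin 2 => ℝ) 0).toAffineMap) v

theorem mul_const (hf : IsSel j f z) (c : ℝ) : IsSel j (fun y => f y * c) z := by
  simpa only [mul_comm] using hf.const_mul c

theorem neg (hf : IsSel j f z) : IsSel j (fun y => -f y) z := by
  simpa using hf.const_mul (-1)

theorem max (hf : IsSel j f z) (hg : IsSel j g z) : IsSel j (fun y => Max.max (f y) (g y)) z := by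
  refine of_selection (F := ![f, g]) (K := univ) finite_univ
    (by intro i _; fin_cases i <;> simpa) ?_
  filter_upwards [hf.eventually, hg.eventually] with y h1 h2
  refine ⟨h1.continuousAt.max h2.continuousAt, ?_⟩
  rcases max_choice (f y) (g y) with h | h
  · exact ⟨0, trivial, by simpa using h⟩
  · exact ⟨1, trivial, by simpa using h⟩

theorem min (hf : IsSel j f z) (hg : IsSel j g z) : IsSel j (fun y => Min.min (f y) (g y)) z := by
  have := (hf.neg.max hg.neg).neg
  simpa [max_neg_neg] using this

theorem sum {κ : Type*} {F : κ → Z → ℝ} (s : Finset κ) (hF : ∀ i ∈ s, IsSel j (F i) z) :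
    IsSel j (fun y => ∑ i ∈ s, F i y) z := by
  classical
  induction s using Finset.induction_on with
  | empty => simpa using const 0 z
  | insert a s ha ih =>
    simp only [Finset.sum_insert ha]
    exact (hF a (by simp)).add (ih fun i hi => hF i (by simp [hi]))

theorem fold_max {κ : Type*} {F : κ → Z → ℝ} (s : Finset κ) (hf : IsSel j f z)
    (hF : ∀ i ∈ s, IsSel j (F i) z) :
    IsSel j (fun y => s.fold Max.max (f y) fun i => F i y) z := by
  classical
  induction s using Finset.induction_on with
  | empty => simpa using hf
  | insert a s ha ih =>
    simp only [Finset.fold_insert ha]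
    exact (hF a (by simp)).max (ih fun i hi => hF i (by simp [hi]))

theorem fold_min {κ : Type*} {F : κ → Z → ℝ} (s : Finset κ) (hf : IsSel j f z)
    (hF : ∀ i ∈ s, IsSel j (F i) z) :
    IsSel j (fun y => s.fold Min.min (f y) fun i => F i y) z := by
  classical
  induction s using Finset.induction_on with
  | empty => simpa using hf
  | insert a s ha ih =>
    simp only [Finset.fold_insert ha]
    exact (hF a (by simp)).min (ih fun i hi => hF i (by simp [hi]))

end IsSel

/-! ### Ordered selections are affine -/

/-- A non-negative affine function vanishes at a midpoint only if it vanishes at both ends, so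
passing to midpoints keeps all strict inequalities already achieved. The resulting point plays the
role of a relative interior point with respect to `Q`. -/
theorem exists_generic_point {ι : Type*} {C : Set (ι → ℝ)} (hC : Convex ℝ C) (hne : C.Nonempty)
    {Q : Set ((ι → ℝ) →ᵃ[ℝ] ℝ)} (hQ : Q.Finite) (hpos : ∀ d ∈ Q, ∀ z ∈ C, 0 ≤ d z) :
    ∃ z₀ ∈ C, ∀ d ∈ Q, d z₀ = 0 → ∀ z ∈ C, d z = 0 := by
  induction Q, hQ using Set.Finite.induction_on with
  | empty => obtain ⟨z, hz⟩ := hne; exact ⟨z, hz, by simp⟩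
  | @insert d Q hd hQ ih =>
    obtain ⟨z₀, hz₀, h₀⟩ := ih fun d hd => hpos d (mem_insert_of_mem _ hd)
    by_cases hz : ∀ z ∈ C, d z = 0
    · refine ⟨z₀, hz₀, ?_⟩
      rintro e (rfl | he) h0
      exacts [hz, h₀ e he h0]
    push Not at hz
    obtain ⟨z₁, hz₁, h₁⟩ := hz
    have hmid : ∀ e : (ι → ℝ) →ᵃ[ℝ] ℝ, e (AffineMap.lineMap z₀ z₁ (1 / 2 : ℝ)) =
        (e z₀ + e z₁) / 2 := by
      intro e
      rw [AffineMap.apply_lineMap, AffineMap.lineMap_apply_ring]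
      ring
    refine ⟨AffineMap.lineMap z₀ z₁ (1 / 2 : ℝ),
      hC.lineMap_mem hz₀ hz₁ ⟨by norm_num, by norm_num⟩, ?_⟩
    rintro e (rfl | he) h0
    · rw [hmid] at h0
      have h2 := hpos _ (mem_insert _ _) _ hz₀
      have h3 := hpos _ (mem_insert _ _) _ hz₁
      exact absurd (by linarith) h₁
    · rw [hmid] at h0
      have h2 := hpos _ (mem_insert_of_mem _ he) _ hz₀
      have h3 := hpos _ (mem_insert_of_mem _ he) _ hz₁
      exact h₀ e he (by linarith)

/-- Take the candidate `a` selected at a generic point `z₀`. Along the segment from `z₀` to `z`, a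
candidate that differs from `a` somewhere on `C` cannot meet `a` before the end, so connectedness
prevents `f` from leaving `a`, and continuity settles the endpoint. -/
theorem exists_eqOn_affine {ι : Type*} [Finite ι] {C : Set (ι → ℝ)} (hC : Convex ℝ C)
    (hne : C.Nonempty) {f : (ι → ℝ) → ℝ} (hf : ContinuousOn f C)
    {S : Set ((ι → ℝ) →ᵃ[ℝ] ℝ)} (hS : S.Finite) (hsel : ∀ z ∈ C, ∃ a ∈ S, f z = a z)
    (hord : ∀ a ∈ S, ∀ b ∈ S, (∀ z ∈ C, a z ≤ b z) ∨ ∀ z ∈ C, b z ≤ a z) :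
    ∃ a ∈ S, EqOn f a C := by
  obtain ⟨z₀, hz₀, h₀⟩ := exists_generic_point hC hne
    (Q := {d | (∃ a ∈ S, ∃ b ∈ S, b - a = d) ∧ ∀ z ∈ C, 0 ≤ d z})
    (((hS.prod hS).image fun p => p.2 - p.1).subset (by
      rintro d ⟨⟨a, ha, b, hb, rfl⟩, -⟩
      exact ⟨(a, b), ⟨ha, hb⟩, rfl⟩)) (fun d hd => hd.2)
  obtain ⟨a, ha, hfa⟩ := hsel z₀ hz₀
  refine ⟨a, ha, fun z hz => ?_⟩
  set l : ℝ → ι → ℝ := fun t => AffineMap.lineMap z₀ z t with hl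
  have hlc : Continuous l := AffineMap.lineMap_continuous
  have hlC : ∀ t ∈ Icc (0 : ℝ) 1, l t ∈ C := fun t ht => hC.lineMap_mem hz₀ hz ht
  -- The difference `b - a` has a constant sign on `C`; vanishing strictly before the end of the
  -- segment it vanishes at `z₀`, hence on `C` by genericity.
  have key : ∀ b ∈ S, ∀ t ∈ Ico (0 : ℝ) 1, b (l t) = a (l t) → ∀ z ∈ C, b z = a z := by
    intro b hb t ht h
    simp only [hl, AffineMap.apply_lineMap, AffineMap.lineMap_apply_ring'] at h
    have e : (1 - t) * (b z₀ - a z₀) + t * (b z - a z) = 0 := by linarith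
    rcases hord a ha b hb with h' | h'
    · have h1 := mul_nonneg (sub_nonneg.2 ht.2.le) (sub_nonneg.2 (h' _ hz₀))
      have h2 := mul_nonneg ht.1 (sub_nonneg.2 (h' _ hz))
      have h3 : (1 - t) * (b z₀ - a z₀) = 0 := by linarith
      have h4 := (mul_eq_zero.1 h3).resolve_left (by linarith [ht.2])
      intro w hw
      have := h₀ (b - a) ⟨⟨a, ha, b, hb, rfl⟩, fun z hz => by simpa using h' z hz⟩ (by simpa using h4)
        w hw
      simpa [sub_eq_zero] using this
    · have h1 := mul_nonneg (sub_nonneg.2 ht.2.le) (sub_nonneg.2 (h' _ hz₀))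
      have h2 := mul_nonneg ht.1 (sub_nonneg.2 (h' _ hz))
      have h3 : (1 - t) * (b z₀ - a z₀) = 0 := by linarith
      have h4 := (mul_eq_zero.1 h3).resolve_left (by linarith [ht.2])
      intro w hw
      have := h₀ (a - b) ⟨⟨b, hb, a, ha, rfl⟩, fun z hz => by simpa using h' z hz⟩
        (by simp; linarith) w hw
      simp [sub_eq_zero] at this
      exact this.symm
  have hfl : ContinuousOn (fun t => f (l t)) (Icc 0 1) :=
    hf.comp hlc.continuousOn fun t ht => hlC t ht
  have hal : ∀ b : (ι → ℝ) →ᵃ[ℝ] ℝ, Continuous fun t => b (l t) :=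
    fun b => (continuous_affine b).comp hlc
  have main : EqOn (fun t => f (l t)) (fun t => a (l t)) (Ico 0 1) := by
    intro r hr
    have hsub : Icc 0 r ⊆ Icc (0 : ℝ) 1 := Icc_subset_Icc_right hr.2.le
    have hcl : ∀ b : (ι → ℝ) →ᵃ[ℝ] ℝ, IsClosed (Icc 0 r ∩ {t | f (l t) - b (l t) = 0}) := fun b =>
      ((hfl.mono hsub).sub (hal b).continuousOn).preimage_isClosed_of_isClosed isClosed_Icc
        isClosed_singleton
    by_contra hne
    -- Two closed sets cover `[0, r]`: where `f` agrees with `a`, and where it agrees with a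
    -- candidate different from `a` on `C`. They must meet, which `key` forbids.
    obtain ⟨t, ht, ht1, ht2⟩ := isPreconnected_closed_iff.1 (isPreconnected_Icc (a := 0) (b := r))
      (Icc 0 r ∩ {t | f (l t) - a (l t) = 0})
      (⋃ b ∈ {b ∈ S | ¬ ∀ z ∈ C, b z = a z}, Icc 0 r ∩ {t | f (l t) - b (l t) = 0}) (hcl a)
      ((hS.subset (sep_subset _ _)).isClosed_biUnion fun b _ => hcl b)
      (by
        intro t ht
        obtain ⟨b, hb, hfb⟩ := hsel _ (hlC t (hsub ht))
        by_cases hba : ∀ z ∈ C, b z = a z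
        · exact Or.inl ⟨ht, by rw [mem_ofPred_eq, hfb, hba _ (hlC t (hsub ht)), sub_self]⟩
        · exact Or.inr (mem_biUnion (show b ∈ {b ∈ S | ¬ ∀ z ∈ C, b z = a z} from ⟨hb, hba⟩)
            ⟨ht, by rw [mem_ofPred_eq, hfb, sub_self]⟩))
      ⟨0, ⟨le_rfl, hr.1⟩, ⟨le_rfl, hr.1⟩, by simp [hl, hfa]⟩
      (by
        obtain ⟨b, hb, hfb⟩ := hsel _ (hlC r (hsub ⟨hr.1, le_rfl⟩))
        refine ⟨r, ⟨hr.1, le_rfl⟩, mem_biUnion (x := b) ⟨hb, fun h => hne ?_⟩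
          ⟨⟨hr.1, le_rfl⟩, by rw [mem_ofPred_eq, hfb, sub_self]⟩⟩
        change f (l r) = a (l r)
        rw [hfb, h _ (hlC r (hsub ⟨hr.1, le_rfl⟩))])
    obtain ⟨b, ⟨hb, hba⟩, -, hbt⟩ := mem_iUnion₂.1 ht2
    refine hba (key b hb t ⟨ht.1, ht.2.trans_lt hr.2⟩ ?_)
    have h1 : f (l t) - a (l t) = 0 := ht1.2
    have h2 : f (l t) - b (l t) = 0 := hbt
    linarith
  have := main.of_subset_closure hfl (hal a).continuousOn Ico_subset_Icc_self
    (by rw [closure_Ico (by norm_num)]) (show (1 : ℝ) ∈ Icc (0 : ℝ) 1 by norm_num)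
  simpa [hl] using this

/-! ### Polytopes -/

/-- A compact convex set is the closed convex hull of its extreme points, and an extreme point of a
polyhedron is determined by the constraints that are active at it, so there are finitely many. -/
theorem exists_finset_convexHull_eq {ι : Type*} [Fintype ι] {D : Set ((ι → ℝ) →ᵃ[ℝ] ℝ)}
    (hD : D.Finite) (hb : Bornology.IsBounded {z | ∀ d ∈ D, 0 ≤ d z}) :
    ∃ V : Finset (ι → ℝ), convexHull ℝ (V : Set (ι → ℝ)) = {z | ∀ d ∈ D, 0 ≤ d z} := by
  set C := {z | ∀ d ∈ D, 0 ≤ d z} with hCdef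
  have hclosed : IsClosed C := by
    have : C = ⋂ d ∈ D, {z | 0 ≤ d z} := by ext; simp [hCdef]
    rw [this]
    exact isClosed_biInter fun d _ => isClosed_le continuous_const (continuous_affine d)
  have hconv : Convex ℝ C := by
    intro x hx y hy s t hs ht hst d hd
    rw [Convex.combo_affine_apply hst]
    exact add_nonneg (mul_nonneg hs (hx d hd)) (mul_nonneg ht (hy d hd))
  have hcpt : IsCompact C := Metric.isCompact_of_isClosed_isBounded hclosed hb
  have hfin : (C.extremePoints ℝ).Finite := by
    refine Set.Finite.of_finite_image (f := fun x => {d ∈ D | d x = 0})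
      (hD.finite_subsets.subset (by rintro _ ⟨x, -, rfl⟩; exact sep_subset _ _)) ?_
    intro x hx y hy hxy
    have hact : ∀ d ∈ D, d x = 0 → d y = 0 := fun d hd h =>
      ((Set.ext_iff.1 hxy d).1 ⟨hd, h⟩).2
    -- If `y` is also tight on the constraints active at `x`, then small moves along the line
    -- through `x` and `y` stay in `C` in both directions, so extremality of `x` forces `y = x`.
    have hev : ∀ᶠ ε : ℝ in 𝓝 0, ∀ d ∈ D, 0 ≤ d (AffineMap.lineMap x y ε) := by
      refine (eventually_all_finite hD).2 fun d hd => ?_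
      by_cases h : d x = 0
      · refine Eventually.of_forall fun ε => ?_
        simp [AffineMap.apply_lineMap, h, hact d hd h]
      · have hc : Continuous fun ε : ℝ => d (AffineMap.lineMap x y ε) :=
          (continuous_affine d).comp AffineMap.lineMap_continuous
        have : (0 : ℝ) < d (AffineMap.lineMap x y (0 : ℝ)) := by
          simpa using lt_of_le_of_ne (hx.1 d hd) (Ne.symm h)
        exact (hc.continuousAt.eventually_const_lt this).mono fun _ => le_of_lt
    have hev' : ∀ᶠ ε : ℝ in 𝓝 0, ∀ d ∈ D, 0 ≤ d (AffineMap.lineMap x y (-ε)) :=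
      (by simpa using (continuous_neg (G := ℝ)).tendsto 0 :
        Tendsto (fun ε : ℝ => -ε) (𝓝 0) (𝓝 0)).eventually hev
    obtain ⟨ε, ⟨h1, h2⟩, hε⟩ := (((hev.and hev').filter_mono nhdsWithin_le_nhds).and
      (self_mem_nhdsWithin : Ioi (0 : ℝ) ∈ 𝓝[>] 0)).exists
    have hε' : (0 : ℝ) < ε := hε
    have := (mem_extremePoints.1 hx).2 _ h1 _ h2
      ⟨1 / 2, 1 / 2, by norm_num, by norm_num, by norm_num, by
        ext i; simp [AffineMap.lineMap_apply]; ring⟩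
    have h3 := this.1
    rw [AffineMap.lineMap_apply] at h3
    have h4 : ε • (y - x) = 0 := by simpa using h3
    exact (sub_eq_zero.1 ((smul_eq_zero.1 h4).resolve_left hε'.ne')).symm
  refine ⟨hfin.toFinset, ?_⟩
  rw [hfin.coe_toFinset]
  exact ((hfin.isCompact_convexHull ℝ).isClosed.closure_eq).symm.trans
    (closure_convexHull_extremePoints hcpt hconv)

/-! ### Piecewise linear functions on `ℝ^ι` -/

/-- Continuity is glued from the finitely many closed polytopes that cover a neighbourhood. -/
theorem isSel_of_plAt {ι : Type*} [Fintype ι] {f : (ι → ℝ) → ℝ} {x : ι → ℝ} (h : PLAt f x) :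
    IsSel id f x := by
  obtain ⟨T, hT, hcov, U, hU, hf⟩ := h
  choose! a ha using hf
  refine ⟨a '' T, hT.image a, ?_⟩
  filter_upwards [eventually_mem_nhds_iff.2 (inter_mem hcov hU)] with z hz
  refine ⟨?_, ?_⟩
  · have hcw : ContinuousWithinAt f (⋃ V ∈ T, convexHull ℝ (V : Set (ι → ℝ)) ∩ U) z := by
      rw [ContinuousWithinAt, nhdsWithin_biUnion hT]
      refine tendsto_iSup.2 fun V => tendsto_iSup.2 fun hV => ?_
      by_cases hz' : z ∈ convexHull ℝ (V : Set (ι → ℝ))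
      · exact (continuous_affine (a V)).continuousWithinAt.congr (ha V hV)
          (ha V hV ⟨hz', (mem_of_mem_nhds hz).2⟩)
      · have : z ∉ closure (convexHull ℝ (V : Set (ι → ℝ)) ∩ U) := fun h => hz'
          (((V.finite_toSet.isCompact_convexHull ℝ).isClosed.closure_eq ▸
            closure_mono inter_subset_left) h)
        rw [notMem_closure_iff_nhdsWithin_eq_bot.1 this]
        exact tendsto_bot
    refine hcw.continuousAt ?_
    simpa only [iUnion_inter] using hz
  · obtain ⟨h1, h2⟩ := mem_of_mem_nhds hz
    obtain ⟨V, hV, hzV⟩ := mem_iUnion₂.1 h1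
    exact ⟨_, mem_image_of_mem a hV, ha V hV ⟨hzV, h2⟩⟩

/-- Cut a small cube along all loci where two candidates agree. On each cell the candidates are
totally ordered, so `f` is affine there by `exists_eqOn_affine`. -/
theorem plAt_of_isSel {ι : Type*} [Fintype ι] {f : (ι → ℝ) → ℝ} {x : ι → ℝ} (h : IsSel id f x) :
    PLAt f x := by
  classical
  obtain ⟨S, hS, hf⟩ := h
  obtain ⟨ε, hε, hball⟩ := Metric.nhds_basis_closedBall.mem_iff.1 hf
  set B := Metric.closedBall x ε with hB
  let c : ι → (ι → ℝ) →ᵃ[ℝ] ℝ := fun i => (LinearMap.proj (R := ℝ) (φ := fun _ : ι => ℝ) i).toAffineMap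
  -- The set `s` of pairs prescribes the direction of every comparison of candidates; the first two
  -- families are the facets of the cube, that is, of the ball for the sup norm.
  let D : Set (((ι → ℝ) →ᵃ[ℝ] ℝ) × ((ι → ℝ) →ᵃ[ℝ] ℝ)) → Set ((ι → ℝ) →ᵃ[ℝ] ℝ) := fun s =>
    (range (fun i => c i - AffineMap.const ℝ _ (x i - ε)) ∪
      range (fun i => AffineMap.const ℝ _ (x i + ε) - c i)) ∪
    (fun p => if p ∈ s then p.2 - p.1 else p.1 - p.2) '' (S ×ˢ S)
  have hDfin : ∀ s, (D s).Finite := fun s =>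
    ((finite_range _).union (finite_range _)).union ((hS.prod hS).image _)
  have hDB : ∀ s, {z | ∀ d ∈ D s, 0 ≤ d z} =
      {z ∈ B | ∀ a ∈ S, ∀ b ∈ S, if (a, b) ∈ s then a z ≤ b z else b z ≤ a z} := by
    intro s
    ext z
    have hzB : z ∈ B ↔ ∀ i, x i - ε ≤ z i ∧ z i ≤ x i + ε := by
      rw [hB, mem_closedBall_iff_norm, pi_norm_le_iff_of_nonneg hε.le]
      refine forall_congr' fun i => ?_
      rw [Pi.sub_apply, Real.norm_eq_abs, abs_le]
      constructor <;> rintro ⟨h1, h2⟩ <;> constructor <;> linarith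
    simp only [D, mem_ofPred_eq, hzB]
    constructor
    · intro h
      refine ⟨fun i => ⟨?_, ?_⟩, fun a ha b hb => ?_⟩
      · simpa [c] using h _ (Or.inl (Or.inl ⟨i, rfl⟩))
      · simpa [c] using h _ (Or.inl (Or.inr ⟨i, rfl⟩))
      · have := h _ (Or.inr ⟨(a, b), ⟨ha, hb⟩, rfl⟩)
        dsimp only at this
        split_ifs at this ⊢ <;> simpa using this
    · rintro ⟨h1, h2⟩ d ((⟨i, rfl⟩ | ⟨i, rfl⟩) | ⟨⟨a, b⟩, ⟨ha, hb⟩, rfl⟩)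
      · simpa [c] using (h1 i).1
      · simpa [c] using (h1 i).2
      · have := h2 a ha b hb
        dsimp only
        split_ifs at this ⊢ <;> simpa using this
  have hV : ∀ s : Set (((ι → ℝ) →ᵃ[ℝ] ℝ) × ((ι → ℝ) →ᵃ[ℝ] ℝ)), ∃ V : Finset (ι → ℝ), convexHull ℝ (V : Set (ι → ℝ)) =
      {z ∈ B | ∀ a ∈ S, ∀ b ∈ S, if (a, b) ∈ s then a z ≤ b z else b z ≤ a z} := by
    intro s
    rw [← hDB]
    refine exists_finset_convexHull_eq (hDfin s) ?_
    rw [hDB]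
    exact Metric.isBounded_closedBall.subset (sep_subset _ _)
  choose V hV using hV
  refine ⟨V '' 𝒫 (S ×ˢ S), (hS.prod hS).finite_subsets.image V, ?_, univ, univ_mem, ?_⟩
  · filter_upwards [Metric.closedBall_mem_nhds x hε] with z hz
    -- The cell containing `z` is given by the comparisons that hold at `z` itself.
    refine mem_biUnion (mem_image_of_mem V 
      (show {p : ((ι → ℝ) →ᵃ[ℝ] ℝ) × ((ι → ℝ) →ᵃ[ℝ] ℝ) | p ∈ S ×ˢ S ∧ p.1 z ≤ p.2 z} ∈ 𝒫 (S ×ˢ S)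
        from fun _ h => h.1)) ?_
    rw [hV]
    refine ⟨hz, fun a ha b hb => ?_⟩
    split_ifs with h
    · exact h.2
    · by_contra h'
      exact h ⟨⟨ha, hb⟩, (not_le.1 h').le⟩
  · rintro _ ⟨s, -, rfl⟩
    rw [inter_univ]
    rcases (convexHull ℝ (V s : Set (ι → ℝ))).eq_empty_or_nonempty with h | h
    · exact ⟨0, by rw [h]; simp⟩
    obtain ⟨a, -, ha⟩ := exists_eqOn_affine (convex_convexHull ℝ _) h (f := f) (S := S)
      (fun z hz => by
        rw [hV] at hz
        exact (hball hz.1).1.continuousWithinAt) hS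
      (fun z hz => by
        rw [hV] at hz
        exact (hball hz.1).2)
      (fun a ha b hb => by
        rw [hV]
        by_cases h : (a, b) ∈ s
        · left
          intro z hz
          simpa [h] using hz.2 a ha b hb
        · right
          intro z hz
          simpa [h] using hz.2 a ha b hb)
    exact ⟨a, ha⟩

/-! ### PL maps, PL embeddings and charts -/

section PLMaps

variable {A B Y Z W : Type*} [TopologicalSpace A] [PLStructure A] [TopologicalSpace B]
  [PLStructure B] [TopologicalSpace Y] [PLStructure Y] [TopologicalSpace Z] [PLStructure Z]
  [TopologicalSpace W] [PLStructure W]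

theorem IsPLMapAt.comp {g : Z → W} {f : Y → Z} {y : Y} (hg : IsPLMapAt g (f y))
    (hf : IsPLMapAt f y) : IsPLMapAt (fun y => g (f y)) y :=
  ⟨hg.1.comp hf.1, fun h hh => hf.2 _ (hg.2 h hh)⟩

theorem IsPLMapAt.congr {f g : Y → Z} {y : Y} (hf : IsPLMapAt f y) (h : f =ᶠ[𝓝 y] g) :
    IsPLMapAt g y := by
  refine ⟨hf.1.congr h, fun u hu => ?_⟩
  rw [← h.self_of_nhds] at hu
  exact PLStructure.congr_germ (h.fun_comp u) (hf.2 u hu)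

theorem isPLMapAt_id (y : Y) : IsPLMapAt (fun y : Y => y) y := ⟨continuousAt_id, fun _ h => h⟩

/-- Embeddings for which the PL structure of the source is induced from the target. -/
structure IsPLEmbedding (i : A → B) : Prop where
  isEmbedding : IsEmbedding i
  plAt_iff : ∀ (f : A → ℝ) (a : A), PLAt f a ↔ ∃ g : B → ℝ, PLAt g (i a) ∧ f =ᶠ[𝓝 a] g ∘ i

theorem isPLEmbedding_val (p : Y → Prop) : IsPLEmbedding (Subtype.val : Subtype p → Y) :=
  ⟨IsEmbedding.subtypeVal, fun _ _ => Iff.rfl⟩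

namespace IsPLEmbedding

theorem isPLMapAt {i : A → B} (hi : IsPLEmbedding i) (a : A) : IsPLMapAt i a :=
  ⟨hi.isEmbedding.continuous.continuousAt, fun g hg => (hi.plAt_iff _ _).2 ⟨g, hg, .rfl⟩⟩

theorem isPLMapAt_of_comp {i : A → B} (hi : IsPLEmbedding i) {f : Z → A} {z : Z}
    (h : IsPLMapAt (fun z => i (f z)) z) : IsPLMapAt f z := by
  have hc : ContinuousAt f z := hi.isEmbedding.isInducing.continuousAt_iff.2 h.1
  refine ⟨hc, fun g hg => ?_⟩
  obtain ⟨g', hg', hgg'⟩ := (hi.plAt_iff _ _).1 hg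
  exact PLStructure.congr_germ (EventuallyEq.symm (hc.eventually hgg')) (h.2 g' hg')

theorem comp {i : A → B} {i' : B → Y} (hi' : IsPLEmbedding i') (hi : IsPLEmbedding i) :
    IsPLEmbedding fun a => i' (i a) := by
  refine ⟨hi'.isEmbedding.comp hi.isEmbedding, fun f a => ⟨fun h => ?_, ?_⟩⟩
  · obtain ⟨g, hg, hfg⟩ := (hi.plAt_iff _ _).1 h
    obtain ⟨g', hg', hgg'⟩ := (hi'.plAt_iff _ _).1 hg
    exact ⟨g', hg', hfg.trans (hi.isEmbedding.continuous.continuousAt.eventually hgg')⟩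
  · rintro ⟨g, hg, hfg⟩
    exact (hi.plAt_iff _ _).2 ⟨g ∘ i', (hi'.isPLMapAt _).2 g hg, hfg⟩

end IsPLEmbedding

/-- The two maps are given on the ambient spaces, where formulas are available, and need to be PL
only at the points of the subspaces. -/
theorem PLHomeomorphic.of_ambient {i : A → Y} {j : B → Z} (hi : IsPLEmbedding i)
    (hj : IsPLEmbedding j) (f : Y → Z) (g : Z → Y) (hf : ∀ a, IsPLMapAt f (i a))
    (hg : ∀ b, IsPLMapAt g (j b)) (hfr : ∀ a, ∃ b, j b = f (i a)) (hgr : ∀ b, ∃ a, i a = g (j b))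
    (hgf : ∀ a, g (f (i a)) = i a) (hfg : ∀ b, f (g (j b)) = j b) : PLHomeomorphic A B := by
  choose F hF using hfr
  choose G hG using hgr
  have hF' : ∀ a, IsPLMapAt F a := fun a => hj.isPLMapAt_of_comp (by
    simp only [hF]; exact (hf a).comp (hi.isPLMapAt a))
  have hG' : ∀ b, IsPLMapAt G b := fun b => hi.isPLMapAt_of_comp (by
    simp only [hG]; exact (hg b).comp (hj.isPLMapAt b))
  refine ⟨⟨⟨F, G, fun a => ?_, fun b => ?_⟩, ?_, ?_⟩, hF', hG'⟩
  · apply hi.isEmbedding.injective; rw [hG, hF, hgf]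
  · apply hj.isEmbedding.injective; rw [hF, hG, hfg]
  · exact continuous_iff_continuousAt.2 fun a => (hF' a).1
  · exact continuous_iff_continuousAt.2 fun b => (hG' b).1

/-- Two PL maps that are inverse to each other near a point give a chart. -/
theorem exists_isPLLocalHomeo {f : Y → Z} {g : Z → Y} {y : Y}
    (hf : ∀ᶠ u in 𝓝 y, IsPLMapAt f u ∧ g (f u) = u)
    (hg : ∀ᶠ v in 𝓝 (f y), IsPLMapAt g v ∧ f (g v) = v) :
    ∃ e : OpenPartialHomeomorph Y Z, y ∈ e.source ∧ IsPLLocalHomeo e ∧ ⇑e = f := by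
  obtain ⟨U, hU, hUo, hyU⟩ := eventually_nhds_iff.1 hf
  obtain ⟨V, hV, hVo, hyV⟩ := eventually_nhds_iff.1 hg
  have hfc : ContinuousOn f U := fun u hu => (hU u hu).1.1.continuousWithinAt
  have hgc : ContinuousOn g V := fun v hv => (hV v hv).1.1.continuousWithinAt
  refine ⟨⟨⟨⟨f, g, U ∩ f ⁻¹' V, V ∩ g ⁻¹' U, ?_, ?_, ?_, ?_⟩, hfc.mono inter_subset_left,
    hgc.mono inter_subset_left⟩, hfc.isOpen_inter_preimage hUo hVo,
    hgc.isOpen_inter_preimage hVo hUo⟩,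
    ⟨hyU, hyV⟩, ⟨fun u hu => (hU u hu.1).1, fun v hv => (hV v hv.1).1⟩, rfl⟩
  · rintro u ⟨hu, hu'⟩
    exact ⟨hu', by rw [mem_preimage, (hU u hu).2]; exact hu⟩
  · rintro v ⟨hv, hv'⟩
    exact ⟨hv', by rw [mem_preimage, (hV v hv).2]; exact hv⟩
  · exact fun u hu => (hU u hu.1).2
  · exact fun v hv => (hV v hv.1).2

end PLMaps

/-! ### PL functions on subsets of `ℝ^ι` -/

theorem plAt_iff_isSel {ι : Type*} [Fintype ι] {f : (ι → ℝ) → ℝ} {x : ι → ℝ} :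
    PLAt f x ↔ IsSel id f x := ⟨isSel_of_plAt, plAt_of_isSel⟩

theorem isSel_val_of_plAt {ι : Type*} [Fintype ι] {p : (ι → ℝ) → Prop} {f : Subtype p → ℝ}
    {x : Subtype p} (h : PLAt f x) : IsSel Subtype.val f x := by
  obtain ⟨g, hg, hfg⟩ := h
  refine IsSel.congr ?_ hfg.symm
  exact IsSel.pullback (F := Subtype.val) (j' := id) (isSel_of_plAt hg)
    (Eventually.of_forall fun y => continuous_subtype_val.continuousAt)
    (Eventually.of_forall fun y => rfl)

theorem isPLMapAt_pi {ι κ : Type*} [Fintype ι] [Fintype κ] {F : (ι → ℝ) → κ → ℝ} {x : ι → ℝ}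
    (hF : ∀ k, IsSel id (fun y => F y k) x) : IsPLMapAt F x := by
  refine ⟨continuousAt_pi.2 fun k => (hF k).continuousAt, fun g hg => ?_⟩
  exact plAt_of_isSel (IsSel.comp_pi (F := fun k y => F y k) hF (isSel_of_plAt hg))

theorem isSel_of_isPLMapAt {ι κ : Type*} [Fintype ι] [Fintype κ] {F : (ι → ℝ) → κ → ℝ}
    {x : ι → ℝ} (hF : IsPLMapAt F x) (k : κ) : IsSel id (fun y => F y k) x :=
  isSel_of_plAt (hF.2 _ (plAt_of_isSel (IsSel.coord continuous_id k _)))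

/-- The simplex is a PL retract of a neighbourhood of `x`: clamp negative coordinates to zero and
restore the sum by a coordinate `i₀` that is positive at `x`. Composition with the retraction
extends `f`. -/
theorem plAt_stdSimplex_of_isSel {ι : Type*} [Fintype ι] {f : stdSimplex ℝ ι → ℝ}
    {x : stdSimplex ℝ ι} (h : IsSel Subtype.val f x) : PLAt f x := by
  classical
  obtain ⟨i₀, hi₀⟩ : ∃ i, 0 < x.1 i := by
    by_contra! h
    have : ∑ i, x.1 i ≤ 0 := Finset.sum_nonpos fun i _ => h i
    linarith [x.2.2]
  let r : (ι → ℝ) → ι → ℝ := fun z i =>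
    if i = i₀ then 1 - ∑ k ∈ Finset.univ.erase i₀, max (z k) 0 else max (z i) 0
  have hr : ∀ i z, IsSel id (fun z => r z i) z := by
    intro i z
    by_cases hi : i = i₀
    · simp only [r, hi, if_true]
      exact (IsSel.const 1 z).sub (IsSel.sum _ fun k _ => (IsSel.coord continuous_id k z).max
        (IsSel.const 0 z))
    · simp only [r, hi, if_false]
      exact (IsSel.coord continuous_id i z).max (IsSel.const 0 z)
  have hrc : Continuous r := continuous_pi fun i => continuous_iff_continuousAt.2 fun z =>
    (hr i z).continuousAt
  have hrid : ∀ z ∈ stdSimplex ℝ ι, r z = z := by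
    intro z hz
    have h1 : ∀ k, max (z k) 0 = z k := fun k => max_eq_left (hz.1 k)
    ext i
    simp only [r, h1]
    split_ifs with hi
    · rw [hi, ← hz.2, ← Finset.add_sum_erase _ _ (Finset.mem_univ i₀)]; ring
    · rfl
  have hrmem : ∀ z, 0 ≤ r z i₀ → r z ∈ stdSimplex ℝ ι := by
    intro z hz
    refine ⟨fun i => ?_, ?_⟩
    · by_cases hi : i = i₀
      · rwa [hi]
      · simp [r, hi]
    · rw [← Finset.add_sum_erase _ _ (Finset.mem_univ i₀)]
      have : ∑ k ∈ Finset.univ.erase i₀, r z k = ∑ k ∈ Finset.univ.erase i₀, max (z k) 0 :=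
        Finset.sum_congr rfl fun k hk => by simp [r, Finset.ne_of_mem_erase hk]
      rw [this]
      simp [r]
  -- The default value `x` is taken only where `r z i₀ < 0`, which does not happen near `x`.
  let F : (ι → ℝ) → stdSimplex ℝ ι := fun z => if h : 0 ≤ r z i₀ then ⟨r z, hrmem z h⟩ else x
  have hFid : ∀ z : stdSimplex ℝ ι, F z.1 = z := by
    intro z
    have : 0 ≤ r z.1 i₀ := by rw [hrid _ z.2]; exact z.2.1 _
    apply Subtype.ext
    simp only [F, this, dif_pos]
    exact hrid _ z.2
  have hev : ∀ᶠ z in 𝓝 x.1, 0 < r z i₀ := by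
    refine ((continuous_apply i₀).comp hrc).continuousAt.eventually_const_lt ?_
    simpa [hrid _ x.2] using hi₀
  have hFr : ∀ z, 0 < r z i₀ → (F z).1 = r z := fun z hz => by simp [F, hz.le]
  refine ⟨fun z => f (F z), plAt_of_isSel ?_, ?_⟩
  · refine IsSel.comp (j' := Subtype.val) ?_ ?_ fun i => ?_
    · rwa [hFid]
    · filter_upwards [hev.eventually_nhds] with z hz
      rw [IsEmbedding.subtypeVal.isInducing.continuousAt_iff]
      exact hrc.continuousAt.congr (hz.mono fun w hw => (hFr w hw).symm)
    · exact (hr i x.1).congr (hev.mono fun w hw => by dsimp only; rw [hFr w hw])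
  · exact Eventually.of_forall fun z => by simp [hFid]

theorem plAt_stdSimplex_iff {ι : Type*} [Fintype ι] {f : stdSimplex ℝ ι → ℝ}
    {x : stdSimplex ℝ ι} : PLAt f x ↔ IsSel Subtype.val f x :=
  ⟨isSel_val_of_plAt, plAt_stdSimplex_of_isSel⟩

/-! ### Local homogeneity -/

/-- Close to `x` only candidates that agree with `f` at `x` are selected. On a segment starting at
`x` these are ordered by their values at the far end, so `f` is affine on it. -/
theorem IsSel.homogeneous {ι : Type*} [Finite ι] {p : (ι → ℝ) → Prop} (hp : Convex ℝ {x | p x})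
    {f : Subtype p → ℝ} {x : Subtype p} (hf : IsSel Subtype.val f x) :
    ∀ᶠ z in 𝓝 x, ∀ w : Subtype p, ∀ t ∈ Icc (0 : ℝ) 1, w.1 = x.1 + t • (z.1 - x.1) →
      f w = f x + t * (f z - f x) := by
  classical
  obtain ⟨S, hS, h⟩ := hf
  have h' : ∀ᶠ y in 𝓝 x, ∀ a ∈ S, a x.1 ≠ f x → f y ≠ a y.1 := by
    refine (eventually_all_finite hS).2 fun a _ => ?_
    by_cases hax : a x.1 = f x
    · simp [hax]
    · have h1 : ContinuousAt (fun y => f y - a y.1) x := h.self_of_nhds.1.sub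
        ((continuous_affine a).comp continuous_subtype_val).continuousAt
      filter_upwards [h1.eventually_ne (sub_ne_zero.2 (Ne.symm hax))] with y hy _
      exact sub_ne_zero.1 hy
  rw [nhds_subtype_eq_comap] at h h' ⊢
  have h2 := (h.and h')
  obtain ⟨V, hV, hVs⟩ := mem_comap.1 h2
  have := Fintype.ofFinite ι
  obtain ⟨ε, hε, hball⟩ := Metric.nhds_basis_ball.mem_iff.1 hV
  refine mem_comap.2 ⟨_, Metric.ball_mem_nhds x.1 hε, ?_⟩
  intro z hz w t ht hw
  have hz' : z.1 ∈ Metric.ball x.1 ε := hz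
  let F : (ι → ℝ) → ℝ := fun y => if h : p y then f ⟨y, h⟩ else 0
  have hF : ∀ y : Subtype p, F y.1 = f y := fun y => by simp [F, y.2]
  have hsegp : segment ℝ x.1 z.1 ⊆ {x | p x} := hp.segment_subset x.2 z.2
  have hsegb : segment ℝ x.1 z.1 ⊆ Metric.ball x.1 ε :=
    (convex_ball x.1 ε).segment_subset (Metric.mem_ball_self hε) hz'
  have hgood : ∀ y : Subtype p, y.1 ∈ segment ℝ x.1 z.1 →
      (ContinuousAt f y ∧ ∃ a ∈ S, f y = a y.1) ∧ ∀ a ∈ S, a x.1 ≠ f x → f y ≠ a y.1 :=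
    fun y hy => hVs (hball (hsegb hy))
  have hex : ∃ a ∈ {a ∈ S | a x.1 = f x}, EqOn F a (segment ℝ x.1 z.1) := by
    refine exists_eqOn_affine (convex_segment _ _) ⟨_, left_mem_segment ℝ _ _⟩ ?_
      (hS.subset (sep_subset _ _)) ?_ ?_
    · intro y hy
      have hpy : p y := hsegp hy
      have h3 : ContinuousWithinAt F {x | p x} y := by
        rw [continuousWithinAt_iff_continuousAt_domRestrict F (show y ∈ {x | p x} from hpy)]
        have : {x | p x}.domRestrict F = f := funext fun v => hF v
        rw [this]
        exact (hgood ⟨y, hpy⟩ hy).1.1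
      exact h3.mono hsegp
    · intro y hy
      obtain ⟨⟨-, a, ha, hya⟩, h4⟩ := hgood ⟨y, hsegp hy⟩ hy
      refine ⟨a, ⟨ha, by_contra fun h5 => h4 a ha h5 hya⟩, ?_⟩
      rw [← hya]
      exact hF ⟨y, hsegp hy⟩
    · rintro a ⟨-, ha⟩ b ⟨-, hb⟩
      have e : ∀ c : (ι → ℝ) →ᵃ[ℝ] ℝ, c x.1 = f x → ∀ s : ℝ, c (x.1 + s • (z.1 - x.1)) =
          f x + s * (c z.1 - f x) := by
        intro c hc s
        have : x.1 + s • (z.1 - x.1) = AffineMap.lineMap x.1 z.1 s := by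
          rw [AffineMap.lineMap_apply]; simp [add_comm]
        rw [this, AffineMap.apply_lineMap, AffineMap.lineMap_apply_ring', hc]
        ring
      rw [segment_eq_image']
      rcases le_total (a z.1) (b z.1) with h | h
      · left
        rintro _ ⟨s, hs, rfl⟩
        simp only
        rw [e a ha, e b hb]
        have := mul_le_mul_of_nonneg_left (sub_le_sub_right h (f x)) hs.1
        linarith
      · right
        rintro _ ⟨s, hs, rfl⟩
        simp only
        rw [e a ha, e b hb]
        have := mul_le_mul_of_nonneg_left (sub_le_sub_right h (f x)) hs.1
        linarith
  obtain ⟨a, ha, hFa⟩ := hex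
  have hwseg : w.1 ∈ segment ℝ x.1 z.1 := by
    rw [segment_eq_image']
    exact ⟨t, ht, hw.symm⟩
  have e1 := hFa hwseg
  have e2 := hFa (right_mem_segment ℝ x.1 z.1)
  rw [hF] at e1 e2
  have hw' : w.1 = AffineMap.lineMap x.1 z.1 t := by
    rw [hw, AffineMap.lineMap_apply]; simp [add_comm]
  rw [e1, hw', AffineMap.apply_lineMap, e2, AffineMap.lineMap_apply_ring', ha.2]
  ring

/-! ### General position -/

/-- Proper affine subspaces are Lebesgue null sets, and so are countable unions of them. -/
theorem exists_mem_forall_notMem_affineSubspace {ι : Type*} [Fintype ι] {U : Set (ι → ℝ)}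
    (hU : IsOpen U) (hne : U.Nonempty) {Q : Set (AffineSubspace ℝ (ι → ℝ))} (hQ : Q.Countable)
    (htop : ∀ q ∈ Q, q ≠ ⊤) : ∃ x ∈ U, ∀ q ∈ Q, x ∉ q := by
  by_contra! h
  have h0 : MeasureTheory.volume (⋃ q ∈ Q, (q : Set (ι → ℝ))) = 0 :=
    (MeasureTheory.measure_biUnion_null_iff hQ).2 fun q hq =>
      MeasureTheory.Measure.addHaar_affineSubspace _ q (htop q hq)
  have h1 : MeasureTheory.volume U = 0 := MeasureTheory.measure_mono_null
    (fun x hx => by obtain ⟨q, hq, hxq⟩ := h x hx; exact mem_biUnion hq hxq) h0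
  exact (hU.measure_pos _ hne).ne' h1

/-- The points where two affine maps agree. -/
def affineEqLocus {ι : Type*} (a b : (ι → ℝ) →ᵃ[ℝ] ℝ) : AffineSubspace ℝ (ι → ℝ) :=
  (AffineSubspace.mk' (0 : ℝ) ⊥).comap (a - b)

theorem mem_affineEqLocus {ι : Type*} {a b : (ι → ℝ) →ᵃ[ℝ] ℝ} {x : ι → ℝ} :
    x ∈ affineEqLocus a b ↔ a x = b x := by
  simp [affineEqLocus, AffineSubspace.mem_comap, sub_eq_zero]

/-- Each `q` satisfies `q = a (g q)` for one of finitely many affine maps `a`. The non-injective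
ones have proper affine subspaces as images, so generic points use injective ones, and by continuity
of `g` all points can. Then `g q` is the value of the affine inverse of `a`. -/
theorem isSel_of_inverse {ι : Type*} [Fintype ι] {f g : (ι → ℝ) → ι → ℝ} {p : ι → ℝ}
    (hf : ∀ i, IsSel id (fun z => f z i) p)
    (hg : ∀ᶠ q in 𝓝 (f p), ContinuousAt g q ∧ f (g q) = q) (hgp : g (f p) = p) (i : ι) :
    IsSel id (fun q => g q i) (f p) := by
  choose S hS hfS using hf
  let 𝒮 : Set ((ι → ℝ) →ᵃ[ℝ] (ι → ℝ)) := (fun b => AffineMap.pi b) '' {b | ∀ i, b i ∈ S i}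
  have h𝒮 : 𝒮.Finite := (Set.Finite.pi' hS).image _
  have hsel : ∀ᶠ z in 𝓝 p, ∃ a ∈ 𝒮, f z = a z := by
    filter_upwards [eventually_all.2 hfS] with z hz
    choose b hb hb' using fun i => (hz i).2
    exact ⟨_, ⟨b, hb, rfl⟩, by ext i; simp [hb' i]⟩
  have hgc : ContinuousAt g (f p) := hg.self_of_nhds.1
  have hq : ∀ᶠ q in 𝓝 (f p), ContinuousAt g q ∧ ∃ a ∈ 𝒮, q = a (g q) := by
    have h1 : ∀ᶠ q in 𝓝 (f p), ∃ a ∈ 𝒮, f (g q) = a (g q) := by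
      have : Tendsto g (𝓝 (f p)) (𝓝 p) := by simpa [ContinuousAt, hgp] using hgc
      exact this.eventually hsel
    filter_upwards [hg, h1] with q h2 h3
    exact ⟨h2.1, by simpa [h2.2] using h3⟩
  have hq' : ∀ᶠ q in 𝓝 (f p), ContinuousAt g q ∧
      ∃ a ∈ 𝒮, Function.Injective a ∧ q = a (g q) := by
    filter_upwards [hq.eventually_nhds] with q hq
    refine ⟨hq.self_of_nhds.1, ?_⟩
    -- If no injective candidate fits at `q`, none fits on a neighbourhood of `q`, which would then
    -- be covered by finitely many proper affine subspaces.
    by_contra! hcon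
    have h1 : ∀ᶠ r in 𝓝 q, ∀ a ∈ 𝒮, Function.Injective a → r ≠ a (g r) := by
      refine (eventually_all_finite h𝒮).2 fun a ha => ?_
      by_cases hai : Function.Injective a
      · have hc : ContinuousAt (fun r => r - a (g r)) q := continuousAt_id.sub
          (a.continuous_of_finiteDimensional.continuousAt.comp hq.self_of_nhds.1)
        filter_upwards [hc.eventually_ne (sub_ne_zero.2 (hcon a ha hai))] with r hr _
        exact sub_ne_zero.1 hr
      · simp [hai]
    obtain ⟨U, hUs, hUo, hqU⟩ := eventually_nhds_iff.1 (h1.and hq)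
    obtain ⟨r, hrU, hr⟩ := exists_mem_forall_notMem_affineSubspace hUo ⟨q, hqU⟩
      (Q := (fun a : (ι → ℝ) →ᵃ[ℝ] (ι → ℝ) => (⊤ : AffineSubspace ℝ (ι → ℝ)).map a) ''
        {a ∈ 𝒮 | ¬ Function.Injective a}) ((h𝒮.subset (sep_subset _ _)).image _).countable (by
        rintro _ ⟨a, ⟨-, ha⟩, rfl⟩ htop
        refine ha ?_
        rw [← AffineMap.linear_injective_iff, LinearMap.injective_iff_surjective,
          AffineMap.linear_surjective_iff]
        intro y
        have htop' : (⊤ : AffineSubspace ℝ (ι → ℝ)).map a = ⊤ := htop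
        have : y ∈ (⊤ : AffineSubspace ℝ (ι → ℝ)).map a := by rw [htop']; trivial
        obtain ⟨x, -, hx⟩ := this
        exact ⟨x, hx⟩)
    obtain ⟨h2, -, a, ha, hra⟩ := hUs r hrU
    by_cases hai : Function.Injective a
    · exact h2 a ha hai hra
    · exact hr _ ⟨a, ⟨ha, hai⟩, rfl⟩ ⟨g r, trivial, hra.symm⟩
  classical
  have hinv : ∀ a : (ι → ℝ) →ᵃ[ℝ] (ι → ℝ), ∃ b : (ι → ℝ) →ᵃ[ℝ] ℝ,
      Function.Injective a → ∀ x, b (a x) = x i := by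
    intro a
    by_cases ha : Function.Injective a
    · have hs : Function.Surjective a := by
        rw [← AffineMap.linear_surjective_iff, ← LinearMap.injective_iff_surjective,
          AffineMap.linear_injective_iff]
        exact ha
      refine ⟨(LinearMap.proj (R := ℝ) (φ := fun _ : ι => ℝ) i).toAffineMap.comp
        (AffineEquiv.ofBijective ⟨ha, hs⟩).symm.toAffineMap, fun _ x => ?_⟩
      exact congrFun ((AffineEquiv.ofBijective (φ := a) ⟨ha, hs⟩).symm_apply_apply x) i
    · exact ⟨0, fun h => absurd h ha⟩
  choose b hb using hinv
  refine ⟨b '' 𝒮, h𝒮.image b, ?_⟩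
  filter_upwards [hq'] with q hq
  obtain ⟨hc, a, ha, hai, hqa⟩ := hq
  refine ⟨(continuous_apply i).continuousAt.comp hc, b a, mem_image_of_mem b ha, ?_⟩
  rw [id, show b a q = b a (a (g q)) by rw [← hqa], hb a hai]

/-! ### Invariance of the boundary -/

/-- At a generic point `x` of the bounding hyperplane, two candidates with the same value at `x`
agree on the whole hyperplane, hence differ by a multiple of the first coordinate and are ordered on
the half-space. So `f` is affine on a half-ball around `x`. An affine open map between spaces of
equal dimension is bijective, and the half-ball would be a neighbourhood of `x`. -/
theorem not_isOpenMap_halfSpace {n : ℕ} [NeZero n] {f : PLHalfSpace n → Fin n → ℝ}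
    {p : PLHalfSpace n} (hp : p.1 0 = 0) (hf : ∀ i, IsSel Subtype.val (fun z => f z i) p)
    (hopen : ∀ᶠ z in 𝓝 p, 𝓝 (f z) ≤ map f (𝓝 z)) : False := by
  classical
  choose S hS hfS using hf
  have hall := (eventually_all.2 hfS).and hopen
  rw [nhds_subtype_eq_comap] at hall
  obtain ⟨V, hV, hVs⟩ := mem_comap.1 hall
  obtain ⟨ε, hε, hball⟩ := Metric.nhds_basis_ball.mem_iff.1 hV
  -- The hyperplane is itself a null set, so general position is applied in `ℝ^n` to the loci pulled
  -- back along this projection.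
  let π : (Fin n → ℝ) →ₗ[ℝ] (Fin n → ℝ) :=
    LinearMap.pi fun i => if i = 0 then 0 else LinearMap.proj i
  have hπ0 : ∀ z, π z 0 = 0 := fun z => by simp [π]
  have hπi : ∀ z i, i ≠ 0 → π z i = z i := fun z i hi => by simp [π, hi]
  have hπ : ∀ z, z 0 = 0 → π z = z := by
    intro z hz
    ext i
    by_cases hi : i = 0
    · rw [hi, hπ0, hz]
    · exact hπi z i hi
  obtain ⟨z₁, hz₁, hgen⟩ := exists_mem_forall_notMem_affineSubspace
    (Metric.isOpen_ball (x := p.1) (ε := ε)) ⟨p.1, Metric.mem_ball_self hε⟩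
    (Q := {q | (∃ a ∈ ⋃ i, S i, ∃ b ∈ ⋃ i, S i,
      q = affineEqLocus (a.comp π.toAffineMap) (b.comp π.toAffineMap)) ∧ q ≠ ⊤})
    ((((finite_iUnion hS).prod (finite_iUnion hS)).image fun ab =>
      affineEqLocus (ab.1.comp π.toAffineMap) (ab.2.comp π.toAffineMap)).subset (by
        rintro q ⟨⟨a, ha, b, hb, rfl⟩, -⟩
        exact ⟨(a, b), ⟨ha, hb⟩, rfl⟩)).countable (fun q hq => hq.2)
  set x := π z₁ with hx
  have hx0 : x 0 = 0 := hπ0 _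
  have hxball : x ∈ Metric.ball p.1 ε := by
    rw [mem_ball_iff_norm] at hz₁ ⊢
    refine lt_of_le_of_lt ((pi_norm_le_iff_of_nonneg (norm_nonneg _)).2 fun i => ?_) hz₁
    by_cases hi : i = 0
    · rw [hi, Pi.sub_apply, hx0, hp]; simp
    · rw [Pi.sub_apply, hx, hπi _ _ hi, ← Pi.sub_apply]
      exact norm_le_pi_norm _ i
  have hgen' : ∀ a ∈ ⋃ i, S i, ∀ b ∈ ⋃ i, S i, a x = b x → ∀ z : Fin n → ℝ, a (π z) = b (π z) := by
    intro a ha b hb hab z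
    by_contra hne
    refine hgen _ ⟨⟨a, ha, b, hb, rfl⟩, fun htop => hne ?_⟩ (mem_affineEqLocus.2 hab)
    have h1 : z ∈ affineEqLocus (a.comp π.toAffineMap) (b.comp π.toAffineMap) := by
      rw [htop]; trivial
    exact mem_affineEqLocus.1 h1
  have hev : ∀ᶠ z in 𝓝 x, ∀ a ∈ ⋃ i, S i, ∀ b ∈ ⋃ i, S i, a x < b x → a z < b z := by
    refine (eventually_all_finite (finite_iUnion hS)).2 fun a _ =>
      (eventually_all_finite (finite_iUnion hS)).2 fun b _ => ?_
    by_cases h : a x < b x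
    · filter_upwards [(continuous_affine a).continuousAt.eventually_lt
        (continuous_affine b).continuousAt h] with z hz _ using hz
    · simp [h]
  obtain ⟨δ, hδ, hδs⟩ := Metric.nhds_basis_ball.mem_iff.1
    (hev.and (Metric.isOpen_ball.mem_nhds hxball))
  set C := Metric.ball x δ ∩ {z : Fin n → ℝ | 0 ≤ z 0} with hC
  have hCconv : Convex ℝ C := (convex_ball x δ).inter
    (convex_halfSpace_ge (LinearMap.proj (R := ℝ) (φ := fun _ : Fin n => ℝ) 0).isLinear 0)
  have hxC : x ∈ C := ⟨Metric.mem_ball_self hδ, hx0.ge⟩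
  have hord : ∀ a ∈ ⋃ i, S i, ∀ b ∈ ⋃ i, S i, (∀ z ∈ C, a z ≤ b z) ∨ ∀ z ∈ C, b z ≤ a z := by
    intro a ha b hb
    rcases lt_trichotomy (a x) (b x) with h | h | h
    · exact Or.inl fun z hz => ((hδs hz.1).1 a ha b hb h).le
    -- Decompose `z` into its normal part and `π z`; the difference of the candidates vanishes on
    -- the latter.
    · have key : ∀ z : Fin n → ℝ, b z - a z = z 0 * (b - a).linear (Pi.single 0 1) := by
        intro z
        have e : z = (z 0 • (Pi.single 0 1 : Fin n → ℝ) : Fin n → ℝ) +ᵥ π z := by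
          ext i
          by_cases hi : i = 0
          · subst hi; simp [hπ0]
          · simp [hi, hπi]
        have h1 : (b - a) z = (b - a).linear (z 0 • Pi.single 0 1) + (b - a) (π z) := by
          conv_lhs => rw [e, AffineMap.map_vadd]
          rfl
        have h2 : (b - a) (π z) = 0 := by simp [hgen' a ha b hb h z]
        rw [h2, add_zero, map_smul, smul_eq_mul] at h1
        exact h1
      rcases le_total 0 ((b - a).linear (Pi.single 0 1)) with h' | h'
      · left
        intro z hz
        have := key z
        have h3 := mul_nonneg hz.2 h'
        linarith
      · right
        intro z hz
        have := key z
        have h3 := mul_nonpos_of_nonneg_of_nonpos (show 0 ≤ z 0 from hz.2) h'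
        linarith
    · exact Or.inr fun z hz => ((hδs hz.1).1 b hb a ha h).le
  have hgood : ∀ z : PLHalfSpace n, z.1 ∈ C → (∀ i, ContinuousAt (fun z => f z i) z ∧
      ∃ a ∈ S i, f z i = a z.1) ∧ 𝓝 (f z) ≤ map f (𝓝 z) :=
    fun z hz => hVs (hball (hδs hz.1).2)
  have haff : ∀ i, ∃ a : (Fin n → ℝ) →ᵃ[ℝ] ℝ, ∀ z : PLHalfSpace n, z.1 ∈ C → f z i = a z.1 := by
    intro i
    let F : (Fin n → ℝ) → ℝ := fun y => if h : 0 ≤ y 0 then f ⟨y, h⟩ i else 0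
    have hF : ∀ y : PLHalfSpace n, F y.1 = f y i := fun y => by simp [F, y.2]
    have hex : ∃ a ∈ S i, EqOn F a C := by
      refine exists_eqOn_affine hCconv ⟨x, hxC⟩ (fun y hy => ?_) (hS i) (fun y hy => ?_)
        (fun a ha b hb => hord a (mem_iUnion_of_mem i ha) b (mem_iUnion_of_mem i hb))
      · have h3 : ContinuousWithinAt F {z | 0 ≤ z 0} y := by
          rw [continuousWithinAt_iff_continuousAt_domRestrict F hy.2]
          have : {z : Fin n → ℝ | 0 ≤ z 0}.domRestrict F = fun z => f z i := funext fun v => hF v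
          rw [this]
          exact ((hgood ⟨y, hy.2⟩ hy).1 i).1
        exact h3.mono inter_subset_right
      · obtain ⟨a, ha, h⟩ := ((hgood ⟨y, hy.2⟩ hy).1 i).2
        exact ⟨a, ha, (hF ⟨y, hy.2⟩).trans h⟩
    obtain ⟨a, -, ha⟩ := hex
    exact ⟨a, fun z hz => (hF z).symm.trans (ha hz)⟩
  choose a ha using haff
  set A : (Fin n → ℝ) →ᵃ[ℝ] (Fin n → ℝ) := AffineMap.pi a with hA
  have hfA : ∀ z : PLHalfSpace n, z.1 ∈ C → f z = A z.1 := fun z hz => by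
    ext i; simp [hA, ha i z hz]
  have himg : A '' C ∈ 𝓝 (A x) := by
    have h1 := (hgood ⟨x, hx0.ge⟩ hxC).2
    rw [hfA ⟨x, hx0.ge⟩ hxC] at h1
    have h2 : {z : PLHalfSpace n | z.1 ∈ C} ∈ 𝓝 (⟨x, hx0.ge⟩ : PLHalfSpace n) := by
      rw [nhds_subtype_eq_comap]
      exact mem_comap.2 ⟨_, Metric.ball_mem_nhds x hδ, fun z hz => ⟨hz, z.2⟩⟩
    refine mem_of_superset (h1 (image_mem_map h2)) ?_
    rintro _ ⟨z, hz, rfl⟩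
    exact ⟨z.1, hz, (hfA z hz).symm⟩
  have hsurj : Function.Surjective A.linear := by
    rw [← LinearMap.range_eq_top]
    refine Submodule.eq_top_of_nonempty_interior' _ ⟨0, mem_interior_iff_mem_nhds.2 ?_⟩
    have hc : Tendsto (fun v : Fin n → ℝ => v + A x) (𝓝 0) (𝓝 (A x)) := by
      have : Continuous fun v : Fin n → ℝ => v + A x := by fun_prop
      simpa using this.tendsto 0
    filter_upwards [hc himg] with v hv
    obtain ⟨y, -, hy⟩ := hv
    refine ⟨y - x, ?_⟩
    rw [← vsub_eq_sub, AffineMap.linearMap_vsub, hy, vsub_eq_sub, add_sub_cancel_right]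
  have hinj : Function.Injective A := by
    rw [← AffineMap.linear_injective_iff, LinearMap.injective_iff_surjective]
    exact hsurj
  have hCn : C ∈ 𝓝 x := by
    have := A.continuous_of_finiteDimensional.continuousAt himg
    rwa [mem_map, preimage_image_eq _ hinj] at this
  have hc : Tendsto (fun t : ℝ => x + t • (Pi.single 0 1 : Fin n → ℝ)) (𝓝 0) (𝓝 x) := by
    have : Continuous fun t : ℝ => x + t • (Pi.single 0 1 : Fin n → ℝ) := by fun_prop
    simpa using this.tendsto 0
  obtain ⟨t, ht, ht'⟩ := (Eventually.and (Filter.Eventually.filter_mono nhdsWithin_le_nhds (hc hCn))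
    (self_mem_nhdsWithin : Iio (0 : ℝ) ∈ 𝓝[<] 0)).exists
  have h1 : 0 ≤ (x + t • (Pi.single 0 1 : Fin n → ℝ)) 0 := ht.2
  simp [hx0] at h1
  exact absurd h1 (not_le.2 ht')

/-! ### Closed maps from compact spaces -/

/-- Separate the closed fibres in the normal space `Y`. For a closed map, the complement of `q ''
Uᶜ` is open and its preimage lies in `U`. -/
theorem IsClosedMap.t2Space_of_compact {Y X : Type*} [TopologicalSpace Y] [TopologicalSpace X]
    [CompactSpace Y] [T2Space Y] {q : Y → X} (hq : IsClosedMap q) (hc : Continuous q)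
    (hs : Function.Surjective q) : T2Space X := by
  have hker : ∀ U : Set Y, IsOpen U → IsOpen (q '' Uᶜ)ᶜ := fun U hU =>
    (hq _ hU.isClosed_compl).isOpen_compl
  have hfib : ∀ x, IsClosed (q ⁻¹' {x}) := by
    intro x
    obtain ⟨y, rfl⟩ := hs x
    have : IsClosed {q y} := by simpa using hq _ (isClosed_singleton (x := y))
    exact this.preimage hc
  refine ⟨fun x x' hne => ?_⟩
  obtain ⟨U, U', hU, hU', hxU, hxU', hd⟩ := normal_separation (hfib x) (hfib x')
    (Disjoint.preimage _ (disjoint_singleton.2 hne))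
  refine ⟨_, _, hker U hU, hker U' hU', ?_, ?_, ?_⟩
  · rintro ⟨y, hy, hyx⟩
    exact hy (hxU hyx)
  · rintro ⟨y, hy, hyx⟩
    exact hy (hxU' hyx)
  · rw [Set.disjoint_left]
    intro z hz hz'
    obtain ⟨y, rfl⟩ := hs z
    refine Set.disjoint_left.1 hd (by_contra fun h => hz ⟨y, h, rfl⟩)
      (by_contra fun h => hz' ⟨y, h, rfl⟩)

/-- Fibres are compact, so finite unions of basic open sets suffice to squeeze between a fibre and
the preimage of an open set. -/
theorem IsClosedMap.secondCountableTopology_of_compact {Y X : Type*} [TopologicalSpace Y]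
    [TopologicalSpace X] [CompactSpace Y] [SecondCountableTopology Y] [T2Space X] {q : Y → X}
    (hq : IsClosedMap q) (hc : Continuous q) (hs : Function.Surjective q) :
    SecondCountableTopology X := by
  set B := TopologicalSpace.countableBasis Y
  refine (TopologicalSpace.isTopologicalBasis_of_isOpen_of_nhds
    (s := (fun S : Set (Set Y) => (q '' (⋃₀ S)ᶜ)ᶜ) '' {S | S.Finite ∧ S ⊆ B}) ?_ ?_
    ).secondCountableTopology ((countable_ofPred_finite_subset
      (TopologicalSpace.countable_countableBasis Y)).image _)
  · rintro _ ⟨S, ⟨-, hS⟩, rfl⟩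
    exact (hq _ (isOpen_sUnion fun u hu =>
      TopologicalSpace.isOpen_of_mem_countableBasis (hS hu)).isClosed_compl).isOpen_compl
  · intro x O hx hO
    have hK : IsCompact (q ⁻¹' {x}) := (isClosed_singleton.preimage hc).isCompact
    have hO' := hO.preimage hc
    obtain ⟨T, hTB, hTf, hT⟩ := hK.elim_finite_subcover_image
      (b := {u ∈ B | u ⊆ q ⁻¹' O}) (c := id)
      (fun u hu => TopologicalSpace.isOpen_of_mem_countableBasis hu.1) (by
        intro y hy
        obtain ⟨u, hu, hyu, huO⟩ := (TopologicalSpace.isBasis_countableBasis Y).exists_subset_of_mem_open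
          (show y ∈ q ⁻¹' O by rw [mem_preimage, show q y = x from hy]; exact hx) hO'
        exact mem_biUnion (x := u) ⟨hu, huO⟩ hyu)
    refine ⟨_, ⟨T, ⟨hTf, fun u hu => (hTB hu).1⟩, rfl⟩, ?_, ?_⟩
    · rintro ⟨y, hy, hyx⟩
      refine hy ?_
      rw [sUnion_eq_biUnion]
      exact hT hyx
    · intro z hz
      obtain ⟨y, rfl⟩ := hs z
      have : y ∈ ⋃₀ T := by
        by_contra h
        exact hz ⟨y, h, rfl⟩
      obtain ⟨u, hu, hyu⟩ := this
      exact (hTB hu).2 hyu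

/-! ### The topology of the glued spaces -/

/-- Sets of points that are stable under permutations of the coordinates. -/
def PermInvariant {m : ℕ} (A : Set (Fin m → ℝ)) : Prop :=
  ∀ (σ : Equiv.Perm (Fin m)), ∀ x ∈ A, x ∘ σ.symm ∈ A

theorem permInvariant_stdSimplex (m : ℕ) : PermInvariant (stdSimplex ℝ (Fin m)) := fun σ x hx =>
  ⟨fun i => hx.1 _, by rw [← hx.2]; exact Equiv.sum_comp σ.symm x⟩

namespace FacePairing

variable {k n : ℕ} (P : FacePairing k n)

/-- The projection of the `i`-th copy of `A` to the glued space. -/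
def pt (A : Set (Fin (n + 1) → ℝ)) (i : Fin k) (x : A) : Quot (P.Glued A) := Quot.mk _ ⟨i, x⟩

variable {P}

theorem Glued.symm {A : Set (Fin (n + 1) → ℝ)} {p q : (_ : Fin k) × A} (h : P.Glued A p q) :
    P.Glued A q p := by
  obtain ⟨v, hv, hq, hw⟩ := h
  have e : (q.1, (P.partner (p.1, v)).2) = P.partner (p.1, v) := by rw [hq]
  refine ⟨(P.partner (p.1, v)).2, ?_, ?_, fun w => ?_⟩
  · rw [← P.vertexMap_opposite (p.1, v)]
    exact (hw v).trans hv
  · rw [e, P.partner_partner]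
  · rw [e, P.vertexMap_partner, ← hw, Equiv.apply_symm_apply]

/-- A chain of glueings acts by one permutation of coordinates, and it applies to every point that
vanishes where `p` does, in any permutation invariant set `A`. This permits passing between the full
and the truncated simplices. -/
theorem exists_perm_of_eqvGen {A₀ : Set (Fin (n + 1) → ℝ)} {p q : (_ : Fin k) × A₀}
    (h : Relation.EqvGen (P.Glued A₀) p q) : ∃ σ : Equiv.Perm (Fin (n + 1)),
      (∀ w, q.2.1 (σ w) = p.2.1 w) ∧ ∀ (A : Set (Fin (n + 1) → ℝ)) (hA : PermInvariant A) (x : A),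
        (∀ v, p.2.1 v = 0 → x.1 v = 0) → P.pt A p.1 x = P.pt A q.1 ⟨x.1 ∘ σ.symm, hA σ _ x.2⟩ := by
  induction h with
  | rel p q h =>
    obtain ⟨v, hv, hq, hw⟩ := h
    refine ⟨P.vertexMap (p.1, v), hw, fun A hA x hx => Quot.sound ⟨v, hx v hv, hq, fun w => ?_⟩⟩
    simp
  | refl p => exact ⟨1, fun w => rfl, fun A hA x hx => rfl⟩
  | symm p q h ih =>
    obtain ⟨σ, h1, h2⟩ := ih
    refine ⟨σ.symm, fun w => by rw [← h1, Equiv.apply_symm_apply], fun A hA x hx => ?_⟩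
    have := h2 A hA ⟨x.1 ∘ σ, by simpa using hA σ.symm _ x.2⟩ fun v hv => hx _ (by rw [h1, hv])
    rw [show (⟨x.1 ∘ σ.symm.symm, hA σ.symm _ x.2⟩ : A) = ⟨x.1 ∘ σ, by simpa using hA σ.symm _ x.2⟩
      from rfl, this]
    congr 1
    ext w
    simp
  | trans p q r _ _ ih ih' =>
    obtain ⟨σ, h1, h2⟩ := ih
    obtain ⟨σ', h1', h2'⟩ := ih'
    refine ⟨σ.trans σ', fun w => by rw [Equiv.trans_apply, h1', h1], fun A hA x hx => ?_⟩
    rw [h2 A hA x hx, h2' A hA _ fun v hv => ?_]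
    · rfl
    · refine hx _ ?_
      rw [← h1, Equiv.apply_symm_apply, hv]

theorem exists_perm_of_pt_eq {A₀ : Set (Fin (n + 1) → ℝ)} {i i' : Fin k} {x x' : A₀}
    (h : P.pt A₀ i x = P.pt A₀ i' x') : ∃ σ : Equiv.Perm (Fin (n + 1)),
      (∀ w, x'.1 (σ w) = x.1 w) ∧ ∀ (A : Set (Fin (n + 1) → ℝ)) (hA : PermInvariant A) (z : A),
        (∀ v, x.1 v = 0 → z.1 v = 0) → P.pt A i z = P.pt A i' ⟨z.1 ∘ σ.symm, hA σ _ z.2⟩ :=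
  exists_perm_of_eqvGen (Quot.eqvGen_exact h)

theorem pt_surjective {A : Set (Fin (n + 1) → ℝ)} (y : Quot (P.Glued A)) :
    ∃ i x, P.pt A i x = y := by
  obtain ⟨⟨i, x⟩, rfl⟩ := Quot.exists_rep y
  exact ⟨i, x, rfl⟩

theorem continuous_pt {A : Set (Fin (n + 1) → ℝ)} (i : Fin k) : Continuous (P.pt A i) :=
  continuous_quot_mk.comp continuous_sigmaMk

/-- The saturation of a closed set is a finite union of closed sets, indexed by a simplex, a
permutation and a set of coordinates required to vanish: by `exists_perm_of_eqvGen` these data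
account for all identifications. -/
theorem isClosedMap_quot_mk {A : Set (Fin (n + 1) → ℝ)} (hA : PermInvariant A) :
    IsClosedMap (Quot.mk (P.Glued A)) := by
  intro F hF
  rw [← isQuotientMap_quot_mk.isClosed_preimage, isClosed_sigma_iff]
  intro i'
  have hσ : ∀ σ : Equiv.Perm (Fin (n + 1)), Continuous fun y : A =>
      (⟨y.1 ∘ σ, by simpa using hA σ.symm _ y.2⟩ : A) := fun σ =>
    Continuous.subtype_mk (f := fun y : A => y.1 ∘ σ) (continuous_pi fun w =>
      (continuous_apply (σ w)).comp continuous_subtype_val) _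
  have : (Sigma.mk i' ⁻¹' (Quot.mk (P.Glued A) ⁻¹' (Quot.mk (P.Glued A) '' F))) =
      ⋃ t ∈ {t : Fin k × Equiv.Perm (Fin (n + 1)) × Finset (Fin (n + 1)) |
        ∀ x : A, (∀ v ∈ t.2.2, x.1 v = 0) →
          P.pt A t.1 x = P.pt A i' ⟨x.1 ∘ t.2.1.symm, hA t.2.1 _ x.2⟩},
      (fun y : A => (⟨y.1 ∘ t.2.1, by simpa using hA t.2.1.symm _ y.2⟩ : A)) ⁻¹'
        ({x : A | (⟨t.1, x⟩ : (_ : Fin k) × A) ∈ F} ∩ {x : A | ∀ v ∈ t.2.2, x.1 v = 0}) := by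
    ext y
    constructor
    · rintro ⟨⟨i, x⟩, hx, hxy⟩
      obtain ⟨σ, h1, h2⟩ := exists_perm_of_pt_eq (P := P) (show P.pt A i x = P.pt A i' y from hxy)
      have hyx : (⟨y.1 ∘ σ, by simpa using hA σ.symm _ y.2⟩ : A) = x := Subtype.ext (funext h1)
      classical
      refine mem_biUnion (x := (i, σ, Finset.univ.filter fun v => x.1 v = 0)) ?_ ?_
      · intro z hz
        exact h2 A hA z fun v hv => hz v (by simpa using hv)
      · simp only [mem_preimage, hyx]
        exact ⟨hx, fun v hv => by simpa using hv⟩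
    · intro hy
      obtain ⟨⟨i, σ, Z⟩, ht, h1, h2⟩ := mem_iUnion₂.1 hy
      refine ⟨_, h1, ?_⟩
      have := ht _ h2
      refine this.trans ?_
      change P.pt A i' _ = P.pt A i' y
      congr 1
      ext w
      simp
  rw [this]
  refine (Set.toFinite _).isClosed_biUnion fun t _ => IsClosed.preimage (hσ _)
    (IsClosed.inter (hF.preimage (continuous_sigmaMk (σ := fun _ : Fin k => A) (i := t.1))) ?_)
  have : {x : A | ∀ v ∈ t.2.2, x.1 v = 0} = ⋂ v ∈ t.2.2, {x : A | x.1 v = 0} := by ext; simp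
  rw [this]
  exact isClosed_biInter fun v _ => isClosed_eq
    ((continuous_apply v).comp continuous_subtype_val) continuous_const

/-- For a closed map, neighbourhoods of a fibre contain preimages of neighbourhoods of the point.
Local statements on a glued space are thereby reduced to the lifts of a point. -/
theorem eventually_nhds_iff_pt {A : Set (Fin (n + 1) → ℝ)} (hA : PermInvariant A)
    {y : Quot (P.Glued A)} {R : Quot (P.Glued A) → Prop} :
    (∀ᶠ z in 𝓝 y, R z) ↔ ∀ i x, P.pt A i x = y → ∀ᶠ x' in 𝓝 x, R (P.pt A i x') := by
  constructor
  · rintro h i x rfl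
    exact (continuous_pt i).continuousAt.eventually h
  · intro h
    have h1 : {p | R (Quot.mk (P.Glued A) p)} ∈ 𝓝ˢ (Quot.mk (P.Glued A) ⁻¹' {y}) := by
      rw [mem_nhdsSet_iff_forall]
      rintro ⟨i, x⟩ hx
      rw [Sigma.nhds_mk]
      exact h i x hx
    rw [← (isClosedMap_quot_mk hA).comap_nhds_eq continuous_quot_mk, mem_comap] at h1
    obtain ⟨V, hV, hVs⟩ := h1
    filter_upwards [hV] with z hz
    obtain ⟨p, rfl⟩ := Quot.exists_rep z
    exact hVs hz

theorem continuousAt_iff_pt {A : Set (Fin (n + 1) → ℝ)} (hA : PermInvariant A) {Z : Type*}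
    [TopologicalSpace Z] {y : Quot (P.Glued A)} {f : Quot (P.Glued A) → Z} :
    ContinuousAt f y ↔ ∀ i x, P.pt A i x = y → ContinuousAt (fun x' => f (P.pt A i x')) x := by
  constructor
  · rintro h i x rfl
    exact h.comp (continuous_pt i).continuousAt
  · intro h V hV
    refine (eventually_nhds_iff_pt hA).2 ?_
    rintro i x rfl
    exact h i x rfl hV

theorem plAt_iff_pt {A : Set (Fin (n + 1) → ℝ)} {y : Quot (P.Glued A)}
    {f : Quot (P.Glued A) → ℝ} :
    PLAt f y ↔ ∀ i x, P.pt A i x = y → PLAt (fun x' => f (P.pt A i x')) x :=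
  ⟨fun h i x hx => h ⟨i, x⟩ hx, fun h p hp => h p.1 p.2 hp⟩

theorem isPLMapAt_pt {A : Set (Fin (n + 1) → ℝ)} (i : Fin k) (x : A) :
    IsPLMapAt (P.pt A i) x :=
  ⟨(continuous_pt i).continuousAt, fun _ hg => plAt_iff_pt.1 hg i x rfl⟩

theorem isPLMapAt_iff_pt {A : Set (Fin (n + 1) → ℝ)} (hA : PermInvariant A) {Z : Type*}
    [TopologicalSpace Z] [PLStructure Z] {y : Quot (P.Glued A)} {f : Quot (P.Glued A) → Z} :
    IsPLMapAt f y ↔ ∀ i x, P.pt A i x = y → IsPLMapAt (fun x' => f (P.pt A i x')) x := by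
  constructor
  · rintro h i x rfl
    exact h.comp (isPLMapAt_pt i x)
  · intro h
    refine ⟨(continuousAt_iff_pt hA).2 fun i x hx => (h i x hx).1, fun g hg => ?_⟩
    refine plAt_iff_pt.2 ?_
    rintro i x rfl
    exact (h i x rfl).2 g hg

theorem t2Space_glued {A : Set (Fin (n + 1) → ℝ)} (hA : PermInvariant A) (hc : IsCompact A) :
    T2Space (Quot (P.Glued A)) :=
  have := isCompact_iff_compactSpace.1 hc
  (isClosedMap_quot_mk hA).t2Space_of_compact continuous_quot_mk Quot.mk_surjective

theorem compactSpace_glued {A : Set (Fin (n + 1) → ℝ)} (hc : IsCompact A) :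
    CompactSpace (Quot (P.Glued A)) :=
  have := isCompact_iff_compactSpace.1 hc
  inferInstance

theorem secondCountableTopology_glued {A : Set (Fin (n + 1) → ℝ)} (hA : PermInvariant A)
    (hc : IsCompact A) : SecondCountableTopology (Quot (P.Glued A)) :=
  have := isCompact_iff_compactSpace.1 hc
  have := t2Space_glued (P := P) hA hc
  (isClosedMap_quot_mk hA).secondCountableTopology_of_compact continuous_quot_mk Quot.mk_surjective

/-- The map of glued spaces induced by an inclusion. -/
def incl {A B : Set (Fin (n + 1) → ℝ)} (hAB : A ⊆ B) : Quot (P.Glued A) → Quot (P.Glued B) :=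
  Quot.map (fun p => ⟨p.1, ⟨p.2.1, hAB p.2.2⟩⟩) fun _ _ h => h

theorem incl_pt {A B : Set (Fin (n + 1) → ℝ)} (hAB : A ⊆ B) (i : Fin k) (x : A) :
    P.incl hAB (P.pt A i x) = P.pt B i ⟨x.1, hAB x.2⟩ := rfl

/-- The permutation realized by a chain of glueings in `B` also identifies the two points within the
permutation invariant set `A`. -/
theorem pt_eq_pt_iff {A B : Set (Fin (n + 1) → ℝ)} (hA : PermInvariant A) (hAB : A ⊆ B)
    {i i' : Fin k} {x x' : A} :
    P.pt B i ⟨x.1, hAB x.2⟩ = P.pt B i' ⟨x'.1, hAB x'.2⟩ ↔ P.pt A i x = P.pt A i' x' := by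
  refine ⟨fun h => ?_, fun h => by rw [← incl_pt hAB, h, incl_pt]⟩
  obtain ⟨σ, h1, h2⟩ := exists_perm_of_pt_eq h
  rw [h2 A hA x fun v hv => hv]
  congr 1
  refine Subtype.ext (funext fun w => ?_)
  have := h1 (σ.symm w)
  rw [Equiv.apply_symm_apply] at this
  exact this.symm

theorem continuous_incl {A B : Set (Fin (n + 1) → ℝ)} (hAB : A ⊆ B) :
    Continuous (P.incl hAB) := by
  refine continuous_quot_lift _ (continuous_quot_mk.comp (continuous_sigma fun i => ?_))
  exact continuous_sigmaMk.comp (Continuous.subtype_mk continuous_subtype_val _)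

theorem isClosedEmbedding_incl {A B : Set (Fin (n + 1) → ℝ)} (hA : PermInvariant A)
    (hB : PermInvariant B) (hAB : A ⊆ B) (hAc : IsCompact A) (hBc : IsCompact B) :
    IsClosedEmbedding (P.incl hAB) := by
  have := compactSpace_glued (P := P) hAc
  have := t2Space_glued (P := P) hB hBc
  refine (continuous_incl hAB).isClosedEmbedding fun y y' h => ?_
  obtain ⟨i, x, rfl⟩ := pt_surjective y
  obtain ⟨i', x', rfl⟩ := pt_surjective y'
  exact (pt_eq_pt_iff hA hAB).1 h

end FacePairing

/-! ### Layers of a non-negative function on a finite set -/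

section Layers

variable {K : Type*} [Fintype K] [DecidableEq K]

/-- The maximum of `0` and the values of `y`. -/
noncomputable def topLevel (y : K → ℝ) : ℝ := Finset.univ.fold max 0 y

/-- The length of the interval of levels `t > 0` with `{k | t ≤ y k} = C`. -/
noncomputable def layer (y : K → ℝ) (C : Finset K) : ℝ :=
  max 0 (C.fold min (topLevel y) y - Cᶜ.fold max 0 y)

/-- The layers, scaled to become barycentric coordinates. -/
noncomputable def layers (y : K → ℝ) (C : Finset K) : ℝ := (C.card + 1) * layer y C

/-- The function with given scaled layers. -/
noncomputable def unlayers (w : Finset K → ℝ) (k : K) : ℝ :=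
  ∑ C : Finset K, if k ∈ C then w C / (C.card + 1) else 0

theorem layer_nonneg (y : K → ℝ) (C : Finset K) : 0 ≤ layer y C := le_max_left _ _

theorem layers_nonneg (y : K → ℝ) (C : Finset K) : 0 ≤ layers y C :=
  mul_nonneg (by positivity) (layer_nonneg y C)

theorem layers_eq_zero_iff {y : K → ℝ} {C : Finset K} : layers y C = 0 ↔ layer y C = 0 := by
  have : (C.card + 1 : ℝ) ≠ 0 := by positivity
  simp [layers, this]

theorem le_topLevel (y : K → ℝ) (k : K) : y k ≤ topLevel y :=
  (Finset.le_fold_max _).2 (Or.inr ⟨k, Finset.mem_univ k, le_rfl⟩)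

theorem topLevel_nonneg (y : K → ℝ) : 0 ≤ topLevel y :=
  (Finset.le_fold_max _).2 (Or.inl le_rfl)

theorem topLevel_le {y : K → ℝ} {c : ℝ} (hc : 0 ≤ c) (h : ∀ k, y k ≤ c) : topLevel y ≤ c :=
  (Finset.fold_max_le _).2 ⟨hc, fun k _ => h k⟩

theorem mem_layer_Ioc {y : K → ℝ} {C : Finset K} {t : ℝ} :
    t ∈ Ioc (Cᶜ.fold max 0 y) (C.fold min (topLevel y) y) ↔
      t ∈ Ioc 0 (topLevel y) ∧ ∀ k, k ∈ C ↔ t ≤ y k := by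
  rw [mem_Ioc, Finset.fold_max_lt, Finset.le_fold_min, mem_Ioc]
  constructor
  · rintro ⟨⟨h0, h1⟩, h2, h3⟩
    refine ⟨⟨h0, h2⟩, fun k => ⟨h3 k, fun h => ?_⟩⟩
    by_contra hk
    exact absurd h (not_le.2 (h1 k (by simpa using hk)))
  · rintro ⟨⟨h0, h2⟩, h⟩
    exact ⟨⟨h0, fun k hk => not_le.1 fun h' => Finset.mem_compl.1 hk ((h k).2 h')⟩, h2,
      fun k hk => (h k).1 hk⟩

theorem layer_eq_volume (y : K → ℝ) (C : Finset K) :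
    ENNReal.ofReal (layer y C) =
      MeasureTheory.volume (Ioc (Cᶜ.fold max 0 y) (C.fold min (topLevel y) y)) := by
  rw [Real.volume_Ioc, layer, max_comm, ENNReal.ofReal_max, ENNReal.ofReal_zero]
  simp

/-- Layers are the lengths of disjoint intervals of levels, here with union `(0, c]`; additivity of
Lebesgue measure gives the sum. -/
theorem sum_layer (y : K → ℝ) (s : Finset (Finset K)) {c : ℝ} (hc : 0 ≤ c)
    (hs : ∀ t ∈ Ioc 0 (topLevel y), (Finset.univ.filter fun k => t ≤ y k) ∈ s ↔ t ≤ c)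
    (hcM : c ≤ topLevel y) : ∑ C ∈ s, layer y C = c := by
  have h1 : (⋃ C ∈ s, Ioc (Cᶜ.fold max 0 y) (C.fold min (topLevel y) y)) = Ioc 0 c := by
    ext t
    simp only [mem_iUnion, mem_layer_Ioc, exists_prop]
    constructor
    · rintro ⟨C, hC, ht, h⟩
      refine ⟨ht.1, (hs t ht).1 ?_⟩
      convert! hC
      ext k
      simp [h]
    · intro ht
      have ht' : t ∈ Ioc 0 (topLevel y) := ⟨ht.1, ht.2.trans hcM⟩
      exact ⟨_, (hs t ht').2 ht.2, ht', fun k => by simp⟩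
  have h2 : MeasureTheory.volume (⋃ C ∈ s, Ioc (Cᶜ.fold max 0 y) (C.fold min (topLevel y) y)) =
      ∑ C ∈ s, ENNReal.ofReal (layer y C) := by
    rw [MeasureTheory.measure_biUnion_finset]
    · exact Finset.sum_congr rfl fun C _ => (layer_eq_volume y C).symm
    · intro C _ D _ hne
      refine Set.disjoint_left.2 fun t ht ht' => hne ?_
      rw [mem_layer_Ioc] at ht ht'
      ext k
      rw [ht.2, ht'.2]
    · exact fun _ _ => measurableSet_Ioc
  rw [h1, Real.volume_Ioc, sub_zero, ← ENNReal.ofReal_sum_of_nonneg fun C _ => layer_nonneg y C,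
    ENNReal.ofReal_eq_ofReal_iff hc (Finset.sum_nonneg fun C _ => layer_nonneg y C)] at h2
  exact h2.symm

theorem sum_layer_mem {y : K → ℝ} (hy : ∀ k, 0 ≤ y k) (k : K) :
    (∑ C : Finset K, if k ∈ C then layer y C else 0) = y k := by
  rw [← Finset.sum_filter]
  refine sum_layer y _ (hy k) (fun t ht => ?_) (le_topLevel y k)
  simp

theorem sum_layer_univ (y : K → ℝ) : ∑ C : Finset K, layer y C = topLevel y :=
  sum_layer y _ (topLevel_nonneg y) (fun t ht => by simp [ht.2]) le_rfl

theorem layer_empty (y : K → ℝ) : layer y ∅ = 0 := by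
  simp [layer, topLevel]

theorem layers_empty (y : K → ℝ) : layers y ∅ = 0 := by simp [layers, layer_empty]

theorem isChain_layer (y : K → ℝ) : IsChain (· ⊆ ·) {C | layer y C ≠ 0} := by
  intro C hC D hD _
  have key : ∀ C, layer y C ≠ 0 →
      (Ioc (Cᶜ.fold max 0 y) (C.fold min (topLevel y) y)).Nonempty := by
    intro C hC
    rw [nonempty_Ioc]
    by_contra h
    exact hC (max_eq_left (by linarith))
  obtain ⟨t, ht⟩ := key C hC
  obtain ⟨s, hs⟩ := key D hD
  rw [mem_layer_Ioc] at ht hs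
  rcases le_total t s with h | h
  · right
    intro k hk
    exact (ht.2 k).2 (h.trans ((hs.2 k).1 hk))
  · left
    intro k hk
    exact (hs.2 k).2 (h.trans ((ht.2 k).1 hk))

theorem isChain_layers (y : K → ℝ) : IsChain (· ⊆ ·) {C | layers y C ≠ 0} := by
  simpa only [ne_eq, layers_eq_zero_iff] using isChain_layer y

/-- Uniqueness of the decomposition along a chain: each `w C` is at most the corresponding layer,
while the total of the layers is at most the total of `w`. -/
theorem layer_eq_of_isChain {w : Finset K → ℝ} (hw : ∀ C, 0 ≤ w C) (hw0 : w ∅ = 0)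
    (hch : IsChain (· ⊆ ·) {C | w C ≠ 0}) :
    layer (fun k => ∑ C : Finset K, if k ∈ C then w C else 0) = w := by
  set y : K → ℝ := fun k => ∑ C : Finset K, if k ∈ C then w C else 0 with hy
  have hle : ∀ C, w C ≤ layer y C := by
    intro C
    by_cases hC : w C = 0
    · rw [hC]; exact layer_nonneg y C
    have hCne : C.Nonempty := Finset.nonempty_iff_ne_empty.2 fun h => hC (h ▸ hw0)
    -- The weight of the members of the chain that contain `C`. Off `C` the function loses at least
    -- `w C` compared with this value, which leaves an interval of levels of length at least `w C`.
    set s : ℝ := ∑ D : Finset K, if C ⊆ D then w D else 0 with hs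
    have h1 : ∀ k ∈ C, s ≤ y k := fun k hk => Finset.sum_le_sum fun D _ => by
      by_cases h : C ⊆ D
      · simp [h, h hk]
      · simp only [h, if_false]; split_ifs <;> simp [hw]
    have h2 : ∀ k ∉ C, y k ≤ s - w C := by
      intro k hk
      have : s - w C = ∑ D : Finset K, ((if C ⊆ D then w D else 0) - if D = C then w D else 0) := by
        rw [Finset.sum_sub_distrib]; simp [hs]
      rw [this]
      refine Finset.sum_le_sum fun D _ => ?_
      by_cases hD : w D = 0
      · simp [hD]
      by_cases hkD : k ∈ D
      · have hne : D ≠ C := fun h => hk (h ▸ hkD)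
        have hCD : C ⊆ D := (hch.total hC hD).resolve_right fun h => hk (h hkD)
        simp [hkD, hne, hCD]
      · by_cases h : D = C
        · simp [h, hk]
        · simp only [hkD, if_false, h, sub_zero]; split_ifs <;> simp [hw]
    have h3 : s ≤ C.fold min (topLevel y) y := by
      obtain ⟨k, hk⟩ := hCne
      exact (Finset.le_fold_min _).2 ⟨(h1 k hk).trans (le_topLevel y k), h1⟩
    have h4 : Cᶜ.fold max 0 y ≤ s - w C := by
      refine (Finset.fold_max_le _).2 ⟨?_, fun k hk => h2 k (by simpa using hk)⟩
      have : w C ≤ s := by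
        have := Finset.single_le_sum (f := fun D => if C ⊆ D then w D else 0)
          (fun D _ => by split_ifs <;> simp [hw]) (Finset.mem_univ C)
        simpa using this
      linarith
    exact le_max_of_le_right (by linarith)
  have htot : ∑ C, layer y C ≤ ∑ C, w C := by
    rw [sum_layer_univ]
    refine topLevel_le (Finset.sum_nonneg fun C _ => hw C) fun k => ?_
    exact Finset.sum_le_sum fun C _ => by split_ifs <;> simp [hw]
  have heq : ∑ C, (layer y C - w C) = 0 := by
    refine le_antisymm ?_ (Finset.sum_nonneg fun C _ => sub_nonneg.2 (hle C))
    rw [Finset.sum_sub_distrib]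
    linarith
  ext C
  have := (Finset.sum_eq_zero_iff_of_nonneg fun C _ => sub_nonneg.2 (hle C)).1 heq C
    (Finset.mem_univ C)
  linarith

theorem layers_unlayers {w : Finset K → ℝ} (hw : ∀ C, 0 ≤ w C) (hw0 : w ∅ = 0)
    (hch : IsChain (· ⊆ ·) {C | w C ≠ 0}) : layers (unlayers w) = w := by
  have hpos : ∀ C : Finset K, (C.card + 1 : ℝ) ≠ 0 := fun C => by positivity
  have := layer_eq_of_isChain (w := fun C => w C / (C.card + 1))
    (fun C => div_nonneg (hw C) (by positivity)) (by simp [hw0])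
    (by simpa [hpos] using hch)
  ext C
  have h := congrFun this C
  unfold layers unlayers
  rw [h]
  field_simp

theorem unlayers_layers {y : K → ℝ} (hy : ∀ k, 0 ≤ y k) : unlayers (layers y) = y := by
  ext k
  rw [← sum_layer_mem hy k]
  refine Finset.sum_congr rfl fun C _ => ?_
  have : (C.card + 1 : ℝ) ≠ 0 := by positivity
  unfold layers
  split_ifs
  · field_simp
  · rfl

/-- The factor `C.card + 1` splits: the part `C.card` counts each layer once for every element of
`C` and gives the sum of `y`, the part `1` gives the top level. The second term is what makes
`starRadius` exceed one. -/
theorem sum_layers {y : K → ℝ} (hy : ∀ k, 0 ≤ y k) :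
    ∑ C, layers y C = ∑ k, y k + topLevel y := by
  have h1 : ∑ C : Finset K, (C.card : ℝ) * layer y C = ∑ k, y k := by
    simp only [← sum_layer_mem hy]
    rw [Finset.sum_comm]
    refine Finset.sum_congr rfl fun C _ => ?_
    rw [Finset.sum_ite_mem, Finset.univ_inter, Finset.sum_const, nsmul_eq_mul]
  rw [← h1, ← sum_layer_univ, ← Finset.sum_add_distrib]
  exact Finset.sum_congr rfl fun C _ => by unfold layers; ring

theorem unlayers_nonneg {w : Finset K → ℝ} (hw : ∀ C, 0 ≤ w C) (k : K) : 0 ≤ unlayers w k :=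
  Finset.sum_nonneg fun C _ => by
    split_ifs
    · exact div_nonneg (hw C) (by positivity)
    · rfl

theorem exists_of_unlayers_ne_zero {w : Finset K → ℝ} {k : K} (h : unlayers w k ≠ 0) :
    ∃ C, k ∈ C ∧ w C ≠ 0 := by
  obtain ⟨C, -, hC⟩ := Finset.exists_ne_zero_of_sum_ne_zero h
  refine ⟨C, by_contra fun h' => by simp [h'] at hC, fun h' => by simp [h'] at hC⟩

theorem ne_zero_of_layers_ne_zero {y : K → ℝ} (hy : ∀ k, 0 ≤ y k) {C : Finset K} {k : K}
    (hk : k ∈ C) (h : layers y C ≠ 0) : y k ≠ 0 := by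
  rw [← sum_layer_mem hy k]
  have h' : layer y C ≠ 0 := fun h' => h (layers_eq_zero_iff.2 h')
  refine (Finset.sum_pos' (fun D _ => ?_) ⟨C, Finset.mem_univ C, ?_⟩).ne'
  · split_ifs <;> simp [layer_nonneg]
  · simpa [hk] using lt_of_le_of_ne (layer_nonneg y C) (Ne.symm h')

theorem fold_max_const_mul {c : ℝ} (hc : 0 ≤ c) (s : Finset K) (b : ℝ) (y : K → ℝ) :
    s.fold max (c * b) (fun k => c * y k) = c * s.fold max b y := by
  induction s using Finset.induction_on with
  | empty => simp
  | insert a s ha ih => rw [Finset.fold_insert ha, Finset.fold_insert ha, ih, mul_max_of_nonneg _ _ hc]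

theorem fold_min_const_mul {c : ℝ} (hc : 0 ≤ c) (s : Finset K) (b : ℝ) (y : K → ℝ) :
    s.fold min (c * b) (fun k => c * y k) = c * s.fold min b y := by
  induction s using Finset.induction_on with
  | empty => simp
  | insert a s ha ih => rw [Finset.fold_insert ha, Finset.fold_insert ha, ih, mul_min_of_nonneg _ _ hc]

theorem layers_const_mul {c : ℝ} (hc : 0 ≤ c) (y : K → ℝ) :
    layers (fun k => c * y k) = fun C => c * layers y C := by
  have h1 : ∀ s : Finset K, s.fold max 0 (fun k => c * y k) = c * s.fold max 0 y := fun s => by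
    rw [← fold_max_const_mul hc, mul_zero]
  ext C
  rw [layers, layer, topLevel, h1, h1, fold_min_const_mul hc, ← mul_sub]
  unfold layers layer topLevel
  conv_rhs => rw [mul_left_comm, mul_max_of_nonneg _ _ hc, mul_zero]

theorem layers_comp_symm (y : K → ℝ) (e : Equiv.Perm K) :
    layers (y ∘ e.symm) = layers y ∘ e.finsetCongr.symm := by
  have h1 : ∀ s : Finset K, ∀ b, s.fold max b (y ∘ e.symm) =
      (s.map e.symm.toEmbedding).fold max b y := fun s b => by rw [Finset.fold_map]; rfl
  have h2 : ∀ s : Finset K, ∀ b, s.fold min b (y ∘ e.symm) =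
      (s.map e.symm.toEmbedding).fold min b y := fun s b => by rw [Finset.fold_map]; rfl
  ext C
  have h3 : e.finsetCongr.symm C = C.map e.symm.toEmbedding := rfl
  have h4 : Finset.univ.map e.symm.toEmbedding = (Finset.univ : Finset K) := by
    ext; simp
  have h5 : Cᶜ.map e.symm.toEmbedding = (C.map e.symm.toEmbedding)ᶜ := by
    ext k; simp
  rw [Function.comp_apply, h3]
  unfold layers layer topLevel
  rw [h1, h1, h2, h4, h5, Finset.card_map]

theorem unlayers_comp_symm (w : Finset K → ℝ) (e : Equiv.Perm K) :
    unlayers (w ∘ e.finsetCongr.symm) = unlayers w ∘ e.symm := by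
  ext k
  simp only [unlayers, Function.comp_apply]
  rw [← Equiv.sum_comp e.finsetCongr]
  refine Finset.sum_congr rfl fun C _ => ?_
  have : (C.map e.toEmbedding).map e.symm.toEmbedding = C := by ext; simp
  simp [this]

theorem isSel_topLevel {Z ι : Type*} [TopologicalSpace Z] {j : Z → ι → ℝ} {y : Z → K → ℝ} {z : Z}
    (h : ∀ k, IsSel j (fun z => y z k) z) : IsSel j (fun z => topLevel (y z)) z :=
  IsSel.fold_max (f := fun _ => 0) (F := fun k z => y z k) _ (IsSel.const 0 z) fun k _ => h k

theorem isSel_layers {Z ι : Type*} [TopologicalSpace Z] {j : Z → ι → ℝ} {y : Z → K → ℝ} {z : Z}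
    (h : ∀ k, IsSel j (fun z => y z k) z) (C : Finset K) :
    IsSel j (fun z => layers (y z) C) z := by
  refine IsSel.const_mul _ ((IsSel.const 0 z).max (IsSel.sub ?_ ?_))
  · exact IsSel.fold_min (F := fun k z => y z k) _ (isSel_topLevel h) fun k _ => h k
  · exact IsSel.fold_max (f := fun _ => 0) (F := fun k z => y z k) _ (IsSel.const 0 z) fun k _ => h k

theorem isSel_unlayers {Z ι : Type*} [TopologicalSpace Z] {j : Z → ι → ℝ} {w : Z → Finset K → ℝ}
    {z : Z} (h : ∀ C, IsSel j (fun z => w z C) z) (k : K) :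
    IsSel j (fun z => unlayers (w z) k) z := by
  refine IsSel.sum _ fun C _ => ?_
  by_cases hk : k ∈ C
  · simpa only [hk, if_true, div_eq_mul_inv] using (h C).mul_const _
  · simpa only [hk, if_false] using IsSel.const 0 z

end Layers

/-! ### Reparametrizing ranked barycentric coordinates -/

section Ranked

variable {I : Type*} [Fintype I]

/-- The sum of the coordinates of rank less than `m`. -/
noncomputable def rankSum (r : I → ℕ) (w : I → ℝ) (m : ℕ) : ℝ := ∑ i, if r i < m then w i else 0

/-- Apply `F` to the partial sums of `w`. -/
noncomputable def reparam (r : I → ℕ) (F : ℝ → ℝ) (w : I → ℝ) (i : I) : ℝ :=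
  F (rankSum r w (r i) + w i) - F (rankSum r w (r i))

variable {r : I → ℕ} {w : I → ℝ} {F : ℝ → ℝ}

/-- Each rank carries at most one non-zero coordinate, so the increments of `F` telescope along the
ranks. -/
theorem rankSum_reparam (hw : ∀ i i', w i ≠ 0 → w i' ≠ 0 → r i = r i' → i = i') (hF : F 0 = 0)
    (m : ℕ) : rankSum r (reparam r F w) m = F (rankSum r w m) := by
  classical
  induction m with
  | zero => simp [rankSum, hF]
  | succ m ih =>
    have hsucc : ∀ v : I → ℝ, rankSum r v (m + 1) = rankSum r v m + ∑ i, if r i = m then v i else 0 := by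
      intro v
      rw [rankSum, rankSum, ← Finset.sum_add_distrib]
      refine Finset.sum_congr rfl fun i _ => ?_
      rcases lt_trichotomy (r i) m with h | h | h
      · simp [h, h.ne, Nat.lt_succ_of_lt h]
      · simp [h]
      · simp [h.ne', not_lt.2 h.le, not_lt.2 (Nat.succ_le_of_lt h)]
    rw [hsucc, hsucc, ih]
    by_cases h : ∃ i, r i = m ∧ w i ≠ 0
    · obtain ⟨i₀, hi₀, hwi₀⟩ := h
      have hz : ∀ i, i ≠ i₀ → r i = m → w i = 0 := fun i hi hri => by
        by_contra h
        exact hi (hw i i₀ h hwi₀ (hri.trans hi₀.symm))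
      rw [Finset.sum_eq_single i₀ (fun i _ hi => ?_) (by simp),
        Finset.sum_eq_single i₀ (fun i _ hi => ?_) (by simp)]
      · simp [hi₀, reparam]
      · split_ifs with h
        · exact hz i hi h
        · rfl
      · split_ifs with h
        · simp [reparam, hz i hi h]
        · rfl
    · push Not at h
      rw [Finset.sum_eq_zero (fun i _ => ?_), Finset.sum_eq_zero (fun i _ => ?_)]
      · simp
      · split_ifs with h'
        · exact h i h'
        · rfl
      · split_ifs with h'
        · simp [reparam, h i h']
        · rfl

theorem exists_rankSum_eq (r : I → ℕ) : ∃ m, ∀ w : I → ℝ, rankSum r w m = ∑ i, w i := by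
  refine ⟨Finset.univ.sup r + 1, fun w => Finset.sum_congr rfl fun i _ => ?_⟩
  rw [if_pos (Nat.lt_succ_of_le (Finset.le_sup (Finset.mem_univ i)))]

theorem sum_reparam (hw : ∀ i i', w i ≠ 0 → w i' ≠ 0 → r i = r i' → i = i') (hF : F 0 = 0) :
    ∑ i, reparam r F w i = F (∑ i, w i) := by
  obtain ⟨m, hm⟩ := exists_rankSum_eq r
  rw [← hm, ← hm, rankSum_reparam hw hF]

/-- Since partial sums are transformed by `F`, successive reparametrizations compose like functions.
In particular inverse functions give inverse reparametrizations. -/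
theorem reparam_reparam (hw : ∀ i i', w i ≠ 0 → w i' ≠ 0 → r i = r i' → i = i') (hF : F 0 = 0)
    (G : ℝ → ℝ) : reparam r G (reparam r F w) = reparam r (fun s => G (F s)) w := by
  ext i
  unfold reparam
  have h := rankSum_reparam hw hF (r i)
  unfold reparam at h
  rw [h, add_sub_cancel]

theorem reparam_congr (hw : ∀ i, 0 ≤ w i) {G : ℝ → ℝ} (h : EqOn F G (Icc 0 (∑ i, w i))) :
    reparam r F w = reparam r G w := by
  classical
  ext i
  have h0 : 0 ≤ rankSum r w (r i) := Finset.sum_nonneg fun i _ => by split_ifs <;> simp [hw]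
  have h1 : rankSum r w (r i) + w i ≤ ∑ i, w i := by
    have : w i = ∑ i', if i' = i then w i' else 0 := by simp
    rw [rankSum, this, ← Finset.sum_add_distrib]
    refine Finset.sum_le_sum fun i' _ => ?_
    by_cases hi : i' = i
    · simp [hi]
    · simp only [hi, if_false, add_zero]; split_ifs <;> simp [hw]
  have h2 := hw i
  rw [reparam, reparam, h ⟨by linarith, h1⟩, h ⟨h0, by linarith⟩]

theorem reparam_id : reparam r (fun s => s) w = w := by
  ext i; simp [reparam]

theorem reparam_nonneg (hw : ∀ i, 0 ≤ w i) (hF : MonotoneOn F (Icc 0 (∑ i, w i))) (i : I) :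
    0 ≤ reparam r F w i := by
  classical
  have h0 : 0 ≤ rankSum r w (r i) := Finset.sum_nonneg fun i _ => by split_ifs <;> simp [hw]
  have h1 : rankSum r w (r i) + w i ≤ ∑ i, w i := by
    have : w i = ∑ i', if i' = i then w i' else 0 := by simp
    rw [rankSum, this, ← Finset.sum_add_distrib]
    refine Finset.sum_le_sum fun i' _ => ?_
    by_cases hi : i' = i
    · simp [hi]
    · simp only [hi, if_false, add_zero]; split_ifs <;> simp [hw]
  have h2 := hw i
  exact sub_nonneg.2 (hF ⟨h0, by linarith⟩ ⟨by linarith, h1⟩ (by linarith))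

theorem reparam_eq_zero {i : I} (h : w i = 0) : reparam r F w i = 0 := by simp [reparam, h]

theorem reparam_comp_symm (e : Equiv.Perm I) (he : ∀ i, r (e i) = r i) :
    reparam r F (w ∘ e.symm) = reparam r F w ∘ e.symm := by
  have h : ∀ m, rankSum r (w ∘ e.symm) m = rankSum r w m := fun m => by
    rw [rankSum, ← Equiv.sum_comp e]
    simp [rankSum, he]
  have he' : ∀ i, r (e.symm i) = r i := fun i => by rw [← he, Equiv.apply_symm_apply]
  ext i
  simp [reparam, h, he']

end Ranked

/-! ### Barycentric coordinates around a vertex of the standard simplex -/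

section Star

variable {K : Type*} [Fintype K] [DecidableEq K]

/-- The barycentric coordinates of `x` with respect to the second barycentric subdivision of the
simplex, except for the coordinate at the vertex `j`; they are meaningful near this vertex. -/
noncomputable def starCoord (j : K) (x : K → ℝ) : Finset (Finset K) → ℝ :=
  layers (layers (Function.update x j 0))

/-- One minus the barycentric coordinate at the vertex `j` in the second barycentric subdivision. -/
noncomputable def gam (j : K) (x : K → ℝ) : ℝ := ∑ C, starCoord j x C

variable (K) in
/-- A radius such that the neighbourhoods `gam j x < starRadius K` of the vertices are disjoint. -/
noncomputable def starRadius : ℝ := 1 + 1 / 2 ^ Fintype.card K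

/-- The point with given coordinates around the vertex `j`. -/
noncomputable def ofStar (j : K) (w : Finset (Finset K) → ℝ) : K → ℝ :=
  Function.update (unlayers (unlayers w)) j (1 - ∑ k, unlayers (unlayers w) k)

theorem one_lt_starRadius : 1 < starRadius K := by
  unfold starRadius
  have : (0 : ℝ) < 1 / 2 ^ Fintype.card K := by positivity
  linarith

theorem starCoord_nonneg (j : K) (x : K → ℝ) (C) : 0 ≤ starCoord j x C := layers_nonneg _ _

theorem gam_nonneg (j : K) (x : K → ℝ) : 0 ≤ gam j x :=
  Finset.sum_nonneg fun C _ => starCoord_nonneg j x C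

/-- By `sum_layers` the right side is the sum of `z` plus its top level, and the latter is at least
the average over the `2 ^ card K` subsets. This is where the constant in `starRadius` comes from. -/
theorem starRadius_mul_sum_le (z : Finset K → ℝ) (hz : ∀ C, 0 ≤ z C) :
    starRadius K * ∑ C, z C ≤ ∑ C, layers z C := by
  rw [sum_layers hz, starRadius, add_mul, one_mul]
  have h : ∑ C, z C ≤ 2 ^ Fintype.card K * topLevel z := by
    have := Finset.sum_le_card_nsmul Finset.univ z _ fun C _ => le_topLevel z C
    simpa using this
  have h2 : (0 : ℝ) < 2 ^ Fintype.card K := by positivity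
  have h3 : 1 / 2 ^ Fintype.card K * ∑ C, z C ≤ topLevel z := by
    rw [one_div, inv_mul_le_iff₀ h2]; exact h
  linarith

theorem update_zero_nonneg {x : K → ℝ} (hx : x ∈ stdSimplex ℝ K) (j k : K) :
    0 ≤ Function.update x j 0 k := by
  by_cases h : k = j
  · simp [h]
  · simp [h, hx.1 k]

theorem sum_update_zero {x : K → ℝ} (hx : x ∈ stdSimplex ℝ K) (j : K) :
    ∑ k, Function.update x j 0 k = 1 - x j := by
  rw [Finset.sum_update_of_mem (Finset.mem_univ j), zero_add, ← hx.2,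
    ← Finset.sum_erase_eq_sub (Finset.mem_univ j), Finset.sdiff_singleton_eq_erase]

theorem starRadius_mul_le_gam {x : K → ℝ} (hx : x ∈ stdSimplex ℝ K) (j : K) :
    starRadius K * (1 - x j + topLevel (Function.update x j 0)) ≤ gam j x := by
  rw [← sum_update_zero hx, ← sum_layers (update_zero_nonneg hx j)]
  exact starRadius_mul_sum_le _ fun C => layers_nonneg _ C

theorem one_sub_le_gam {x : K → ℝ} (hx : x ∈ stdSimplex ℝ K) (j : K) : 1 - x j ≤ gam j x := by
  have h1 := starRadius_mul_le_gam hx j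
  have h2 := topLevel_nonneg (Function.update x j 0)
  have h3 : x j ≤ 1 := by
    rw [← hx.2]; exact Finset.single_le_sum (fun k _ => hx.1 k) (Finset.mem_univ j)
  have := one_lt_starRadius (K := K)
  nlinarith

/-- The gain by the factor `starRadius` in the second subdivision turns the hypothesis into `1 - x j
+ max < 1`, with the maximum over the other coordinates. So a point is this close to at most one
vertex. -/
theorem lt_of_gam_lt {x : K → ℝ} (hx : x ∈ stdSimplex ℝ K) {j k : K} (h : gam j x < starRadius K)
    (hk : k ≠ j) : x k < x j := by
  have h1 := (starRadius_mul_le_gam hx j).trans_lt h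
  have h0 : 0 < starRadius K := one_pos.trans one_lt_starRadius
  have h2 : 1 - x j + topLevel (Function.update x j 0) < 1 := by
    by_contra! h'
    nlinarith
  have h3 := le_topLevel (Function.update x j 0) k
  rw [Function.update_of_ne hk] at h3
  linarith

theorem gam_lt_unique {x : K → ℝ} (hx : x ∈ stdSimplex ℝ K) {j k : K} (h : gam j x < starRadius K)
    (hk : gam k x < starRadius K) : k = j := by
  by_contra hne
  exact lt_asymm (lt_of_gam_lt hx h hne) (lt_of_gam_lt hx hk (Ne.symm hne))

theorem pos_of_gam_lt {x : K → ℝ} (hx : x ∈ stdSimplex ℝ K) {j : K} (h : gam j x < starRadius K) :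
    0 < x j := by
  by_contra! h'
  have h0 : x = 0 := by
    ext k
    by_cases hk : k = j
    · exact le_antisymm (hk ▸ h') (hx.1 k)
    · exact le_antisymm ((lt_of_gam_lt hx h hk).le.trans h') (hx.1 k)
  have := hx.2
  simp [h0] at this

theorem eq_single_of_apply_eq_one {x : K → ℝ} (hx : x ∈ stdSimplex ℝ K) {j : K} (h : 1 ≤ x j) :
    x = Pi.single j 1 := by
  have hs : ∑ k ∈ Finset.univ.erase j, x k = 1 - x j := by
    rw [Finset.sum_erase_eq_sub (Finset.mem_univ j), hx.2]
  have h0 : ∀ k ∈ Finset.univ.erase j, x k = 0 := by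
    refine (Finset.sum_eq_zero_iff_of_nonneg fun k _ => hx.1 k).1 (le_antisymm (by linarith) ?_)
    exact Finset.sum_nonneg fun k _ => hx.1 k
  have hj : x j = 1 := by rw [Finset.sum_eq_zero h0] at hs; linarith
  ext k
  by_cases hk : k = j
  · subst hk; simp [hj]
  · simp [hk, h0 k (by simpa using hk)]

theorem gam_single (j : K) : gam j (Pi.single j 1) = 0 := by
  -- Writing the zero function as a multiple by zero lets homogeneity of `layers` finish the
  -- computation.
  have h : Function.update (Pi.single j (1 : ℝ)) j 0 = fun k : K => 0 * (0 : ℝ) := by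
    ext k
    by_cases hk : k = j
    · simp [hk]
    · simp [hk]
  refine Finset.sum_eq_zero fun C _ => ?_
  rw [starCoord, h, layers_const_mul le_rfl, layers_const_mul le_rfl]
  exact zero_mul _

theorem gam_eq_zero_iff {x : K → ℝ} (hx : x ∈ stdSimplex ℝ K) {j : K} :
    gam j x = 0 ↔ x = Pi.single j 1 := by
  refine ⟨fun h => eq_single_of_apply_eq_one hx ?_, fun h => h ▸ gam_single j⟩
  have := one_sub_le_gam hx j
  linarith

theorem starCoord_smul (j : K) (x : K → ℝ) {t : ℝ} (ht : 0 ≤ t) :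
    starCoord j (Pi.single j 1 + t • (x - Pi.single j 1)) = t • starCoord j x := by
  have h : Function.update (Pi.single j 1 + t • (x - Pi.single j 1)) j 0 =
      fun k => t * Function.update x j 0 k := by
    ext k
    by_cases hk : k = j
    · simp [hk]
    · simp [hk]
  rw [starCoord, h, layers_const_mul ht, layers_const_mul ht]
  rfl

theorem gam_smul (j : K) (x : K → ℝ) {t : ℝ} (ht : 0 ≤ t) :
    gam j (Pi.single j 1 + t • (x - Pi.single j 1)) = t * gam j x := by
  simp [gam, starCoord_smul j x ht, Finset.mul_sum]

theorem starCoord_comp_symm (e : Equiv.Perm K) (j : K) (x : K → ℝ) :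
    starCoord (e j) (x ∘ e.symm) = starCoord j x ∘ e.finsetCongr.finsetCongr.symm := by
  have h : Function.update (x ∘ e.symm) (e j) 0 = Function.update x j 0 ∘ e.symm := by
    ext k
    by_cases hk : k = e j
    · simp [hk]
    · have : e.symm k ≠ j := fun h => hk (by simp [← h])
      simp [hk, this]
  rw [starCoord, h, layers_comp_symm, layers_comp_symm, starCoord]

theorem gam_comp_symm (e : Equiv.Perm K) (j : K) (x : K → ℝ) :
    gam (e j) (x ∘ e.symm) = gam j x := by
  rw [gam, starCoord_comp_symm]
  exact Equiv.sum_comp e.finsetCongr.finsetCongr.symm _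

/-! ### Recovering a point from its star coordinates. -/

section OfStar

variable {x : K → ℝ} {j : K} {w : Finset (Finset K) → ℝ}

/-- Coordinates supported where those of an actual point `x` are supported inherit its chain
conditions, at both levels, so both layer decompositions can be inverted. -/
theorem layers_layers_unlayers_unlayers (hx : x ∈ stdSimplex ℝ K) (hw : ∀ C, 0 ≤ w C)
    (hs : ∀ C, starCoord j x C = 0 → w C = 0) :
    layers (unlayers w) = w ∧ layers (unlayers (unlayers w)) = unlayers w ∧
      ∀ k, Function.update x j 0 k = 0 → unlayers (unlayers w) k = 0 := by
  have h1 : ∀ C, unlayers w C ≠ 0 → layers (Function.update x j 0) C ≠ 0 := fun C hC => by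
    obtain ⟨D, hCD, hD⟩ := exists_of_unlayers_ne_zero hC
    exact ne_zero_of_layers_ne_zero (layers_nonneg _) hCD (mt (hs D) hD)
  refine ⟨layers_unlayers hw (hs _ (layers_empty _)) ?_,
    layers_unlayers (unlayers_nonneg hw) ?_ ?_, fun k hk => ?_⟩
  · exact (isChain_layers _).mono fun C hC => mt (hs C) hC
  · by_contra h
    exact h1 _ h (layers_empty _)
  · exact (isChain_layers _).mono fun C hC => h1 C hC
  · by_contra h
    obtain ⟨D, hkD, hD⟩ := exists_of_unlayers_ne_zero h
    exact ne_zero_of_layers_ne_zero (update_zero_nonneg hx j) hkD (h1 D hD) hk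

theorem update_ofStar (hx : x ∈ stdSimplex ℝ K) (hw : ∀ C, 0 ≤ w C)
    (hs : ∀ C, starCoord j x C = 0 → w C = 0) :
    Function.update (ofStar j w) j 0 = unlayers (unlayers w) := by
  ext k
  by_cases hk : k = j
  · subst hk
    simp [(layers_layers_unlayers_unlayers hx hw hs).2.2 k (by simp)]
  · simp [ofStar, hk]

theorem starCoord_ofStar (hx : x ∈ stdSimplex ℝ K) (hw : ∀ C, 0 ≤ w C)
    (hs : ∀ C, starCoord j x C = 0 → w C = 0) : starCoord j (ofStar j w) = w := by
  obtain ⟨h1, h2, -⟩ := layers_layers_unlayers_unlayers hx hw hs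
  rw [starCoord, update_ofStar hx hw hs, h2, h1]

/-- The only issue is the sign of the coordinate `j`. The estimate behind `starRadius` bounds the
sum of the others by one. -/
theorem ofStar_mem (hx : x ∈ stdSimplex ℝ K) (hw : ∀ C, 0 ≤ w C)
    (hs : ∀ C, starCoord j x C = 0 → w C = 0) (hlt : ∑ C, w C < starRadius K) :
    ofStar j w ∈ stdSimplex ℝ K := by
  obtain ⟨h1, h2, h3⟩ := layers_layers_unlayers_unlayers hx hw hs
  have hy : ∀ k, 0 ≤ unlayers (unlayers w) k := unlayers_nonneg (unlayers_nonneg hw)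
  have h4 : starRadius K * (∑ k, unlayers (unlayers w) k + topLevel (unlayers (unlayers w))) ≤
      ∑ C, w C := by
    rw [← sum_layers hy, h2]
    conv_rhs => rw [← h1]
    exact starRadius_mul_sum_le _ (unlayers_nonneg hw)
  have h5 := topLevel_nonneg (unlayers (unlayers w))
  have h6 : ∑ k, unlayers (unlayers w) k ≤ 1 := by
    by_contra! h'
    have := one_lt_starRadius (K := K)
    nlinarith
  refine ⟨fun k => ?_, ?_⟩
  · by_cases hk : k = j
    · subst hk; simpa [ofStar] using h6
    · simpa [ofStar, hk] using hy k
  · rw [ofStar, Finset.sum_update_of_mem (Finset.mem_univ j), Finset.sdiff_singleton_eq_erase,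
      Finset.sum_erase_eq_sub (Finset.mem_univ j), h3 j (by simp)]
    ring

theorem ofStar_starCoord (hx : x ∈ stdSimplex ℝ K) : ofStar j (starCoord j x) = x := by
  have h := unlayers_layers (update_zero_nonneg hx j)
  have h' := unlayers_layers (layers_nonneg (Function.update x j 0))
  rw [ofStar, starCoord, h', h, sum_update_zero hx]
  simp

theorem ofStar_apply_eq_zero (hx : x ∈ stdSimplex ℝ K) (hw : ∀ C, 0 ≤ w C)
    (hs : ∀ C, starCoord j x C = 0 → w C = 0) {k : K} (hk : k ≠ j) (h : x k = 0) :
    ofStar j w k = 0 := by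
  have := (layers_layers_unlayers_unlayers hx hw hs).2.2 k (by simp [hk, h])
  simpa [ofStar, hk] using this

theorem ofStar_comp_symm (e : Equiv.Perm K) :
    ofStar (e j) (w ∘ e.finsetCongr.finsetCongr.symm) = ofStar j w ∘ e.symm := by
  have h : unlayers (unlayers (w ∘ e.finsetCongr.finsetCongr.symm)) =
      unlayers (unlayers w) ∘ e.symm := by
    rw [unlayers_comp_symm w e.finsetCongr, unlayers_comp_symm]
  rw [ofStar, h]
  have h' : ∑ k, (unlayers (unlayers w) ∘ e.symm) k = ∑ k, unlayers (unlayers w) k :=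
    Equiv.sum_comp e.symm _
  rw [h']
  ext k
  by_cases hk : k = e j
  · simp [hk, ofStar]
  · have : e.symm k ≠ j := fun h => hk (by simp [← h])
    simp [hk, this, ofStar]

end OfStar

section IsSel

variable {Z ι : Type*} [TopologicalSpace Z] {i : Z → ι → ℝ} {z : Z}

theorem isSel_starCoord {f : Z → K → ℝ} (hf : ∀ k, IsSel i (fun z => f z k) z) (j : K)
    (C : Finset (Finset K)) : IsSel i (fun z => starCoord j (f z) C) z := by
  refine isSel_layers (fun D => isSel_layers (fun k => ?_) D) C
  by_cases hk : k = j
  · subst hk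
    simpa using IsSel.const 0 z
  · simpa [hk] using hf k

theorem isSel_gam {f : Z → K → ℝ} (hf : ∀ k, IsSel i (fun z => f z k) z) (j : K) :
    IsSel i (fun z => gam j (f z)) z :=
  IsSel.sum _ fun C _ => isSel_starCoord hf j C

theorem isSel_ofStar {w : Z → Finset (Finset K) → ℝ} (hw : ∀ C, IsSel i (fun z => w z C) z)
    (j k : K) : IsSel i (fun z => ofStar j (w z) k) z := by
  have h : ∀ k, IsSel i (fun z => unlayers (unlayers (w z)) k) z := fun k =>
    isSel_unlayers (fun C => isSel_unlayers hw C) k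
  by_cases hk : k = j
  · subst hk
    simpa [ofStar] using (IsSel.const 1 z).sub (IsSel.sum _ fun k _ => h k)
  · simpa [ofStar, hk] using h k

end IsSel

theorem continuous_gam (j : K) : Continuous (gam j : (K → ℝ) → ℝ) :=
  continuous_iff_continuousAt.2 fun x =>
    (isSel_gam (i := id) (f := id) (fun k => IsSel.coord continuous_id k x) j).continuousAt

/-- Maps of the coordinates around a vertex that preserve supports and are equivariant. -/
structure IsStarMap (G : (Finset (Finset K) → ℝ) → Finset (Finset K) → ℝ) : Prop where
  nonneg : ∀ w, (∀ C, 0 ≤ w C) → ∀ C, 0 ≤ G w C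
  eq_zero : ∀ w C, w C = 0 → G w C = 0
  equivariant : ∀ (e : Equiv.Perm K) (w), G (w ∘ e.finsetCongr.finsetCongr.symm) =
    G w ∘ e.finsetCongr.finsetCongr.symm

open Classical in
/-- The map of the standard simplex that is given by `G` in the coordinates around the vertices. -/
noncomputable def starMap (G : (Finset (Finset K) → ℝ) → Finset (Finset K) → ℝ) (x : K → ℝ) :
    K → ℝ :=
  if h : ∃ j, gam j x < starRadius K ∧ ∑ C, G (starCoord j x) C < starRadius K then
    ofStar h.choose (G (starCoord h.choose x)) else x

/-! ### Self-maps of the simplex given in star coordinates. -/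

section StarMap

variable {G : (Finset (Finset K) → ℝ) → Finset (Finset K) → ℝ} {x : K → ℝ} {j : K}

theorem starMap_of_lt (hx : x ∈ stdSimplex ℝ K) (h1 : gam j x < starRadius K)
    (h2 : ∑ C, G (starCoord j x) C < starRadius K) : starMap G x = ofStar j (G (starCoord j x)) := by
  have h : ∃ j, gam j x < starRadius K ∧ ∑ C, G (starCoord j x) C < starRadius K := ⟨j, h1, h2⟩
  have hj : h.choose = j := gam_lt_unique hx h1 h.choose_spec.1
  rw [starMap, dif_pos h, hj]

theorem starMap_of_not (h : ¬ ∃ j, gam j x < starRadius K ∧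
    ∑ C, G (starCoord j x) C < starRadius K) : starMap G x = x := by
  rw [starMap, dif_neg h]

namespace IsStarMap

variable (hG : IsStarMap G)

include hG

theorem starMap_mem (hx : x ∈ stdSimplex ℝ K) : starMap G x ∈ stdSimplex ℝ K := by
  by_cases h : ∃ j, gam j x < starRadius K ∧ ∑ C, G (starCoord j x) C < starRadius K
  · obtain ⟨j, h1, h2⟩ := h
    rw [starMap_of_lt hx h1 h2]
    exact ofStar_mem hx (hG.nonneg _ (starCoord_nonneg j x)) (hG.eq_zero _) h2
  · rwa [starMap_of_not h]

theorem starMap_apply_eq_zero (hx : x ∈ stdSimplex ℝ K) {k : K} (hk : x k = 0) :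
    starMap G x k = 0 := by
  by_cases h : ∃ j, gam j x < starRadius K ∧ ∑ C, G (starCoord j x) C < starRadius K
  · obtain ⟨j, h1, h2⟩ := h
    rw [starMap_of_lt hx h1 h2]
    refine ofStar_apply_eq_zero hx (hG.nonneg _ (starCoord_nonneg j x)) (hG.eq_zero _) ?_ hk
    rintro rfl
    exact (pos_of_gam_lt hx h1).ne' hk
  · rwa [starMap_of_not h]

theorem starCoord_starMap (hx : x ∈ stdSimplex ℝ K) (h1 : gam j x < starRadius K)
    (h2 : ∑ C, G (starCoord j x) C < starRadius K) :
    starCoord j (starMap G x) = G (starCoord j x) := by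
  rw [starMap_of_lt hx h1 h2]
  exact starCoord_ofStar hx (hG.nonneg _ (starCoord_nonneg j x)) (hG.eq_zero _)

theorem gam_starMap (hx : x ∈ stdSimplex ℝ K) (h1 : gam j x < starRadius K)
    (h2 : ∑ C, G (starCoord j x) C < starRadius K) :
    gam j (starMap G x) = ∑ C, G (starCoord j x) C := by
  rw [gam, hG.starCoord_starMap hx h1 h2]

theorem starMap_comp_symm (hx : x ∈ stdSimplex ℝ K) (e : Equiv.Perm K) :
    starMap G (x ∘ e.symm) = starMap G x ∘ e.symm := by
  have hs : ∀ j, ∑ C, G (starCoord (e j) (x ∘ e.symm)) C = ∑ C, G (starCoord j x) C := fun j => by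
    rw [starCoord_comp_symm, hG.equivariant]
    exact Equiv.sum_comp e.finsetCongr.finsetCongr.symm _
  have hx' : x ∘ e.symm ∈ stdSimplex ℝ K :=
    ⟨fun i => hx.1 _, by rw [← hx.2]; exact Equiv.sum_comp e.symm x⟩
  by_cases h : ∃ j, gam j x < starRadius K ∧ ∑ C, G (starCoord j x) C < starRadius K
  · obtain ⟨j, h1, h2⟩ := h
    rw [starMap_of_lt hx h1 h2, starMap_of_lt (j := e j) hx' (by rwa [gam_comp_symm])
      (by rwa [hs]), starCoord_comp_symm, hG.equivariant, ofStar_comp_symm]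
  · rw [starMap_of_not h, starMap_of_not]
    rintro ⟨j, h1, h2⟩
    refine h ⟨e.symm j, ?_, ?_⟩
    · rwa [← gam_comp_symm e, Equiv.apply_symm_apply]
    · rwa [← hs, Equiv.apply_symm_apply]

end IsStarMap

theorem starMap_starMap {G' : (Finset (Finset K) → ℝ) → Finset (Finset K) → ℝ} (hG : IsStarMap G)
    (hx : x ∈ stdSimplex ℝ K) (h1 : gam j x < starRadius K)
    (h2 : ∑ C, G (starCoord j x) C < starRadius K)
    (h3 : ∑ C, G' (G (starCoord j x)) C < starRadius K) :
    starMap G' (starMap G x) = ofStar j (G' (G (starCoord j x))) := by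
  rw [starMap_of_lt (hG.starMap_mem hx) (by rwa [hG.gam_starMap hx h1 h2])
    (by rwa [hG.starCoord_starMap hx h1 h2]), hG.starCoord_starMap hx h1 h2]

theorem isStarMap_smul {t : ℝ} (ht : 0 ≤ t) :
    IsStarMap (K := K) fun w => t • w :=
  ⟨fun _ hw C => mul_nonneg ht (hw C), fun w C h => by simp [h], fun _ _ => rfl⟩

theorem starMap_smul {t : ℝ} (ht : 0 ≤ t) (hx : x ∈ stdSimplex ℝ K) (h1 : gam j x < starRadius K)
    (h2 : t * gam j x < starRadius K) :
    starMap (fun w => t • w) x = Pi.single j 1 + t • (x - Pi.single j 1) := by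
  have h3 : ∑ C, (t • starCoord j x) C < starRadius K := by
    simpa [gam, Finset.mul_sum] using h2
  have h4 := (isStarMap_smul (K := K) ht).starMap_mem hx
  rw [starMap_of_lt hx h1 h3] at h4 ⊢
  set u := Pi.single j 1 + t • (x - Pi.single j 1) with hu
  have hy := unlayers_layers (update_zero_nonneg hx j)
  have hy' := unlayers_layers (layers_nonneg (Function.update x j 0))
  have h5 : unlayers (unlayers (t • starCoord j x)) = t • Function.update x j 0 := by
    have hs : ∀ {L : Type _} [Fintype L] [DecidableEq L] (v : Finset L → ℝ),
        unlayers (t • v) = t • unlayers v := by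
      intro L _ _ v
      ext k
      simp only [unlayers, Pi.smul_apply, smul_eq_mul, Finset.mul_sum]
      refine Finset.sum_congr rfl fun C _ => ?_
      split_ifs
      · ring
      · ring
    rw [hs, hs, starCoord, hy', hy]
  rw [ofStar, h5]
  ext k
  by_cases hk : k = j
  · subst hk
    simp only [Function.update_self, Pi.smul_apply, smul_eq_mul, ← Finset.mul_sum,
      sum_update_zero hx, hu, Pi.add_apply, Pi.single_eq_same, Pi.sub_apply]
    ring
  · simp [hk, hu]

end StarMap

end Star

/-! ### The truncated simplex -/

/-! ### Relative interiors of convex hulls. -/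

section RelativeInterior

variable {E : Type*} [NormedAddCommGroup E] [NormedSpace ℝ E]

theorem exists_add_smul_sub_mem_of_mem_intrinsicInterior {C : Set E} {x e : E}
    (hx : x ∈ intrinsicInterior ℝ C) (he : e ∈ C) : ∃ ε > (0 : ℝ), x + ε • (x - e) ∈ C := by
  obtain ⟨x', hx', rfl⟩ := mem_intrinsicInterior.1 hx
  let e' : affineSpan ℝ C := ⟨e, subset_affineSpan ℝ C he⟩
  have : Nonempty (affineSpan ℝ C) := ⟨e'⟩
  have hc : Continuous fun ε : ℝ => AffineMap.lineMap e' x' (1 + ε) := by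
    refine Continuous.subtype_mk (f := fun ε : ℝ => AffineMap.lineMap e x'.1 (1 + ε)) ?_ _
    simp only [AffineMap.lineMap_apply, vsub_eq_sub, vadd_eq_add]
    fun_prop
  have h0 : ∀ᶠ ε in 𝓝 (0 : ℝ), AffineMap.lineMap e' x' (1 + ε) ∈
      interior ((↑) ⁻¹' C : Set (affineSpan ℝ C)) :=
    hc.continuousAt.eventually (isOpen_interior.mem_nhds (by simpa using hx'))
  obtain ⟨ε, hε, h⟩ := ((h0.filter_mono nhdsWithin_le_nhds).and
    (self_mem_nhdsWithin : Ioi (0 : ℝ) ∈ 𝓝[>] 0)).exists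
  refine ⟨ε, h, ?_⟩
  have h1 := interior_subset hε
  have h2 : ((AffineMap.lineMap e' x' (1 + ε) : affineSpan ℝ C) : E) = x'.1 + ε • (x'.1 - e) := by
    have : ((AffineMap.lineMap e' x' (1 + ε) : affineSpan ℝ C) : E) =
        AffineMap.lineMap e x'.1 (1 + ε) := rfl
    rw [this, AffineMap.lineMap_apply, vsub_eq_sub, vadd_eq_add]
    module
  rw [mem_preimage, h2] at h1
  exact h1

/-- The point `x` lies strictly between the relative interior point `p` and a point `q` of `C`; the
homothety with centre `q` that takes `p` to `x` carries a relative neighbourhood of `p` into `C`. -/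
theorem mem_intrinsicInterior_of_add_smul_sub_mem {C : Set E} (hC : Convex ℝ C) {x p : E}
    (hp : p ∈ intrinsicInterior ℝ C) (hx : x ∈ C) {ε : ℝ} (hε : 0 < ε)
    (hq : x + ε • (x - p) ∈ C) : x ∈ intrinsicInterior ℝ C := by
  obtain ⟨p', hp', rfl⟩ := mem_intrinsicInterior.1 hp
  set q := x + ε • (x - p'.1) with hqdef
  let q' : affineSpan ℝ C := ⟨q, subset_affineSpan ℝ C hq⟩
  let x' : affineSpan ℝ C := ⟨x, subset_affineSpan ℝ C hx⟩
  have : Nonempty (affineSpan ℝ C) := ⟨x'⟩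
  have hval : ∀ z : affineSpan ℝ C, ((AffineMap.lineMap q' z (1 + ε⁻¹) : affineSpan ℝ C) : E) =
      q + (1 + ε⁻¹) • (z.1 - q) := fun z => by
    have : ((AffineMap.lineMap q' z (1 + ε⁻¹) : affineSpan ℝ C) : E) =
        AffineMap.lineMap q z.1 (1 + ε⁻¹) := rfl
    rw [this, AffineMap.lineMap_apply, vsub_eq_sub, vadd_eq_add, add_comm]
  have hc : Continuous fun z : affineSpan ℝ C => AffineMap.lineMap q' z (1 + ε⁻¹) := by
    refine continuous_induced_rng.2 ?_
    simp only [Function.comp_def, hval]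
    fun_prop
  refine mem_intrinsicInterior.2 ⟨x', ?_, rfl⟩
  -- The line map with parameter `1 + ε⁻¹` is the inverse of that homothety: it takes `x` back to
  -- `p`.
  refine mem_interior.2 ⟨(fun z => AffineMap.lineMap q' z (1 + ε⁻¹)) ⁻¹'
    interior ((↑) ⁻¹' C : Set (affineSpan ℝ C)), fun z hz => ?_, isOpen_interior.preimage hc, ?_⟩
  · have h1 : q + (1 + ε⁻¹) • (z.1 - q) ∈ C := by
      rw [← hval]; exact interior_subset (s := Subtype.val ⁻¹' C) hz
    have h2 : z.1 = (ε / (1 + ε)) • (q + (1 + ε⁻¹) • (z.1 - q)) + (1 / (1 + ε)) • q := by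
      match_scalars <;> field_simp <;> ring
    rw [mem_preimage, h2]
    exact hC h1 hq (by positivity) (by positivity) (by field_simp; ring)
  · have : AffineMap.lineMap q' x' (1 + ε⁻¹) = p' := by
      refine Subtype.ext ?_
      rw [hval, hqdef]
      match_scalars <;> field_simp <;> ring
    rw [mem_preimage, this]
    exact hp'

/-- Affine independence is not needed: a combination with positive coefficients can be prolonged
away from any point of the hull, in particular from a relative interior point. -/
theorem mem_intrinsicInterior_convexHull [FiniteDimensional ℝ E] {t : Finset E} {α : E → ℝ}
    (hpos : ∀ v ∈ t, 0 < α v) (hsum : ∑ v ∈ t, α v = 1) :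
    ∑ v ∈ t, α v • v ∈ intrinsicInterior ℝ (convexHull ℝ (t : Set E)) := by
  have hcv := convex_convexHull ℝ (t : Set E)
  have hne : t.Nonempty := by
    rw [Finset.nonempty_iff_ne_empty]; rintro rfl; simp at hsum
  have hx : ∑ v ∈ t, α v • v ∈ convexHull ℝ (t : Set E) :=
    hcv.sum_mem (fun v hv => (hpos v hv).le) hsum fun v hv => subset_convexHull ℝ _ hv
  obtain ⟨p, hp⟩ := Set.Nonempty.intrinsicInterior hcv ⟨_, hx⟩
  obtain ⟨β, hβ, hβs, hβp⟩ := Finset.mem_convexHull'.1 (intrinsicInterior_subset hp)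
  -- The smallest coefficient serves as the length of the prolongation. Since `β v ≤ 1`, the
  -- coefficients `α v + α v₀ * (α v - β v)` stay non-negative.
  obtain ⟨v₀, hv₀, hmin⟩ := t.exists_min_image α hne
  refine mem_intrinsicInterior_of_add_smul_sub_mem hcv hp hx (hpos v₀ hv₀) ?_
  have : ∑ v ∈ t, α v • v + α v₀ • (∑ v ∈ t, α v • v - p) =
      ∑ v ∈ t, (α v + α v₀ * (α v - β v)) • v := by
    simp only [add_smul, mul_smul, sub_smul, Finset.sum_add_distrib, ← Finset.smul_sum,
      Finset.sum_sub_distrib, hβp]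
  rw [this]
  refine hcv.sum_mem (fun v hv => ?_) ?_ fun v hv => subset_convexHull ℝ _ hv
  · have h1 : β v ≤ 1 := by rw [← hβs]; exact Finset.single_le_sum hβ hv
    have h2 := hmin v hv
    have h3 := hpos v₀ hv₀
    have h4 := hpos v hv
    nlinarith [mul_pos h3 h4]
  · rw [Finset.sum_add_distrib, ← Finset.mul_sum, Finset.sum_sub_distrib, hsum, hβs]
    ring

theorem mem_intrinsicInterior_convexHull_image [FiniteDimensional ℝ E] {ι : Type*} {s : Finset ι}
    {f : ι → E} {α : ι → ℝ} (hpos : ∀ i ∈ s, 0 < α i) (hsum : ∑ i ∈ s, α i = 1) :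
    ∑ i ∈ s, α i • f i ∈ intrinsicInterior ℝ (convexHull ℝ (f '' s)) := by
  classical
  have hf : ∀ i ∈ s, f i ∈ s.image f := fun i hi => Finset.mem_image_of_mem f hi
  have h := mem_intrinsicInterior_convexHull (t := s.image f)
    (α := fun v => ∑ i ∈ s with f i = v, α i) (fun v hv => ?_) ?_
  · rw [Finset.coe_image] at h
    convert! h using 1
    rw [← Finset.sum_fiberwise_of_maps_to hf]
    refine Finset.sum_congr rfl fun v _ => ?_
    rw [Finset.sum_smul]
    exact Finset.sum_congr rfl fun i hi => by rw [(Finset.mem_filter.1 hi).2]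
  · obtain ⟨i, hi, rfl⟩ := Finset.mem_image.1 hv
    exact Finset.sum_pos (fun i hi => hpos i (Finset.mem_filter.1 hi).1)
      ⟨i, Finset.mem_filter.2 ⟨hi, rfl⟩⟩
  · rw [← hsum, Finset.sum_fiberwise_of_maps_to hf]

end RelativeInterior

/-! ### Barycentric subdivision in terms of index sets. -/

section Subdivision

variable {A E : Type*} [Fintype A] [DecidableEq A] [AddCommGroup E] [Module ℝ E] [DecidableEq E]

/-- The barycenter of the points `f a`, `a ∈ c`. -/
noncomputable def barycenter (f : A → E) (c : Finset A) : E := (c.card : ℝ)⁻¹ • ∑ a ∈ c, f a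

theorem centroid_image {f : A → E} {c : Finset A} (hf : InjOn f c) (hc : c.Nonempty) :
    (c.image f).centroid ℝ id = barycenter f c := by
  have hcard : (c.image f).card = c.card := Finset.card_image_of_injOn hf
  have h0 : (c.card : ℝ) ≠ 0 := by simpa using hc.ne_empty
  rw [Finset.centroid_eq_centerMass _ (hc.image f), Finset.centerMass]
  simp only [Finset.centroidWeights_apply, Finset.sum_const, hcard, nsmul_eq_mul, id]
  rw [mul_inv_cancel₀ h0, inv_one, one_smul, ← Finset.smul_sum,
    Finset.sum_image hf, barycenter]

/-- Translates the geometric subdivision into chains of index sets. Injectivity of `f` makes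
inclusion of simplices the same as inclusion of their index sets, and the form of the result allows
the translation to be iterated. -/
theorem barycentricSubdivision_image {T : Set (Finset A)} {f : A → E} {U : Set A} (hf : InjOn f U)
    (hT : ∀ c ∈ T, c.Nonempty ∧ (c : Set A) ⊆ U) :
    barycentricSubdivision ((fun c => c.image f) '' T) =
      (fun d => d.image (barycenter f)) ''
        {d : Finset (Finset A) | d.Nonempty ∧ (d : Set (Finset A)) ⊆ T ∧
          IsChain (· ⊆ ·) (d : Set (Finset A))} := by
  classical
  have hcen : ∀ c ∈ T, (c.image f).centroid ℝ id = barycenter f c := fun c hc =>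
    centroid_image (hf.mono (hT c hc).2) (hT c hc).1
  have hsub : ∀ c ∈ T, ∀ c' ∈ T, c.image f ⊆ c'.image f → c ⊆ c' := by
    intro c hc c' hc' h a ha
    obtain ⟨b, hb, hab⟩ := Finset.mem_image.1 (h (Finset.mem_image_of_mem f ha))
    rwa [← hf ((hT c' hc').2 hb) ((hT c hc).2 ha) hab]
  ext t
  constructor
  · rintro ⟨c, ⟨s, hs⟩, hcT, hch, ht⟩
    have hd : ∀ a, a ∈ Finset.univ.filter (fun a : Finset A => a ∈ T ∧ a.image f ∈ c) ↔
        a ∈ T ∧ a.image f ∈ c := fun a => by simp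
    refine ⟨Finset.univ.filter fun a : Finset A => a ∈ T ∧ a.image f ∈ c, ⟨?_, ?_, ?_⟩, ?_⟩
    · obtain ⟨a, ha, rfl⟩ := hcT hs
      exact ⟨a, (hd a).2 ⟨ha, hs⟩⟩
    · exact fun a ha => ((hd a).1 ha).1
    · intro a ha b hb _
      have ha := (hd a).1 ha
      have hb := (hd b).1 hb
      exact (hch.total ha.2 hb.2).imp (hsub _ ha.1 _ hb.1) (hsub _ hb.1 _ ha.1)
    · refine Finset.coe_injective ?_
      rw [ht, Finset.coe_image]
      ext v
      constructor
      · rintro ⟨a, ha, rfl⟩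
        have ha := (hd a).1 ha
        exact ⟨_, ha.2, hcen a ha.1⟩
      · rintro ⟨s, hs, rfl⟩
        obtain ⟨a, ha, rfl⟩ := hcT hs
        exact ⟨a, (hd a).2 ⟨ha, hs⟩, (hcen a ha).symm⟩
  · rintro ⟨d, ⟨⟨a, ha⟩, hdT, hch⟩, rfl⟩
    refine ⟨(fun c => c.image f) '' d, ⟨_, a, ha, rfl⟩, image_mono hdT, ?_, ?_⟩
    · rintro _ ⟨a, ha, rfl⟩ _ ⟨b, hb, rfl⟩ _
      exact (hch.total ha hb).imp (fun h => Finset.image_mono f h) fun h => Finset.image_mono f h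
    · rw [Finset.coe_image, image_image]
      exact image_congr fun c hc => (hcen c (hdT hc)).symm

end Subdivision

/-! ### The open stars of the vertices in the second subdivision. -/

section SecondSubdivision

variable {K : Type*} [Fintype K] [DecidableEq K]

/-- The vertices of the first barycentric subdivision. -/
noncomputable def bary (S : Finset K) : K → ℝ := barycenter (fun k => Pi.single k (1 : ℝ)) S

/-- The vertices of the second barycentric subdivision. -/
noncomputable def bary₂ (c : Finset (Finset K)) : K → ℝ := barycenter bary c

/-- Non-empty chains of non-empty sets. -/
def flags (K : Type*) : Set (Finset (Finset K)) :=
  {d | d.Nonempty ∧ (d : Set (Finset K)) ⊆ {S | S.Nonempty} ∧ IsChain (· ⊆ ·) (d : Set (Finset K))}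

theorem bary_apply (S : Finset K) (k : K) : bary S k = if k ∈ S then (S.card : ℝ)⁻¹ else 0 := by
  simp [bary, barycenter, Finset.sum_apply, Pi.single_apply]

theorem bary₂_apply (c : Finset (Finset K)) (k : K) :
    bary₂ c k = (c.card : ℝ)⁻¹ * ∑ S ∈ c, if k ∈ S then (S.card : ℝ)⁻¹ else 0 := by
  simp [bary₂, barycenter, Finset.sum_apply, bary_apply]

theorem injOn_bary : InjOn (bary (K := K)) {S | S.Nonempty} := by
  intro S hS S' hS' h
  have key : ∀ S : Finset K, S.Nonempty → ∀ k, k ∈ S ↔ bary S k ≠ 0 := fun S hS k => by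
    rw [bary_apply]
    by_cases hk : k ∈ S
    · simpa [hk] using hS.ne_empty
    · simp [hk]
  ext k
  rw [key S hS, key S' hS', h]

theorem sum_bary₂ {c : Finset (Finset K)} (hc : c ∈ flags K) : ∑ k, bary₂ c k = 1 := by
  have h1 : ∀ S ∈ c, ∑ k, bary S k = 1 := fun S hS => by
    have : (S.card : ℝ) ≠ 0 := by simpa using (hc.2.1 hS).ne_empty
    simp [bary_apply, this]
  have h0 : (c.card : ℝ) ≠ 0 := by simpa using hc.1.ne_empty
  simp only [bary₂, barycenter, Pi.smul_apply, Finset.sum_apply, smul_eq_mul, ← Finset.mul_sum]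
  rw [Finset.sum_comm, Finset.sum_congr rfl h1]
  simp [h0]

theorem eq_of_bary₂_eq_single {c : Finset (Finset K)} (hc : c ∈ flags K) {j : K}
    (h : bary₂ c = Pi.single j 1) : c = {{j}} := by
  have h0 : (c.card : ℝ) ≠ 0 := by simpa using hc.1.ne_empty
  have h1 : ∀ S ∈ c, S = {j} := by
    intro S hS
    refine (hc.2.1 hS).subset_singleton_iff.1 fun k hk => Finset.mem_singleton.2 ?_
    by_contra hkj
    have h2 := congrFun h k
    rw [bary₂_apply, Pi.single_eq_of_ne hkj, mul_eq_zero_iff_left (inv_ne_zero h0),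
      Finset.sum_eq_zero_iff_of_nonneg fun S _ => by positivity] at h2
    have h3 := h2 S hS
    rw [if_pos hk, inv_eq_zero, Nat.cast_eq_zero, Finset.card_eq_zero] at h3
    simp [h3] at hk
  exact hc.1.subset_singleton_iff.1 fun S hS => Finset.mem_singleton.2 (h1 S hS)

theorem bary₂_singleton (j : K) : bary₂ {{j}} = Pi.single j (1 : ℝ) := by
  simp [bary₂, barycenter, bary]

/-- The chain in the complement of `j` that corresponds to a chain of sets containing `j`. -/
def reduceFlag (j : K) (c : Finset (Finset K)) : Finset (Finset K) :=
  (c.erase {j}).image fun S => S.erase j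

theorem unlayers_single {L : Type*} [Fintype L] [DecidableEq L] (C : Finset L) (k : L) :
    unlayers (Pi.single C 1) k = if k ∈ C then ((C.card : ℝ) + 1)⁻¹ else 0 := by
  rw [unlayers, Finset.sum_eq_single C (fun D _ hD => by simp [hD]) (by simp)]
  simp

theorem unlayers_sum_smul {L T : Type*} [Fintype L] [DecidableEq L] (s : Finset T) (α : T → ℝ)
    (g : T → Finset L → ℝ) :
    unlayers (∑ v ∈ s, α v • g v) = ∑ v ∈ s, α v • unlayers (g v) := by
  ext k
  simp only [unlayers, Finset.sum_apply, Pi.smul_apply, smul_eq_mul, Finset.mul_sum]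
  rw [Finset.sum_comm]
  refine Finset.sum_congr rfl fun C _ => ?_
  split_ifs
  · rw [Finset.sum_div]
    exact Finset.sum_congr rfl fun _ _ => by ring
  · simp

/-- Erasing `j` lowers the cardinality of every set of the flag by one, and discarding `{j}` lowers
the length of the flag by one. The factor `card + 1` in `layers` compensates exactly for this, at
both levels of subdivision. -/
theorem bary₂_eq_unlayers {j : K} {c : Finset (Finset K)} (hj : {j} ∈ c) (hc : ∀ S ∈ c, j ∈ S)
    {k : K} (hk : k ≠ j) :
    bary₂ c k = unlayers (unlayers (Pi.single (reduceFlag j c) 1)) k := by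
  have hinj : InjOn (fun S : Finset K => S.erase j) (c.erase {j} : Finset (Finset K)) := by
    intro S hS S' hS' h
    have hS := hc S (Finset.mem_of_mem_erase hS)
    have hS' := hc S' (Finset.mem_of_mem_erase hS')
    rw [← Finset.insert_erase hS, ← Finset.insert_erase hS']
    exact congrArg (insert j) h
  have hcard : ((reduceFlag j c).card : ℝ) + 1 = c.card := by
    rw [reduceFlag, Finset.card_image_of_injOn hinj, ← Finset.card_erase_add_one hj]
    push_cast; ring
  rw [bary₂_apply, ← Finset.sum_erase_add _ _ hj, if_neg (by simpa using hk), add_zero]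
  rw [unlayers]
  simp only [unlayers_single, hcard]
  have : ∀ S : Finset K, (if k ∈ S then
      (if S ∈ reduceFlag j c then (c.card : ℝ)⁻¹ else 0) / ((S.card : ℝ) + 1) else 0) =
      if S ∈ reduceFlag j c then
        (c.card : ℝ)⁻¹ * (if k ∈ S then ((S.card : ℝ) + 1)⁻¹ else 0) else 0 := fun S => by
    split_ifs <;> simp [div_eq_mul_inv]
  rw [Finset.sum_congr rfl fun S _ => this S, Finset.sum_ite_mem, Finset.univ_inter,
    ← Finset.mul_sum]
  congr 1
  rw [reduceFlag, Finset.sum_image hinj]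
  refine Finset.sum_congr rfl fun S hS => ?_
  have hjS := hc S (Finset.mem_of_mem_erase hS)
  have : ((S.erase j).card : ℝ) + 1 = S.card := by
    rw [← Finset.card_erase_add_one hjS]; push_cast; ring
  simp [hk, this]

theorem stdSimplexComplex_eq (n : ℕ) : stdSimplexComplex n =
    (fun c => c.image fun i => Pi.single i (1 : ℝ)) '' {c : Finset (Fin (n + 1)) | c.Nonempty} := by
  classical
  ext t
  constructor
  · rintro ⟨hne, ht⟩
    have h : (Finset.univ.filter fun i : Fin (n + 1) => Pi.single i (1 : ℝ) ∈ t).image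
        (fun i => Pi.single i (1 : ℝ)) = t := by
      ext v
      simp only [Finset.mem_image, Finset.mem_filter, Finset.mem_univ, true_and]
      refine ⟨fun ⟨i, hi, hv⟩ => hv ▸ hi, fun hv => ?_⟩
      obtain ⟨i, rfl⟩ := ht hv
      exact ⟨i, hv, rfl⟩
    refine ⟨_, ?_, h⟩
    rw [← h] at hne
    exact Finset.image_nonempty.1 hne
  · rintro ⟨c, hc, rfl⟩
    refine ⟨Finset.Nonempty.image hc _, ?_⟩
    intro v hv
    obtain ⟨i, -, rfl⟩ := Finset.mem_image.1 (Finset.mem_coe.1 hv)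
    exact ⟨i, rfl⟩

theorem secondSubdivision_eq (n : ℕ) :
    barycentricSubdivision (barycentricSubdivision (stdSimplexComplex n)) =
      (fun d => d.image bary₂) '' {d : Finset (Finset (Finset (Fin (n + 1)))) | d.Nonempty ∧
        (d : Set _) ⊆ flags (Fin (n + 1)) ∧ IsChain (· ⊆ ·) (d : Set (Finset (Finset (Fin (n + 1)))))} := by
  have h1 : Function.Injective fun i : Fin (n + 1) => (Pi.single i (1 : ℝ) : Fin (n + 1) → ℝ) :=
    fun i i' h => by
      by_contra hne
      have := congrFun h i
      simp [hne] at this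
  have h2 := barycentricSubdivision_image (T := {c : Finset (Fin (n + 1)) | c.Nonempty})
    (U := univ) (f := fun i : Fin (n + 1) => (Pi.single i (1 : ℝ) : Fin (n + 1) → ℝ))
    h1.injOn fun c hc => ⟨hc, subset_univ _⟩
  have h3 := barycentricSubdivision_image (T := flags (Fin (n + 1))) injOn_bary
    fun c hc => ⟨hc.1, hc.2.1⟩
  rw [stdSimplexComplex_eq]
  refine Eq.trans ?_ h3
  exact congrArg barycentricSubdivision h2

theorem sum_apply_eq_of_forall_ne {x y : K → ℝ} {j : K} (h : ∀ k, k ≠ j → x k = y k)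
    (hs : ∑ k, x k = ∑ k, y k) : x = y := by
  have h1 : ∑ k ∈ Finset.univ.erase j, x k = ∑ k ∈ Finset.univ.erase j, y k :=
    Finset.sum_congr rfl fun k hk => h k (Finset.ne_of_mem_erase hk)
  rw [Finset.sum_erase_eq_sub (Finset.mem_univ j), Finset.sum_erase_eq_sub (Finset.mem_univ j)] at h1
  ext k
  by_cases hk : k = j
  · subst hk; linarith
  · exact h k hk

theorem reduceFlag_mono (j : K) {c c' : Finset (Finset K)} (h : c ⊆ c') :
    reduceFlag j c ⊆ reduceFlag j c' :=
  Finset.image_mono _ (Finset.erase_subset_erase _ h)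

theorem isChain_reduceFlag {j : K} {c : Finset (Finset K)} (hc : c ∈ flags K) {S S' : Finset K}
    (hS : S ∈ reduceFlag j c) (hS' : S' ∈ reduceFlag j c) : S ⊆ S' ∨ S' ⊆ S := by
  obtain ⟨T, hT, rfl⟩ := Finset.mem_image.1 hS
  obtain ⟨T', hT', rfl⟩ := Finset.mem_image.1 hS'
  exact (hc.2.2.total (Finset.mem_of_mem_erase hT) (Finset.mem_of_mem_erase hT')).imp
    (Finset.erase_subset_erase j) (Finset.erase_subset_erase j)

/-- A point of the open star is a convex combination of vertices of one simplex with positive weight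
at `j`. The remaining weights, placed at the reduced flags, satisfy the chain conditions and hence
are the star coordinates; they sum to less than one. -/
theorem gam_lt_one_of_mem_openStar {n : ℕ} {x : Fin (n + 1) → ℝ} {j : Fin (n + 1)}
    (h : x ∈ openStar (barycentricSubdivision (barycentricSubdivision (stdSimplexComplex n)))
      (Pi.single j 1)) : gam j x < 1 := by
  classical
  simp only [openStar, mem_iUnion, exists_prop] at h
  obtain ⟨t, ⟨htK, hjt⟩, hx⟩ := h
  rw [secondSubdivision_eq] at htK
  obtain ⟨d, ⟨-, hdF, hdch⟩, hdt⟩ := htK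
  dsimp only at hdt
  subst hdt
  set t := d.image bary₂ with ht
  -- Prolonging the segment from the vertex through `x` inside the simplex and solving back for `x`
  -- produces a positive weight at the vertex.
  obtain ⟨ε, hε, hq⟩ := exists_add_smul_sub_mem_of_mem_intrinsicInterior hx
    (subset_convexHull ℝ _ hjt)
  obtain ⟨β, hβ, hβs, hβq⟩ := Finset.mem_convexHull'.1 hq
  set e : Fin (n + 1) → ℝ := Pi.single j 1 with he
  -- positive coefficient at the vertex
  set α : (Fin (n + 1) → ℝ) → ℝ := fun v => (β v + if v = e then ε else 0) / (1 + ε) with hα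
  have hα0 : ∀ v ∈ t, 0 ≤ α v := fun v hv => by
    have := hβ v hv
    simp only [hα]
    split_ifs <;> positivity
  have hαe : 0 < α e := by
    have := hβ e hjt
    simp only [hα, if_true]; positivity
  have hαs : ∑ v ∈ t, α v = 1 := by
    simp only [hα, ← Finset.sum_div, Finset.sum_add_distrib, hβs, Finset.sum_ite_eq', hjt, if_true]
    field_simp
  have hαx : ∑ v ∈ t, α v • v = x := by
    have h1 : ∑ v ∈ t, α v • v = (1 + ε)⁻¹ • (∑ v ∈ t, β v • v + ε • e) := by
      have h2 : ∑ v ∈ t, (if v = e then ε else 0) • v = ε • e := by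
        rw [Finset.sum_eq_single e (fun v _ hv => by simp [hv]) (fun h => absurd hjt h)]
        simp
      rw [← h2, ← Finset.sum_add_distrib, Finset.smul_sum]
      refine Finset.sum_congr rfl fun v _ => ?_
      simp only [hα]
      module
    rw [h1, hβq]
    match_scalars <;> field_simp <;> ring
  have hc : ∀ v ∈ t, ∃ c ∈ d, bary₂ c = v := fun v hv => Finset.mem_image.1 hv
  choose! c hcd hcv using hc
  -- The flags of `d` are comparable with `{{j}}` and hence contain it; likewise the members of each
  -- flag are comparable with `{j}`.
  have hjc : ∀ a ∈ d, {j} ∈ a ∧ ∀ S ∈ a, j ∈ S := by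
    have hce : c e = {{j}} := eq_of_bary₂_eq_single (hdF (hcd e hjt)) (hcv e hjt)
    have hjd : ({{j}} : Finset (Finset (Fin (n + 1)))) ∈ d := hce ▸ hcd e hjt
    intro a ha
    have hja : {j} ∈ a := by
      rcases hdch.total hjd ha with h | h
      · exact h (by simp)
      · obtain ⟨S, hS⟩ := (hdF ha).1
        have := h hS
        rw [Finset.mem_singleton] at this
        exact this ▸ hS
    refine ⟨hja, fun S hS => ?_⟩
    rcases (hdF ha).2.2.total hja hS with h | h
    · exact h (by simp)
    · obtain ⟨k, hk⟩ := (hdF ha).2.1 hS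
      have := h hk
      rw [Finset.mem_singleton] at this
      exact this ▸ hk
  set w : Finset (Finset (Fin (n + 1))) → ℝ :=
    ∑ v ∈ t.erase e, α v • Pi.single (reduceFlag j (c v)) 1 with hw
  have hwap : ∀ C, w C = ∑ v ∈ t.erase e, if C = reduceFlag j (c v) then α v else 0 := fun C => by
    simp [hw, Finset.sum_apply, Pi.single_apply]
  have hw0 : ∀ C, 0 ≤ w C := fun C => by
    rw [hwap]
    exact Finset.sum_nonneg fun v hv => by
      split_ifs
      · exact hα0 v (Finset.mem_of_mem_erase hv)
      · exact le_rfl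
  have hsupp : ∀ C, w C ≠ 0 → ∃ v ∈ t.erase e, C = reduceFlag j (c v) := fun C hC => by
    rw [hwap] at hC
    obtain ⟨v, hv, hne⟩ := Finset.exists_ne_zero_of_sum_ne_zero hC
    exact ⟨v, hv, by by_contra h; simp [h] at hne⟩
  have hsum : ∑ C, w C < 1 := by
    have h1 : ∑ C, w C = ∑ v ∈ t.erase e, α v := by
      simp only [hwap]
      rw [Finset.sum_comm]
      simp
    rw [h1, Finset.sum_erase_eq_sub hjt, hαs]
    linarith
  have hcd' : ∀ v ∈ t.erase e, c v ∈ d := fun v hv => hcd v (Finset.mem_of_mem_erase hv)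
  have hwempty : w ∅ = 0 := by
    by_contra hne
    obtain ⟨v, hv, h⟩ := hsupp _ hne
    have h1 : (c v).erase {j} = ∅ := Finset.image_eq_empty.1 h.symm
    have h2 : c v = {{j}} := by
      rw [← Finset.insert_erase (hjc _ (hcd' v hv)).1, h1]
      rfl
    refine Finset.ne_of_mem_erase hv ?_
    rw [← hcv v (Finset.mem_of_mem_erase hv), h2, bary₂_singleton]
  have hwch : IsChain (· ⊆ ·) {C | w C ≠ 0} := by
    intro C hC C' hC' _
    obtain ⟨v, hv, rfl⟩ := hsupp _ hC
    obtain ⟨v', hv', rfl⟩ := hsupp _ hC'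
    exact (hdch.total (hcd' v hv) (hcd' v' hv')).imp (reduceFlag_mono j) (reduceFlag_mono j)
  have huch : IsChain (· ⊆ ·) {S | unlayers w S ≠ 0} := by
    intro S hS S' hS' _
    obtain ⟨C, hSC, hC⟩ := exists_of_unlayers_ne_zero hS
    obtain ⟨C', hSC', hC'⟩ := exists_of_unlayers_ne_zero hS'
    rcases hwch.total hC hC' with h | h
    · obtain ⟨v, hv, rfl⟩ := hsupp _ hC'
      exact isChain_reduceFlag (hdF (hcd' v hv)) (h hSC) hSC'
    · obtain ⟨v, hv, rfl⟩ := hsupp _ hC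
      exact isChain_reduceFlag (hdF (hcd' v hv)) hSC (h hSC')
  have huempty : unlayers w ∅ = 0 := by
    by_contra hne
    obtain ⟨C, hSC, hC⟩ := exists_of_unlayers_ne_zero hne
    obtain ⟨v, hv, rfl⟩ := hsupp _ hC
    obtain ⟨S, hS, h⟩ := Finset.mem_image.1 hSC
    have h1 : S = {j} := by
      rw [← Finset.insert_erase ((hjc _ (hcd' v hv)).2 S (Finset.mem_of_mem_erase hS)), h]
      rfl
    exact Finset.ne_of_mem_erase hS h1
  have hupd : Function.update x j 0 = unlayers (unlayers w) := by
    have hw2 : unlayers (unlayers w) =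
        ∑ v ∈ t.erase e, α v • unlayers (unlayers (Pi.single (reduceFlag j (c v)) 1)) := by
      rw [hw, unlayers_sum_smul, unlayers_sum_smul]
    ext k
    by_cases hk : k = j
    · subst hk
      rw [Function.update_self]
      by_contra hne
      obtain ⟨S, hkS, hS⟩ := exists_of_unlayers_ne_zero (Ne.symm hne)
      obtain ⟨C, hSC, hC⟩ := exists_of_unlayers_ne_zero hS
      obtain ⟨v, hv, rfl⟩ := hsupp _ hC
      obtain ⟨T, hT, rfl⟩ := Finset.mem_image.1 hSC
      simp at hkS
    · rw [Function.update_of_ne hk, hw2, ← hαx, ← Finset.sum_erase_add _ _ hjt, Pi.add_apply,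
        Finset.sum_apply, Finset.sum_apply]
      have : (α e • e) k = 0 := by simp [he, hk]
      rw [this, add_zero]
      refine Finset.sum_congr rfl fun v hv => ?_
      have h1 := hjc _ (hcd' v hv)
      rw [Pi.smul_apply, Pi.smul_apply, ← bary₂_eq_unlayers h1.1 h1.2 hk,
        hcv v (Finset.mem_of_mem_erase hv)]
  have hfin : starCoord j x = w := by
    rw [starCoord, hupd, layers_unlayers (unlayers_nonneg hw0) huempty huch,
      layers_unlayers hw0 hwempty hwch]
  rw [gam, hfin]
  exact hsum

/-- The supports of the star coordinates form a chain of flags. With the vertex `j` of weight `1 -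
gam j x` added, `x` becomes a combination with positive weights of the vertices of one simplex. -/
theorem mem_openStar_of_gam_lt_one {n : ℕ} {x : Fin (n + 1) → ℝ} {j : Fin (n + 1)}
    (hx : x ∈ stdSimplex ℝ (Fin (n + 1))) (h : gam j x < 1) :
    x ∈ openStar (barycentricSubdivision (barycentricSubdivision (stdSimplexComplex n)))
      (Pi.single j 1) := by
  classical
  set w := starCoord j x with hw
  have hz := layers_nonneg (Function.update x j 0)
  have hu : unlayers w = layers (Function.update x j 0) := unlayers_layers hz
  have huu : unlayers (unlayers w) = Function.update x j 0 := by
    rw [hu, unlayers_layers (update_zero_nonneg hx j)]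
  have hmem : ∀ C, w C ≠ 0 → ∀ S ∈ C, layers (Function.update x j 0) S ≠ 0 := fun C hC S hS =>
    ne_zero_of_layers_ne_zero hz hS hC
  have hjS : ∀ C, w C ≠ 0 → ∀ S ∈ C, j ∉ S ∧ S.Nonempty := fun C hC S hS => by
    refine ⟨fun hj => ?_, Finset.nonempty_iff_ne_empty.2 ?_⟩
    · exact ne_zero_of_layers_ne_zero (update_zero_nonneg hx j) hj (hmem C hC S hS) (by simp)
    · rintro rfl
      exact hmem C hC _ hS (layers_empty _)
  -- The inverse of `reduceFlag`: put `j` back into every set and restore the member `{j}`.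
  obtain ⟨expand, hexp⟩ : ∃ f : Finset (Finset (Fin (n + 1))) → Finset (Finset (Fin (n + 1))),
      ∀ C, f C = insert {j} (C.image (insert j)) := ⟨_, fun _ => rfl⟩
  have hred : ∀ C, w C ≠ 0 → reduceFlag j (expand C) = C := by
    intro C hC
    have h1 : {j} ∉ C.image (insert j) := by
      intro h1
      obtain ⟨S, hS, h2⟩ := Finset.mem_image.1 h1
      obtain ⟨k, hk⟩ := (hjS C hC S hS).2
      have h3 : k ∈ ({j} : Finset _) := h2 ▸ Finset.mem_insert_of_mem hk
      rw [Finset.mem_singleton] at h3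
      exact (hjS C hC S hS).1 (h3 ▸ hk)
    rw [hexp, reduceFlag, Finset.erase_insert h1, Finset.image_image]
    ext S
    simp only [Finset.mem_image, Function.comp_apply]
    constructor
    · rintro ⟨T, hT, rfl⟩
      rwa [Finset.erase_insert (hjS C hC T hT).1]
    · exact fun hS => ⟨S, hS, Finset.erase_insert (hjS C hC S hS).1⟩
  set s := Finset.univ.filter fun C => w C ≠ 0 with hs
  have hsC : ∀ C ∈ s, w C ≠ 0 := fun C hC => by simpa [hs] using hC
  have hflag : ∀ C, w C ≠ 0 → expand C ∈ flags (Fin (n + 1)) := by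
    intro C hC
    rw [hexp]
    refine ⟨Finset.insert_nonempty _ _, fun S hS => ?_, ?_⟩
    · rcases Finset.mem_insert.1 (Finset.mem_coe.1 hS) with rfl | hS
      · exact Finset.singleton_nonempty j
      · obtain ⟨T, -, rfl⟩ := Finset.mem_image.1 hS
        exact Finset.insert_nonempty _ _
    · intro S hS S' hS' _
      rcases Finset.mem_insert.1 (Finset.mem_coe.1 hS) with rfl | hS
      · left
        rcases Finset.mem_insert.1 (Finset.mem_coe.1 hS') with rfl | hS'
        · exact subset_rfl
        · obtain ⟨T, -, rfl⟩ := Finset.mem_image.1 hS'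
          simp
      · obtain ⟨T, hT, rfl⟩ := Finset.mem_image.1 hS
        rcases Finset.mem_insert.1 (Finset.mem_coe.1 hS') with rfl | hS'
        · right; simp
        · obtain ⟨T', hT', rfl⟩ := Finset.mem_image.1 hS'
          exact ((isChain_layers _).total (hmem C hC T hT) (hmem C hC T' hT')).imp
            (Finset.insert_subset_insert j) (Finset.insert_subset_insert j)
  have hjexp : ∀ C, {j} ∈ expand C ∧ ∀ S ∈ expand C, j ∈ S := fun C => by
    rw [hexp]
    refine ⟨Finset.mem_insert_self _ _, fun S hS => ?_⟩
    rcases Finset.mem_insert.1 hS with rfl | hS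
    · simp
    · obtain ⟨T, -, rfl⟩ := Finset.mem_image.1 hS
      simp
  have hexp0 : expand ∅ = {{j}} := by
    rw [hexp]; rfl
  have h0s : ∅ ∉ s := fun h => hsC _ h (layers_empty _)
  have hflag' : ∀ C ∈ insert ∅ s, expand C ∈ flags (Fin (n + 1)) := by
    intro C hC
    rcases Finset.mem_insert.1 hC with rfl | hC
    · rw [hexp0]
      exact ⟨Finset.singleton_nonempty _, by simp, by simp⟩
    · exact hflag C (hsC C hC)
  have hgs : ∑ C ∈ s, w C = gam j x := by
    rw [gam, ← hw, hs, Finset.sum_filter_ne_zero]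
  -- The index `∅` stands for the vertex `j` itself, since it expands to `{{j}}`; it never carries a
  -- star coordinate.
  set α : Finset (Finset (Fin (n + 1))) → ℝ := fun C => if C = ∅ then 1 - gam j x else w C with hα
  have hα0 : α ∅ = 1 - gam j x := if_pos rfl
  have hαs : ∀ C ∈ s, α C = w C := fun C hC => if_neg fun h => by
    rw [h] at hC; exact h0s hC
  have hpos : ∀ C ∈ insert ∅ s, 0 < α C := by
    intro C hC
    rcases Finset.mem_insert.1 hC with rfl | hC
    · rw [hα0]; linarith
    · rw [hαs C hC]
      exact lt_of_le_of_ne (starCoord_nonneg j x C) (hsC C hC).symm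
  have hsum : ∑ C ∈ insert ∅ s, α C = 1 := by
    rw [Finset.sum_insert h0s, hα0, Finset.sum_congr rfl hαs, hgs]
    ring
  have hxeq : x = ∑ C ∈ insert ∅ s, α C • bary₂ (expand C) := by
    refine sum_apply_eq_of_forall_ne (j := j) (fun k hk => ?_) ?_
    · have h1 : w = ∑ C ∈ s, w C • Pi.single C 1 := by
        ext C
        simp only [Finset.sum_apply, Pi.smul_apply, Pi.single_apply, smul_eq_mul, mul_ite, mul_one,
          mul_zero, Finset.sum_ite_eq]
        by_cases hC : w C = 0 <;> simp [hs, hC]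
      have h2 : Function.update x j 0 k = (∑ C ∈ s, w C • unlayers (unlayers (Pi.single C 1))) k := by
        rw [← unlayers_sum_smul, ← unlayers_sum_smul, ← h1, huu]
      rw [Function.update_of_ne hk] at h2
      have h3 : bary₂ (expand ∅) k = 0 := by
        rw [hexp0, bary₂_singleton, Pi.single_eq_of_ne hk]
      rw [h2, Finset.sum_insert h0s, Pi.add_apply, Pi.smul_apply, h3, smul_zero, zero_add,
        Finset.sum_apply, Finset.sum_apply]
      refine Finset.sum_congr rfl fun C hC => ?_
      rw [Pi.smul_apply, Pi.smul_apply, bary₂_eq_unlayers (hjexp C).1 (hjexp C).2 hk,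
        hred C (hsC C hC), hαs C hC]
    · simp only [Finset.sum_apply, Pi.smul_apply, smul_eq_mul]
      rw [Finset.sum_comm]
      simp only [← Finset.mul_sum]
      have h4 : ∀ C ∈ insert ∅ s, α C * ∑ k, bary₂ (expand C) k = α C := fun C hC => by
        rw [sum_bary₂ (hflag' C hC), mul_one]
      rw [Finset.sum_congr rfl h4, hsum, hx.2]
  simp only [openStar, mem_iUnion, exists_prop]
  refine ⟨((insert ∅ s).image expand).image bary₂, ⟨?_, ?_⟩, ?_⟩
  · rw [secondSubdivision_eq]
    refine ⟨(insert ∅ s).image expand, ⟨(Finset.insert_nonempty _ _).image _, fun c hc => ?_, ?_⟩,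
      rfl⟩
    · obtain ⟨C, hC, rfl⟩ := Finset.mem_image.1 (Finset.mem_coe.1 hc)
      exact hflag' C hC
    · intro c hc c' hc' _
      obtain ⟨C, hC, rfl⟩ := Finset.mem_image.1 (Finset.mem_coe.1 hc)
      obtain ⟨C', hC', rfl⟩ := Finset.mem_image.1 (Finset.mem_coe.1 hc')
      have hmono : ∀ {C C' : Finset (Finset (Fin (n + 1)))}, C ⊆ C' → expand C ⊆ expand C' :=
        fun h => by
          rw [hexp, hexp]
          exact Finset.insert_subset_insert _ (Finset.image_mono _ h)
      rcases Finset.mem_insert.1 hC with rfl | hC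
      · exact Or.inl (hmono (Finset.empty_subset _))
      rcases Finset.mem_insert.1 hC' with rfl | hC'
      · exact Or.inr (hmono (Finset.empty_subset _))
      exact ((isChain_layers _).total (hsC C hC) (hsC C' hC')).imp hmono hmono
  · refine Finset.mem_image.2 ⟨expand ∅, Finset.mem_image_of_mem _ (Finset.mem_insert_self _ _), ?_⟩
    rw [hexp0, bary₂_singleton]
  · have h1 := mem_intrinsicInterior_convexHull_image (f := fun C => bary₂ (expand C)) hpos hsum
    rw [Finset.image_image, Finset.coe_image, hxeq]
    exact h1

theorem mem_truncatedSimplex_iff {n : ℕ} {x : Fin (n + 1) → ℝ} :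
    x ∈ truncatedSimplex n ↔ x ∈ stdSimplex ℝ (Fin (n + 1)) ∧ ∀ j, 1 ≤ gam j x := by
  simp only [truncatedSimplex, Set.mem_sdiff, mem_iUnion, not_exists]
  refine and_congr_right fun hx => forall_congr' fun j => ?_
  rw [← not_lt, not_iff_not]
  exact ⟨gam_lt_one_of_mem_openStar, mem_openStar_of_gam_lt_one hx⟩

end SecondSubdivision

/-! ### Radial structure of the glued spaces near the vertices -/

theorem affine_add_smul_sub {V : Type*} [AddCommGroup V] [Module ℝ V] (a : V →ᵃ[ℝ] ℝ) (p x : V)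
    (c : ℝ) : a (p + c • (x - p)) = a p + c * (a x - a p) := by
  have h := a.apply_lineMap p x c
  simp only [AffineMap.lineMap_apply, vsub_eq_sub, vadd_eq_add, smul_eq_mul] at h
  rw [add_comm p, h]
  ring

/-! ### The least of the functions `gam j`. -/

section Tau

variable {n : ℕ}

/-- The minimum of the functions `gam j`. -/
noncomputable def minGam (x : Fin (n + 1) → ℝ) : ℝ :=
  Finset.univ.fold min (gam 0 x) fun j => gam j x

theorem le_minGam_iff {x : Fin (n + 1) → ℝ} {c : ℝ} : c ≤ minGam x ↔ ∀ j, c ≤ gam j x := by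
  rw [minGam, Finset.le_fold_min]
  exact ⟨fun h j => h.2 j (Finset.mem_univ j), fun h => ⟨h 0, fun j _ => h j⟩⟩

theorem minGam_lt_iff {x : Fin (n + 1) → ℝ} {c : ℝ} : minGam x < c ↔ ∃ j, gam j x < c := by
  rw [← not_le, le_minGam_iff]
  push Not
  rfl

theorem minGam_eq {x : Fin (n + 1) → ℝ} (hx : x ∈ stdSimplex ℝ (Fin (n + 1))) {j : Fin (n + 1)}
    (h : gam j x < starRadius (Fin (n + 1))) : minGam x = gam j x := by
  refine le_antisymm (le_minGam_iff.1 le_rfl j) (le_minGam_iff.2 fun k => ?_)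
  by_cases hk : gam k x < starRadius (Fin (n + 1))
  · rw [gam_lt_unique hx h hk]
  · exact h.le.trans (not_lt.1 hk)

theorem minGam_nonneg (x : Fin (n + 1) → ℝ) : 0 ≤ minGam x := le_minGam_iff.2 fun j => gam_nonneg j x

theorem minGam_comp_symm (e : Equiv.Perm (Fin (n + 1))) (x : Fin (n + 1) → ℝ) :
    minGam (x ∘ e.symm) = minGam x := by
  refine le_antisymm (le_minGam_iff.2 fun j => ?_) (le_minGam_iff.2 fun j => ?_)
  · rw [← gam_comp_symm e]; exact le_minGam_iff.1 le_rfl (e j)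
  · have := gam_comp_symm e (e.symm j) x
    rw [Equiv.apply_symm_apply] at this
    rw [this]; exact le_minGam_iff.1 le_rfl _

theorem isSel_minGam {Z ι : Type*} [TopologicalSpace Z] {i : Z → ι → ℝ} {z : Z}
    {f : Z → Fin (n + 1) → ℝ} (hf : ∀ k, IsSel i (fun z => f z k) z) :
    IsSel i (fun z => minGam (f z)) z :=
  IsSel.fold_min (F := fun j z => gam j (f z)) _ (isSel_gam hf 0) fun j _ => isSel_gam hf j

theorem mem_truncatedSimplex_iff_minGam {x : Fin (n + 1) → ℝ} :
    x ∈ truncatedSimplex n ↔ x ∈ stdSimplex ℝ (Fin (n + 1)) ∧ 1 ≤ minGam x := by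
  rw [mem_truncatedSimplex_iff, le_minGam_iff]

theorem continuous_minGam : Continuous (minGam : (Fin (n + 1) → ℝ) → ℝ) :=
  continuous_iff_continuousAt.2 fun x =>
    (isSel_minGam (i := id) (f := id) (fun k => IsSel.coord continuous_id k x)).continuousAt

theorem truncatedSimplex_subset : truncatedSimplex n ⊆ stdSimplex ℝ (Fin (n + 1)) :=
  fun _ hx => hx.1

theorem permInvariant_truncatedSimplex : PermInvariant (truncatedSimplex n) := fun σ x hx => by
  rw [mem_truncatedSimplex_iff_minGam] at hx ⊢
  exact ⟨permInvariant_stdSimplex _ σ x hx.1, by rw [minGam_comp_symm]; exact hx.2⟩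

theorem isCompact_truncatedSimplex : IsCompact (truncatedSimplex n) := by
  have : truncatedSimplex n = stdSimplex ℝ (Fin (n + 1)) ∩ minGam ⁻¹' Ici 1 := by
    ext x; exact mem_truncatedSimplex_iff_minGam
  rw [this]
  exact (isCompact_stdSimplex ℝ _).inter_right (isClosed_Ici.preimage continuous_minGam)

end Tau

namespace FacePairing

variable {k n : ℕ} {P : FacePairing k n}

theorem plAt_space_iff {f : P.Space → ℝ} {z : P.Space} :
    PLAt f z ↔ ∀ i x, P.pt _ i x = z → IsSel Subtype.val (fun x' => f (P.pt _ i x')) x := by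
  simp only [plAt_iff_pt, plAt_stdSimplex_iff]

variable (P) in
/-- The minimum of the functions `gam` on the glued space. -/
noncomputable def tau : P.Space → ℝ :=
  Quot.lift (fun p => minGam p.2.1) <| by
    rintro ⟨i, x⟩ ⟨i', x'⟩ ⟨v, -, -, h⟩
    have : x'.1 = x.1 ∘ (P.vertexMap (i, v)).symm := by
      ext w
      rw [Function.comp_apply, ← h, Equiv.apply_symm_apply]
    dsimp only
    rw [this, minGam_comp_symm]

theorem tau_pt (i : Fin k) (x : stdSimplex ℝ (Fin (n + 1))) : P.tau (P.pt _ i x) = minGam x.1 := rfl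

theorem tau_nonneg (z : P.Space) : 0 ≤ P.tau z := by
  obtain ⟨i, x, rfl⟩ := pt_surjective z
  exact minGam_nonneg _

theorem isSel_coord_stdSimplex (x : stdSimplex ℝ (Fin (n + 1))) (l : Fin (n + 1)) :
    IsSel Subtype.val (fun x' : stdSimplex ℝ (Fin (n + 1)) => x'.1 l) x :=
  IsSel.coord continuous_subtype_val l x

theorem plAt_tau (z : P.Space) : PLAt P.tau z :=
  plAt_space_iff.2 fun i x _ => isSel_minGam (f := Subtype.val) (isSel_coord_stdSimplex x)

theorem continuous_tau : Continuous P.tau :=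
  continuous_iff_continuousAt.2 fun _ =>
    (continuousAt_iff_pt (permInvariant_stdSimplex _)).2 fun _ _ _ =>
      (continuous_minGam.comp continuous_subtype_val).continuousAt

variable (P) in
/-- The map of the glued space that is given by `G` in the coordinates around the vertices. -/
noncomputable def glueMap {G : (Finset (Finset (Fin (n + 1))) → ℝ) → Finset (Finset (Fin (n + 1))) → ℝ}
    (hG : IsStarMap G) : P.Space → P.Space :=
  Quot.map (fun p => ⟨p.1, ⟨starMap G p.2.1, hG.starMap_mem p.2.2⟩⟩) <| by
    rintro ⟨i, x⟩ ⟨i', x'⟩ ⟨v, hv, hi, h⟩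
    have : x'.1 = x.1 ∘ (P.vertexMap (i, v)).symm := by
      ext w
      rw [Function.comp_apply, ← h, Equiv.apply_symm_apply]
    refine ⟨v, hG.starMap_apply_eq_zero x.2 hv, hi, fun w => ?_⟩
    dsimp only
    rw [this, hG.starMap_comp_symm x.2, Function.comp_apply, Equiv.symm_apply_apply]

section GlueMap

variable {G : (Finset (Finset (Fin (n + 1))) → ℝ) → Finset (Finset (Fin (n + 1))) → ℝ}
  (hG : IsStarMap G)

theorem glueMap_pt (i : Fin k) (x : stdSimplex ℝ (Fin (n + 1))) :
    P.glueMap hG (P.pt _ i x) = P.pt _ i ⟨starMap G x.1, hG.starMap_mem x.2⟩ := rfl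

theorem isPLMapAt_glueMap {z : P.Space}
    (h : ∀ i x, P.pt _ i x = z → ∀ l, IsSel Subtype.val
      (fun x' : stdSimplex ℝ (Fin (n + 1)) => starMap G x'.1 l) x) :
    IsPLMapAt (P.glueMap hG) z := by
  refine (isPLMapAt_iff_pt (permInvariant_stdSimplex _)).2 fun i x hx => ?_
  have h1 : ∀ᶠ x' in 𝓝 x, ContinuousAt (fun x' : stdSimplex ℝ (Fin (n + 1)) =>
      (⟨starMap G x'.1, hG.starMap_mem x'.2⟩ : stdSimplex ℝ (Fin (n + 1)))) x' := by
    filter_upwards [eventually_all.2 fun l => (h i x hx l).eventually] with x' hx'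
    refine IsInducing.subtypeVal.continuousAt_iff.2 (continuousAt_pi.2 fun l => (hx' l).continuousAt)
  refine ⟨(continuous_pt i).continuousAt.comp h1.self_of_nhds, fun g hg => ?_⟩
  rw [plAt_stdSimplex_iff]
  exact IsSel.comp (h := fun u => g (P.pt _ i u))
    (F := fun u : stdSimplex ℝ (Fin (n + 1)) => ⟨starMap G u.1, hG.starMap_mem u.2⟩)
    (plAt_space_iff.1 hg i _ rfl) h1 (h i x hx)

end GlueMap

variable (P) in
/-- The dilatation by the factor `t` around the vertices. -/
noncomputable def rad (t : ℝ) : P.Space → P.Space :=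
  -- Taking the maximum with zero makes the factor non-negative, so that the dilatation is defined
  -- for every real parameter.
  P.glueMap (isStarMap_smul (K := Fin (n + 1)) (le_max_right t 0))

theorem exists_pt_of_tau_lt {z : P.Space} (h : P.tau z < starRadius (Fin (n + 1))) :
    ∃ i x j, P.pt _ i x = z ∧ gam j x.1 < starRadius (Fin (n + 1)) ∧ gam j x.1 = P.tau z := by
  obtain ⟨i, x, rfl⟩ := pt_surjective z
  obtain ⟨j, hj⟩ := minGam_lt_iff.1 h
  exact ⟨i, x, j, rfl, hj, (minGam_eq x.2 hj).symm⟩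

theorem single_add_smul_mem {x : Fin (n + 1) → ℝ} {j : Fin (n + 1)} {t : ℝ}
    (hx : x ∈ stdSimplex ℝ (Fin (n + 1))) (ht : 0 ≤ t) (h1 : gam j x < starRadius (Fin (n + 1)))
    (h2 : t * gam j x < starRadius (Fin (n + 1))) :
    Pi.single j 1 + t • (x - Pi.single j 1) ∈ stdSimplex ℝ (Fin (n + 1)) := by
  rw [← starMap_smul ht hx h1 h2]
  exact (isStarMap_smul ht).starMap_mem hx

theorem rad_pt {t : ℝ} (ht : 0 ≤ t) (i : Fin k) (x : stdSimplex ℝ (Fin (n + 1))) {j : Fin (n + 1)}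
    (h1 : gam j x.1 < starRadius (Fin (n + 1))) (h2 : t * gam j x.1 < starRadius (Fin (n + 1))) :
    P.rad t (P.pt _ i x) =
      P.pt _ i ⟨Pi.single j 1 + t • (x.1 - Pi.single j 1), single_add_smul_mem x.2 ht h1 h2⟩ := by
  rw [rad, glueMap_pt]
  congr 1
  refine Subtype.ext ?_
  simp only [max_eq_left ht]
  exact starMap_smul ht x.2 h1 h2

theorem tau_pt_of_lt {i : Fin k} {x : stdSimplex ℝ (Fin (n + 1))} {j : Fin (n + 1)}
    (h : gam j x.1 < starRadius (Fin (n + 1))) : P.tau (P.pt _ i x) = gam j x.1 := minGam_eq x.2 h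

/-! ### Calculus of the dilatations. -/

section Rad

variable {s t : ℝ} {z : P.Space}

theorem tau_rad (ht : 0 ≤ t) (h1 : P.tau z < starRadius (Fin (n + 1)))
    (h2 : t * P.tau z < starRadius (Fin (n + 1))) : P.tau (P.rad t z) = t * P.tau z := by
  obtain ⟨i, x, j, rfl, hj, hτ⟩ := exists_pt_of_tau_lt h1
  rw [← hτ] at h2 ⊢
  rw [rad_pt ht i x hj h2, tau_pt_of_lt (j := j) (by rwa [gam_smul j x.1 ht]), gam_smul j x.1 ht]

theorem rad_rad (hs : 0 ≤ s) (ht : 0 ≤ t) (h1 : P.tau z < starRadius (Fin (n + 1)))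
    (h2 : t * P.tau z < starRadius (Fin (n + 1)))
    (h3 : s * t * P.tau z < starRadius (Fin (n + 1))) : P.rad s (P.rad t z) = P.rad (s * t) z := by
  obtain ⟨i, x, j, rfl, hj, hτ⟩ := exists_pt_of_tau_lt h1
  rw [← hτ] at h2 h3
  rw [rad_pt ht i x hj h2, rad_pt (mul_nonneg hs ht) i x hj h3, rad_pt (j := j) hs]
  · congr 1
    refine Subtype.ext ?_
    dsimp only
    module
  · rwa [gam_smul j x.1 ht]
  · rwa [gam_smul j x.1 ht, ← mul_assoc]

theorem rad_one (z : P.Space) : P.rad 1 z = z := by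
  obtain ⟨i, x, rfl⟩ := pt_surjective z
  by_cases h : ∃ j, gam j x.1 < starRadius (Fin (n + 1))
  · obtain ⟨j, hj⟩ := h
    rw [rad_pt zero_le_one i x hj (by rwa [one_mul])]
    congr 1
    refine Subtype.ext ?_
    dsimp only
    module
  · rw [rad, glueMap_pt]
    congr 1
    exact Subtype.ext (starMap_of_not fun ⟨j, hj, _⟩ => h ⟨j, hj⟩)

theorem rad_zero_pt {i : Fin k} {x : stdSimplex ℝ (Fin (n + 1))} {j : Fin (n + 1)}
    (h : gam j x.1 < starRadius (Fin (n + 1))) :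
    P.rad 0 (P.pt _ i x) = P.pt _ i ⟨Pi.single j 1, single_mem_stdSimplex ℝ j⟩ := by
  rw [rad_pt le_rfl i x h (by rw [zero_mul]; exact one_pos.trans one_lt_starRadius)]
  congr 1
  refine Subtype.ext ?_
  dsimp only
  module

theorem starRadius_pos : 0 < starRadius (Fin (n + 1)) := one_pos.trans one_lt_starRadius

theorem tau_eq_zero_iff : P.tau z = 0 ↔ z ∈ P.vertices := by
  constructor
  · intro h
    obtain ⟨i, x, j, rfl, hj, hτ⟩ := exists_pt_of_tau_lt (z := z) (by rw [h]; exact starRadius_pos)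
    rw [h, gam_eq_zero_iff x.2] at hτ
    refine ⟨(i, j), ?_⟩
    have : x = ⟨Pi.single j 1, single_mem_stdSimplex ℝ j⟩ := Subtype.ext hτ
    rw [this]
    rfl
  · rintro ⟨⟨i, j⟩, rfl⟩
    have h := tau_pt_of_lt (P := P) (i := i) (x := ⟨Pi.single j 1, single_mem_stdSimplex ℝ j⟩)
      (j := j) (by rw [gam_single]; exact starRadius_pos)
    rw [gam_single] at h
    exact h

theorem tau_pos_iff : 0 < P.tau z ↔ z ∉ P.vertices := by
  rw [← tau_eq_zero_iff]
  exact ⟨fun h => h.ne', fun h => lt_of_le_of_ne (tau_nonneg z) (Ne.symm h)⟩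

theorem rad_of_mem_vertices (hz : z ∈ P.vertices) (t : ℝ) : P.rad t z = z := by
  obtain ⟨⟨i, j⟩, rfl⟩ := hz
  change P.rad t (P.pt _ i ⟨Pi.single j 1, single_mem_stdSimplex ℝ j⟩) = P.pt _ i _
  rw [rad, glueMap_pt]
  congr 1
  refine Subtype.ext ?_
  dsimp only
  rw [starMap_smul (j := j) (le_max_right t 0) (single_mem_stdSimplex ℝ j)]
  · simp
  · rw [gam_single]; exact starRadius_pos
  · rw [gam_single, mul_zero]; exact starRadius_pos

theorem rad_zero_mem_vertices (h : P.tau z < starRadius (Fin (n + 1))) :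
    P.rad 0 z ∈ P.vertices := by
  rw [← tau_eq_zero_iff, tau_rad le_rfl h (by rw [zero_mul]; exact starRadius_pos), zero_mul]

/-- In the `starRadius` neighbourhood of a vertex, `P.rad 0` collapses points to that vertex, so it
is locally constant there and labels the links. -/
theorem eventually_rad_zero_eq (h : P.tau z < starRadius (Fin (n + 1))) :
    ∀ᶠ z' in 𝓝 z, P.rad 0 z' = P.rad 0 z := by
  refine (eventually_nhds_iff_pt (permInvariant_stdSimplex _)).2 fun i x hx => ?_
  subst hx
  obtain ⟨j, hj⟩ := minGam_lt_iff.1 h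
  filter_upwards [((continuous_gam j).comp continuous_subtype_val).continuousAt.eventually
    (Iio_mem_nhds hj)] with x' hx'
  rw [rad_zero_pt hx', rad_zero_pt hj]

theorem isPLMapAt_rad (ht : 0 ≤ t) (h1 : P.tau z < starRadius (Fin (n + 1)))
    (h2 : t * P.tau z < starRadius (Fin (n + 1))) : IsPLMapAt (P.rad t) z := by
  refine isPLMapAt_glueMap _ fun i x hx l => ?_
  subst hx
  obtain ⟨j, hj⟩ := minGam_lt_iff.1 h1
  rw [tau_pt_of_lt hj] at h2
  have hc : Continuous fun x' : stdSimplex ℝ (Fin (n + 1)) => gam j x'.1 :=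
    (continuous_gam j).comp continuous_subtype_val
  have key : IsSel Subtype.val (fun x' : stdSimplex ℝ (Fin (n + 1)) =>
      (Pi.single j (1 : ℝ) : Fin (n + 1) → ℝ) l +
        t * (x'.1 l - (Pi.single j (1 : ℝ) : Fin (n + 1) → ℝ) l)) x :=
    (IsSel.const _ x).add (((isSel_coord_stdSimplex x l).sub (IsSel.const _ x)).const_mul t)
  refine key.congr ?_
  filter_upwards [hc.continuousAt.eventually (Iio_mem_nhds hj),
    (continuous_const.mul hc).continuousAt.eventually (Iio_mem_nhds h2)] with x' hx1 hx2
  simp only [max_eq_left ht]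
  rw [starMap_smul ht x'.2 hx1 hx2]
  simp

end Rad

/-! ### The truncated space as a subspace -/

instance : T2Space P.Space := t2Space_glued (permInvariant_stdSimplex _) (isCompact_stdSimplex ℝ _)

instance : CompactSpace P.Space := compactSpace_glued (isCompact_stdSimplex ℝ _)

instance : SecondCountableTopology P.Space :=
  secondCountableTopology_glued (permInvariant_stdSimplex _) (isCompact_stdSimplex ℝ _)

instance : T2Space P.TruncatedSpace :=
  t2Space_glued permInvariant_truncatedSimplex isCompact_truncatedSimplex

instance : CompactSpace P.TruncatedSpace := compactSpace_glued isCompact_truncatedSimplex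

instance : SecondCountableTopology P.TruncatedSpace :=
  secondCountableTopology_glued permInvariant_truncatedSimplex isCompact_truncatedSimplex

variable (P) in
/-- The inclusion of the truncated space. -/
def trunc : P.TruncatedSpace → P.Space := P.incl truncatedSimplex_subset

theorem isEmbedding_trunc : IsClosedEmbedding P.trunc :=
  isClosedEmbedding_incl permInvariant_truncatedSimplex (permInvariant_stdSimplex _) _
    isCompact_truncatedSimplex (isCompact_stdSimplex ℝ _)

theorem range_trunc : range P.trunc = {z | 1 ≤ P.tau z} := by
  ext z
  constructor
  · rintro ⟨y, rfl⟩
    obtain ⟨i, x, rfl⟩ := pt_surjective y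
    exact (mem_truncatedSimplex_iff_minGam.1 x.2).2
  · intro h
    obtain ⟨i, x, rfl⟩ := pt_surjective z
    exact ⟨P.pt _ i ⟨x.1, mem_truncatedSimplex_iff_minGam.2 ⟨x.2, h⟩⟩, rfl⟩

theorem one_le_tau_trunc (y : P.TruncatedSpace) : 1 ≤ P.tau (P.trunc y) :=
  range_trunc.le (mem_range_self y)

theorem exists_trunc_eq {z : P.Space} (h : 1 ≤ P.tau z) : ∃ y, P.trunc y = z := range_trunc.ge h

open Classical in
variable (P) in
/-- The extension to the glued space of a function on the truncated space. -/
noncomputable def extendTrunc (f : P.TruncatedSpace → ℝ) (z : P.Space) : ℝ :=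
  min (P.tau z) 1 * if h : ∃ y, P.trunc y = P.rad (min (P.tau z) 1)⁻¹ z then f h.choose else 0

theorem extendTrunc_of_eq {f : P.TruncatedSpace → ℝ} {z : P.Space} {y : P.TruncatedSpace}
    (h : P.trunc y = P.rad (min (P.tau z) 1)⁻¹ z) :
    P.extendTrunc f z = min (P.tau z) 1 * f y := by
  have h' : ∃ y, P.trunc y = P.rad (min (P.tau z) 1)⁻¹ z := ⟨y, h⟩
  have : h'.choose = y := isEmbedding_trunc.injective (h'.choose_spec.trans h.symm)
  rw [extendTrunc, dif_pos h', this]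

theorem extendTrunc_trunc (f : P.TruncatedSpace → ℝ) (y : P.TruncatedSpace) :
    P.extendTrunc f (P.trunc y) = f y := by
  have h : min (P.tau (P.trunc y)) 1 = 1 := min_eq_right (one_le_tau_trunc y)
  rw [extendTrunc_of_eq (y := y), h, one_mul]
  rw [h, inv_one, rad_one]

theorem isSel_of_plAt_truncatedSpace {f : P.TruncatedSpace → ℝ} {i : Fin k} {x : truncatedSimplex n}
    (h : PLAt f (P.pt _ i x)) : IsSel Subtype.val (fun x' => f (P.pt _ i x')) x :=
  isSel_val_of_plAt (plAt_iff_pt.1 h i x rfl)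

/-- An extension that is constant along rays would not be PL. With the factor `min (tau z) 1` an
affine candidate `a` becomes `m * a (e + m⁻¹ • (x - e)) = a x + (m - 1) * a e`, where `e` is the
vertex and `m` the factor, and this is PL in `x`. -/
theorem plAt_extendTrunc {f : P.TruncatedSpace → ℝ} {y : P.TruncatedSpace} (hf : PLAt f y) :
    PLAt (P.extendTrunc f) (P.trunc y) := by
  classical
  refine plAt_space_iff.2 fun i x hx => ?_
  have hxT : x.1 ∈ truncatedSimplex n :=
    mem_truncatedSimplex_iff_minGam.2 ⟨x.2, by
      have := one_le_tau_trunc y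
      rwa [← hx, tau_pt] at this⟩
  obtain rfl : P.pt _ i ⟨x.1, hxT⟩ = y := isEmbedding_trunc.injective hx
  have hsel := isSel_of_plAt_truncatedSpace hf
  by_cases h1 : ∃ j, gam j x.1 < starRadius (Fin (n + 1))
  · obtain ⟨j, hj⟩ := h1
    obtain ⟨S, hS, hSf⟩ := hsel
    set m : stdSimplex ℝ (Fin (n + 1)) → ℝ := fun x' => min (gam j x'.1) 1 with hm
    have hγ : Continuous fun x' : stdSimplex ℝ (Fin (n + 1)) => gam j x'.1 :=
      (continuous_gam j).comp continuous_subtype_val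
    have hmc : Continuous m := hγ.min continuous_const
    have h1x : 1 ≤ gam j x.1 := (mem_truncatedSimplex_iff.1 hxT).2 j
    have hmx : m x = 1 := min_eq_right h1x
    have hev : ∀ᶠ x' in 𝓝 x, gam j x'.1 < starRadius (Fin (n + 1)) ∧ 0 < m x' ∧
        (m x')⁻¹ * gam j x'.1 < starRadius (Fin (n + 1)) := by
      refine (hγ.continuousAt.eventually (Iio_mem_nhds hj)).and
        ((hmc.continuousAt.eventually (Ioi_mem_nhds (by rw [hmx]; exact one_pos))).and ?_)
      refine ((hmc.continuousAt.inv₀ (by rw [hmx]; exact one_ne_zero)).mul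
        hγ.continuousAt).eventually (Iio_mem_nhds ?_)
      change (m x)⁻¹ * gam j x.1 < _
      rw [hmx, inv_one, one_mul]; exact hj
    have hmem : ∀ x' : stdSimplex ℝ (Fin (n + 1)), gam j x'.1 < starRadius (Fin (n + 1)) → 0 < m x' →
        (m x')⁻¹ * gam j x'.1 < starRadius (Fin (n + 1)) →
        Pi.single j 1 + (m x')⁻¹ • (x'.1 - Pi.single j 1) ∈ truncatedSimplex n := by
      intro x' h1 h2 h3
      have h4 := single_add_smul_mem x'.2 (inv_nonneg.2 h2.le) h1 h3
      have h5 := gam_smul j x'.1 (inv_nonneg.2 h2.le)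
      refine mem_truncatedSimplex_iff_minGam.2 ⟨h4, ?_⟩
      rw [minGam_eq h4 (by rwa [h5]), h5, ← div_eq_inv_mul, one_le_div h2]
      exact min_le_left _ _
    let r : stdSimplex ℝ (Fin (n + 1)) → truncatedSimplex n := fun x' =>
      if h : Pi.single j 1 + (m x')⁻¹ • (x'.1 - Pi.single j 1) ∈ truncatedSimplex n then ⟨_, h⟩
      else ⟨x.1, hxT⟩
    have hr : ∀ᶠ x' in 𝓝 x, (r x').1 = Pi.single j 1 + (m x')⁻¹ • (x'.1 - Pi.single j 1) := by
      filter_upwards [hev] with x' hx'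
      simp only [r, dif_pos (hmem x' hx'.1 hx'.2.1 hx'.2.2)]
    have hrx : r x = ⟨x.1, hxT⟩ := by
      refine Subtype.ext ?_
      rw [hr.self_of_nhds, hmx]
      simp
    have hrc : ∀ᶠ x' in 𝓝 x, ContinuousAt r x' := by
      filter_upwards [hr.eventually_nhds, hev] with x' h1 h2
      refine IsInducing.subtypeVal.continuousAt_iff.2 (ContinuousAt.congr ?_ (EventuallyEq.symm h1))
      exact continuousAt_const.add ((hmc.continuousAt.inv₀ h2.2.1.ne').smul
        (continuous_subtype_val.sub continuous_const).continuousAt)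
    have hval : ∀ᶠ x' in 𝓝 x, P.extendTrunc f (P.pt _ i x') = m x' * f (P.pt _ i (r x')) := by
      filter_upwards [hev, hr] with x' h1 h2
      have hτ := tau_pt_of_lt (P := P) (i := i) h1.1
      rw [extendTrunc_of_eq (y := P.pt _ i (r x')), hτ]
      rw [hτ, rad_pt (inv_nonneg.2 h1.2.1.le) i x' h1.1 h1.2.2, trunc, incl_pt]
      exact congrArg _ (Subtype.ext h2)
    have hSf' : ∀ᶠ x' in 𝓝 x, ContinuousAt (fun u => f (P.pt _ i u)) (r x') ∧
        ∃ a ∈ S, f (P.pt _ i (r x')) = a (r x').1 := by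
      rw [← hrx] at hSf
      exact hrc.self_of_nhds.eventually hSf
    refine IsSel.of_selection (F := fun (a : (Fin (n + 1) → ℝ) →ᵃ[ℝ] ℝ) x' =>
      a x'.1 + (m x' - 1) * a (Pi.single j 1)) hS (fun a _ => ?_) ?_
    · have h1 : IsSel Subtype.val m x :=
        (isSel_gam (f := Subtype.val) (isSel_coord_stdSimplex x) j).min (IsSel.const 1 x)
      exact (IsSel.affine continuous_subtype_val a x).add ((h1.sub (IsSel.const 1 x)).mul_const _)
    · filter_upwards [hval.eventually_nhds, hSf', hrc, hr, hev] with x' h1 h2 h3 h4 h5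
      obtain ⟨h2c, a, ha, h2a⟩ := h2
      refine ⟨ContinuousAt.congr ?_ (EventuallyEq.symm h1), a, ha, ?_⟩
      · exact hmc.continuousAt.mul (ContinuousAt.comp (g := fun u => f (P.pt _ i u)) h2c h3)
      · rw [h1.self_of_nhds, h2a, h4]
        rw [affine_add_smul_sub]
        have := h5.2.1.ne'
        field_simp
        ring
  · push Not at h1
    have hτ : starRadius (Fin (n + 1)) ≤ minGam x.1 := le_minGam_iff.2 h1
    have hev : ∀ᶠ x' : stdSimplex ℝ (Fin (n + 1)) in 𝓝 x, 1 < minGam x'.1 :=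
      (continuous_minGam.comp continuous_subtype_val).continuousAt.eventually
        (Ioi_mem_nhds (one_lt_starRadius.trans_le hτ))
    have hmem : ∀ x' : stdSimplex ℝ (Fin (n + 1)), 1 < minGam x'.1 → x'.1 ∈ truncatedSimplex n :=
      fun x' h => mem_truncatedSimplex_iff_minGam.2 ⟨x'.2, h.le⟩
    let r : stdSimplex ℝ (Fin (n + 1)) → truncatedSimplex n := fun x' =>
      if h : x'.1 ∈ truncatedSimplex n then ⟨_, h⟩ else ⟨x.1, hxT⟩
    have hr : ∀ᶠ x' in 𝓝 x, (r x').1 = x'.1 := by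
      filter_upwards [hev] with x' hx'
      simp only [r, dif_pos (hmem x' hx')]
    have hrx : r x = ⟨x.1, hxT⟩ := Subtype.ext hr.self_of_nhds
    have hrc : ∀ᶠ x' in 𝓝 x, ContinuousAt r x' := by
      filter_upwards [hr.eventually_nhds] with x' h1
      exact IsInducing.subtypeVal.continuousAt_iff.2
        (continuous_subtype_val.continuousAt.congr (EventuallyEq.symm h1))
    rw [← hrx] at hsel
    refine (IsSel.pullback (F := r) hsel hrc hr).congr ?_
    filter_upwards [hr] with x' h
    rw [← extendTrunc_trunc f, trunc, incl_pt]
    exact congrArg (fun u => P.extendTrunc f (P.pt _ i u)) (Subtype.ext h)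

theorem isPLEmbedding_trunc : IsPLEmbedding P.trunc := by
  refine ⟨isEmbedding_trunc.isEmbedding, fun f y => ⟨fun hf => ?_, ?_⟩⟩
  · exact ⟨P.extendTrunc f, plAt_extendTrunc hf,
      Eventually.of_forall fun y => (extendTrunc_trunc f y).symm⟩
  · rintro ⟨g, hg, hfg⟩
    refine PLStructure.congr_germ (EventuallyEq.symm hfg) (plAt_iff_pt.2 fun i x hx => ?_)
    subst hx
    obtain ⟨G, hG, hgG⟩ := plAt_iff_pt.1 hg i ⟨x.1, truncatedSimplex_subset x.2⟩ rfl
    refine ⟨G, hG, ?_⟩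
    have hc : ContinuousAt (fun u : truncatedSimplex n =>
        (⟨u.1, truncatedSimplex_subset u.2⟩ : stdSimplex ℝ (Fin (n + 1)))) x :=
      (continuous_subtype_val.subtype_mk _).continuousAt
    exact hc.eventually hgG

end FacePairing

/-! ### Pushing the punctured space off the vertices -/

section Step

/-- The pieces of `stepFun`. -/
noncomputable def stepPiece (g : ℝ) (m : ℕ) (γ s : ℝ) : ℝ :=
  max ((1 - 1 / g + 2 ^ m / g) * s)
    ((1 - 1 / g + 2 ^ (m + 1) / g) * s + (1 - 2 ^ (m + 1) * γ / g))

/-- The pieces of `stepInv`. -/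
noncomputable def stepInvPiece (g : ℝ) (m : ℕ) (γ t : ℝ) : ℝ :=
  min (t / (1 - 1 / g + 2 ^ m / g))
    ((t - (1 - 2 ^ (m + 1) * γ / g)) / (1 - 1 / g + 2 ^ (m + 1) / g))

/-- A piecewise linear function in two variables that maps the interval `[0, γ]` onto
`[0, (1 - 1 / g) * γ + 1]` if `0 < γ ≤ g` and `m` is large. -/
noncomputable def stepFun (g : ℝ) : ℕ → ℝ → ℝ → ℝ
  | 0, γ, s => stepPiece g 0 γ s
  | m + 1, γ, s => min (stepFun g m γ s) (stepPiece g (m + 1) γ s)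

/-- The inverse of `stepFun`. -/
noncomputable def stepInv (g : ℝ) : ℕ → ℝ → ℝ → ℝ
  | 0, γ, t => stepInvPiece g 0 γ t
  | m + 1, γ, t => max (stepInv g m γ t) (stepInvPiece g (m + 1) γ t)

variable {g γ s t : ℝ} {m : ℕ}

theorem slope_pos (hg : 1 < g) (m : ℕ) : 0 < 1 - 1 / g + 2 ^ m / g := by
  have h1 : 1 / g < 1 := by rw [div_lt_one (by linarith)]; exact hg
  have h2 : 0 < 2 ^ m / g := by positivity
  linarith

/-- An adjunction of order: maxima of increasing functions correspond to minima of their inverses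
and vice versa. So `stepInv` inverts `stepFun` without a case distinction on the pieces. -/
theorem le_stepPiece_iff (hg : 1 < g) : t ≤ stepPiece g m γ s ↔ stepInvPiece g m γ t ≤ s := by
  rw [stepPiece, stepInvPiece, le_max_iff, min_le_iff, div_le_iff₀ (slope_pos hg m),
    div_le_iff₀ (slope_pos hg (m + 1)), sub_le_iff_le_add, mul_comm s, mul_comm s]

theorem le_stepFun_iff (hg : 1 < g) : t ≤ stepFun g m γ s ↔ stepInv g m γ t ≤ s := by
  induction m with
  | zero => exact le_stepPiece_iff hg
  | succ m ih => rw [stepFun, stepInv, le_min_iff, max_le_iff, ih, le_stepPiece_iff hg]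

theorem strictMono_stepPiece (hg : 1 < g) : StrictMono (stepPiece g m γ) := by
  intro s s' h
  refine max_lt_max (mul_lt_mul_of_pos_left h (slope_pos hg m)) ?_
  have := mul_lt_mul_of_pos_left h (slope_pos hg (m + 1))
  linarith

theorem strictMono_stepFun (hg : 1 < g) : StrictMono (stepFun g m γ) := by
  induction m with
  | zero => exact strictMono_stepPiece hg
  | succ m ih => exact fun s s' h => min_lt_min (ih h) (strictMono_stepPiece hg h)

theorem continuous_stepFun : Continuous (stepFun g m γ) := by
  have h : ∀ m, Continuous (stepPiece g m γ) := fun m => by unfold stepPiece; fun_prop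
  induction m with
  | zero => exact h 0
  | succ m ih => exact ih.min (h (m + 1))

theorem stepInv_stepFun (hg : 1 < g) (s : ℝ) : stepInv g m γ (stepFun g m γ s) = s := by
  refine le_antisymm ((le_stepFun_iff hg).1 le_rfl) ?_
  rw [← (strictMono_stepFun (m := m) (γ := γ) hg).le_iff_le]
  exact (le_stepFun_iff hg).2 le_rfl

theorem stepFun_stepInv (hg : 1 < g) (t : ℝ) : stepFun g m γ (stepInv g m γ t) = t := by
  refine le_antisymm ?_ ((le_stepFun_iff hg).2 le_rfl)
  by_contra! h
  obtain ⟨s, hs, hlt⟩ := (((continuous_stepFun.continuousAt.eventually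
    (Ioi_mem_nhds h)).filter_mono (nhdsWithin_le_nhds (s := Iio (stepInv g m γ t)))).and
      self_mem_nhdsWithin).exists
  exact not_le.2 hlt ((le_stepFun_iff hg).1 (le_of_lt hs))

theorem stepPiece_le_succ (hg : 1 < g) (hs : 0 ≤ s) (h : g ≤ 2 ^ (m + 1) * γ) :
    stepPiece g m γ s ≤ stepPiece g (m + 1) γ s := by
  refine le_max_of_le_left (max_le ?_ ?_)
  · refine mul_le_mul_of_nonneg_right ?_ hs
    have : (2 : ℝ) ^ m / g ≤ 2 ^ (m + 1) / g := by
      refine div_le_div_of_nonneg_right ?_ (by linarith)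
      exact pow_le_pow_right₀ one_le_two (Nat.le_succ m)
    linarith
  · have : 1 ≤ 2 ^ (m + 1) * γ / g := by rw [one_le_div (by linarith)]; exact h
    linarith

theorem stepFun_le_stepPiece : stepFun g m γ s ≤ stepPiece g m γ s := by
  cases m with
  | zero => exact le_rfl
  | succ m => exact min_le_right _ _

/-- As soon as `g ≤ 2 ^ (m + 1) * γ`, further pieces lie above the earlier ones. Hence finitely many
pieces suffice while `γ` stays away from zero. No finite number serves all `γ > 0`, since an
interval of length `γ` is stretched to length greater than one. -/
theorem stepFun_eq_of_le (hg : 1 < g) (hs : 0 ≤ s) (hγ : 0 ≤ γ) (h : g ≤ 2 ^ (m + 1) * γ) {m' : ℕ}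
    (hm : m ≤ m') : stepFun g m' γ s = stepFun g m γ s := by
  induction m', hm using Nat.le_induction with
  | base => rfl
  | succ l hl ih =>
    rw [stepFun, ← ih, min_eq_left]
    refine stepFun_le_stepPiece.trans (stepPiece_le_succ hg hs (h.trans ?_))
    exact mul_le_mul_of_nonneg_right (pow_le_pow_right₀ one_le_two (by lia)) hγ

theorem stepFun_zero (hg : 1 < g) (h : g ≤ 2 ^ (m + 1) * γ) : stepFun g m γ 0 = 0 := by
  refine le_antisymm (stepFun_le_stepPiece.trans (max_le (by simp) ?_)) ?_
  · have : 1 ≤ 2 ^ (m + 1) * γ / g := by rw [one_le_div (by linarith)]; exact h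
    linarith
  · clear h
    induction m with
    | zero => exact le_max_of_le_left (by simp)
    | succ m ih => exact le_min ih (le_max_of_le_left (by simp))

/-- Beyond the radius `g` nothing moves, which lets the push-off be extended by the identity. -/
theorem stepFun_of_ge (hg : 1 < g) (hγ : g ≤ γ) (hs : 0 ≤ s) (hsγ : s ≤ γ) : stepFun g m γ s = s := by
  have h0 : 0 < g := by linarith
  rw [stepFun_eq_of_le hg hs (by linarith) (m := 0) (by norm_num; linarith) (Nat.zero_le m), stepFun, stepPiece]
  have h1 : (1 - 1 / g + 2 ^ 0 / g) * s = s := by field_simp; ring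
  rw [h1, max_eq_left]
  have : (1 - 1 / g + 2 ^ (0 + 1) / g) * s + (1 - 2 ^ (0 + 1) * γ / g) = s + (g + s - 2 * γ) / g := by
    field_simp; ring
  rw [this]
  have : (g + s - 2 * γ) / g ≤ 0 := div_nonpos_of_nonpos_of_nonneg (by linarith) h0.le
  linarith

/-- At `s = γ` the piece with index `m` equals `(1 - 1 / g) * γ + max (2 ^ m * γ / g) 1`, so the
first piece is the least and its maximum is one. -/
theorem stepFun_self (hg : 1 < g) (h0 : 0 ≤ γ) (hγ : γ ≤ g) :
    stepFun g m γ γ = (1 - 1 / g) * γ + 1 := by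
  have h0' : 0 < g := by linarith
  have key : ∀ m, stepPiece g m γ γ = (1 - 1 / g) * γ + max (2 ^ m * γ / g) 1 := fun m => by
    rw [stepPiece, ← max_add_add_left]
    congr 1 <;> ring
  have hle : ∀ m, (1 - 1 / g) * γ + 1 ≤ stepPiece g m γ γ := fun m => by
    rw [key]
    linarith [le_max_right (2 ^ m * γ / g) 1]
  induction m with
  | zero =>
    rw [stepFun, key, max_eq_right]
    rw [div_le_one h0']
    simpa using hγ
  | succ m ih => rw [stepFun, ih, min_eq_left (hle _)]

/-- The number of pieces of `stepFun` that are needed for `γ`. -/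
noncomputable def stepNum (g γ : ℝ) : ℕ := ⌈g / γ⌉₊

theorem le_two_pow_stepNum (hγ : 0 < γ) : g ≤ 2 ^ (stepNum g γ + 1) * γ := by
  rw [← div_le_iff₀ hγ]
  refine (Nat.le_ceil _).trans ?_
  have h : stepNum g γ + 1 < 2 ^ (stepNum g γ + 1) := Nat.lt_two_pow_self
  exact_mod_cast (Nat.le_succ _).trans h.le

theorem stepFun_eq_stepFun_stepNum (hg : 1 < g) (hγ : 0 < γ) (hs : 0 ≤ s) (h : g ≤ 2 ^ (m + 1) * γ) :
    stepFun g m γ s = stepFun g (stepNum g γ) γ s := by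
  rcases le_total m (stepNum g γ) with h' | h'
  · exact (stepFun_eq_of_le hg hs hγ.le h h').symm
  · exact stepFun_eq_of_le hg hs hγ.le (le_two_pow_stepNum hγ) h'

theorem stepInv_nonneg (hg : 1 < g) (ht : 0 ≤ t) (h : g ≤ 2 ^ (m + 1) * γ) :
    0 ≤ stepInv g m γ t := by
  rw [← (strictMono_stepFun (m := m) (γ := γ) hg).le_iff_le, stepFun_stepInv hg, stepFun_zero hg h]
  exact ht

theorem stepInv_eq_stepInv_stepNum (hg : 1 < g) (hγ : 0 < γ) (ht : 0 ≤ t)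
    (h : g ≤ 2 ^ (m + 1) * γ) : stepInv g m γ t = stepInv g (stepNum g γ) γ t := by
  have h1 := stepInv_nonneg hg ht (le_two_pow_stepNum (g := g) hγ)
  conv_lhs => rw [← stepFun_stepInv (m := stepNum g γ) (γ := γ) hg t]
  rw [← stepFun_eq_stepFun_stepNum hg hγ h1 h, stepInv_stepFun hg]

theorem monotone_stepInv (hg : 1 < g) : Monotone (stepInv g m γ) := fun t t' h => by
  rw [← (strictMono_stepFun (m := m) (γ := γ) hg).le_iff_le, stepFun_stepInv hg, stepFun_stepInv hg]
  exact h

/-- The inverse of the map `γ ↦ stepFun g m γ γ`. -/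
noncomputable def stepRadius (g γ : ℝ) : ℝ := min γ ((γ - 1) / (1 - 1 / g))

theorem kappa_pos (hg : 1 < g) : 0 < 1 - 1 / g := by
  rw [sub_pos, div_lt_one (by linarith)]; exact hg

theorem stepRadius_pos (hg : 1 < g) (hγ : 1 < γ) : 0 < stepRadius g γ :=
  lt_min (by linarith) (div_pos (by linarith) (kappa_pos hg))

theorem stepRadius_of_ge (hg : 1 < g) (hγ : g ≤ γ) : stepRadius g γ = γ := by
  refine min_eq_left ?_
  rw [le_div_iff₀ (kappa_pos hg)]
  have : 1 ≤ γ / g := by rw [one_le_div (by linarith)]; exact hγ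
  have h2 : γ * (1 - 1 / g) = γ - γ / g := by ring
  linarith

theorem stepRadius_of_le (hg : 1 < g) (hγ : γ ≤ g) : stepRadius g γ = (γ - 1) / (1 - 1 / g) := by
  refine min_eq_right ?_
  rw [div_le_iff₀ (kappa_pos hg)]
  have : γ / g ≤ 1 := by rw [div_le_one (by linarith)]; exact hγ
  have h2 : γ * (1 - 1 / g) = γ - γ / g := by ring
  linarith

theorem stepFun_stepRadius (hg : 1 < g) (hγ : 1 < γ) :
    stepFun g m (stepRadius g γ) (stepRadius g γ) = γ := by
  rcases le_total g γ with h | h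
  · rw [stepRadius_of_ge hg h, stepFun_of_ge hg h (by linarith) le_rfl]
  · have h1 := stepRadius_of_le hg h
    have h2 : stepRadius g γ ≤ γ := min_le_left _ _
    rw [stepFun_self hg (stepRadius_pos hg hγ).le (h2.trans h), h1,
      mul_div_cancel₀ _ (kappa_pos hg).ne']
    ring

theorem one_lt_stepFun_self (hg : 1 < g) (hγ : 0 < γ) : 1 < stepFun g m γ γ := by
  rcases le_total g γ with h | h
  · rw [stepFun_of_ge hg h hγ.le le_rfl]; linarith
  · rw [stepFun_self hg hγ.le h]
    have := mul_pos (kappa_pos hg) hγ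
    linarith

theorem stepRadius_stepFun (hg : 1 < g) (hγ : 0 < γ) : stepRadius g (stepFun g m γ γ) = γ := by
  rcases le_total g γ with h | h
  · rw [stepFun_of_ge hg h hγ.le le_rfl, stepRadius_of_ge hg h]
  · have h1 : (1 - 1 / g) * γ + 1 ≤ g := by
      have h2 : (1 - 1 / g) * γ ≤ (1 - 1 / g) * g := mul_le_mul_of_nonneg_left h (kappa_pos hg).le
      have h3 : (1 - 1 / g) * g = g - 1 := by
        have : g ≠ 0 := by linarith
        field_simp
      linarith
    rw [stepFun_self hg hγ.le h, stepRadius_of_le hg h1]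
    rw [add_sub_cancel_right, mul_div_cancel_left₀ _ (kappa_pos hg).ne']

theorem stepFun_self_lt (hg : 1 < g) {c : ℝ} (hgc : g < c) (h0 : 0 ≤ γ) (hγ : γ < c) :
    stepFun g m γ γ < c := by
  rcases le_total g γ with h | h
  · rwa [stepFun_of_ge hg h h0 le_rfl]
  · rw [stepFun_self hg h0 h]
    have h2 : (1 - 1 / g) * γ ≤ (1 - 1 / g) * g := mul_le_mul_of_nonneg_left h (kappa_pos hg).le
    have h3 : (1 - 1 / g) * g = g - 1 := by
      have : g ≠ 0 := by linarith
      field_simp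
    linarith

section IsSel

variable {Z ι : Type*} [TopologicalSpace Z] {i : Z → ι → ℝ} {z : Z} {a b : Z → ℝ}

theorem isSel_stepFun (ha : IsSel i a z) (hb : IsSel i b z) (g : ℝ) (m : ℕ) :
    IsSel i (fun z => stepFun g m (a z) (b z)) z := by
  have h : ∀ m, IsSel i (fun z => stepPiece g m (a z) (b z)) z := fun m => by
    refine (hb.const_mul _).max ((hb.const_mul _).add ((IsSel.const 1 z).sub ?_))
    simpa only [div_eq_mul_inv] using (ha.const_mul (2 ^ (m + 1))).mul_const g⁻¹
  induction m with
  | zero => exact h 0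
  | succ m ih => exact ih.min (h (m + 1))

theorem isSel_stepInv (ha : IsSel i a z) (hb : IsSel i b z) (g : ℝ) (m : ℕ) :
    IsSel i (fun z => stepInv g m (a z) (b z)) z := by
  have h : ∀ m, IsSel i (fun z => stepInvPiece g m (a z) (b z)) z := fun m => by
    unfold stepInvPiece
    simp only [div_eq_mul_inv]
    refine (hb.mul_const _).min (IsSel.mul_const (hb.sub ((IsSel.const 1 z).sub ?_)) _)
    exact (ha.const_mul (2 ^ (m + 1))).mul_const _
  induction m with
  | zero => exact h 0
  | succ m ih => exact ih.max (h (m + 1))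

theorem isSel_stepRadius (ha : IsSel i a z) (g : ℝ) : IsSel i (fun z => stepRadius g (a z)) z := by
  unfold stepRadius
  simp only [div_eq_mul_inv]
  exact ha.min ((ha.sub (IsSel.const 1 z)).mul_const _)

theorem isSel_reparam {I : Type*} [Fintype I] {r : I → ℕ} {w : Z → I → ℝ} {F : Z → ℝ → ℝ}
    (hw : ∀ l, IsSel i (fun z => w z l) z)
    (hF : ∀ b : Z → ℝ, IsSel i b z → IsSel i (fun z => F z (b z)) z) (l : I) :
    IsSel i (fun z => reparam r (F z) (w z) l) z := by
  have h : IsSel i (fun z => rankSum r (w z) (r l)) z := by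
    refine IsSel.sum _ fun l' _ => ?_
    by_cases h : r l' < r l
    · simpa only [h, if_true] using hw l'
    · simpa only [h, if_false] using IsSel.const 0 z
  exact (hF _ (h.add (hw l))).sub (hF _ h)

end IsSel

end Step

/-! ### The push-off in star coordinates and its inverse. -/

section PushOff

variable {K : Type*} [Fintype K] [DecidableEq K]

variable (K) in
/-- A number between `1` and `starRadius K`. -/
noncomputable def midRadius : ℝ := (1 + starRadius K) / 2

theorem one_lt_midRadius : 1 < midRadius K := by
  have := one_lt_starRadius (K := K); unfold midRadius; linarith

theorem midRadius_lt : midRadius K < starRadius K := by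
  have := one_lt_starRadius (K := K); unfold midRadius; linarith

/-- Push off the vertex, in the coordinates around a vertex. -/
noncomputable def pushOut (w : Finset (Finset K) → ℝ) : Finset (Finset K) → ℝ :=
  reparam Finset.card
    (stepFun (midRadius K) (stepNum (midRadius K) (∑ C, w C)) (∑ C, w C)) w

/-- The inverse of `pushOut`. -/
noncomputable def pullIn (w : Finset (Finset K) → ℝ) : Finset (Finset K) → ℝ :=
  reparam Finset.card
    (stepInv (midRadius K) (stepNum (midRadius K) (stepRadius (midRadius K) (∑ C, w C)))
      (stepRadius (midRadius K) (∑ C, w C))) w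

theorem reparam_card_equivariant (F : ℝ → ℝ) (e : Equiv.Perm K) (w : Finset (Finset K) → ℝ) :
    reparam Finset.card F (w ∘ e.finsetCongr.finsetCongr.symm) =
      reparam Finset.card F w ∘ e.finsetCongr.finsetCongr.symm :=
  reparam_comp_symm e.finsetCongr.finsetCongr fun C => by simp

theorem sum_comp_finsetCongr (e : Equiv.Perm K) (w : Finset (Finset K) → ℝ) :
    ∑ C, (w ∘ e.finsetCongr.finsetCongr.symm) C = ∑ C, w C :=
  Equiv.sum_comp e.finsetCongr.finsetCongr.symm w

theorem isStarMap_pushOut : IsStarMap (pushOut (K := K)) := by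
  refine ⟨fun w hw C => reparam_nonneg hw ((strictMono_stepFun one_lt_midRadius).monotone.monotoneOn _) C,
    fun w C h => reparam_eq_zero h, fun e w => ?_⟩
  rw [pushOut, sum_comp_finsetCongr, reparam_card_equivariant, pushOut]

theorem isStarMap_pullIn : IsStarMap (pullIn (K := K)) := by
  refine ⟨fun w hw C => reparam_nonneg hw ((monotone_stepInv one_lt_midRadius).monotoneOn _) C,
    fun w C h => reparam_eq_zero h, fun e w => ?_⟩
  rw [pullIn, sum_comp_finsetCongr, reparam_card_equivariant, pullIn]

/-- Different coordinates in the support are of different rank. -/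
theorem starCoord_card_injective (j : K) (x : K → ℝ) (C C' : Finset (Finset K))
    (hC : starCoord j x C ≠ 0) (hC' : starCoord j x C' ≠ 0) (h : C.card = C'.card) : C = C' := by
  rcases (isChain_layers _).total hC hC' with h' | h'
  · exact Finset.eq_of_subset_of_card_le h' h.ge
  · exact (Finset.eq_of_subset_of_card_le h' h.le).symm

variable {x : K → ℝ} {j : K}

theorem sum_pushOut (hγ : 0 < gam j x) : ∑ C, pushOut (starCoord j x) C =
    stepFun (midRadius K) (stepNum (midRadius K) (gam j x)) (gam j x) (gam j x) :=
  sum_reparam (starCoord_card_injective j x)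
    (stepFun_zero one_lt_midRadius (le_two_pow_stepNum hγ))

theorem stepInv_zero {g γ : ℝ} (hg : 1 < g) (hγ : 0 < γ) : stepInv g (stepNum g γ) γ 0 = 0 := by
  conv_lhs => rw [← stepFun_zero hg (le_two_pow_stepNum (g := g) hγ), stepInv_stepFun hg]

theorem sum_pullIn (hγ : 1 < gam j x) :
    ∑ C, pullIn (starCoord j x) C = stepRadius (midRadius K) (gam j x) := by
  have h := stepRadius_pos (g := midRadius K) one_lt_midRadius hγ
  refine (sum_reparam (starCoord_card_injective j x) (stepInv_zero one_lt_midRadius h)).trans ?_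
  change stepInv _ _ _ (gam j x) = _
  conv_lhs => rw [← stepFun_stepRadius (m := stepNum (midRadius K) (stepRadius (midRadius K)
    (gam j x))) (g := midRadius K) one_lt_midRadius hγ]
  rw [stepFun_stepRadius one_lt_midRadius hγ]
  conv_lhs =>
    arg 4
    rw [← stepFun_stepRadius (m := stepNum (midRadius K) (stepRadius (midRadius K)
      (gam j x))) (g := midRadius K) one_lt_midRadius hγ]
  exact stepInv_stepFun one_lt_midRadius _

theorem pullIn_pushOut (hγ : 0 < gam j x) : pullIn (pushOut (starCoord j x)) = starCoord j x := by
  have h0 := stepFun_zero (g := midRadius K) one_lt_midRadius (le_two_pow_stepNum hγ)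
  rw [pullIn, sum_pushOut hγ, stepRadius_stepFun one_lt_midRadius hγ, pushOut]
  refine (reparam_reparam (starCoord_card_injective j x) h0 _).trans ?_
  simp only [gam, stepInv_stepFun (one_lt_midRadius (K := K))]
  exact reparam_id

theorem pushOut_pullIn (hγ : 1 < gam j x) : pushOut (pullIn (starCoord j x)) = starCoord j x := by
  have h := stepRadius_pos (g := midRadius K) one_lt_midRadius hγ
  have h0 := stepInv_zero (g := midRadius K) one_lt_midRadius h
  rw [pushOut, sum_pullIn hγ, pullIn]
  refine (reparam_reparam (starCoord_card_injective j x) h0 _).trans ?_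
  simp only [gam, stepFun_stepInv (one_lt_midRadius (K := K))]
  exact reparam_id

theorem pushOut_of_ge (hγ : midRadius K ≤ gam j x) : pushOut (starCoord j x) = starCoord j x := by
  refine (reparam_congr (starCoord_nonneg j x) fun s hs => ?_).trans reparam_id
  exact stepFun_of_ge one_lt_midRadius hγ hs.1 hs.2

theorem pullIn_of_ge (hγ : midRadius K ≤ gam j x) : pullIn (starCoord j x) = starCoord j x := by
  have h0 : 0 < gam j x := by linarith [one_lt_midRadius (K := K)]
  conv_lhs => rw [← pushOut_of_ge hγ]
  exact pullIn_pushOut h0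

theorem starMap_of_forall_ge {G : (Finset (Finset K) → ℝ) → Finset (Finset K) → ℝ}
    (hx : x ∈ stdSimplex ℝ K) (hG : ∀ j, G (starCoord j x) = starCoord j x) : starMap G x = x := by
  by_cases h : ∃ j, gam j x < starRadius K
  · obtain ⟨j, hj⟩ := h
    rw [starMap_of_lt hx hj (by rw [hG]; exact hj), hG, ofStar_starCoord hx]
  · exact starMap_of_not fun ⟨j, hj, _⟩ => h ⟨j, hj⟩

theorem starMap_pullIn_pushOut (hx : x ∈ stdSimplex ℝ K) (hγ : ∀ j, 0 < gam j x) :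
    starMap pullIn (starMap pushOut x) = x := by
  by_cases h : ∃ j, gam j x < starRadius K
  · obtain ⟨j, hj⟩ := h
    have h1 : ∑ C, pushOut (starCoord j x) C < starRadius K := by
      rw [sum_pushOut (hγ j)]
      exact stepFun_self_lt one_lt_midRadius midRadius_lt (hγ j).le hj
    rw [starMap_starMap isStarMap_pushOut hx hj h1 (by rwa [pullIn_pushOut (hγ j)]),
      pullIn_pushOut (hγ j), ofStar_starCoord hx]
  · push Not at h
    rw [starMap_of_forall_ge (G := pushOut) hx fun j => pushOut_of_ge (midRadius_lt.le.trans (h j)),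
      starMap_of_forall_ge hx fun j => pullIn_of_ge (midRadius_lt.le.trans (h j))]

theorem sum_pullIn_lt (hγ : 1 < gam j x) (hj : gam j x < starRadius K) :
    ∑ C, pullIn (starCoord j x) C < starRadius K := by
  rw [sum_pullIn hγ]
  exact (min_le_left _ _).trans_lt hj

theorem starMap_pushOut_pullIn (hx : x ∈ stdSimplex ℝ K) (hγ : ∀ j, 1 < gam j x) :
    starMap pushOut (starMap pullIn x) = x := by
  by_cases h : ∃ j, gam j x < starRadius K
  · obtain ⟨j, hj⟩ := h
    rw [starMap_starMap isStarMap_pullIn hx hj (sum_pullIn_lt (hγ j) hj)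
      (by rwa [pushOut_pullIn (hγ j)]), pushOut_pullIn (hγ j), ofStar_starCoord hx]
  · push Not at h
    rw [starMap_of_forall_ge (G := pullIn) hx fun j => pullIn_of_ge (midRadius_lt.le.trans (h j)),
      starMap_of_forall_ge hx fun j => pushOut_of_ge (midRadius_lt.le.trans (h j))]

end PushOff

/-! ### Piecewise linearity of the push-off. -/

section PushOff

variable {n : ℕ} {x : stdSimplex ℝ (Fin (n + 1))} {j : Fin (n + 1)}

theorem isSel_starMap_of_lt {G : (Finset (Finset (Fin (n + 1))) → ℝ) → Finset (Finset (Fin (n + 1))) → ℝ}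
    (h1 : gam j x.1 < starRadius (Fin (n + 1)))
    (h2 : ∑ C, G (starCoord j x.1) C < starRadius (Fin (n + 1)))
    (hG : ∀ C, IsSel Subtype.val
      (fun x' : stdSimplex ℝ (Fin (n + 1)) => G (starCoord j x'.1) C) x) (l : Fin (n + 1)) :
    IsSel Subtype.val (fun x' : stdSimplex ℝ (Fin (n + 1)) => starMap G x'.1 l) x := by
  refine (isSel_ofStar hG j l).congr ?_
  have h3 := (IsSel.sum (F := fun C (x' : stdSimplex ℝ (Fin (n + 1))) => G (starCoord j x'.1) C)
    Finset.univ fun C _ => hG C).continuousAt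
  filter_upwards [((continuous_gam j).comp continuous_subtype_val).continuousAt.eventually
    (Iio_mem_nhds h1), h3.eventually (Iio_mem_nhds h2)] with x' h4 h5
  rw [starMap_of_lt x'.2 h4 h5]

theorem isSel_starMap_of_forall_ge
    {G : (Finset (Finset (Fin (n + 1))) → ℝ) → Finset (Finset (Fin (n + 1))) → ℝ}
    (hG : ∀ j (x : Fin (n + 1) → ℝ), midRadius (Fin (n + 1)) ≤ gam j x →
      G (starCoord j x) = starCoord j x)
    (hx : ∀ j, starRadius (Fin (n + 1)) ≤ gam j x.1) (l : Fin (n + 1)) :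
    IsSel Subtype.val (fun x' : stdSimplex ℝ (Fin (n + 1)) => starMap G x'.1 l) x := by
  refine (IsSel.coord continuous_subtype_val l x).congr ?_
  have h : ∀ᶠ x' : stdSimplex ℝ (Fin (n + 1)) in 𝓝 x, ∀ j, midRadius (Fin (n + 1)) < gam j x'.1 :=
    eventually_all.2 fun j => ((continuous_gam j).comp continuous_subtype_val).continuousAt.eventually
      (Ioi_mem_nhds (midRadius_lt.trans_le (hx j)))
  filter_upwards [h] with x' hx'
  rw [starMap_of_forall_ge x'.2 fun j => hG j _ (hx' j).le]

/-- The number of pieces depends on the point, so the defining formula is not visibly PL. Near a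
fixed point it may be replaced by a constant number that is large enough. -/
theorem isSel_starMap_pushOut (hγ : ∀ j, 0 < gam j x.1) (l : Fin (n + 1)) :
    IsSel Subtype.val (fun x' : stdSimplex ℝ (Fin (n + 1)) => starMap pushOut x'.1 l) x := by
  by_cases h : ∃ j, gam j x.1 < starRadius (Fin (n + 1))
  · obtain ⟨j, hj⟩ := h
    refine isSel_starMap_of_lt hj ?_ (fun C => ?_) l
    · rw [sum_pushOut (hγ j)]
      exact stepFun_self_lt one_lt_midRadius midRadius_lt (hγ j).le hj
    -- Half the present radius is a lower bound for the radii of nearby points, so this many pieces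
    -- suffice for all of them.
    set m := stepNum (midRadius (Fin (n + 1))) (gam j x.1 / 2) with hm
    have h0 : 0 < gam j x.1 / 2 := half_pos (hγ j)
    have hsel : IsSel Subtype.val (fun x' : stdSimplex ℝ (Fin (n + 1)) =>
        reparam Finset.card (stepFun (midRadius (Fin (n + 1))) m (gam j x'.1)) (starCoord j x'.1) C) x :=
      isSel_reparam (fun C => isSel_starCoord (f := Subtype.val) (FacePairing.isSel_coord_stdSimplex x) j C)
        (fun b hb => isSel_stepFun (isSel_gam (f := Subtype.val) (FacePairing.isSel_coord_stdSimplex x) j) hb _ _) C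
    refine hsel.congr ?_
    filter_upwards [((continuous_gam j).comp continuous_subtype_val).continuousAt.eventually
      (Ioi_mem_nhds (half_lt_self (hγ j)))] with x' hx'
    have hx' : gam j x.1 / 2 < gam j x'.1 := hx'
    have h3 : midRadius (Fin (n + 1)) ≤ 2 ^ (m + 1) * gam j x'.1 :=
      (le_two_pow_stepNum h0).trans (mul_le_mul_of_nonneg_left hx'.le (by positivity))
    refine congrFun (reparam_congr (starCoord_nonneg j x'.1) fun s hs => ?_) C
    exact stepFun_eq_stepFun_stepNum one_lt_midRadius (h0.trans hx') hs.1 h3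
  · push Not at h
    exact isSel_starMap_of_forall_ge (fun j x hx => pushOut_of_ge hx) h l

theorem isSel_starMap_pullIn (hγ : ∀ j, 1 < gam j x.1) (l : Fin (n + 1)) :
    IsSel Subtype.val (fun x' : stdSimplex ℝ (Fin (n + 1)) => starMap pullIn x'.1 l) x := by
  by_cases h : ∃ j, gam j x.1 < starRadius (Fin (n + 1))
  · obtain ⟨j, hj⟩ := h
    refine isSel_starMap_of_lt hj (sum_pullIn_lt (hγ j) hj) (fun C => ?_) l
    set g := midRadius (Fin (n + 1)) with hg
    have hg1 : 1 < g := one_lt_midRadius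
    have hpos : 0 < stepRadius g (gam j x.1) := stepRadius_pos hg1 (hγ j)
    -- Again a number of pieces sufficient for all nearby points, now counted at half the radius
    -- before the push-off.
    set m := stepNum g (stepRadius g (gam j x.1) / 2) with hm
    have h0 : 0 < stepRadius g (gam j x.1) / 2 := half_pos hpos
    have hγs := isSel_gam (f := Subtype.val) (FacePairing.isSel_coord_stdSimplex x) j
    have hsel : IsSel Subtype.val (fun x' : stdSimplex ℝ (Fin (n + 1)) =>
        reparam Finset.card (stepInv g m (stepRadius g (gam j x'.1))) (starCoord j x'.1) C) x :=
      isSel_reparam (fun C => isSel_starCoord (f := Subtype.val) (FacePairing.isSel_coord_stdSimplex x) j C)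
        (fun b hb => isSel_stepInv (isSel_stepRadius hγs g) hb _ _) C
    refine hsel.congr ?_
    filter_upwards [(isSel_stepRadius hγs g).continuousAt.eventually
      (Ioi_mem_nhds (half_lt_self hpos))] with x' hx'
    have hx' : stepRadius g (gam j x.1) / 2 < stepRadius g (gam j x'.1) := hx'
    have h3 : g ≤ 2 ^ (m + 1) * stepRadius g (gam j x'.1) :=
      (le_two_pow_stepNum h0).trans (mul_le_mul_of_nonneg_left hx'.le (by positivity))
    refine congrFun (reparam_congr (starCoord_nonneg j x'.1) fun s hs => ?_) C
    exact stepInv_eq_stepInv_stepNum hg1 (h0.trans hx') hs.1 h3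
  · push Not at h
    exact isSel_starMap_of_forall_ge (fun j x hx => pullIn_of_ge hx) h l

end PushOff

namespace FacePairing

variable {k n : ℕ} {P : FacePairing k n}

/-- The punctured space is homeomorphic to the complement of the boundary of the truncated space. -/
theorem plHomeomorphic_puncturedSpace {B : Type*} [TopologicalSpace B] [PLStructure B]
    {i : B → P.Space} (hi : IsPLEmbedding i) (hr : range i = {z | 1 < P.tau z}) :
    PLHomeomorphic P.PuncturedSpace B := by
  have hpos : ∀ a : P.PuncturedSpace, ∀ i x, P.pt _ i x = a.1 → ∀ j, 0 < gam j x.1 := by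
    intro a i x hx j
    have := tau_pos_iff.2 a.2
    rw [← hx, tau_pt] at this
    exact this.trans_le (le_minGam_iff.1 le_rfl j)
  have hgt : ∀ b : B, ∀ i' x, P.pt _ i' x = i b → ∀ j, 1 < gam j x.1 := by
    intro b i' x hx j
    have : 1 < P.tau (i b) := hr.le (mem_range_self b)
    rw [← hx, tau_pt] at this
    exact this.trans_le (le_minGam_iff.1 le_rfl j)
  refine PLHomeomorphic.of_ambient (isPLEmbedding_val _) hi (P.glueMap isStarMap_pushOut)
    (P.glueMap isStarMap_pullIn) (fun a => ?_) (fun b => ?_) (fun a => ?_) (fun b => ?_) (fun a => ?_)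
    fun b => ?_
  · exact isPLMapAt_glueMap _ fun i x hx l => isSel_starMap_pushOut (hpos a i x hx) l
  · exact isPLMapAt_glueMap _ fun i x hx l => isSel_starMap_pullIn (hgt b i x hx) l
  · obtain ⟨i, x, hx⟩ := pt_surjective a.1
    refine hr.ge ?_
    have hγ := hpos a i x hx
    rw [← hx, glueMap_pt, mem_ofPred_eq, tau_pt]
    by_cases h : ∃ j, gam j x.1 < starRadius (Fin (n + 1))
    · obtain ⟨j, hj⟩ := h
      have h1 : ∑ C, pushOut (starCoord j x.1) C < starRadius (Fin (n + 1)) := by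
        rw [sum_pushOut (hγ j)]
        exact stepFun_self_lt one_lt_midRadius midRadius_lt (hγ j).le hj
      have h2 := isStarMap_pushOut.gam_starMap x.2 hj h1
      rw [minGam_eq (isStarMap_pushOut.starMap_mem x.2) (h2.trans_lt h1), h2, sum_pushOut (hγ j)]
      exact one_lt_stepFun_self one_lt_midRadius (hγ j)
    · push Not at h
      dsimp only
      rw [starMap_of_forall_ge x.2 fun j => pushOut_of_ge (midRadius_lt.le.trans (h j))]
      exact one_lt_starRadius.trans_le (le_minGam_iff.2 h)
  · obtain ⟨i', x, hx⟩ := pt_surjective (i b)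
    have hγ := hgt b i' x hx
    refine ⟨⟨P.glueMap isStarMap_pullIn (i b), ?_⟩, rfl⟩
    change _ ∉ P.vertices
    rw [← tau_pos_iff, ← hx, glueMap_pt, tau_pt]
    by_cases h : ∃ j, gam j x.1 < starRadius (Fin (n + 1))
    · obtain ⟨j, hj⟩ := h
      have h1 := sum_pullIn_lt (hγ j) hj
      have h2 := isStarMap_pullIn.gam_starMap x.2 hj h1
      rw [minGam_eq (isStarMap_pullIn.starMap_mem x.2) (h2.trans_lt h1), h2, sum_pullIn (hγ j)]
      exact stepRadius_pos one_lt_midRadius (hγ j)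
    · push Not at h
      dsimp only
      rw [starMap_of_forall_ge x.2 fun j => pullIn_of_ge (midRadius_lt.le.trans (h j))]
      exact starRadius_pos.trans_le (le_minGam_iff.2 h)
  · obtain ⟨i, x, hx⟩ := pt_surjective a.1
    rw [← hx, glueMap_pt, glueMap_pt]
    congr 1
    exact Subtype.ext (starMap_pullIn_pushOut x.2 (hpos a i x hx))
  · obtain ⟨i', x, hx⟩ := pt_surjective (i b)
    rw [← hx, glueMap_pt, glueMap_pt]
    congr 1
    exact Subtype.ext (starMap_pushOut_pullIn x.2 (hgt b i' x hx))

end FacePairing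

/-! ### Points away from the vertices are not boundary points -/

section Codimension

variable {n : ℕ}

/-- The affine subspace spanned by the image of a codimension-2 face and a further direction. -/
noncomputable def coneSubspace (A : (Fin (n + 1) → ℝ) →ᵃ[ℝ] Fin n → ℝ) (w : Fin n → ℝ)
    (a b c : Fin (n + 1)) : AffineSubspace ℝ (Fin n → ℝ) :=
  AffineSubspace.mk' (A (Pi.single c 1)) (Submodule.span ℝ
    (((Finset.univ.erase a).erase c).image fun l =>
      if l = b then w else A.linear (Pi.single l 1 - Pi.single c 1) : Finset (Fin n → ℝ)))

/-- Of the `n + 1` vertices, `a` is dropped and `c` is the base point, so the direction is spanned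
by `n - 1` vectors. The slot of `b` is free for the extra direction `w` because the points of
interest have vanishing coordinate `b`. -/
theorem coneSubspace_ne_top (A : (Fin (n + 1) → ℝ) →ᵃ[ℝ] Fin n → ℝ) (w : Fin n → ℝ)
    {a b c : Fin (n + 1)} (hab : a ≠ b) (hca : c ≠ a) (hcb : c ≠ b) : coneSubspace A w a b c ≠ ⊤ := by
  intro h
  have h1 := congrArg AffineSubspace.direction h
  rw [coneSubspace, AffineSubspace.direction_mk', AffineSubspace.direction_top] at h1
  have h2 := finrank_span_finset_le_card (R := ℝ) (((Finset.univ.erase a).erase c).image fun l =>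
      if l = b then w else A.linear (Pi.single l 1 - Pi.single c 1))
  rw [Set.finrank, h1, finrank_top, Module.finrank_fin_fun] at h2
  have h3 := h2.trans Finset.card_image_le
  have h4 : b ∈ (Finset.univ.erase a).erase c := by simp [hab.symm, hcb.symm]
  have h5 : c ∈ Finset.univ.erase a := by simp [hca]
  rw [Finset.card_erase_of_mem h5, Finset.card_erase_of_mem (Finset.mem_univ a)] at h3
  simp only [Finset.card_univ, Fintype.card_fin] at h3
  have h6 : a.1 < n + 1 := a.2
  have h7 : b.1 < n + 1 := b.2
  have h8 : a.1 ≠ b.1 := fun h => hab (Fin.ext h)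
  lia

theorem mem_coneSubspace {A : (Fin (n + 1) → ℝ) →ᵃ[ℝ] Fin n → ℝ} {w : Fin n → ℝ}
    {a b c : Fin (n + 1)} (hab : a ≠ b) (hcb : c ≠ b) {x : Fin (n + 1) → ℝ}
    (hx : x ∈ stdSimplex ℝ (Fin (n + 1))) (ha : x a = 0) (hb : x b = 0) (t : ℝ) :
    A x + t • w ∈ coneSubspace A w a b c := by
  rw [coneSubspace, AffineSubspace.mem_mk', vsub_eq_sub]
  set V := Submodule.span ℝ
    ((((Finset.univ.erase a).erase c).image fun l =>
      if l = b then w else A.linear (Pi.single l 1 - Pi.single c 1) : Finset (Fin n → ℝ)) :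
        Set (Fin n → ℝ))
  have hmem : ∀ l ∈ (Finset.univ.erase a).erase c,
      (if l = b then w else A.linear (Pi.single l 1 - Pi.single c 1)) ∈ V := fun l hl =>
    Submodule.subset_span (Finset.mem_coe.2 (Finset.mem_image_of_mem _ hl))
  have hw : w ∈ V := by
    have := hmem b (by simp [hab.symm, hcb.symm])
    simpa using this
  have h1 : x - Pi.single c 1 = ∑ l, x l • (Pi.single l 1 - Pi.single c (1 : ℝ)) := by
    simp only [smul_sub, Finset.sum_sub_distrib, ← Finset.sum_smul, hx.2, one_smul]
    congr 1
    ext m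
    simp [Finset.sum_apply, Pi.single_apply]
  have h2 : A x + t • w - A (Pi.single c 1) = A.linear (x - Pi.single c 1) + t • w := by
    have := A.linearMap_vsub x (Pi.single c 1)
    rw [vsub_eq_sub, vsub_eq_sub] at this
    rw [this]
    abel
  rw [h2, h1, map_sum]
  refine V.add_mem (V.sum_mem fun l _ => ?_) (V.smul_mem t hw)
  rw [map_smul]
  by_cases hla : l = a
  · simp [hla, ha]
  by_cases hlb : l = b
  · simp [hlb, hb]
  by_cases hlc : l = c
  · simp [hlc]
  · have := hmem l (by simp [hla, hlc])
    rw [if_neg hlb] at this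
    exact V.smul_mem _ this

end Codimension

namespace FacePairing

variable {k n : ℕ} {P : FacePairing k n}

/-- In the chart, the points with two vanishing coordinates lie in countably many affine images of
codimension-2 faces. Enlarged by the normal direction of the hyperplane these still span proper
subspaces, so the projection of a generic point to the hyperplane avoids them. -/
theorem exists_boundary_point_few_zeros [NeZero n]
    {e : OpenPartialHomeomorph P.TruncatedSpace (PLHalfSpace n)} (he : IsPLLocalHomeo e)
    {p₀ : PLHalfSpace n} (hp : p₀.1 0 = 0) {V : Set (PLHalfSpace n)} (hV : V ∈ 𝓝 p₀)
    (hVe : V ⊆ e.target) :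
    ∃ p ∈ interior V, p.1 0 = 0 ∧ ∀ i x, P.pt _ i x = P.trunc (e.symm p) →
      ∀ a b, a ≠ b → x.1 a = 0 → x.1 b ≠ 0 := by
  classical
  -- local affine descriptions of the chart
  have hloc : ∀ i : Fin k, ∀ x : truncatedSimplex n, P.pt _ i x ∈ e.source →
      ∃ 𝒜 : Set ((Fin (n + 1) → ℝ) →ᵃ[ℝ] Fin n → ℝ), 𝒜.Finite ∧
        ∀ᶠ x' in 𝓝 x, ∃ A ∈ 𝒜, (e (P.pt _ i x')).1 = A x'.1 := by
    intro i x hx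
    have hsel : ∀ l, IsSel Subtype.val (fun x' => (e (P.pt (truncatedSimplex n) i x')).1 l) x :=
      fun l => by
        have h1 : IsPLMapAt (fun x' => e (P.pt (truncatedSimplex n) i x')) x :=
          (he.1 _ hx).comp (isPLMapAt_pt i x)
        have h2 : PLAt (fun u : PLHalfSpace n => u.1 l) (e (P.pt _ i x)) :=
          ⟨fun u => u l, plAt_of_isSel (IsSel.coord continuous_id l _), .rfl⟩
        exact isSel_val_of_plAt (h1.2 _ h2)
    choose S hS hSx using hsel
    refine ⟨(fun a : Fin n → (Fin (n + 1) → ℝ) →ᵃ[ℝ] ℝ => AffineMap.pi a) '' Set.pi univ S,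
      (Set.Finite.pi fun l => hS l).image _, ?_⟩
    filter_upwards [eventually_all.2 hSx] with x' hx'
    choose hc a ha hea using hx'
    refine ⟨_, ⟨a, fun l _ => ha l, rfl⟩, ?_⟩
    ext l
    exact hea l
  choose! 𝒜 h𝒜 h𝒜x using hloc
  -- Second countability reduces the local affine descriptions to countably many.
  have hcov : ∀ i : Fin k, ∃ t ⊆ {x : truncatedSimplex n | P.pt _ i x ∈ e.source}, t.Countable ∧
      {x : truncatedSimplex n | P.pt _ i x ∈ e.source} ⊆
        ⋃ x ∈ t, {x' | ∃ A ∈ 𝒜 i x, (e (P.pt _ i x')).1 = A x'.1} := fun i =>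
    TopologicalSpace.countable_cover_nhdsWithin fun x hx =>
      mem_nhdsWithin_of_mem_nhds (h𝒜x i x hx)
  choose t ht htc hts using hcov
  -- The normal direction: a point and its projection to the hyperplane differ by a multiple of it,
  -- so general position of the point in `ℝ^n` controls the projection.
  set w : Fin n → ℝ := Pi.single 0 1 with hw
  set Q : Set (AffineSubspace ℝ (Fin n → ℝ)) := ⋃ i, ⋃ x ∈ t i, ⋃ A ∈ 𝒜 i x,
    ⋃ a, ⋃ b, ⋃ c, {q | (a ≠ b ∧ c ≠ a ∧ c ≠ b) ∧ q = coneSubspace A w a b c} with hQ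
  have hQc : Q.Countable := by
    refine countable_iUnion fun i => (htc i).biUnion fun x hx =>
      (h𝒜 i x (ht i hx)).countable.biUnion fun A _ => countable_iUnion fun a =>
        countable_iUnion fun b => countable_iUnion fun c => ?_
    exact (countable_singleton (coneSubspace A w a b c)).mono fun q hq => hq.2
  have hQtop : ∀ q ∈ Q, q ≠ ⊤ := by
    intro q hq
    simp only [hQ, mem_iUnion] at hq
    obtain ⟨i, x, hx, A, hA, a, b, c, ⟨h1, h2, h3⟩, rfl⟩ := hq
    exact coneSubspace_ne_top A w h1 h2 h3
  let π : (Fin n → ℝ) → PLHalfSpace n := fun q => ⟨Function.update q 0 0, by simp⟩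
  have hπ : Continuous π := (continuous_id.update 0 continuous_const).subtype_mk _
  have hπp : π p₀.1 = p₀ := by
    refine Subtype.ext ?_
    change Function.update p₀.1 0 0 = p₀.1
    exact (congrArg (Function.update p₀.1 0) hp.symm).trans (Function.update_eq_self _ _)
  obtain ⟨q, hqU, hq⟩ := exists_mem_forall_notMem_affineSubspace
    (isOpen_interior.preimage hπ : IsOpen (π ⁻¹' interior V))
    ⟨p₀.1, by rw [mem_preimage, hπp]; exact mem_interior_iff_mem_nhds.2 hV⟩ hQc hQtop
  refine ⟨π q, hqU, by simp [π], fun i x hx a b hab ha hb => ?_⟩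
  have hpt : π q ∈ e.target := hVe (interior_subset hqU)
  have hxT : x.1 ∈ truncatedSimplex n := mem_truncatedSimplex_iff_minGam.2 ⟨x.2, by
    rw [← tau_pt (P := P) i, hx]; exact one_le_tau_trunc _⟩
  have hx' : P.pt _ i ⟨x.1, hxT⟩ = e.symm (π q) := isEmbedding_trunc.injective hx
  have hsrc : P.pt _ i ⟨x.1, hxT⟩ ∈ e.source := hx' ▸ e.map_target hpt
  obtain ⟨x₀, hx₀, A, hA, hAx⟩ : ∃ x₀ ∈ t i, ∃ A ∈ 𝒜 i x₀, (e (P.pt _ i ⟨x.1, hxT⟩)).1 = A x.1 := by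
    have h := hts i hsrc
    simp only [mem_iUnion, exists_prop] at h
    exact h
  rw [hx', e.right_inv hpt] at hAx
  obtain ⟨c, hc⟩ : ∃ c, x.1 c ≠ 0 := by
    by_contra! h
    have := x.2.2
    simp [h] at this
  have hca : c ≠ a := fun h => hc (h ▸ ha)
  have hcb : c ≠ b := fun h => hc (h ▸ hb)
  refine hq (coneSubspace A w a b c) ?_ ?_
  · simp only [hQ, mem_iUnion]
    exact ⟨i, x₀, hx₀, A, hA, a, b, c, ⟨hab, hca, hcb⟩, rfl⟩
  · have hqeq : q = A x.1 + q 0 • w := by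
      rw [← hAx]
      ext l
      by_cases hl : l = 0
      · simp [π, hl, hw]
      · simp [π, hl, hw]
    rw [hqeq]
    exact mem_coneSubspace hab hcb x.2 ha hb _

/-- Where `tau > 1` the inclusion of `X^∂` is open, so the inverse chart followed by `κ` is a PL
open map from the half-space, which `not_isOpenMap_halfSpace` excludes at boundary points. -/
theorem notMem_boundary_of_open_map [NeZero n]
    {e : OpenPartialHomeomorph P.TruncatedSpace (PLHalfSpace n)} (he : IsPLLocalHomeo e)
    {p : PLHalfSpace n} (hpe : p ∈ e.target) (hτ : 1 < P.tau (P.trunc (e.symm p)))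
    {κ : P.Space → Fin n → ℝ} (hκ : ∀ l, PLAt (fun z => κ z l) (P.trunc (e.symm p)))
    (hopen : ∀ᶠ z in 𝓝 (P.trunc (e.symm p)), 𝓝 (κ z) ≤ map κ (𝓝 z)) : p.1 0 ≠ 0 := by
  intro hp
  refine not_isOpenMap_halfSpace (f := fun p => κ (P.trunc (e.symm p))) hp (fun l => ?_) ?_
  · have h1 : IsPLMapAt (fun p => P.trunc (e.symm p)) p :=
      (isPLEmbedding_trunc.isPLMapAt _).comp (he.2 p hpe)
    exact isSel_val_of_plAt (h1.2 _ (hκ l))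
  · have hcont : ContinuousAt (fun p => P.trunc (e.symm p)) p :=
      isEmbedding_trunc.continuous.continuousAt.comp (e.continuousAt_symm hpe)
    filter_upwards [hcont.eventually hopen, e.open_target.mem_nhds hpe,
      (continuous_tau.continuousAt.comp hcont).eventually (Ioi_mem_nhds hτ)] with p' h1 h2 h3
    have h4 : map P.trunc (𝓝 (e.symm p')) = 𝓝 (P.trunc (e.symm p')) := by
      refine isEmbedding_trunc.isEmbedding.map_nhds_of_mem _ ?_
      rw [range_trunc]
      exact mem_of_superset ((isOpen_Ioi.preimage continuous_tau).mem_nhds h3)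
        fun z (hz : 1 < P.tau z) => hz.le
    have h5 : map e.symm (𝓝 p') = 𝓝 (e.symm p') := e.symm.map_nhds_eq h2
    have h6 : map (fun p => κ (P.trunc (e.symm p))) (𝓝 p') = map κ (𝓝 (P.trunc (e.symm p'))) := by
      rw [← h4, ← h5, map_map, map_map]
      rfl
    rw [h6]
    exact h1

end FacePairing

/-! ### Coordinates near points of open simplices and open facets -/

namespace FacePairing

variable {k n : ℕ} {P : FacePairing k n}

theorem eq_of_eqvGen_of_ne_zero {A : Set (Fin (n + 1) → ℝ)} {p q : (_ : Fin k) × A}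
    (h : Relation.EqvGen (P.Glued A) p q) (h0 : (∀ v, p.2.1 v ≠ 0) ∨ ∀ v, q.2.1 v ≠ 0) : p = q := by
  induction h with
  | rel p q h =>
    obtain ⟨v, hv, -⟩ := id h
    obtain ⟨w, hw, -⟩ := h.symm
    exact (h0.elim (fun h => h v hv) fun h => h w hw).elim
  | refl p => rfl
  | symm p q _ ih => exact (ih h0.symm).symm
  | trans p q r _ _ ih1 ih2 =>
    rcases h0 with h | h
    · obtain rfl := ih1 (Or.inl h)
      exact ih2 (Or.inl h)
    · obtain rfl := ih2 (Or.inr h)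
      exact ih1 (Or.inr h)

/-- A point with exactly one vanishing coordinate lies on a single facet, so a glueing determines
its only partner; two successive glueings lead back. -/
theorem eq_or_glued_of_eqvGen {A : Set (Fin (n + 1) → ℝ)} {p q : (_ : Fin k) × A}
    (h : Relation.EqvGen (P.Glued A) p q)
    (h0 : (∃ v, p.2.1 v = 0 ∧ ∀ a, a ≠ v → p.2.1 a ≠ 0) ∨ ∃ v, q.2.1 v = 0 ∧ ∀ a, a ≠ v → q.2.1 a ≠ 0) :
    ((∃ v, p.2.1 v = 0 ∧ ∀ a, a ≠ v → p.2.1 a ≠ 0) ∧ ∃ v, q.2.1 v = 0 ∧ ∀ a, a ≠ v → q.2.1 a ≠ 0) ∧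
      (p = q ∨ P.Glued A p q) := by
  have htransfer : ∀ p q : (_ : Fin k) × A, P.Glued A p q →
      (∃ v, p.2.1 v = 0 ∧ ∀ a, a ≠ v → p.2.1 a ≠ 0) → ∃ v, q.2.1 v = 0 ∧ ∀ a, a ≠ v → q.2.1 a ≠ 0 := by
    rintro p q ⟨v, -, -, h⟩ ⟨w, hw, hw'⟩
    refine ⟨P.vertexMap (p.1, v) w, by rw [h, hw], fun a ha => ?_⟩
    have h1 := h ((P.vertexMap (p.1, v)).symm a)
    rw [Equiv.apply_symm_apply] at h1
    rw [h1]
    exact hw' _ fun h2 => ha (by rw [← h2, Equiv.apply_symm_apply])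
  have hunique : ∀ p q r : (_ : Fin k) × A, (∃ v, q.2.1 v = 0 ∧ ∀ a, a ≠ v → q.2.1 a ≠ 0) →
      P.Glued A q p → P.Glued A q r → p = r := by
    rintro ⟨i, x⟩ q ⟨i', x'⟩ ⟨w, hw, hw'⟩ ⟨v, hv, h1, h2⟩ ⟨v', hv', h1', h2'⟩
    obtain rfl : v = w := by_contra fun h => hw' v h hv
    obtain rfl : v' = v := by_contra fun h => hw' v' h hv'
    dsimp only at h1 h1' h2 h2'
    subst h1 h1'
    congr 1
    refine Subtype.ext (funext fun a => ?_)
    rw [← Equiv.apply_symm_apply (P.vertexMap (q.1, v')) a, h2, h2']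
  induction h with
  | rel p q h =>
    have hp : ∃ v, p.2.1 v = 0 ∧ ∀ a, a ≠ v → p.2.1 a ≠ 0 := h0.elim id (htransfer q p h.symm)
    exact ⟨⟨hp, htransfer p q h hp⟩, Or.inr h⟩
  | refl p => exact ⟨⟨h0.elim id id, h0.elim id id⟩, Or.inl rfl⟩
  | symm p q _ ih =>
    obtain ⟨h1, h2⟩ := ih h0.symm
    exact ⟨h1.symm, h2.imp Eq.symm Glued.symm⟩
  | trans p q r _ _ ih1 ih2 =>
    have key : (∃ v, p.2.1 v = 0 ∧ ∀ a, a ≠ v → p.2.1 a ≠ 0) ∧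
        (∃ v, q.2.1 v = 0 ∧ ∀ a, a ≠ v → q.2.1 a ≠ 0) ∧
        ∃ v, r.2.1 v = 0 ∧ ∀ a, a ≠ v → r.2.1 a ≠ 0 := by
      rcases h0 with h | h
      · have h1 := (ih1 (Or.inl h)).1
        exact ⟨h1.1, h1.2, (ih2 (Or.inl h1.2)).1.2⟩
      · have h1 := (ih2 (Or.inr h)).1
        exact ⟨(ih1 (Or.inr h1.1)).1.1, h1.1, h1.2⟩
    refine ⟨⟨key.1, key.2.2⟩, ?_⟩
    rcases (ih1 (Or.inl key.1)).2 with rfl | h1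
    · exact (ih2 (Or.inl key.1)).2
    · rcases (ih2 (Or.inl key.2.1)).2 with rfl | h2
      · exact Or.inr h1
      · exact Or.inl (hunique p q r key.2.1 h1.symm h2)

theorem eventually_pt_mem {A : Set (Fin (n + 1) → ℝ)} {C : Type*} [TopologicalSpace C] {s : C → Fin (n + 1) → ℝ}
    {c₀ : C} (hs : ContinuousAt s c₀) (h0 : s c₀ ∈ A) {i : Fin k} {N : Set (Quot (P.Glued A))}
    (hN : N ∈ 𝓝 (P.pt A i ⟨s c₀, h0⟩)) : ∀ᶠ c in 𝓝 c₀, ∀ h : s c ∈ A, P.pt A i ⟨s c, h⟩ ∈ N := by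
  have h1 : P.pt A i ⁻¹' N ∈ 𝓝 (⟨s c₀, h0⟩ : A) := (continuous_pt i).continuousAt hN
  rw [nhds_subtype_eq_comap, mem_comap] at h1
  obtain ⟨M, hM, hMN⟩ := h1
  filter_upwards [hs hM] with c hc h
  exact hMN hc

open Classical in
variable (P) in
/-- Coordinates of the interior of the `i`-th simplex. -/
noncomputable def interiorCoord (i : Fin k) : P.Space → Fin n → ℝ :=
  Quot.lift (fun p => if p.1 = i ∧ ∀ a, 0 < p.2.1 a then fun l => p.2.1 l.succ else 0) <| by
    intro p q h
    obtain ⟨v, hv, -⟩ := id h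
    obtain ⟨w, hw, -⟩ := h.symm
    rw [if_neg fun h => (h.2 v).ne' hv, if_neg fun h => (h.2 w).ne' hw]

theorem interiorCoord_pt {i : Fin k} {x : stdSimplex ℝ (Fin (n + 1))} (hx : ∀ a, 0 < x.1 a) :
    P.interiorCoord i (P.pt _ i x) = fun l => x.1 l.succ := if_pos ⟨rfl, hx⟩

theorem interiorCoord_chart {i : Fin k} {x : stdSimplex ℝ (Fin (n + 1))} (hx : ∀ a, 0 < x.1 a) :
    (∀ l, PLAt (fun z => P.interiorCoord i z l) (P.pt _ i x)) ∧
      ∀ᶠ z in 𝓝 (P.pt _ i x), 𝓝 (P.interiorCoord i z) ≤ map (P.interiorCoord i) (𝓝 z) := by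
  have hfib : ∀ i' x', P.pt _ i' x' = P.pt _ i x → i' = i ∧ x' = x := by
    intro i' x' h
    have := eq_of_eqvGen_of_ne_zero (Quot.eqvGen_exact h) (Or.inr fun v => (hx v).ne')
    exact ⟨congrArg Sigma.fst this, by injection this⟩
  have hpos : ∀ᶠ x' : stdSimplex ℝ (Fin (n + 1)) in 𝓝 x, ∀ a, 0 < x'.1 a :=
    eventually_all.2 fun a => ((continuous_apply a).comp continuous_subtype_val).continuousAt.eventually
      (Ioi_mem_nhds (hx a))
  constructor
  · refine fun l => plAt_space_iff.2 fun i' x' h => ?_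
    obtain ⟨rfl, rfl⟩ := hfib i' x' h
    refine (isSel_coord_stdSimplex x' l.succ).congr ?_
    filter_upwards [hpos] with u hu
    rw [interiorCoord_pt hu]
  · refine (eventually_nhds_iff_pt (permInvariant_stdSimplex _)).2 fun i' x' h => ?_
    obtain ⟨rfl, rfl⟩ := hfib i' x' h
    filter_upwards [hpos] with u hu
    refine le_map_iff.2 fun N hN => ?_
    rw [interiorCoord_pt hu]
    let s : (Fin n → ℝ) → Fin (n + 1) → ℝ := fun c => Fin.cons (1 - ∑ l, c l) c
    have hs : Continuous s := by
      refine continuous_pi fun a => ?_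
      refine Fin.cases ?_ (fun l => ?_) a
      · simp only [s, Fin.cons_zero]; fun_prop
      · simp only [s, Fin.cons_succ]; fun_prop
    have hsu : s (fun l => u.1 l.succ) = u.1 := by
      have := u.2.2
      rw [Fin.sum_univ_succ] at this
      ext a
      refine Fin.cases ?_ (fun l => ?_) a
      · simp only [s, Fin.cons_zero]; linarith
      · simp only [s, Fin.cons_succ]
    have hsp : ∀ᶠ c in 𝓝 (fun l => u.1 (Fin.succ l)), ∀ a, 0 < s c a :=
      eventually_all.2 fun a => ((continuous_apply a).comp hs).continuousAt.eventually
        (Ioi_mem_nhds (by rw [Function.comp_apply, hsu]; exact hu a))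
    have h0 : s (fun l => u.1 l.succ) ∈ stdSimplex ℝ (Fin (n + 1)) := hsu ▸ u.2
    have hN' : N ∈ 𝓝 (P.pt _ i' ⟨s (fun l => u.1 l.succ), h0⟩) := by
      convert! hN using 3
      exact Subtype.ext hsu
    filter_upwards [hsp, eventually_pt_mem hs.continuousAt h0 hN'] with c h1 h2
    have hc : s c ∈ stdSimplex ℝ (Fin (n + 1)) := ⟨fun a => (h1 a).le, by
      simp [s, Fin.sum_univ_succ]⟩
    refine ⟨_, h2 hc, ?_⟩
    rw [interiorCoord_pt (x := ⟨s c, hc⟩) h1]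
    ext l
    simp [s]

/-- The `v`-th coordinate is the strict minimum. -/
def StrictMin (v : Fin (n + 1)) (x : Fin (n + 1) → ℝ) : Prop := ∀ a, a ≠ v → x v < x a

/-- A glued point has a vanishing coordinate, and since no coordinate is negative it must be the
strictly least one. So the only glueing in question is that of the facet opposite `v`. -/
theorem strictMin_partner (i : Fin k) (v : Fin (n + 1)) {p q : (_ : Fin k) × stdSimplex ℝ (Fin (n + 1))}
    (h : P.Glued _ p q) (h1 : p.1 = i ∧ StrictMin v p.2.1) :
    p.2.1 v = 0 ∧ q.2.1 = p.2.1 ∘ (P.vertexMap (i, v)).symm ∧ q.1 = (P.partner (i, v)).1 ∧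
      StrictMin (P.partner (i, v)).2 q.2.1 := by
  obtain ⟨w, hw, hq1, hq2⟩ := h
  obtain ⟨rfl, hv⟩ := h1
  obtain rfl : w = v := by
    by_contra hne
    have := hv w hne
    rw [hw] at this
    exact absurd (p.2.2.1 v) (not_le.2 this)
  refine ⟨hw, ?_, hq1, fun a ha => ?_⟩
  · ext a
    rw [Function.comp_apply, ← hq2, Equiv.apply_symm_apply]
  · rw [← P.vertexMap_opposite, hq2, ← Equiv.apply_symm_apply (P.vertexMap (p.1, w)) a, hq2]
    exact hv _ fun h => ha (((Equiv.symm_apply_eq _).1 h).trans (P.vertexMap_opposite (p.1, w)))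

/-- No facet is glued to itself, so the two sides of a facet are told apart even when they belong to
the same simplex. -/
theorem not_strictMin_both (i : Fin k) (v : Fin (n + 1)) {p : (_ : Fin k) × stdSimplex ℝ (Fin (n + 1))}
    (h1 : p.1 = i ∧ StrictMin v p.2.1)
    (h2 : p.1 = (P.partner (i, v)).1 ∧ StrictMin (P.partner (i, v)).2 p.2.1) : False := by
  have hv : v = (P.partner (i, v)).2 := by
    by_contra hne
    exact lt_asymm (h1.2 _ (Ne.symm hne)) (h2.2 _ hne)
  exact P.partner_ne (i, v) (Prod.ext (h2.1.symm.trans h1.1) hv.symm)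

open Classical in
variable (P) in
/-- Coordinates near the interior of the facet of the `i`-th simplex opposite to `v`. -/
noncomputable def facetCoord (i : Fin k) (v : Fin (n + 1)) : P.Space → Fin n → ℝ :=
  Quot.lift (fun p =>
    if p.1 = i ∧ StrictMin v p.2.1 then fun l => p.2.1 (v.succAbove l)
    else if p.1 = (P.partner (i, v)).1 ∧ StrictMin (P.partner (i, v)).2 p.2.1 then
      -- The correction unfolds the second simplex across the facet: the coordinates add up to `1 -
      -- x v` on the first side and, with the `n` summands `2 / n * x v'`, to `1 + x v'` on the
      -- second.
      fun l => p.2.1 (P.vertexMap (i, v) (v.succAbove l)) + 2 / n * p.2.1 (P.partner (i, v)).2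
    else 0) <| by
    have key : ∀ p q, P.Glued (stdSimplex ℝ (Fin (n + 1))) p q → p.1 = i ∧ StrictMin v p.2.1 →
        (fun l : Fin n => p.2.1 (v.succAbove l)) = fun l => q.2.1 (P.vertexMap (i, v) (v.succAbove l)) +
          2 / n * q.2.1 (P.partner (i, v)).2 := by
      intro p q h h1
      obtain ⟨h2, h3, -⟩ := strictMin_partner i v h h1
      ext l
      rw [h3, Function.comp_apply, Function.comp_apply, Equiv.symm_apply_apply,
        ← P.vertexMap_opposite, Equiv.symm_apply_apply, h2]
      ring
    have key2 : ∀ p q, P.Glued (stdSimplex ℝ (Fin (n + 1))) p q →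
        p.1 = (P.partner (i, v)).1 ∧ StrictMin (P.partner (i, v)).2 p.2.1 →
        q.1 = i ∧ StrictMin v q.2.1 := by
      intro p q h h1
      have h2 := (strictMin_partner _ _ h h1).2.2
      rwa [Prod.mk.eta, P.partner_partner] at h2
    intro p q h
    by_cases hp : p.1 = i ∧ StrictMin v p.2.1
    · have hq := (strictMin_partner i v h hp).2.2
      rw [if_pos hp, if_neg fun h' => not_strictMin_both i v h' hq, if_pos hq]
      exact key p q h hp
    · by_cases hq : q.1 = i ∧ StrictMin v q.2.1
      · have hp' := (strictMin_partner i v h.symm hq).2.2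
        rw [if_neg hp, if_pos hp', if_pos hq]
        exact (key q p h.symm hq).symm
      · rw [if_neg hp, if_neg hq, if_neg fun h' => hq (key2 p q h h'),
          if_neg fun h' => hp (key2 q p h.symm h')]

theorem facetCoord_pt {i : Fin k} {v : Fin (n + 1)} {x : stdSimplex ℝ (Fin (n + 1))}
    (hx : StrictMin v x.1) : P.facetCoord i v (P.pt _ i x) = fun l => x.1 (v.succAbove l) :=
  if_pos ⟨rfl, hx⟩

theorem facetCoord_pt_partner {i : Fin k} {v : Fin (n + 1)} {x : stdSimplex ℝ (Fin (n + 1))}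
    (hx : StrictMin (P.partner (i, v)).2 x.1) :
    P.facetCoord i v (P.pt _ (P.partner (i, v)).1 x) =
      fun l => x.1 (P.vertexMap (i, v) (v.succAbove l)) + 2 / n * x.1 (P.partner (i, v)).2 := by
  refine (if_neg fun h => ?_).trans (if_pos ⟨rfl, hx⟩)
  exact not_strictMin_both i v (p := ⟨(P.partner (i, v)).1, x⟩) h ⟨rfl, hx⟩

/-- The sum of the coordinates tells the two sides apart, and on each side there is a continuous
section (`s₁` where the sum is at most one, `s₂` where it is at least one). The sections show that
the map is open. -/
theorem facetCoord_chart [NeZero n] {i : Fin k} {v : Fin (n + 1)} {x : stdSimplex ℝ (Fin (n + 1))}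
    (hv : x.1 v = 0) (hx : ∀ a, a ≠ v → x.1 a ≠ 0) :
    (∀ l, PLAt (fun z => P.facetCoord i v z l) (P.pt _ i x)) ∧
      ∀ᶠ z in 𝓝 (P.pt _ i x), 𝓝 (P.facetCoord i v z) ≤ map (P.facetCoord i v) (𝓝 z) := by
  set i' := (P.partner (i, v)).1 with hi'
  set v' := (P.partner (i, v)).2 with hv'
  set σ := P.vertexMap (i, v) with hσ
  have hσv : σ v = v' := P.vertexMap_opposite (i, v)
  have hn : (0 : ℝ) < n := by exact_mod_cast Nat.pos_of_ne_zero (NeZero.ne n)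
  have hxmin : StrictMin v x.1 := fun a ha => by
    rw [hv]; exact lt_of_le_of_ne (x.2.1 a) (Ne.symm (hx a ha))
  -- the fibre
  have hfib : ∀ i₁ x₁, P.pt _ i₁ x₁ = P.pt _ i x → (i₁ = i ∧ x₁ = x) ∨
      i₁ = i' ∧ StrictMin v' x₁.1 ∧ x₁.1 = x.1 ∘ σ.symm := by
    intro i₁ x₁ h
    rcases (eq_or_glued_of_eqvGen (Quot.eqvGen_exact h.symm) (Or.inl ⟨v, hv, hx⟩)).2 with h | h
    · exact Or.inl ⟨(congrArg Sigma.fst h).symm, by injection h.symm⟩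
    · obtain ⟨-, h1, h2, h3⟩ := strictMin_partner i v h ⟨rfl, hxmin⟩
      exact Or.inr ⟨h2, h3, h1⟩
  have hmin : ∀ (w : Fin (n + 1)) (u : stdSimplex ℝ (Fin (n + 1))), StrictMin w u.1 →
      ∀ᶠ u' in 𝓝 u, StrictMin w u'.1 := fun w u hu =>
    eventually_all.2 fun a => by
      by_cases ha : a = w
      · exact Eventually.of_forall fun _ h => absurd ha h
      · have h1 : ∀ b, Continuous fun u : stdSimplex ℝ (Fin (n + 1)) => u.1 b := fun b =>
          (continuous_apply b).comp continuous_subtype_val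
        filter_upwards [(h1 w).continuousAt.eventually_lt (h1 a).continuousAt (hu a ha)] with u' h' _
        exact h'
  have hPL : ∀ l, PLAt (fun z => P.facetCoord i v z l) (P.pt _ i x) := by
    refine fun l => plAt_space_iff.2 fun i₁ x₁ h => ?_
    rcases hfib i₁ x₁ h with ⟨rfl, rfl⟩ | ⟨rfl, h1, -⟩
    · refine (isSel_coord_stdSimplex x₁ (v.succAbove l)).congr ?_
      filter_upwards [hmin v x₁ hxmin] with u hu
      rw [facetCoord_pt hu]
    · refine ((isSel_coord_stdSimplex x₁ (σ (v.succAbove l))).add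
        ((isSel_coord_stdSimplex x₁ v').const_mul (2 / n))).congr ?_
      filter_upwards [hmin _ x₁ h1] with u hu
      rw [facetCoord_pt_partner hu]
  refine ⟨hPL, ?_⟩
  have hc : ContinuousAt (P.facetCoord i v) (P.pt _ i x) := continuousAt_pi.2 fun l =>
    (continuousAt_iff_pt (permInvariant_stdSimplex _)).2 fun i₁ x₁ h =>
      (plAt_space_iff.1 (hPL l) i₁ x₁ h).continuousAt
  -- sections over the two sides
  let s₁ : (Fin n → ℝ) → Fin (n + 1) → ℝ := fun c =>
    Fin.insertNth (α := fun _ => ℝ) v (1 - ∑ l, c l) c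
  let s₂ : (Fin n → ℝ) → Fin (n + 1) → ℝ := fun c =>
    (Fin.insertNth (α := fun _ => ℝ) v (∑ l, c l - 1) fun l => c l - 2 / n * (∑ l, c l - 1)) ∘ σ.symm
  have hs₁ : Continuous s₁ := by
    refine continuous_pi fun a => ?_
    rcases Fin.eq_self_or_eq_succAbove v a with rfl | ⟨l, rfl⟩
    · simp only [s₁, Fin.insertNth_apply_same]; fun_prop
    · simp only [s₁, Fin.insertNth_apply_succAbove]; fun_prop
  have hs₂ : Continuous s₂ := by
    refine continuous_pi fun a => ?_
    obtain ⟨b, rfl⟩ := σ.surjective a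
    rcases Fin.eq_self_or_eq_succAbove v b with rfl | ⟨l, rfl⟩
    · simp only [s₂, Function.comp_apply, Equiv.symm_apply_apply, Fin.insertNth_apply_same]; fun_prop
    · simp only [s₂, Function.comp_apply, Equiv.symm_apply_apply, Fin.insertNth_apply_succAbove]
      fun_prop
  have hs₁v : ∀ c, s₁ c v = 1 - ∑ l, c l := fun c => Fin.insertNth_apply_same _ _ _
  have hs₁l : ∀ c l, s₁ c (v.succAbove l) = c l := fun c l => Fin.insertNth_apply_succAbove _ _ _ _
  have hs₂v : ∀ c, s₂ c v' = ∑ l, c l - 1 := fun c => by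
    simp only [s₂, Function.comp_apply, ← hσv, Equiv.symm_apply_apply, Fin.insertNth_apply_same]
  have hs₂l : ∀ c l, s₂ c (σ (v.succAbove l)) = c l - 2 / n * (∑ l, c l - 1) := fun c l => by
    simp only [s₂, Function.comp_apply, Equiv.symm_apply_apply, Fin.insertNth_apply_succAbove]
  have hs₂sum : ∀ u : Fin (n + 1) → ℝ, ∑ a, u a = u v' + ∑ l, u (σ (v.succAbove l)) := fun u => by
    rw [← hσv, ← Equiv.sum_comp σ, Fin.sum_univ_succAbove _ v]
  -- The factor `3` is `1 + 2`, with `2 / n ≤ 2`: it ensures that both sections take values in the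
  -- simplex with the strict minimum at the expected vertex.
  have hpos : ∀ᶠ z in 𝓝 (P.pt _ i x), ∀ l, 3 * |1 - ∑ l, P.facetCoord i v z l| <
      P.facetCoord i v z l := by
    have h1 : P.facetCoord i v (P.pt _ i x) = fun l => x.1 (v.succAbove l) := facetCoord_pt hxmin
    have h2 : ∑ l, x.1 (v.succAbove l) = 1 := by
      have := x.2.2
      rwa [Fin.sum_univ_succAbove _ v, hv, zero_add] at this
    have h3 : ∀ᶠ c in 𝓝 (P.facetCoord i v (P.pt _ i x)), ∀ l : Fin n, 3 * |1 - ∑ l, c l| < c l := by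
      refine eventually_all.2 fun l => ContinuousAt.eventually_lt ?_ ?_ ?_
      · fun_prop
      · exact (continuous_apply l).continuousAt
      · rw [h1, h2, sub_self, abs_zero, mul_zero]
        exact lt_of_le_of_ne (x.2.1 _) (Ne.symm (hx _ (Fin.succAbove_ne v l)))
    exact hc.eventually h3
  have hs₁mem : ∀ c : Fin n → ℝ, (∀ l, 3 * |1 - ∑ l, c l| < c l) → ∑ l, c l ≤ 1 →
      s₁ c ∈ stdSimplex ℝ (Fin (n + 1)) ∧ StrictMin v (s₁ c) := by
    intro c h1 h2
    have h3 : ∀ l, 1 - ∑ l, c l < c l := fun l => by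
      have := h1 l
      rw [abs_of_nonneg (by linarith)] at this
      linarith
    refine ⟨⟨fun a => ?_, ?_⟩, fun a ha => ?_⟩
    · rcases Fin.eq_self_or_eq_succAbove v a with rfl | ⟨l, rfl⟩
      · rw [hs₁v]; linarith
      · rw [hs₁l]; linarith [h3 l]
    · rw [Fin.sum_univ_succAbove _ v]
      simp only [hs₁v, hs₁l]; ring
    · obtain ⟨l, rfl⟩ := Fin.exists_succAbove_eq ha
      rw [hs₁v, hs₁l]
      exact h3 l
  have hs₂mem : ∀ c : Fin n → ℝ, (∀ l, 3 * |1 - ∑ l, c l| < c l) → 1 ≤ ∑ l, c l →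
      s₂ c ∈ stdSimplex ℝ (Fin (n + 1)) ∧ StrictMin v' (s₂ c) := by
    intro c h1 h2
    have h3 : ∀ l, ∑ l, c l - 1 < c l - 2 / n * (∑ l, c l - 1) := fun l => by
      have h4 := h1 l
      rw [abs_of_nonpos (by linarith)] at h4
      have h5 : 2 / (n : ℝ) ≤ 2 := by
        refine div_le_self (by norm_num) ?_
        exact_mod_cast Nat.pos_of_ne_zero (NeZero.ne n)
      have h6 := mul_le_mul_of_nonneg_right h5 (sub_nonneg.2 h2)
      linarith
    refine ⟨⟨fun a => ?_, ?_⟩, fun a ha => ?_⟩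
    · obtain ⟨b, rfl⟩ := σ.surjective a
      rcases Fin.eq_self_or_eq_succAbove v b with rfl | ⟨l, rfl⟩
      · rw [hσv, hs₂v]; linarith
      · rw [hs₂l]; linarith [h3 l]
    · rw [hs₂sum]
      simp only [hs₂v, hs₂l, Finset.sum_sub_distrib, Finset.sum_const, Finset.card_univ,
        Fintype.card_fin, nsmul_eq_mul]
      field_simp
      ring
    · obtain ⟨b, rfl⟩ := σ.surjective a
      obtain ⟨l, rfl⟩ := Fin.exists_succAbove_eq (x := b) (y := v) (by rintro rfl; exact ha hσv)
      rw [hs₂v, hs₂l]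
      exact h3 l
  have hκ₁ : ∀ c (h : s₁ c ∈ stdSimplex ℝ (Fin (n + 1))), StrictMin v (s₁ c) →
      P.facetCoord i v (P.pt _ i ⟨s₁ c, h⟩) = c := fun c h h' => by
    rw [facetCoord_pt h']
    ext l
    exact hs₁l c l
  have hκ₂ : ∀ c (h : s₂ c ∈ stdSimplex ℝ (Fin (n + 1))), StrictMin v' (s₂ c) →
      P.facetCoord i v (P.pt _ i' ⟨s₂ c, h⟩) = c := fun c h h' => by
    rw [facetCoord_pt_partner h']
    ext l
    change s₂ c (σ (v.succAbove l)) + 2 / n * s₂ c v' = c l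
    rw [hs₂l, hs₂v]
    ring
  -- both sections describe the point
  have hglue : ∀ u u' : stdSimplex ℝ (Fin (n + 1)), u.1 v = 0 → (∀ a, u'.1 (σ a) = u.1 a) →
      P.pt _ i u = P.pt _ i' u' := fun u u' h h' => Quot.sound ⟨v, h, rfl, h'⟩
  -- A point of the facet itself, where the sum is one, is represented by both sections. This is
  -- what makes them fit together.
  have hrep : ∀ z, (∃ u, z = P.pt _ i u ∧ StrictMin v u.1) ∨ (∃ u, z = P.pt _ i' u ∧ StrictMin v' u.1) →
      (∑ l, P.facetCoord i v z l ≤ 1 → ∃ h, z = P.pt _ i ⟨s₁ (P.facetCoord i v z), h⟩) ∧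
      (1 ≤ ∑ l, P.facetCoord i v z l → ∃ h, z = P.pt _ i' ⟨s₂ (P.facetCoord i v z), h⟩) := by
    rintro z (⟨u, rfl, hu⟩ | ⟨u, rfl, hu⟩)
    · rw [facetCoord_pt hu]
      have hsum : ∑ l, u.1 (v.succAbove l) = 1 - u.1 v := by
        have := u.2.2
        rw [Fin.sum_univ_succAbove _ v] at this
        linarith
      have h1 : s₁ (fun l => u.1 (v.succAbove l)) = u.1 := by
        ext a
        rcases Fin.eq_self_or_eq_succAbove v a with rfl | ⟨l, rfl⟩
        · rw [hs₁v, hsum]; ring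
        · rw [hs₁l]
      refine ⟨fun _ => ⟨by rw [h1]; exact u.2, ?_⟩, fun h2 => ?_⟩
      · congr 1
        exact Subtype.ext h1.symm
      · have h3 : u.1 v = 0 := le_antisymm (by linarith) (u.2.1 v)
        have h4 : ∀ a, s₂ (fun l => u.1 (v.succAbove l)) (σ a) = u.1 a := by
          intro a
          rcases Fin.eq_self_or_eq_succAbove v a with rfl | ⟨l, rfl⟩
          · rw [hσv, hs₂v, hsum, h3]; ring
          · rw [hs₂l, hsum, h3]; ring
        have h5 : s₂ (fun l => u.1 (v.succAbove l)) ∈ stdSimplex ℝ (Fin (n + 1)) := by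
          have : s₂ (fun l => u.1 (v.succAbove l)) = u.1 ∘ σ.symm := by
            ext a; rw [Function.comp_apply, ← h4, Equiv.apply_symm_apply]
          rw [this]
          exact permInvariant_stdSimplex _ σ _ u.2
        exact ⟨h5, hglue _ _ h3 h4⟩
    · rw [facetCoord_pt_partner hu]
      have hsum : ∑ l, (u.1 (σ (v.succAbove l)) + 2 / n * u.1 v') = 1 + u.1 v' := by
        have := u.2.2
        rw [hs₂sum] at this
        rw [Finset.sum_add_distrib, Finset.sum_const, Finset.card_univ, Fintype.card_fin,
          nsmul_eq_mul]
        field_simp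
        linarith
      have h1 : s₂ (fun l => u.1 (σ (v.succAbove l)) + 2 / n * u.1 v') = u.1 := by
        ext a
        obtain ⟨b, rfl⟩ := σ.surjective a
        rcases Fin.eq_self_or_eq_succAbove v b with rfl | ⟨l, rfl⟩
        · rw [hσv, hs₂v, hsum]; ring
        · rw [hs₂l, hsum]; ring
      refine ⟨fun h2 => ?_, fun _ => ⟨by rw [h1]; exact u.2, ?_⟩⟩
      · have h2' : 1 + u.1 v' ≤ 1 := hsum ▸ h2
        have h3 : u.1 v' = 0 := le_antisymm (by linarith) (u.2.1 v')
        have h4 : ∀ a, u.1 (σ a) = s₁ (fun l => u.1 (σ (v.succAbove l)) + 2 / n * u.1 v') a := by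
          intro a
          rcases Fin.eq_self_or_eq_succAbove v a with rfl | ⟨l, rfl⟩
          · rw [hσv, hs₁v, hsum, h3]; ring
          · rw [hs₁l, h3]; ring
        have h5 : s₁ (fun l => u.1 (σ (v.succAbove l)) + 2 / n * u.1 v') ∈
            stdSimplex ℝ (Fin (n + 1)) := by
          have : s₁ (fun l => u.1 (σ (v.succAbove l)) + 2 / n * u.1 v') = u.1 ∘ σ.symm.symm := by
            ext a; rw [← h4]; rfl
          rw [this]
          exact permInvariant_stdSimplex _ σ.symm _ u.2
        refine ⟨h5, (hglue ⟨_, h5⟩ u ?_ h4).symm⟩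
        exact (h4 v).symm.trans (by rw [hσv, h3])
      · congr 1
        exact Subtype.ext h1.symm
  have hev : ∀ᶠ z in 𝓝 (P.pt _ i x),
      (∃ u, z = P.pt _ i u ∧ StrictMin v u.1) ∨ (∃ u, z = P.pt _ i' u ∧ StrictMin v' u.1) := by
    refine (eventually_nhds_iff_pt (permInvariant_stdSimplex _)).2 fun i₁ x₁ h => ?_
    rcases hfib i₁ x₁ h with ⟨rfl, rfl⟩ | ⟨rfl, h1, -⟩
    · filter_upwards [hmin v x₁ hxmin] with u hu using Or.inl ⟨u, rfl, hu⟩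
    · filter_upwards [hmin _ x₁ h1] with u hu using Or.inr ⟨u, rfl, hu⟩
  filter_upwards [hpos, hev] with z h1 h2
  obtain ⟨h3, h4⟩ := hrep z h2
  refine le_map_iff.2 fun N hN => ?_
  set c₀ := P.facetCoord i v z with hc₀
  have hposc : ∀ᶠ c in 𝓝 c₀, ∀ l : Fin n, 3 * |1 - ∑ l, c l| < c l := by
    refine eventually_all.2 fun l => ContinuousAt.eventually_lt ?_ ?_ (h1 l)
    · fun_prop
    · exact (continuous_apply l).continuousAt
  have hsumc : Continuous fun c : Fin n → ℝ => ∑ l, c l := by fun_prop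
  have hside₁ : ∀ᶠ c in 𝓝 c₀, ∑ l, c l ≤ 1 → ∀ h : s₁ c ∈ stdSimplex ℝ (Fin (n + 1)),
      P.pt _ i ⟨s₁ c, h⟩ ∈ N := by
    by_cases h5 : ∑ l, c₀ l ≤ 1
    · obtain ⟨h6, h7⟩ := h3 h5
      rw [h7] at hN
      filter_upwards [eventually_pt_mem hs₁.continuousAt h6 hN] with c hc _ using hc
    · filter_upwards [hsumc.continuousAt.eventually (Ioi_mem_nhds (not_le.1 h5))] with c hc h
      exact absurd h (not_le.2 hc)
  have hside₂ : ∀ᶠ c in 𝓝 c₀, 1 ≤ ∑ l, c l → ∀ h : s₂ c ∈ stdSimplex ℝ (Fin (n + 1)),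
      P.pt _ i' ⟨s₂ c, h⟩ ∈ N := by
    by_cases h5 : 1 ≤ ∑ l, c₀ l
    · obtain ⟨h6, h7⟩ := h4 h5
      rw [h7] at hN
      filter_upwards [eventually_pt_mem hs₂.continuousAt h6 hN] with c hc _ using hc
    · filter_upwards [hsumc.continuousAt.eventually (Iio_mem_nhds (not_le.1 h5))] with c hc h
      exact absurd h (not_le.2 hc)
  filter_upwards [hposc, hside₁, hside₂] with c h5 h6 h7
  rcases le_total (∑ l, c l) 1 with h8 | h8
  · obtain ⟨h9, h10⟩ := hs₁mem c h5 h8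
    exact ⟨_, h6 h8 h9, hκ₁ c h9 h10⟩
  · obtain ⟨h9, h10⟩ := hs₂mem c h5 h8
    exact ⟨_, h7 h8 h9, hκ₂ c h9 h10⟩

/-- A boundary point would have another one nearby in an open simplex or an open facet, where
coordinates with values in `ℝ^n` that are PL and open are available. -/
theorem notMem_plBoundary [NeZero n] {y : P.TruncatedSpace} (hy : 1 < P.tau (P.trunc y)) :
    y ∉ plBoundary n P.TruncatedSpace := by
  rintro ⟨e, hye, he, hey⟩
  have hcont : ContinuousAt (fun p => P.tau (P.trunc (e.symm p))) (e y) :=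
    continuous_tau.continuousAt.comp (isEmbedding_trunc.continuous.continuousAt.comp
      (e.continuousAt_symm (e.map_source hye)))
  have hV : {p | p ∈ e.target ∧ 1 < P.tau (P.trunc (e.symm p))} ∈ 𝓝 (e y) := by
    refine Filter.inter_mem (e.open_target.mem_nhds (e.map_source hye))
      (hcont.eventually (Ioi_mem_nhds ?_))
    change 1 < P.tau (P.trunc (e.symm (e y)))
    rwa [e.left_inv hye]
  obtain ⟨p, hpV, hp0, hp⟩ := exists_boundary_point_few_zeros he hey hV fun _ h => h.1
  obtain ⟨hpt, hpτ⟩ := interior_subset hpV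
  obtain ⟨i, x, hx⟩ := pt_surjective (P.trunc (e.symm p))
  have hzero := hp i x hx
  by_cases h : ∃ v, x.1 v = 0
  · obtain ⟨v, hv⟩ := h
    have h1 := facetCoord_chart (P := P) (i := i) hv fun a ha => hzero v a (Ne.symm ha) hv
    rw [hx] at h1
    exact notMem_boundary_of_open_map he hpt hpτ h1.1 h1.2 hp0
  · push Not at h
    have h1 := interiorCoord_chart (P := P) (i := i) fun a => lt_of_le_of_ne (x.2.1 a) (Ne.symm (h a))
    rw [hx] at h1
    exact notMem_boundary_of_open_map he hpt hpτ h1.1 h1.2 hp0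

end FacePairing

/-! ### Charts as pairs of locally inverse maps -/

section Charts

variable {A B Y Z W : Type*} [TopologicalSpace A] [PLStructure A] [TopologicalSpace B]
  [PLStructure B] [TopologicalSpace Y] [PLStructure Y] [TopologicalSpace Z] [PLStructure Z]
  [TopologicalSpace W] [PLStructure W]

/-- Near `y` and `f y`, the maps `f` and `g` are PL and inverse to each other. -/
def IsPLChart (f : Y → Z) (g : Z → Y) (y : Y) : Prop :=
  (∀ᶠ u in 𝓝 y, IsPLMapAt f u ∧ g (f u) = u) ∧ ∀ᶠ v in 𝓝 (f y), IsPLMapAt g v ∧ f (g v) = v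

namespace IsPLChart

variable {f : Y → Z} {g : Z → Y} {f' : Z → W} {g' : W → Z} {y : Y}

theorem isPLMapAt (h : IsPLChart f g y) : IsPLMapAt f y := h.1.self_of_nhds.1

theorem left_inv (h : IsPLChart f g y) : g (f y) = y := h.1.self_of_nhds.2

theorem symm (h : IsPLChart f g y) : IsPLChart g f (f y) := by
  refine ⟨h.2, ?_⟩
  rw [h.left_inv]
  exact h.1

theorem eventually (h : IsPLChart f g y) : ∀ᶠ u in 𝓝 y, IsPLChart f g u := by
  filter_upwards [h.1.eventually_nhds, h.isPLMapAt.1.eventually h.2.eventually_nhds] with u h1 h2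
  exact ⟨h1, h2⟩

theorem comp (h' : IsPLChart f' g' (f y)) (h : IsPLChart f g y) :
    IsPLChart (fun u => f' (f u)) (fun w => g (g' w)) y := by
  constructor
  · filter_upwards [h.1, h.isPLMapAt.1.eventually h'.1] with u h1 h2
    exact ⟨h2.1.comp h1.1, by rw [h2.2, h1.2]⟩
  · have h3 : ContinuousAt g' (f' (f y)) := h'.symm.isPLMapAt.1
    have h4 : ∀ᶠ v in 𝓝 (g' (f' (f y))), IsPLMapAt g v ∧ f (g v) = v := by
      rw [h'.left_inv]; exact h.2
    filter_upwards [h'.2, h3.eventually h4] with w h1 h2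
    exact ⟨h2.1.comp h1.1, by rw [h2.2, h1.2]⟩

theorem exists_isPLLocalHomeo (h : IsPLChart f g y) :
    ∃ e : OpenPartialHomeomorph Y Z, y ∈ e.source ∧ IsPLLocalHomeo e ∧ ⇑e = f :=
  _root_.exists_isPLLocalHomeo h.1 h.2

end IsPLChart

theorem IsPLLocalHomeo.isPLChart {e : OpenPartialHomeomorph Y Z} (he : IsPLLocalHomeo e) {y : Y}
    (hy : y ∈ e.source) : IsPLChart e e.symm y := by
  constructor
  · filter_upwards [e.open_source.mem_nhds hy] with u hu using ⟨he.1 u hu, e.left_inv hu⟩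
  · filter_upwards [e.open_target.mem_nhds (e.map_source hy)] with v hv
    exact ⟨he.2 v hv, e.right_inv hv⟩

theorem IsPLEmbedding.exists_isPLChart {i : A → B} (hi : IsPLEmbedding i) {a : A}
    (h : range i ∈ 𝓝 (i a)) : ∃ r, IsPLChart i r a := by
  have : Nonempty A := ⟨a⟩
  have hl := Function.leftInverse_invFun hi.isEmbedding.injective
  refine ⟨Function.invFun i, Eventually.of_forall fun u => ⟨hi.isPLMapAt u, hl u⟩, ?_⟩
  filter_upwards [eventually_mem_nhds_iff.2 h] with v hv
  have hr : ∀ v ∈ range i, i (Function.invFun i v) = v := fun v hv => Function.invFun_eq hv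
  refine ⟨hi.isPLMapAt_of_comp ((isPLMapAt_id v).congr ?_), hr v (mem_of_mem_nhds hv)⟩
  filter_upwards [hv] with u hu using (hr u hu).symm

end Charts

/-! ### A coordinate along which a function grows at unit speed -/

/-- After a linear change of coordinates that makes `w` the first unit vector, the first coordinate
is replaced by `F - F a₀`. Although `F` is only PL, it is strictly controlled along `w`, so the
inverse slides along `w` until `F` attains the prescribed value. -/
theorem exists_isPLChart_shear {n : ℕ} [NeZero n] {F : (Fin n → ℝ) → ℝ} {a₀ w : Fin n → ℝ}
    (hF : IsSel id F a₀) (hw : ∀ᶠ p : ℝ × (Fin n → ℝ) in 𝓝 (0, a₀), F (p.2 + p.1 • w) = F p.2 + p.1) :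
    ∃ f g : (Fin n → ℝ) → Fin n → ℝ, IsPLChart f g a₀ ∧ ∀ a, f a 0 = F a - F a₀ := by
  have hw0 : w ≠ 0 := by
    rintro rfl
    have h1 : ∀ᶠ s : ℝ in 𝓝 0, F a₀ = F a₀ + s := by
      have : ContinuousAt (fun s : ℝ => (s, a₀)) 0 := by fun_prop
      filter_upwards [this.eventually hw] with s hs
      simpa using hs
    obtain ⟨s, hs, hs0⟩ := ((h1.filter_mono nhdsWithin_le_nhds).and
      (self_mem_nhdsWithin : Ioi (0 : ℝ) ∈ 𝓝[>] 0)).exists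
    have : 0 < s := hs0
    linarith
  obtain ⟨A, hA⟩ := SeparatingDual.exists_continuousLinearEquiv_apply_eq (R := ℝ) (x := w)
    (y := Pi.single (0 : Fin n) (1 : ℝ)) hw0 (by simp)
  have hA' : A.symm (Pi.single 0 1) = w := by rw [← hA, A.symm_apply_apply]
  have hAsel : ∀ l a, IsSel id (fun a => A a l) a := fun l a =>
    IsSel.affine (j := id) continuous_id
      ((LinearMap.proj (R := ℝ) (φ := fun _ : Fin n => ℝ) l).comp A.toLinearMap).toAffineMap a
  have hAsel' : ∀ l a, IsSel id (fun a => A.symm a l) a := fun l a =>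
    IsSel.affine (j := id) continuous_id
      ((LinearMap.proj (R := ℝ) (φ := fun _ : Fin n => ℝ) l).comp A.symm.toLinearMap).toAffineMap a
  let f : (Fin n → ℝ) → Fin n → ℝ := fun a => Function.update (A a) 0 (F a - F a₀)
  -- `b` returns to the hyperplane through `a₀` transverse to `w`; `g` then moves along `w` by the
  -- amount that `F` is still short of `d 0 + F a₀`.
  let b : (Fin n → ℝ) → Fin n → ℝ := fun d => A.symm (Function.update d 0 (A a₀ 0))
  let g : (Fin n → ℝ) → Fin n → ℝ := fun d => b d + (d 0 + F a₀ - F (b d)) • w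
  have hbf : ∀ a, b (f a) = a - (A a 0 - A a₀ 0) • w := by
    intro a
    have : Function.update (f a) 0 (A a₀ 0) = A a - (A a 0 - A a₀ 0) • Pi.single 0 1 := by
      ext l
      by_cases hl : l = 0
      · subst hl; simp
      · simp [f, hl]
    simp only [b]
    rw [this, map_sub, map_smul, hA', A.symm_apply_apply]
  have hAb : ∀ d, A (b d) = Function.update d 0 (A a₀ 0) := fun d => by
    simp only [b, A.apply_symm_apply]
  have hfsel : ∀ a, IsSel id F a → IsPLMapAt f a := by
    intro a ha
    refine isPLMapAt_pi fun l => ?_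
    by_cases hl : l = 0
    · subst hl
      simpa [f] using ha.sub (IsSel.const _ a)
    · simpa [f, hl] using hAsel l a
  have hb : ∀ d l, IsSel id (fun d => b d l) d := by
    intro d l
    refine IsSel.comp_pi (F := fun m (d : Fin n → ℝ) => Function.update d 0 (A a₀ 0) m)
      (h := fun v => A.symm v l) (fun m => ?_) (hAsel' l _)
    by_cases hm : m = 0
    · subst hm; simpa using IsSel.const (A a₀ 0) d
    · simpa [hm] using IsSel.coord (j := id) continuous_id m d
  have hgsel : ∀ d, IsSel id F (b d) → IsPLMapAt g d := by
    intro d hd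
    refine isPLMapAt_pi fun l => ?_
    have h1 : IsSel id (fun d => F (b d)) d := IsSel.comp_pi (F := fun m d => b d m) (h := F) (hb d) hd
    exact (hb d l).add ((((IsSel.coord (j := id) continuous_id 0 d).add (IsSel.const _ d)).sub
      h1).mul_const _)
  have hba : b (f a₀) = a₀ := by rw [hbf]; simp
  have hbc : Continuous b := by fun_prop
  have hfc : ContinuousAt f a₀ := (hfsel a₀ hF).1
  have hAc : Continuous fun a => A a 0 - A a₀ 0 := by fun_prop
  refine ⟨f, g, ⟨?_, ?_⟩, fun a => by simp [f]⟩
  · have h1 : ContinuousAt (fun a => (A a 0 - A a₀ 0, b (f a))) a₀ :=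
      hAc.continuousAt.prodMk (ContinuousAt.comp (g := b) (f := f) hbc.continuousAt hfc)
    have h2 : Tendsto (fun a => (A a 0 - A a₀ 0, b (f a))) (𝓝 a₀) (𝓝 (0, a₀)) := by
      convert! h1.tendsto using 2
      rw [sub_self, hba]
    filter_upwards [h2.eventually hw, hF.eventually] with a h3 h4
    refine ⟨hfsel a h4, ?_⟩
    have h5 : b (f a) + (A a 0 - A a₀ 0) • w = a := by rw [hbf]; abel
    rw [h5] at h3
    have h6 : f a 0 + F a₀ - F (b (f a)) = A a 0 - A a₀ 0 := by
      simp only [f, Function.update_self] at h3 ⊢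
      linarith
    change b (f a) + (f a 0 + F a₀ - F (b (f a))) • w = a
    rw [h6, h5]
  · have hFb : ContinuousAt (fun d => F (b d)) (f a₀) :=
      ContinuousAt.comp (by rw [hba]; exact hF.continuousAt) hbc.continuousAt
    have h1 : ContinuousAt (fun d : Fin n → ℝ => (d 0 + F a₀ - F (b d), b d)) (f a₀) := by
      refine ContinuousAt.prodMk (ContinuousAt.sub ?_ hFb) hbc.continuousAt
      exact (continuous_apply 0).continuousAt.add continuousAt_const
    have h2 : Tendsto (fun d : Fin n → ℝ => (d 0 + F a₀ - F (b d), b d)) (𝓝 (f a₀)) (𝓝 (0, a₀)) := by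
      convert! h1.tendsto using 2
      rw [hba]; simp [f]
    have h7 : ∀ᶠ d in 𝓝 (f a₀), IsSel id F (b d) := by
      have h8 : ∀ᶠ v in 𝓝 (b (f a₀)), IsSel id F v := by rw [hba]; exact hF.eventually
      exact hbc.continuousAt.eventually h8
    filter_upwards [h2.eventually hw, h7] with d h3 h4
    refine ⟨hgsel d h4, ?_⟩
    ext l
    by_cases hl : l = 0
    · subst hl
      simp only [f, g, Function.update_self, h3]
      ring
    · simp only [f, g, Function.update_of_ne hl, map_add, map_smul, hAb, hA]
      simp [hl]

/-! ### Translations -/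

theorem eventually_mk_mem {m : ℕ} {A : Set (Fin m → ℝ)} {C : Type*} [TopologicalSpace C]
    {s : C → Fin m → ℝ} {c₀ : C} (hs : ContinuousAt s c₀) {x : A} (h0 : s c₀ = x.1) {N : Set A}
    (hN : N ∈ 𝓝 x) : ∀ᶠ c in 𝓝 c₀, ∀ h : s c ∈ A, (⟨s c, h⟩ : A) ∈ N := by
  rw [nhds_subtype_eq_comap, mem_comap] at hN
  obtain ⟨M, hM, hMN⟩ := hN
  rw [← h0] at hM
  filter_upwards [hs hM] with c hc h
  exact hMN hc

theorem eventually_mem_stdSimplex {m : ℕ} {C : Type*} [TopologicalSpace C]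
    {s : C → Fin m → ℝ} {c₀ : C} (hs : ContinuousAt s c₀) (h1 : ∀ c, ∑ l, s c l = 1)
    (h2 : ∀ l, 0 < s c₀ l ∨ ∀ᶠ c in 𝓝 c₀, 0 ≤ s c l) : ∀ᶠ c in 𝓝 c₀, s c ∈ stdSimplex ℝ (Fin m) := by
  have : ∀ᶠ c in 𝓝 c₀, ∀ l, 0 ≤ s c l := eventually_all.2 fun l => by
    rcases h2 l with h | h
    · filter_upwards [((continuous_apply l).continuousAt.comp hs).eventually (Ioi_mem_nhds h)] with c hc
      exact le_of_lt hc
    · exact h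
  filter_upwards [this] with c hc using ⟨hc, h1 c⟩

/-- Translation by `r • (x - x')` is the homothety with centre `x'` and factor `(1 - r)⁻¹` followed
by the one with centre `x` and factor `1 - r`. Along both kinds of segments `f` is affine, by `hf`
and by `h` respectively. -/
theorem IsSel.translation {m : ℕ} {f : stdSimplex ℝ (Fin m) → ℝ} {x x' : stdSimplex ℝ (Fin m)}
    (h : ∀ᶠ q in 𝓝 x', ∀ w : stdSimplex ℝ (Fin m), ∀ t ∈ Icc (0 : ℝ) 1,
      w.1 = x.1 + t • (q.1 - x.1) → f w = f x + t * (f q - f x)) (hf : IsSel Subtype.val f x') :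
    ∀ᶠ p : ℝ × stdSimplex ℝ (Fin m) in 𝓝 (0, x'), ∀ w : stdSimplex ℝ (Fin m),
      w.1 = p.2.1 + p.1 • (x.1 - x'.1) → f w = f p.2 + p.1 * (f x - f x') := by
  have h' := hf.homogeneous (convex_stdSimplex ℝ (Fin m))
  have hpos : ∀ᶠ p : ℝ × stdSimplex ℝ (Fin m) in 𝓝 (0, x'), 0 ≤ p.1 → ∀ w : stdSimplex ℝ (Fin m),
      w.1 = p.2.1 + p.1 • (x.1 - x'.1) → f w = f p.2 + p.1 * (f x - f x') := by
    let s : ℝ × stdSimplex ℝ (Fin m) → Fin m → ℝ := fun p => x'.1 + (1 - p.1)⁻¹ • (p.2.1 - x'.1)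
    have hinv : ContinuousAt (fun p : ℝ × stdSimplex ℝ (Fin m) => (1 - p.1)⁻¹) (0, x') :=
      (continuous_const.sub continuous_fst).continuousAt.inv₀ (by simp)
    have hs : ContinuousAt s (0, x') :=
      continuousAt_const.add (hinv.smul
        ((continuous_subtype_val.comp continuous_snd).sub continuous_const).continuousAt)
    have hs0 : s (0, x') = x'.1 := by simp [s]
    have hlt : ∀ᶠ p : ℝ × stdSimplex ℝ (Fin m) in 𝓝 (0, x'), p.1 < 1 :=
      continuous_fst.continuousAt.eventually (Iio_mem_nhds (by norm_num))
    have hmem : ∀ᶠ p in 𝓝 ((0 : ℝ), x'), s p ∈ stdSimplex ℝ (Fin m) := by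
      refine eventually_mem_stdSimplex hs (fun p => ?_) fun l => ?_
      · simp [s, Finset.sum_add_distrib, ← Finset.mul_sum, Finset.sum_sub_distrib, x'.2.2, p.2.2.2]
      · rcases (x'.2.1 l).eq_or_lt with h0 | h0
        · right
          filter_upwards [hlt] with p hp
          have h1 : 0 ≤ (1 - p.1)⁻¹ := inv_nonneg.2 (by linarith)
          have h2 := p.2.2.1 l
          simp only [s, Pi.add_apply, Pi.smul_apply, Pi.sub_apply, ← h0, smul_eq_mul]
          simpa using mul_nonneg h1 h2
        · left
          rw [hs0]; exact h0
    filter_upwards [hlt, hmem, eventually_mk_mem hs hs0 (h.and h')] with p h1 h2 h3 h4 w hw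
    obtain ⟨h5, h6⟩ := h3 h2
    have h7 : (1 - p.1 : ℝ) ≠ 0 := by linarith
    have hmem01 : 1 - p.1 ∈ Icc (0 : ℝ) 1 := ⟨by linarith, by linarith⟩
    have e1 := h6 p.2 (1 - p.1) hmem01 (by
      simp only [s, add_sub_cancel_left, smul_smul, mul_inv_cancel₀ h7, one_smul]
      abel)
    have e2 := h5 w (1 - p.1) hmem01 (by
      have : (1 - p.1) • s p = p.2.1 - p.1 • x'.1 := by
        simp only [s, smul_add, smul_smul, mul_inv_cancel₀ h7, one_smul, sub_smul]
        abel
      have e3 : x.1 + (1 - p.1) • (s p - x.1) = x.1 + ((1 - p.1) • s p - (1 - p.1) • x.1) := by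
        rw [smul_sub]
      rw [hw, e3, this]
      module)
    rw [e1, e2]
    ring
  have hneg : ContinuousAt (fun p : ℝ × stdSimplex ℝ (Fin m) => p.2.1 + p.1 • (x.1 - x'.1)) (0, x') := by
    have : Continuous fun p : ℝ × stdSimplex ℝ (Fin m) => p.2.1 + p.1 • (x.1 - x'.1) := by fun_prop
    exact this.continuousAt
  -- For a negative parameter the roles are exchanged: `p.2` is the translate of `w` by the
  -- opposite, positive parameter.
  obtain ⟨U, hU, V, hV, hUV⟩ := mem_nhds_prod_iff.1 hpos
  have hU' : ∀ᶠ p : ℝ × stdSimplex ℝ (Fin m) in 𝓝 (0, x'), -p.1 ∈ U := by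
    have : ContinuousAt (fun p : ℝ × stdSimplex ℝ (Fin m) => -p.1) (0, x') := by fun_prop
    exact this.preimage_mem_nhds (by simpa using hU)
  filter_upwards [hpos, hU', eventually_mk_mem hneg (by simp) hV] with p h1 h2 h3 w hw
  rcases le_total 0 p.1 with hp | hp
  · exact h1 hp w hw
  · have hwV : w ∈ V := by
      have := h3 (hw ▸ w.2)
      convert! this using 1
      exact Subtype.ext hw
    have h4 := hUV (mk_mem_prod h2 hwV) (by simpa using hp) p.2 (by
      dsimp only
      rw [hw]
      module)
    dsimp only at h4
    rw [h4]
    ring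

/-! ### A collar of the link of a vertex -/

section Restrict

variable {A B Y Z : Type*} [TopologicalSpace A] [PLStructure A] [TopologicalSpace B]
  [PLStructure B] [TopologicalSpace Y] [PLStructure Y] [TopologicalSpace Z] [PLStructure Z]

theorem IsPLChart.restrict {i : A → Y} {j : B → Z} (hi : IsPLEmbedding i) (hj : IsPLEmbedding j)
    {f : Y → Z} {g : Z → Y} {a : A} {b : B} (h : IsPLChart f g (i a)) (hb : j b = f (i a))
    (hr : ∀ᶠ u in 𝓝 (i a), u ∈ range i ↔ f u ∈ range j) : ∃ e r, IsPLChart e r a ∧ e a = b := by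
  have : Nonempty A := ⟨a⟩
  have : Nonempty B := ⟨b⟩
  have hi' : ∀ y ∈ range i, i (Function.invFun i y) = y := fun y hy => Function.invFun_eq hy
  have hj' : ∀ z ∈ range j, j (Function.invFun j z) = z := fun z hz => Function.invFun_eq hz
  have hil := Function.leftInverse_invFun hi.isEmbedding.injective
  have hjl := Function.leftInverse_invFun hj.isEmbedding.injective
  let e : A → B := fun a => Function.invFun j (f (i a))
  let r : B → A := fun b => Function.invFun i (g (j b))
  have hea : e a = b := by simp only [e, ← hb, hjl b]
  have h1 : ∀ᶠ u in 𝓝 a, (IsPLMapAt f (i u) ∧ g (f (i u)) = i u) ∧ (i u ∈ range i ↔ f (i u) ∈ range j) :=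
    hi.isEmbedding.continuous.continuousAt.eventually (h.1.and hr)
  have h2 : ∀ᶠ v in 𝓝 b, (IsPLMapAt g (j v) ∧ f (g (j v)) = j v) ∧
      (g (j v) ∈ range i ↔ f (g (j v)) ∈ range j) := by
    refine hj.isEmbedding.continuous.continuousAt.eventually (p := fun v => (IsPLMapAt g v ∧ f (g v) = v) ∧
      (g v ∈ range i ↔ f (g v) ∈ range j)) ?_
    rw [hb]
    refine h.2.and (h.symm.isPLMapAt.1.eventually (p := fun y => y ∈ range i ↔ f y ∈ range j) ?_)
    rw [h.left_inv]
    exact hr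
  refine ⟨e, r, ⟨?_, ?_⟩, hea⟩
  · filter_upwards [h1.eventually_nhds] with u hu
    have hje : ∀ᶠ u in 𝓝 u, j (e u) = f (i u) := by
      filter_upwards [hu] with v hv using hj' _ (hv.2.1 (mem_range_self v))
    refine ⟨hj.isPLMapAt_of_comp ((hu.self_of_nhds.1.1.comp (hi.isPLMapAt u)).congr ?_), ?_⟩
    · filter_upwards [hje] with v hv using hv.symm
    · simp only [r]
      rw [hje.self_of_nhds, hu.self_of_nhds.1.2, hil]
  · rw [hea]
    filter_upwards [h2.eventually_nhds] with v hv
    have hje : ∀ᶠ u in 𝓝 v, i (r u) = g (j u) := by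
      filter_upwards [hv] with v hv
      exact hi' _ (hv.2.2 (by rw [hv.1.2]; exact mem_range_self v))
    refine ⟨hi.isPLMapAt_of_comp ((hv.self_of_nhds.1.1.comp (hj.isPLMapAt v)).congr ?_), ?_⟩
    · filter_upwards [hje] with v hv using hv.symm
    · simp only [e]
      rw [hje.self_of_nhds, hv.self_of_nhds.1.2, hjl]

end Restrict

/-! ### Translations in charts and the collar. -/

namespace FacePairing

variable {k n : ℕ} {P : FacePairing k n}

theorem finite_fibre {A : Set (Fin (n + 1) → ℝ)} (z : Quot (P.Glued A)) :
    {p : Fin k × A | P.pt A p.1 p.2 = z}.Finite := by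
  obtain ⟨i₀, x₀, rfl⟩ := pt_surjective z
  refine Set.Finite.of_finite_image (f := fun p => (p.1, p.2.1)) ?_
    (Function.Injective.injOn fun p q h => ?_)
  · refine (finite_range fun q : Fin k × Equiv.Perm (Fin (n + 1)) => (q.1, x₀.1 ∘ q.2)).subset ?_
    rintro _ ⟨p, hp, rfl⟩
    obtain ⟨σ, hσ, -⟩ := exists_perm_of_pt_eq (show P.pt A p.1 p.2 = P.pt A i₀ x₀ from hp)
    exact ⟨(p.1, σ), Prod.ext rfl (funext fun w => hσ w)⟩
  · obtain ⟨h1, h2⟩ := Prod.ext_iff.1 h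
    exact Prod.ext h1 (Subtype.ext h2)

/-- Finiteness of the fibre allows the neighbourhoods of `c` found at the various lifts to be
intersected. -/
theorem eventually_prod_of_pt {A : Set (Fin (n + 1) → ℝ)} (hA : PermInvariant A) {C : Type*}
    [TopologicalSpace C] {c : C} {z : Quot (P.Glued A)} {R : C → Quot (P.Glued A) → Prop}
    (h : ∀ i x, P.pt A i x = z → ∀ᶠ p : C × A in 𝓝 (c, x), R p.1 (P.pt A i p.2)) :
    ∀ᶠ p : C × Quot (P.Glued A) in 𝓝 (c, z), R p.1 p.2 := by
  have h' : ∀ p : Fin k × A, ∃ U ∈ 𝓝 c, P.pt A p.1 p.2 = z →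
      ∀ᶠ x in 𝓝 p.2, ∀ r ∈ U, R r (P.pt A p.1 x) := by
    intro p
    by_cases hp : P.pt A p.1 p.2 = z
    · obtain ⟨U, hU, V, hV, hUV⟩ := mem_nhds_prod_iff.1 (h _ _ hp)
      exact ⟨U, hU, fun _ => Filter.mem_of_superset hV fun x hx r hr => hUV (mk_mem_prod hr hx)⟩
    · exact ⟨univ, univ_mem, fun hp' => (hp hp').elim⟩
  choose U hU hR using h'
  have hU' : (⋂ p ∈ {p : Fin k × A | P.pt A p.1 p.2 = z}, U p) ∈ 𝓝 c :=
    (biInter_mem (finite_fibre z)).2 fun p _ => hU p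
  have hz : ∀ᶠ y in 𝓝 z, ∀ r ∈ ⋂ p ∈ {p : Fin k × A | P.pt A p.1 p.2 = z}, U p, R r y := by
    rw [eventually_nhds_iff_pt hA]
    intro i x hx
    filter_upwards [hR (i, x) hx] with x' hx' r hr
    exact hx' r (mem_iInter₂.1 hr (i, x) hx)
  rw [nhds_prod_eq]
  filter_upwards [prod_mem_prod hU' hz] with p hp using hp.2 _ hp.1

theorem isPLChart_rad {c : ℝ} {z : P.Space} (hc : 0 < c) (h1 : P.tau z < starRadius (Fin (n + 1)))
    (h2 : c * P.tau z < starRadius (Fin (n + 1))) : IsPLChart (P.rad c) (P.rad c⁻¹) z := by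
  have key : ∀ {c : ℝ} {z : P.Space}, 0 < c → P.tau z < starRadius (Fin (n + 1)) →
      c * P.tau z < starRadius (Fin (n + 1)) →
      ∀ᶠ u in 𝓝 z, IsPLMapAt (P.rad c) u ∧ P.rad c⁻¹ (P.rad c u) = u := by
    intro c z hc h1 h2
    filter_upwards [continuous_tau.continuousAt.eventually (Iio_mem_nhds h1),
      (continuous_const.mul continuous_tau).continuousAt.eventually (Iio_mem_nhds h2)] with u h3 h4
    refine ⟨isPLMapAt_rad hc.le h3 h4, ?_⟩
    rw [rad_rad (inv_nonneg.2 hc.le) hc.le h3 h4 (by rwa [inv_mul_cancel₀ hc.ne', one_mul]),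
      inv_mul_cancel₀ hc.ne', rad_one]
  refine ⟨key hc h1 h2, ?_⟩
  have := key (c := c⁻¹) (z := P.rad c z) (inv_pos.2 hc) (by rwa [tau_rad hc.le h1 h2]) (by
    rwa [tau_rad hc.le h1 h2, ← mul_assoc, inv_mul_cancel₀ hc.ne', one_mul])
  rwa [inv_inv] at this

theorem exists_single_add_of_pt_eq_rad {c : ℝ} {z : P.Space} (hc : 0 < c)
    (h1 : P.tau z < starRadius (Fin (n + 1))) (h2 : c * P.tau z < starRadius (Fin (n + 1)))
    {i : Fin k} {x' : stdSimplex ℝ (Fin (n + 1))} (hx' : P.pt _ i x' = P.rad c z) :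
    ∃ j, ∃ x : stdSimplex ℝ (Fin (n + 1)), P.pt _ i x = z ∧
      x'.1 = Pi.single j 1 + c • (x.1 - Pi.single j 1) := by
  have e1 : minGam x'.1 = c * P.tau z := by rw [← tau_rad hc.le h1 h2, ← hx', tau_pt]
  obtain ⟨j, hj⟩ := minGam_lt_iff.1 (e1.trans_lt h2)
  have e2 : c⁻¹ * gam j x'.1 = P.tau z := by
    rw [← minGam_eq x'.2 hj, e1, ← mul_assoc, inv_mul_cancel₀ hc.ne', one_mul]
  have e3 := rad_pt (P := P) (inv_nonneg.2 hc.le) i x' hj (e2.trans_lt h1)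
  rw [hx', rad_rad (inv_nonneg.2 hc.le) hc.le h1 h2 (by rwa [inv_mul_cancel₀ hc.ne', one_mul]),
    inv_mul_cancel₀ hc.ne', rad_one] at e3
  refine ⟨j, _, e3.symm, ?_⟩
  simp only [add_sub_cancel_left, smul_smul, mul_inv_cancel₀ hc.ne', one_smul, add_sub_cancel]

theorem isSel_comp_pt {f : P.Space → ℝ} {i : Fin k} {x : stdSimplex ℝ (Fin (n + 1))}
    (h : PLAt f (P.pt _ i x)) : IsSel Subtype.val (fun x' => f (P.pt _ i x')) x :=
  plAt_space_iff.1 h i x rfl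

theorem _root_.IsPLMapAt.plAt_apply {Y : Type*} [TopologicalSpace Y] [PLStructure Y] {m : ℕ}
    {f : Y → Fin m → ℝ} {y : Y} (h : IsPLMapAt f y) (l : Fin m) : PLAt (fun u => f u l) y :=
  h.2 (fun v => v l) (plAt_iff_isSel.2 (IsSel.coord (j := id) continuous_id l _))

/-- Near `z` both `tau` and the chart are affine on segments issuing from a lift of `z`. So at the
slightly dilated point `P.rad c z`, translation in each simplex towards the lift of `z` becomes, in
the chart, translation by the same vector `f z - f (P.rad c z)`, and `tau` changes by a multiple of
`1 - c`. -/
theorem exists_isPLChart_translation {z : P.Space} (hz : P.tau z = 1)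
    {f : P.Space → Fin n → ℝ} {g : (Fin n → ℝ) → P.Space} (h : IsPLChart f g z) :
    ∃ c : ℝ, 0 < c ∧ c < 1 ∧ IsPLChart f g (P.rad c z) ∧ ∃ w : Fin n → ℝ,
      ∀ᶠ p : ℝ × (Fin n → ℝ) in 𝓝 (0, f (P.rad c z)),
        P.tau (g (p.2 + p.1 • w)) = P.tau (g p.2) + p.1 := by
  let Δ := stdSimplex ℝ (Fin (n + 1))
  let H : (P.Space → ℝ) → Fin k → Δ → Δ → Prop := fun f i x x' =>
    (∀ᶠ q in 𝓝 x', ∀ w : Δ, ∀ t ∈ Icc (0 : ℝ) 1, w.1 = x.1 + t • (q.1 - x.1) →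
      f (P.pt _ i w) = f (P.pt _ i x) + t * (f (P.pt _ i q) - f (P.pt _ i x))) ∧
    IsSel Subtype.val (fun q => f (P.pt _ i q)) x'
  have hH : ∀ f i x, PLAt f (P.pt Δ i x) → ∀ᶠ x' in 𝓝 x, H f i x x' := fun f i x hf =>
    ((isSel_comp_pt hf).homogeneous (convex_stdSimplex ℝ (Fin (n + 1)))).eventually_nhds.and
      (isSel_comp_pt hf).eventually
  let good : Fin k → Δ → Δ → Prop := fun i x x' =>
    IsPLChart f g (P.pt _ i x') ∧ H P.tau i x x' ∧ ∀ l, H (fun u => f u l) i x x'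
  have hgood : ∀ i x, P.pt Δ i x = z → ∀ᶠ x' in 𝓝 x, good i x x' := by
    rintro i x rfl
    refine ((continuous_pt i).continuousAt.eventually h.eventually).and
      ((hH _ i x (plAt_tau _)).and (eventually_all.2 fun l => hH _ i x (h.isPLMapAt.plAt_apply l)))
  -- All values of `c` near `1` are good for a given lift and vertex; there are finitely many of
  -- both.
  have hc : ∀ p ∈ {p : Fin k × Δ | P.pt _ p.1 p.2 = z}, ∀ᶠ c : ℝ in 𝓝 1, ∀ j,
      ∀ hm : Pi.single j 1 + c • (p.2.1 - Pi.single j 1) ∈ Δ, good p.1 p.2 ⟨_, hm⟩ := by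
    intro p hp
    refine eventually_all.2 fun j => eventually_mk_mem
      (s := fun c : ℝ => Pi.single j 1 + c • (p.2.1 - Pi.single j 1)) ?_ (by simp) (hgood _ _ hp)
    fun_prop
  obtain ⟨c, hc, hc0, hc1⟩ := (((((finite_fibre z).eventually_all).2 hc).filter_mono
    nhdsWithin_le_nhds).and (Ioo_mem_nhdsLT (zero_lt_one' ℝ))).exists
  have hg1 := one_lt_starRadius (K := Fin (n + 1))
  have ht1 : P.tau z < starRadius (Fin (n + 1)) := by rwa [hz]
  have ht2 : c * P.tau z < starRadius (Fin (n + 1)) := by rw [hz]; linarith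
  have hrep : ∀ i (x' : Δ), P.pt _ i x' = P.rad c z → ∃ j, ∃ x : Δ, P.pt _ i x = z ∧
      x'.1 = Pi.single j 1 + c • (x.1 - Pi.single j 1) ∧ good i x x' := by
    intro i x' hx'
    obtain ⟨j, x, h1, h2⟩ := exists_single_add_of_pt_eq_rad hc0 ht1 ht2 hx'
    refine ⟨j, x, h1, h2, ?_⟩
    have := hc (i, x) h1 j (h2 ▸ x'.2)
    convert! this using 1
    exact Subtype.ext h2
  have hchart : IsPLChart f g (P.rad c z) := by
    obtain ⟨i, x', hx'⟩ := pt_surjective (P.rad c z)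
    obtain ⟨j, x, -, -, h3⟩ := hrep i x' hx'
    rw [← hx']
    exact h3.1
  have hmain : ∀ᶠ p : ℝ × P.Space in 𝓝 (0, P.rad c z),
      P.tau (g (f p.2 + p.1 • (f z - f (P.rad c z)))) = P.tau p.2 + p.1 * (1 - c) := by
    refine eventually_prod_of_pt (permInvariant_stdSimplex _)
      (R := fun r y => P.tau (g (f y + r • (f z - f (P.rad c z)))) = P.tau y + r * (1 - c)) ?_
    intro i x' hx'
    obtain ⟨j, x, h1, h2, -, h3, h4⟩ := hrep i x' hx'
    have hs : ContinuousAt (fun p : ℝ × Δ => p.2.1 + p.1 • (x.1 - x'.1)) (0, x') := by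
      have : Continuous fun p : ℝ × Δ => p.2.1 + p.1 • (x.1 - x'.1) := by fun_prop
      exact this.continuousAt
    -- A coordinate that vanishes at the dilated point vanishes at the lift of `z` too, so the
    -- translation does not leave the simplex.
    have hxx : ∀ l, x'.1 l = 0 → x.1 l = 0 := by
      intro l hl
      rw [h2] at hl
      by_cases hlj : l = j
      · subst hlj
        simp only [Pi.add_apply, Pi.single_eq_same, Pi.smul_apply, Pi.sub_apply, smul_eq_mul] at hl
        have := mul_nonneg hc0.le (x.2.1 l)
        linarith
      · simpa [hlj, hc0.ne'] using hl
    have hmem : ∀ᶠ p : ℝ × Δ in 𝓝 (0, x'), p.2.1 + p.1 • (x.1 - x'.1) ∈ Δ := by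
      refine eventually_mem_stdSimplex hs (fun p => ?_) fun l => ?_
      · simp [Finset.sum_add_distrib, ← Finset.mul_sum, Finset.sum_sub_distrib, x'.2.2, x.2.2, p.2.2.2]
      · rcases (x'.2.1 l).eq_or_lt with h0 | h0
        · right
          refine Eventually.of_forall fun p => ?_
          have := p.2.2.1 l
          simpa [← h0, hxx l h0.symm] using this
        · left
          simpa using h0
    have hchart' : {q : Δ | g (f (P.pt _ i q)) = P.pt _ i q} ∈ 𝓝 x' := by
      have := hchart.1
      rw [← hx'] at this
      filter_upwards [(continuous_pt i).continuousAt.eventually this] with q hq using hq.2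
    filter_upwards [hmem, IsSel.translation h3.1 h3.2,
      eventually_all.2 fun l => IsSel.translation (h4 l).1 (h4 l).2,
      eventually_mk_mem hs (by simp) hchart'] with p h5 h6 h7 h8
    have e1 : f (P.pt _ i ⟨_, h5⟩) = f (P.pt _ i p.2) + p.1 • (f z - f (P.rad c z)) := by
      funext l
      have := h7 l ⟨_, h5⟩ rfl
      rw [h1, hx'] at this
      simpa using this
    have e2 := h6 ⟨_, h5⟩ rfl
    have e3 : P.tau (P.rad c z) = c := by rw [tau_rad hc0.le ht1 ht2, hz, mul_one]
    rw [h1, hx', hz, e3] at e2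
    rw [← e1, show g (f (P.pt _ i ⟨_, h5⟩)) = _ from h8 h5, e2]
  -- The factor `(1 - c)⁻¹` normalizes the growth of `tau` to unit speed.
  refine ⟨c, hc0, hc1, hchart, (1 - c)⁻¹ • (f z - f (P.rad c z)), ?_⟩
  have hc2 : (1 - c) ≠ 0 := by linarith
  have hlim : Tendsto (fun p : ℝ × (Fin n → ℝ) => (p.1 * (1 - c)⁻¹, g p.2)) (𝓝 (0, f (P.rad c z)))
      (𝓝 (0, P.rad c z)) := by
    have h1 : ContinuousAt (fun p : ℝ × (Fin n → ℝ) => (p.1 * (1 - c)⁻¹, g p.2)) (0, f (P.rad c z)) :=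
      ((continuous_fst.mul continuous_const).continuousAt).prodMk
        (ContinuousAt.comp (x := ((0 : ℝ), f (P.rad c z))) hchart.symm.isPLMapAt.1 continuous_snd.continuousAt)
    convert! h1.tendsto using 2
    rw [zero_mul, hchart.left_inv]
  filter_upwards [hlim.eventually hmain, (continuous_snd.continuousAt (x := ((0 : ℝ), f (P.rad c z)))).eventually
    hchart.2] with p h1 h2
  rw [h2.2, mul_assoc, inv_mul_cancel₀ hc2, mul_one] at h1
  rw [smul_smul]
  exact h1

variable [NeZero n]

/-- The shear is available at `P.rad c z` rather than at `z`; precomposing with `P.rad c` brings it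
back. There `tau (rad c u) - c = c * (tau u - 1)`, which explains the constant. -/
theorem exists_isPLChart_tau {z : P.Space} (hz : P.tau z = 1)
    {f : P.Space → Fin n → ℝ} {g : (Fin n → ℝ) → P.Space} (h : IsPLChart f g z) :
    ∃ e r, IsPLChart (e : P.Space → Fin n → ℝ) r z ∧ ∃ c : ℝ, 0 < c ∧
      ∀ᶠ u in 𝓝 z, e u 0 = c * (P.tau u - 1) := by
  obtain ⟨c, hc0, hc1, hch, w, hw⟩ := exists_isPLChart_translation hz h
  have hg1 := one_lt_starRadius (K := Fin (n + 1))
  have ht1 : P.tau z < starRadius (Fin (n + 1)) := by rwa [hz]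
  have ht2 : c * P.tau z < starRadius (Fin (n + 1)) := by rw [hz]; linarith
  have hF : IsSel id (fun a => P.tau (g a)) (f (P.rad c z)) :=
    plAt_iff_isSel.1 (hch.symm.isPLMapAt.2 P.tau (plAt_tau _))
  obtain ⟨f', g', h1, h2⟩ := exists_isPLChart_shear hF hw
  refine ⟨_, _, (h1.comp hch).comp (isPLChart_rad hc0 ht1 ht2), c, hc0, ?_⟩
  have hrc := (isPLChart_rad (P := P) hc0 ht1 ht2).isPLMapAt.1
  filter_upwards [hrc.eventually hch.1, continuous_tau.continuousAt.eventually (Iio_mem_nhds ht1),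
    (continuous_const.mul continuous_tau).continuousAt.eventually (Iio_mem_nhds ht2)] with u h3 h4 h5
  rw [h2, h3.2, tau_rad hc0.le h4 h5, hch.left_inv, tau_rad hc0.le ht1 ht2, hz]
  ring

theorem exists_isPLChart_halfSpace {y : P.TruncatedSpace} (hy : P.tau (P.trunc y) = 1)
    {f : P.Space → Fin n → ℝ} {g : (Fin n → ℝ) → P.Space} (h : IsPLChart f g (P.trunc y)) :
    ∃ e r, IsPLChart (e : P.TruncatedSpace → PLHalfSpace n) r y ∧ (e y).1 0 = 0 := by
  obtain ⟨e, r, h1, c, hc, h2⟩ := exists_isPLChart_tau hy h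
  have h0 : e (P.trunc y) 0 = 0 := by rw [h2.self_of_nhds, hy, sub_self, mul_zero]
  obtain ⟨e', r', h3, h4⟩ := h1.restrict isPLEmbedding_trunc
    (isPLEmbedding_val fun x : Fin n → ℝ => 0 ≤ x 0) (b := ⟨e (P.trunc y), h0.ge⟩) rfl (by
      filter_upwards [h2] with u hu
      rw [range_trunc, Subtype.range_coe_subtype]
      change 1 ≤ P.tau u ↔ 0 ≤ e u 0
      rw [hu, mul_nonneg_iff_of_pos_left hc, sub_nonneg])
  exact ⟨e', r', h3, by rw [h4]; exact h0⟩

end FacePairing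

/-! ### Manifolds in terms of charts -/

section Manifolds

variable {Y Z : Type*} [TopologicalSpace Y] [PLStructure Y] [TopologicalSpace Z] [PLStructure Z]

theorem exists_isPLLocalHomeo_iff {y : Y} :
    (∃ e : OpenPartialHomeomorph Y Z, y ∈ e.source ∧ IsPLLocalHomeo e) ↔
      ∃ (f : Y → Z) (g : Z → Y), IsPLChart f g y := by
  constructor
  · rintro ⟨e, hy, he⟩
    exact ⟨_, _, he.isPLChart hy⟩
  · rintro ⟨f, g, h⟩
    obtain ⟨e, h1, h2, -⟩ := h.exists_isPLLocalHomeo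
    exact ⟨e, h1, h2⟩

theorem mem_plBoundary_iff {n : ℕ} [NeZero n] {y : Y} :
    y ∈ plBoundary n Y ↔ ∃ (f : Y → PLHalfSpace n) (g : PLHalfSpace n → Y), IsPLChart f g y ∧ (f y).1 0 = 0 := by
  constructor
  · rintro ⟨e, hy, he, h0⟩
    exact ⟨_, _, he.isPLChart hy, h0⟩
  · rintro ⟨f, g, h, h0⟩
    obtain ⟨e, h1, h2, h3⟩ := h.exists_isPLLocalHomeo
    exact ⟨e, h1, h2, by rw [h3, h0]⟩

theorem IsPLEmbedding.exists_isPLChart_iff {A : Type*} [TopologicalSpace A] [PLStructure A] {i : A → Y}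
    (hi : IsPLEmbedding i) {a : A} (h : range i ∈ 𝓝 (i a)) :
    (∃ (f : A → Z) (g : Z → A), IsPLChart f g a) ↔ ∃ (f : Y → Z) (g : Z → Y), IsPLChart f g (i a) := by
  obtain ⟨r, hr⟩ := hi.exists_isPLChart h
  constructor
  · rintro ⟨f, g, hf⟩
    rw [← hr.left_inv] at hf
    exact ⟨_, _, hf.comp hr.symm⟩
  · rintro ⟨f, g, hf⟩
    exact ⟨_, _, hf.comp hr⟩

theorem PLHomeomorphic.exists_isPLChart (h : PLHomeomorphic Y Z) (y : Y) :
    ∃ z : Z, ∃ f g, IsPLChart (f : Y → Z) g y ∧ f y = z := by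
  obtain ⟨h, h1, h2⟩ := h
  exact ⟨h y, h, h.symm, ⟨Eventually.of_forall fun u => ⟨h1 u, h.symm_apply_apply u⟩,
    Eventually.of_forall fun u => ⟨h2 u, h.apply_symm_apply u⟩⟩, rfl⟩

theorem isPLMapAt_add_const {m : ℕ} (v a : Fin m → ℝ) : IsPLMapAt (fun x => x + v) a :=
  isPLMapAt_pi fun l => (IsSel.coord (j := id) continuous_id l a).add (IsSel.const (v l) a)

theorem isPLChart_add_const {m : ℕ} (v a : Fin m → ℝ) :
    IsPLChart (fun x => x + v) (fun x => x - v) a :=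
  ⟨Eventually.of_forall fun u => ⟨isPLMapAt_add_const v u, by simp⟩,
    Eventually.of_forall fun u => ⟨by simpa [sub_eq_add_neg] using isPLMapAt_add_const (-v) u, by simp⟩⟩

theorem halfSpace_mem_nhds {n : ℕ} [NeZero n] {x : Fin n → ℝ} (h : 0 < x 0) :
    range (Subtype.val : PLHalfSpace n → Fin n → ℝ) ∈ 𝓝 x := by
  rw [Subtype.range_coe_subtype]
  filter_upwards [(continuous_apply (0 : Fin n)).continuousAt.eventually (Ioi_mem_nhds h)] with v hv
  exact le_of_lt hv

theorem exists_isPLChart_of_halfSpace {n : ℕ} [NeZero n] {f : Y → PLHalfSpace n}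
    {g : PLHalfSpace n → Y} {y : Y} (h : IsPLChart f g y) (h0 : 0 < (f y).1 0) :
    ∃ (f : Y → Fin n → ℝ) (g : (Fin n → ℝ) → Y), IsPLChart f g y := by
  obtain ⟨r, hr⟩ := (isPLEmbedding_val fun x : Fin n → ℝ => 0 ≤ x 0).exists_isPLChart
    (a := f y) (halfSpace_mem_nhds h0)
  exact ⟨_, _, hr.comp h⟩

theorem exists_isPLChart_halfSpace_of_euclidean {n : ℕ} [NeZero n] {f : Y → Fin n → ℝ}
    {g : (Fin n → ℝ) → Y} {y : Y} (h : IsPLChart f g y) :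
    ∃ (f : Y → PLHalfSpace n) (g : PLHalfSpace n → Y), IsPLChart f g y := by
  let b : PLHalfSpace n := ⟨1, zero_le_one⟩
  obtain ⟨r, hr⟩ := (isPLEmbedding_val fun x : Fin n → ℝ => 0 ≤ x 0).exists_isPLChart
    (a := b) (halfSpace_mem_nhds zero_lt_one)
  have h1 := (isPLChart_add_const (1 - f y) (f y)).comp h
  have h2 : IsPLChart r Subtype.val (f y + (1 - f y)) := by
    rw [add_sub_cancel]
    exact hr.symm
  exact ⟨_, _, IsPLChart.comp (f := fun u => f u + (1 - f y)) h2 h1⟩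

end Manifolds

/-! ### The interior of the truncated space -/

namespace FacePairing

variable {k n : ℕ} {P : FacePairing k n}

theorem range_trunc_mem_nhds {z : P.Space} (h : 1 < P.tau z) : range P.trunc ∈ 𝓝 z := by
  rw [range_trunc]
  filter_upwards [continuous_tau.continuousAt.eventually (Ioi_mem_nhds h)] with u hu using le_of_lt hu

theorem compl_vertices_eq : (P.verticesᶜ : Set P.Space) = {z | 0 < P.tau z} := by
  ext z
  exact tau_pos_iff.symm

theorem compl_vertices_mem_nhds (z : P.PuncturedSpace) :
    range (Subtype.val : P.PuncturedSpace → P.Space) ∈ 𝓝 z.1 := by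
  rw [Subtype.range_coe]
  exact (compl_vertices_eq (P := P) ▸ isOpen_lt continuous_const continuous_tau).mem_nhds z.2

theorem isPLManifold_puncturedSpace_iff : IsPLManifold n P.PuncturedSpace ↔
    ∀ z : P.Space, 0 < P.tau z → ∃ (f : P.Space → Fin n → ℝ) (g : (Fin n → ℝ) → P.Space),
      IsPLChart f g z := by
  have key : ∀ z : P.PuncturedSpace, (∃ e : OpenPartialHomeomorph P.PuncturedSpace (Fin n → ℝ),
      z ∈ e.source ∧ IsPLLocalHomeo e) ↔ ∃ (f : P.Space → Fin n → ℝ) (g : (Fin n → ℝ) → P.Space),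
      IsPLChart f g z.1 := fun z =>
    exists_isPLLocalHomeo_iff.trans
      ((isPLEmbedding_val fun z => z ∈ P.verticesᶜ).exists_isPLChart_iff (compl_vertices_mem_nhds z))
  constructor
  · rintro ⟨-, -, h⟩ z hz
    exact (key ⟨z, tau_pos_iff.1 hz⟩).1 (h _)
  · intro h
    exact ⟨inferInstance, inferInstance, fun z => (key z).2 (h z (tau_pos_iff.2 z.2))⟩

/-- Within a simplex, move straight to a vertex. The interior of a segment that starts at a point
other than a vertex contains no vertex, so the path stays in `X^*` until its end. -/
theorem exists_small_tau_mem_connectedComponent [NeZero n] (z : P.PuncturedSpace) {ε : ℝ} (hε : 0 < ε) :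
    ∃ u ∈ connectedComponent z, P.tau u.1 < ε := by
  obtain ⟨i, x, hx⟩ := pt_surjective z.1
  have hne : ∀ m, x.1 ≠ Pi.single m 1 := by
    intro m hm
    apply z.2
    rw [← hx]
    exact ⟨(i, m), congrArg (P.pt _ i) (Subtype.ext hm.symm)⟩
  have hseg : ∀ s ∈ Icc (0 : ℝ) 1, (1 - s) • x.1 + s • Pi.single 0 1 ∈ stdSimplex ℝ (Fin (n + 1)) :=
    fun s hs => convex_stdSimplex ℝ _ x.2 (single_mem_stdSimplex ℝ 0) (by linarith [hs.2]) hs.1 (by ring)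
  let c : Icc (0 : ℝ) 1 → P.Space := fun s => P.pt _ i ⟨_, hseg s.1 s.2⟩
  have hcc : Continuous c := by
    refine (continuous_pt i).comp (Continuous.subtype_mk ?_ _)
    fun_prop
  have hcv : ∀ s : Icc (0 : ℝ) 1, s.1 < 1 → c s ∈ P.verticesᶜ := by
    intro s hs
    rw [mem_compl_iff, ← tau_eq_zero_iff, tau_pt]
    intro h0
    obtain ⟨m, hm⟩ := minGam_lt_iff.1 (h0.trans_lt starRadius_pos)
    rw [minGam_eq (hseg s.1 s.2) hm, gam_eq_zero_iff (hseg s.1 s.2)] at h0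
    refine hne m (funext fun l => ?_)
    have hl : ∀ l, l ≠ m → x.1 l = 0 := by
      intro l hl
      have h1 := congrFun h0 l
      simp only [Pi.add_apply, Pi.smul_apply, smul_eq_mul, Pi.single_apply, hl, if_false] at h1
      have h2 := mul_nonneg (sub_nonneg.2 hs.le) (x.2.1 l)
      have h3 : 0 ≤ s.1 * (if l = 0 then (1 : ℝ) else 0) := mul_nonneg s.2.1 (by split_ifs <;> norm_num)
      have h4 : (1 - s.1) * x.1 l = 0 := by linarith
      exact (mul_eq_zero.1 h4).resolve_left (by linarith)
    by_cases h : l = m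
    · subst h
      rw [Pi.single_eq_same, ← x.2.2, Finset.sum_eq_single_of_mem l (Finset.mem_univ l) fun b _ => hl b]
    · rw [hl l h, Pi.single_eq_of_ne h]
  let d : Ico (0 : ℝ) 1 → P.PuncturedSpace := fun s => ⟨c ⟨s.1, Ico_subset_Icc_self s.2⟩, hcv _ s.2.2⟩
  have hd : Continuous d := by
    refine Continuous.subtype_mk (hcc.comp (Continuous.subtype_mk continuous_subtype_val _)) _
  have hconn : range d ⊆ connectedComponent z := by
    have : PreconnectedSpace (Ico (0 : ℝ) 1) := Subtype.preconnectedSpace isPreconnected_Ico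
    refine (isPreconnected_range hd).subset_connectedComponent ⟨⟨0, by simp⟩, Subtype.ext ?_⟩
    simp [d, c, hx]
  have h1 : P.tau (c 1) < ε := by
    have : P.tau (c 1) = 0 := by
      rw [tau_eq_zero_iff]
      refine ⟨(i, 0), congrArg (P.pt _ i) (Subtype.ext ?_)⟩
      simp
    rwa [this]
  have h2 : ∀ᶠ s in 𝓝[<] (1 : ℝ), ∀ hs : s ∈ Icc (0 : ℝ) 1, P.tau (c ⟨s, hs⟩) < ε := by
    have h3 := (continuous_tau.comp hcc).continuousAt.eventually (Iio_mem_nhds h1)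
    rw [nhds_subtype_eq_comap, eventually_comap] at h3
    filter_upwards [nhdsWithin_le_nhds h3] with s hs hs'
    exact hs _ rfl
  obtain ⟨s, hs, hs1⟩ := (h2.and (Ico_mem_nhdsLT (zero_lt_one' ℝ))).exists
  exact ⟨d ⟨s, hs1⟩, hconn (mem_range_self _), hs _⟩

/-- On a compact component the positive function `tau` would have a positive minimum. -/
theorem not_isCompact_connectedComponent [NeZero n] (z : P.PuncturedSpace) :
    ¬IsCompact (connectedComponent z) := by
  intro h
  obtain ⟨u, -, hu⟩ := h.exists_isMinOn ⟨z, mem_connectedComponent⟩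
    (continuous_tau.comp continuous_subtype_val).continuousOn
  obtain ⟨v, hv, hv'⟩ := exists_small_tau_mem_connectedComponent z (tau_pos_iff.2 u.2)
  exact absurd (hu hv) (not_le.2 hv')

theorem isOpenPLManifold_puncturedSpace_iff [NeZero n] :
    IsOpenPLManifold n P.PuncturedSpace ↔ IsPLManifold n P.PuncturedSpace :=
  and_iff_left not_isCompact_connectedComponent

variable [NeZero n]

/-- There are no boundary points where `tau > 1`, so half-space charts can be turned into Euclidean
ones there; the push-off carries this to all of `X^*`. -/
theorem isPLManifold_puncturedSpace_of_truncatedSpace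
    (h : IsCompactPLManifoldWithBoundary n P.TruncatedSpace) : IsPLManifold n P.PuncturedSpace := by
  have hin : ∀ z : P.Space, 1 < P.tau z → ∃ (f : P.Space → Fin n → ℝ) (g : (Fin n → ℝ) → P.Space),
      IsPLChart f g z := by
    intro z hz
    obtain ⟨y, rfl⟩ := exists_trunc_eq hz.le
    rw [← isPLEmbedding_trunc.exists_isPLChart_iff (range_trunc_mem_nhds hz)]
    obtain ⟨f, g, hf⟩ := exists_isPLLocalHomeo_iff.1 (h.2.2.2 y)
    refine exists_isPLChart_of_halfSpace hf ((f y).2.lt_of_ne fun h0 => ?_)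
    exact notMem_plBoundary hz (mem_plBoundary_iff.2 ⟨f, g, hf, h0.symm⟩)
  let B : Type := {z : P.Space // 1 < P.tau z}
  have hΦ : PLHomeomorphic P.PuncturedSpace B := plHomeomorphic_puncturedSpace
    (isPLEmbedding_val fun z => 1 < P.tau z) Subtype.range_coe_subtype
  refine ⟨inferInstance, inferInstance, fun z => exists_isPLLocalHomeo_iff.2 ?_⟩
  obtain ⟨b, f, g, hf, rfl⟩ := hΦ.exists_isPLChart z
  have hb : range (Subtype.val : B → P.Space) ∈ 𝓝 (f z).1 := by
    rw [Subtype.range_coe_subtype]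
    exact (isOpen_lt continuous_const continuous_tau).mem_nhds (f z).2
  obtain ⟨f', g', hf'⟩ := ((isPLEmbedding_val fun z => 1 < P.tau z).exists_isPLChart_iff hb).2
    (hin (f z).1 (f z).2)
  exact ⟨_, _, hf'.comp hf⟩

/-- Where `tau > 1` a chart of `X^*` restricts; where `tau = 1` the collar provides a half-space
chart. -/
theorem isCompactPLManifoldWithBoundary_truncatedSpace
    (h : IsPLManifold n P.PuncturedSpace) : IsCompactPLManifoldWithBoundary n P.TruncatedSpace := by
  rw [isPLManifold_puncturedSpace_iff] at h
  refine ⟨inferInstance, inferInstance, inferInstance, fun y => exists_isPLLocalHomeo_iff.2 ?_⟩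
  have h1 := one_le_tau_trunc y
  obtain ⟨f, g, hf⟩ := h _ (one_pos.trans_le h1)
  rcases h1.eq_or_lt with h1 | h1
  · obtain ⟨e, r, he, -⟩ := exists_isPLChart_halfSpace h1.symm hf
    exact ⟨e, r, he⟩
  · obtain ⟨f', g', hf'⟩ := (isPLEmbedding_trunc.exists_isPLChart_iff (range_trunc_mem_nhds h1)).2
      ⟨f, g, hf⟩
    exact exists_isPLChart_halfSpace_of_euclidean hf'

theorem plBoundary_truncatedSpace (h : IsPLManifold n P.PuncturedSpace) :
    plBoundary n P.TruncatedSpace = {y | P.tau (P.trunc y) = 1} := by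
  ext y
  constructor
  · intro hy
    by_contra h1
    exact notMem_plBoundary ((one_le_tau_trunc y).lt_of_ne (Ne.symm h1)) hy
  · intro (hy : P.tau (P.trunc y) = 1)
    obtain ⟨f, g, hf⟩ := isPLManifold_puncturedSpace_iff.1 h (P.trunc y) (by rw [hy]; exact one_pos)
    exact mem_plBoundary_iff.2 (exists_isPLChart_halfSpace hy hf)

theorem isPLManifold_puncturedSpace_iff_truncatedSpace : IsPLManifold n P.PuncturedSpace ↔
    IsCompactPLManifoldWithBoundary n P.TruncatedSpace :=
  ⟨isCompactPLManifoldWithBoundary_truncatedSpace, isPLManifold_puncturedSpace_of_truncatedSpace⟩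

theorem plHomeomorphic_compl_plBoundary (h : IsPLManifold n P.PuncturedSpace) :
    PLHomeomorphic P.PuncturedSpace ↥(plBoundary n P.TruncatedSpace)ᶜ := by
  refine plHomeomorphic_puncturedSpace (isPLEmbedding_trunc.comp
    (isPLEmbedding_val fun y => y ∈ (plBoundary n P.TruncatedSpace)ᶜ)) ?_
  rw [plBoundary_truncatedSpace h]
  ext z
  constructor
  · rintro ⟨y, rfl⟩
    exact (one_le_tau_trunc y.1).lt_of_ne (Ne.symm y.2)
  · intro (hz : 1 < P.tau z)
    obtain ⟨y, rfl⟩ := exists_trunc_eq hz.le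
    exact ⟨⟨y, fun h => hz.ne h.symm⟩, rfl⟩

end FacePairing

/-! ### Complete simplicial fans -/

/-- A complete simplicial fan in `ℝ^m`, given by generators `vec` of its rays, the coefficients
`coord` of a point with respect to the generators of the cone that contains it, and the set `Adm`
of the vectors of coefficients whose support spans a cone. -/
structure SimplicialFan (m : ℕ) where
  Ray : Type
  [fintype : Fintype Ray]
  vec : Ray → Fin m → ℝ
  coord : (Fin m → ℝ) → Ray → ℝ
  Adm : Set (Ray → ℝ)
  nonneg : ∀ d ∈ Adm, ∀ x, 0 ≤ d x
  mem_of_support : ∀ d ∈ Adm, ∀ d' : Ray → ℝ, (∀ x, 0 ≤ d' x) → (∀ x, d x = 0 → d' x = 0) → d' ∈ Adm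
  coord_mem : ∀ y, coord y ∈ Adm
  sum_coord : ∀ y, ∑ x, coord y x • vec x = y
  coord_sum : ∀ d ∈ Adm, coord (∑ x, d x • vec x) = d
  isSel_coord : ∀ x y, IsSel id (fun y => coord y x) y

namespace SimplicialFan

attribute [instance] SimplicialFan.fintype

variable {m : ℕ}

/-- The least of `0` and the coordinates. -/
noncomputable def minCoord (y : Fin m → ℝ) : ℝ := Finset.univ.fold min 0 y

theorem le_minCoord_iff {y : Fin m → ℝ} {c : ℝ} : c ≤ minCoord y ↔ c ≤ 0 ∧ ∀ l, c ≤ y l := by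
  simp [minCoord, Finset.le_fold_min]

theorem minCoord_le_zero (y : Fin m → ℝ) : minCoord y ≤ 0 := (le_minCoord_iff.1 le_rfl).1

theorem minCoord_le (y : Fin m → ℝ) (l : Fin m) : minCoord y ≤ y l := (le_minCoord_iff.1 le_rfl).2 l

theorem minCoord_eq (y : Fin m → ℝ) : minCoord y = 0 ∨ ∃ l, minCoord y = y l := by
  by_contra! h
  have h1 : ∀ l, minCoord y < y l := fun l => (minCoord_le y l).lt_of_ne (h.2 l)
  have h0 := (minCoord_le_zero y).lt_of_ne h.1
  have : minCoord y < minCoord y := by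
    rw [minCoord, Finset.lt_fold_min]
    exact ⟨h0, fun l _ => h1 l⟩
  exact lt_irrefl _ this

/-- The linear map which sends the vertices of the standard simplex to the generators of the
standard fan. -/
def stdVec (d : Fin (m + 1) → ℝ) : Fin m → ℝ := fun l => d l.succ - d 0

/-- The coordinates for the standard fan. -/
noncomputable def stdCoord (y : Fin m → ℝ) : Fin (m + 1) → ℝ :=
  Fin.cons (-minCoord y) fun l => y l - minCoord y

theorem stdCoord_nonneg (y : Fin m → ℝ) (j : Fin (m + 1)) : 0 ≤ stdCoord y j := by
  refine Fin.cases ?_ (fun l => ?_) j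
  · simpa [stdCoord] using minCoord_le_zero y
  · simpa [stdCoord] using minCoord_le y l

theorem exists_stdCoord_eq_zero (y : Fin m → ℝ) : ∃ j, stdCoord y j = 0 := by
  rcases minCoord_eq y with h | ⟨l, h⟩
  · exact ⟨0, by simp [stdCoord, h]⟩
  · exact ⟨l.succ, by simp [stdCoord, h]⟩

theorem stdVec_stdCoord (y : Fin m → ℝ) : stdVec (stdCoord y) = y := by
  funext l
  simp [stdVec, stdCoord]

theorem stdCoord_stdVec {d : Fin (m + 1) → ℝ} (h : ∀ j, 0 ≤ d j) (h0 : ∃ j, d j = 0) :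
    stdCoord (stdVec d) = d := by
  have : minCoord (stdVec d) = -d 0 := by
    refine le_antisymm ?_ (le_minCoord_iff.2 ⟨neg_nonpos.2 (h 0), fun l => ?_⟩)
    · obtain ⟨j, hj⟩ := h0
      rcases Fin.eq_zero_or_eq_succ j with rfl | ⟨l, rfl⟩
      · rw [hj, neg_zero]
        exact minCoord_le_zero _
      · have := minCoord_le (stdVec d) l
        simpa [stdVec, hj] using this
    · have := h l.succ
      simp only [stdVec]
      linarith
  funext j
  refine Fin.cases ?_ (fun l => ?_) j
  · simp [stdCoord, this]
  · simp [stdCoord, this, stdVec]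

theorem isSel_minCoord (y : Fin m → ℝ) : IsSel id (minCoord : (Fin m → ℝ) → ℝ) y :=
  IsSel.fold_min _ (IsSel.const 0 y) fun l _ => IsSel.coord (j := id) continuous_id l y

theorem isSel_stdCoord (j : Fin (m + 1)) (y : Fin m → ℝ) : IsSel id (fun y => stdCoord y j) y := by
  refine Fin.cases ?_ (fun l => ?_) j
  · simpa [stdCoord] using (isSel_minCoord y).neg
  · simpa [stdCoord] using (IsSel.coord (j := id) continuous_id l y).sub (isSel_minCoord y)

theorem stdVec_eq_sum (d : Fin (m + 1) → ℝ) :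
    stdVec d = ∑ j, d j • stdVec (Pi.single j 1 : Fin (m + 1) → ℝ) := by
  funext l
  simp only [Finset.sum_apply, Pi.smul_apply, smul_eq_mul, stdVec, mul_sub, Finset.sum_sub_distrib]
  congr 1 <;> simp [Pi.single_apply]

variable (m) in
/-- The fan whose generators are the unit vectors and the negative of their sum. -/
noncomputable def standard : SimplicialFan m where
  Ray := Fin (m + 1)
  vec j := stdVec (Pi.single j 1)
  coord := stdCoord
  Adm := {d | (∀ j, 0 ≤ d j) ∧ ∃ j, d j = 0}
  nonneg _ hd := hd.1
  mem_of_support d hd d' h h' := ⟨h, hd.2.imp h'⟩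
  coord_mem y := ⟨stdCoord_nonneg y, exists_stdCoord_eq_zero y⟩
  sum_coord y := by rw [← stdVec_eq_sum, stdVec_stdCoord]
  coord_sum d hd := by rw [← stdVec_eq_sum, stdCoord_stdVec hd.1 hd.2]
  isSel_coord := isSel_stdCoord

variable (T : SimplicialFan m)

/-! ### Stellar subdivision of a fan. -/

section Stellar

variable {T} {u w : T.Ray} {p q : ℝ}

open Classical in
/-- The coefficients of the new generator of a stellar subdivision. -/
noncomputable def stellarCoeff (u w : T.Ray) (p q : ℝ) (x : T.Ray) : ℝ :=
  if x = u then p else if x = w then q else 0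

theorem sum_stellarCoeff {V : Type*} [AddCommGroup V] [Module ℝ V] (huw : u ≠ w) (f : T.Ray → V) :
    ∑ x, stellarCoeff u w p q x • f x = p • f u + q • f w := by
  classical
  have : ∀ x, stellarCoeff u w p q x • f x =
      (if x = u then p • f x else 0) + if x = w then q • f x else 0 := by
    intro x
    unfold stellarCoeff
    split_ifs with h1 h2
    · exact absurd (h1.symm.trans h2) huw
    all_goals simp
  simp [this, Finset.sum_add_distrib]

theorem stellarCoeff_left : stellarCoeff u w p q u = p := by simp [stellarCoeff]

theorem stellarCoeff_right (huw : u ≠ w) : stellarCoeff u w p q w = q := by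
  simp [stellarCoeff, huw.symm]

theorem stellarCoeff_nonneg (hp : 0 < p) (hq : 0 < q) (x : T.Ray) : 0 ≤ stellarCoeff u w p q x := by
  unfold stellarCoeff
  split_ifs <;> linarith

theorem stellarCoeff_mul_le (hp : 0 < p) (hq : 0 < q) {d : T.Ray → ℝ} (hd : ∀ x, 0 ≤ d x) (x : T.Ray) :
    stellarCoeff u w p q x * min (d u / p) (d w / q) ≤ d x := by
  unfold stellarCoeff
  split_ifs with h1 h2
  · subst h1
    have := mul_le_mul_of_nonneg_left (min_le_left (d x / p) (d w / q)) hp.le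
    rwa [mul_div_cancel₀ _ hp.ne'] at this
  · subst h2
    have := mul_le_mul_of_nonneg_left (min_le_right (d u / p) (d x / q)) hq.le
    rwa [mul_div_cancel₀ _ hq.ne'] at this
  · rw [zero_mul]
    exact hd x

variable (T) in
/-- The stellar subdivision of a fan with the new generator `p • vec u + q • vec w`. -/
noncomputable def stellar {u w : T.Ray} (huw : u ≠ w) {p q : ℝ} (hp : 0 < p) (hq : 0 < q) :
    SimplicialFan m where
  Ray := Option T.Ray
  vec x := x.elim (p • T.vec u + q • T.vec w) T.vec
  -- The new generator receives the largest multiple that can be split off from the coefficients of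
  -- `u` and `w`.
  coord y x := x.elim (min (T.coord y u / p) (T.coord y w / q)) fun x =>
    T.coord y x - stellarCoeff u w p q x * min (T.coord y u / p) (T.coord y w / q)
  -- The rays `u` and `w` no longer span a common cone, and rewriting the new generator in terms of
  -- them must give admissible coefficients of the old fan.
  Adm := {d | (∀ x, 0 ≤ d x) ∧ (d (some u) = 0 ∨ d (some w) = 0) ∧
    (fun x => d (some x) + stellarCoeff u w p q x * d none) ∈ T.Adm}
  nonneg _ hd := hd.1
  mem_of_support d hd d' h h' := by
    refine ⟨h, hd.2.1.imp (h' _) (h' _), T.mem_of_support _ hd.2.2 _ (fun x =>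
      add_nonneg (h _) (mul_nonneg (stellarCoeff_nonneg hp hq x) (h _))) fun x hx => ?_⟩
    have h1 := mul_nonneg (stellarCoeff_nonneg (u := u) (w := w) hp hq x) (hd.1 none)
    have h2 := hd.1 (some x)
    rw [h' (some x) (by linarith), zero_add, mul_eq_zero]
    have h3 : stellarCoeff u w p q x * d none = 0 := by linarith
    exact (mul_eq_zero.1 h3).imp_right (h' _)
  coord_mem y := by
    have h0 := T.nonneg _ (T.coord_mem y)
    refine ⟨fun x => ?_, ?_, ?_⟩
    · cases x with
      | none => exact le_min (div_nonneg (h0 u) hp.le) (div_nonneg (h0 w) hq.le)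
      | some x => exact sub_nonneg.2 (stellarCoeff_mul_le hp hq h0 x)
    · change T.coord y u - _ = 0 ∨ T.coord y w - _ = 0
      rw [stellarCoeff_left, stellarCoeff_right huw]
      rcases min_choice (T.coord y u / p) (T.coord y w / q) with h | h
      · left; rw [h, mul_div_cancel₀ _ hp.ne', sub_self]
      · right; rw [h, mul_div_cancel₀ _ hq.ne', sub_self]
    · convert! T.coord_mem y using 1
      funext x
      simp
  sum_coord y := by
    rw [Fintype.sum_option]
    simp only [Option.elim, sub_smul, Finset.sum_sub_distrib, T.sum_coord, mul_comm _ (min _ _),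
      ← smul_smul, ← Finset.smul_sum, sum_stellarCoeff huw]
    simp
  coord_sum d hd := by
    have h1 : ∑ x, d x • (x.elim (p • T.vec u + q • T.vec w) T.vec : Fin m → ℝ) =
        ∑ x, (d (some x) + stellarCoeff u w p q x * d none) • T.vec x := by
      rw [Fintype.sum_option]
      simp only [Option.elim, add_smul, Finset.sum_add_distrib, mul_comm _ (d none),
        ← smul_smul, ← Finset.smul_sum, sum_stellarCoeff huw]
      rw [add_comm]
    have h2 := T.coord_sum _ hd.2.2
    rw [h1]
    have h3 : min (T.coord (∑ x, (d (some x) + stellarCoeff u w p q x * d none) • T.vec x) u / p)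
        (T.coord (∑ x, (d (some x) + stellarCoeff u w p q x * d none) • T.vec x) w / q) = d none := by
      rw [h2]
      beta_reduce
      rw [stellarCoeff_left, stellarCoeff_right huw, add_div, add_div,
        mul_div_cancel_left₀ _ hp.ne', mul_div_cancel_left₀ _ hq.ne', min_add_add_right]
      have h4 : 0 ≤ d (some u) / p := div_nonneg (hd.1 _) hp.le
      have h5 : 0 ≤ d (some w) / q := div_nonneg (hd.1 _) hq.le
      rcases hd.2.1 with h | h
      · rw [h, zero_div, min_eq_left h5, zero_add]
      · rw [h, zero_div, min_eq_right h4, zero_add]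
    funext x
    cases x with
    | none => exact h3
    | some x =>
      change T.coord _ x - stellarCoeff u w p q x * min _ _ = d (some x)
      rw [h3, h2, add_sub_cancel_right]
  isSel_coord x y := by
    have h1 : IsSel id (fun y => min (T.coord y u / p) (T.coord y w / q)) y := by
      simp only [div_eq_mul_inv]
      exact ((T.isSel_coord u y).mul_const _).min ((T.isSel_coord w y).mul_const _)
    cases x with
    | none => exact h1
    | some x => exact (T.isSel_coord x y).sub (h1.const_mul _)

end Stellar

/-- No cone of the fan meets both open half-spaces defined by `a`. -/
def NonCrossing (a : (Fin m → ℝ) →ₗ[ℝ] ℝ) : Prop :=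
  ∀ d ∈ T.Adm, ∀ x y, d x ≠ 0 → d y ≠ 0 → 0 ≤ a (T.vec x) * a (T.vec y)

/-- Every cone of the subdivision lies in a cone of `T`, and the new generator is a positive
combination of generators of that cone. So later subdivisions do not spoil what has been achieved
for other functionals. -/
theorem NonCrossing.stellar {T : SimplicialFan m} {a : (Fin m → ℝ) →ₗ[ℝ] ℝ} (h : T.NonCrossing a)
    {u w : T.Ray} (huw : u ≠ w) {p q : ℝ} (hp : 0 < p) (hq : 0 < q) :
    (T.stellar huw hp hq).NonCrossing a := by
  rintro d ⟨h0, -, hd⟩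
  have key : ∀ x, d (some x) ≠ 0 ∨ (d none ≠ 0 ∧ (x = u ∨ x = w)) →
      d (some x) + stellarCoeff u w p q x * d none ≠ 0 := by
    rintro x hx hx'
    have h1 := mul_nonneg (stellarCoeff_nonneg (u := u) (w := w) hp hq x) (h0 none)
    have h2 := h0 (some x)
    rcases hx with hx | ⟨hn, hx⟩
    · exact hx (by linarith)
    · have h3 : stellarCoeff u w p q x * d none = 0 := by linarith
      rcases (mul_eq_zero.1 h3).resolve_right hn with h4
      rcases hx with rfl | rfl
      · rw [stellarCoeff_left] at h4; exact hp.ne' h4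
      · rw [stellarCoeff_right huw] at h4; exact hq.ne' h4
  have hnone : a (p • T.vec u + q • T.vec w) = p * a (T.vec u) + q * a (T.vec w) := by simp
  have hmix : ∀ y : T.Ray, d none ≠ 0 → d (some y) ≠ 0 →
      0 ≤ a (p • T.vec u + q • T.vec w) * a (T.vec y) := by
    intro y hn hy
    have h1 := h _ hd u y (key u (Or.inr ⟨hn, Or.inl rfl⟩)) (key y (Or.inl hy))
    have h2 := h _ hd w y (key w (Or.inr ⟨hn, Or.inr rfl⟩)) (key y (Or.inl hy))
    rw [hnone]
    have := add_nonneg (mul_nonneg hp.le h1) (mul_nonneg hq.le h2)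
    linarith
  rintro (_ | x) (_ | y) hx hy
  · exact mul_self_nonneg _
  · exact hmix y hx hy
  · rw [mul_comm]
    exact hmix x hy hx
  · exact h _ hd x y (key x (Or.inl hx)) (key y (Or.inl hy))

/-- The pairs of generators of a common cone that `a` separates. -/
def crossing (a : (Fin m → ℝ) →ₗ[ℝ] ℝ) : Set (T.Ray × T.Ray) :=
  {e | a (T.vec e.1) < 0 ∧ 0 < a (T.vec e.2) ∧ ∃ d ∈ T.Adm, d e.1 ≠ 0 ∧ d e.2 ≠ 0}

/-- Subdividing a crossing pair at a point in the kernel of `a` separates this pair, and the new ray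
belongs to no crossing pair. Thus the number of crossing pairs drops. -/
theorem exists_nonCrossing (a : (Fin m → ℝ) →ₗ[ℝ] ℝ) : ∀ (N : ℕ) (T : SimplicialFan m),
    (T.crossing a).ncard ≤ N → ∃ T' : SimplicialFan m, T'.NonCrossing a ∧
      ∀ b, T.NonCrossing b → T'.NonCrossing b := by
  intro N
  induction N with
  | zero =>
    intro T hT
    refine ⟨T, fun d hd x y hx hy => ?_, fun b hb => hb⟩
    have hT' : T.crossing a = ∅ := by
      rw [← Set.ncard_eq_zero (toFinite _)]
      omega
    by_contra! h
    rcases mul_neg_iff.1 h with h | h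
    · exact (hT' ▸ (show (y, x) ∈ T.crossing a from ⟨h.2, h.1, d, hd, hy, hx⟩) : (y, x) ∈ ∅)
    · exact (hT' ▸ (show (x, y) ∈ T.crossing a from ⟨h.1, h.2, d, hd, hx, hy⟩) : (x, y) ∈ ∅)
  | succ N ih =>
    intro T hT
    by_cases hne : (T.crossing a).Nonempty
    swap
    · refine ih T ?_
      rw [not_nonempty_iff_eq_empty.1 hne]
      simp
    obtain ⟨⟨u, w⟩, hu, hw, hd⟩ := hne
    dsimp only at hu hw hd
    have huw : u ≠ w := by
      rintro rfl
      exact lt_asymm hu hw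
    -- The coefficients `a (vec w)` of `u` and `-a (vec u)` of `w` are positive and place the new
    -- generator in the kernel of `a`.
    let T' := T.stellar huw hw (neg_pos.2 hu)
    have hnone : a (T'.vec none) = 0 := by
      change a (_ • T.vec u + _ • T.vec w) = 0
      simp only [map_add, map_smul, smul_eq_mul]
      ring
    have hsub : T'.crossing a ⊆ (fun e => (some e.1, some e.2)) '' (T.crossing a \ {(u, w)}) := by
      rintro ⟨x, y⟩ ⟨hx, hy, d, hd, hdx, hdy⟩
      cases x with
      | none => exact absurd hnone hx.ne
      | some x =>
        cases y with
        | none => exact absurd hnone hy.ne'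
        | some y =>
          have h1 : ∀ x, d (some x) ≠ 0 → d (some x) +
              stellarCoeff u w (a (T.vec w)) (-a (T.vec u)) x * d none ≠ 0 := by
            intro x hx
            have h1 := mul_nonneg (stellarCoeff_nonneg (u := u) (w := w) hw (neg_pos.2 hu) x) (hd.1 none)
            have h2 := (hd.1 (some x)).lt_of_ne (Ne.symm hx)
            exact (add_pos_of_pos_of_nonneg h2 h1).ne'
          refine ⟨(x, y), ⟨⟨hx, hy, _, hd.2.2, h1 x hdx, h1 y hdy⟩, ?_⟩, rfl⟩
          rintro h
          obtain ⟨rfl, rfl⟩ := Prod.ext_iff.1 h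
          exact hd.2.1.elim hdx hdy
    have hcard : (T'.crossing a).ncard ≤ N := by
      have h1 := (ncard_le_ncard hsub (toFinite _)).trans
        (ncard_image_le (toFinite (T.crossing a \ {(u, w)})))
      have h3 := ncard_sdiff_singleton_lt_of_mem (show (u, w) ∈ T.crossing a from ⟨hu, hw, hd⟩) (toFinite _)
      omega
    obtain ⟨T'', h1, h2⟩ := ih T' hcard
    exact ⟨T'', h1, fun b hb => h2 b (hb.stellar huw hw (neg_pos.2 hu))⟩

theorem exists_forall_nonCrossing {S : Set ((Fin m → ℝ) →ₗ[ℝ] ℝ)} (hS : S.Finite) :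
    ∃ T : SimplicialFan m, ∀ a ∈ S, T.NonCrossing a := by
  induction S, hS using Set.Finite.induction_on with
  | empty => exact ⟨standard m, by simp⟩
  | @insert a S _ _ ih =>
    obtain ⟨T, hT⟩ := ih
    obtain ⟨T', h1, h2⟩ := exists_nonCrossing a _ T le_rfl
    refine ⟨T', fun b hb => ?_⟩
    rcases hb with rfl | hb
    · exact h1
    · exact h2 b (hT b hb)

theorem NonCrossing.sum_nonneg_or {T : SimplicialFan m} {a : (Fin m → ℝ) →ₗ[ℝ] ℝ} (h : T.NonCrossing a)
    {d : T.Ray → ℝ} (hd : d ∈ T.Adm) :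
    (∀ x, d x ≠ 0 → 0 ≤ a (T.vec x)) ∨ ∀ x, d x ≠ 0 → a (T.vec x) ≤ 0 := by
  by_contra! h'
  obtain ⟨⟨x, hx, hx'⟩, y, hy, hy'⟩ := h'
  exact absurd (h d hd x y hx hy) (not_le.2 (mul_neg_of_neg_of_pos hx' hy'))

/-- A germ of a PL function at the origin is linear on the cones of a suitable fan. -/
theorem exists_linear_of_isSel {g : (Fin m → ℝ) → ℝ} (hg : IsSel id g 0) (hg0 : g 0 = 0) :
    ∃ S : Set ((Fin m → ℝ) →ₗ[ℝ] ℝ), S.Finite ∧ ∀ T : SimplicialFan m, (∀ a ∈ S, T.NonCrossing a) →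
      ∃ ε > 0, ∀ δ ∈ Ioc 0 ε, ∀ d ∈ T.Adm, (∀ x, d x ≤ δ) →
        g (∑ x, d x • T.vec x) = ∑ x, d x * (g (δ • T.vec x) / δ) := by
  obtain ⟨S, hS, h⟩ := hg
  have h' : ∀ᶠ y in 𝓝 (0 : Fin m → ℝ), ∀ a ∈ S, a 0 ≠ 0 → g y ≠ a y := by
    refine (eventually_all_finite hS).2 fun a _ => ?_
    by_cases ha : a 0 = 0
    · simp [ha]
    · have h1 : ContinuousAt (fun y => g y - a y) 0 :=
        h.self_of_nhds.1.sub (continuous_affine a).continuousAt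
      filter_upwards [h1.eventually_ne (show g 0 - a 0 ≠ 0 by rwa [hg0, zero_sub, neg_ne_zero])] with y hy _
      exact sub_ne_zero.1 hy
  -- If no cone crosses the zero set of any difference of linear parts, the candidates are ordered
  -- on each cone, as `exists_eqOn_affine` requires.
  refine ⟨(fun p => p.1.linear - p.2.linear) '' (S ×ˢ S), (hS.prod hS).image _, fun T hT => ?_⟩
  have hlim : Tendsto (fun d : T.Ray → ℝ => ∑ x, d x • T.vec x) (𝓝 0) (𝓝 0) := by
    have : Continuous fun d : T.Ray → ℝ => ∑ x, d x • T.vec x := by fun_prop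
    simpa using this.tendsto 0
  obtain ⟨ε, hε, hball⟩ := Metric.nhds_basis_closedBall.eventually_iff.1 (hlim.eventually (h.and h'))
  refine ⟨ε, hε, fun δ hδ d₀ hd₀ hle => ?_⟩
  -- The cube of coefficients of size at most `δ` in the cone supporting `d₀`. It contains `d₀` and
  -- the multiples by `δ` of the generators of that cone, where the linear function is read off.
  let D : Set (T.Ray → ℝ) := {d | ∀ x, 0 ≤ d x ∧ d x ≤ δ ∧ (d₀ x = 0 → d x = 0)}
  have hDA : ∀ d ∈ D, d ∈ T.Adm := fun d hd =>
    T.mem_of_support _ hd₀ d (fun x => (hd x).1) fun x => (hd x).2.2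
  have hDb : ∀ d ∈ D, d ∈ Metric.closedBall (0 : T.Ray → ℝ) ε := by
    intro d hd
    rw [mem_closedBall_zero_iff, pi_norm_le_iff_of_nonneg hε.le]
    intro x
    rw [Real.norm_of_nonneg (hd x).1]
    exact (hd x).2.1.trans hδ.2
  have hDconv : Convex ℝ D := by
    intro d hd d' hd' s t hs ht hst x
    refine ⟨add_nonneg (mul_nonneg hs (hd x).1) (mul_nonneg ht (hd' x).1), ?_, fun h0 => ?_⟩
    · have h1 := mul_le_mul_of_nonneg_left (hd x).2.1 hs
      have h2 := mul_le_mul_of_nonneg_left (hd' x).2.1 ht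
      calc s * d x + t * d' x ≤ s * δ + t * δ := add_le_add h1 h2
        _ = δ := by rw [← add_mul, hst, one_mul]
    · simp [(hd x).2.2 h0, (hd' x).2.2 h0]
  let L : (T.Ray → ℝ) →ₗ[ℝ] (Fin m → ℝ) := Fintype.linearCombination ℝ T.vec
  have hL : ∀ d, L d = ∑ x, d x • T.vec x := fun d => Fintype.linearCombination_apply ℝ T.vec d
  have hd₀D : d₀ ∈ D := fun x => ⟨T.nonneg _ hd₀ x, hle x, id⟩
  obtain ⟨a, ⟨-, ha⟩, haC⟩ := exists_eqOn_affine (f := g) (hDconv.linear_image L) (⟨_, d₀, hd₀D, rfl⟩)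
    (fun y hy => by
      obtain ⟨d, hd, rfl⟩ := hy
      rw [hL]
      exact (hball (hDb d hd)).1.1.continuousWithinAt)
    (hS.subset (sep_subset _ fun a => a 0 = 0))
    (fun y hy => by
      obtain ⟨d, hd, rfl⟩ := hy
      rw [hL]
      obtain ⟨⟨-, a, ha, hya⟩, h4⟩ := hball (hDb d hd)
      exact ⟨a, ⟨ha, by_contra fun h5 => h4 a ha h5 hya⟩, hya⟩)
    (by
      rintro a ⟨ha, ha0⟩ b ⟨hb, hb0⟩
      have e : ∀ d, a (L d) - b (L d) = ∑ x, d x * (a.linear - b.linear) (T.vec x) := by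
        intro d
        have e1 : ∀ c : (Fin m → ℝ) →ᵃ[ℝ] ℝ, c 0 = 0 → ∀ y, c y = c.linear y := fun c hc y => by
          have := congrFun c.decomp y
          simpa [hc] using this
        rw [e1 a ha0, e1 b hb0, ← LinearMap.sub_apply, hL, map_sum]
        simp
      rcases (hT _ ⟨(a, b), ⟨ha, hb⟩, rfl⟩).sum_nonneg_or hd₀ with h1 | h1
      · right
        rintro _ ⟨d, hd, rfl⟩
        rw [← sub_nonneg, e]
        refine Finset.sum_nonneg fun x _ => ?_
        by_cases hx : d₀ x = 0
        · rw [(hd x).2.2 hx, zero_mul]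
        · exact mul_nonneg (hd x).1 (h1 x hx)
      · left
        rintro _ ⟨d, hd, rfl⟩
        rw [← sub_nonpos, e]
        refine Finset.sum_nonpos fun x _ => ?_
        by_cases hx : d₀ x = 0
        · rw [(hd x).2.2 hx, zero_mul]
        · exact mul_nonpos_of_nonneg_of_nonpos (hd x).1 (h1 x hx))
  have ha' : ∀ y, a y = a.linear y := fun y => by
    have := congrFun a.decomp y
    simpa [ha] using this
  have hx : ∀ x, d₀ x ≠ 0 → g (δ • T.vec x) / δ = a.linear (T.vec x) := by
    classical
    intro x hx
    have hmem : Pi.single x δ ∈ D := by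
      intro y
      by_cases hy : y = x
      · subst hy
        simp [hδ.1.le, hx]
      · simp [hy, hδ.1.le]
    have h1 := haC ⟨_, hmem, rfl⟩
    have h2 : L (Pi.single x δ) = δ • T.vec x := by
      rw [hL]
      simp [Pi.single_apply, ite_smul]
    rw [h2, ha', map_smul, smul_eq_mul] at h1
    rw [h1, mul_div_cancel_left₀ _ hδ.1.ne']
  have := haC ⟨d₀, hd₀D, rfl⟩
  rw [ha', hL, map_sum] at this
  rw [this]
  refine Finset.sum_congr rfl fun x _ => ?_
  by_cases h0 : d₀ x = 0
  · simp [h0]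
  · rw [hx x h0, map_smul, smul_eq_mul]

end SimplicialFan

/-! ### Pseudo-radial maps -/

namespace SimplicialFan

variable {m : ℕ}

/-- The map which multiplies the generator `x` of the fan by `r x`. -/
noncomputable def rescale (T : SimplicialFan m) (r : T.Ray → ℝ) (y : Fin m → ℝ) : Fin m → ℝ :=
  ∑ x, (T.coord y x * r x) • T.vec x

variable {T : SimplicialFan m} {r : T.Ray → ℝ}

theorem isPLMapAt_rescale (y : Fin m → ℝ) : IsPLMapAt (T.rescale r) y := by
  refine isPLMapAt_pi fun l => ?_
  simp only [rescale, Finset.sum_apply, Pi.smul_apply, smul_eq_mul]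
  exact IsSel.sum _ fun x _ => ((T.isSel_coord x y).mul_const _).mul_const _

theorem coord_rescale_mem {y : Fin m → ℝ} (hr : ∀ x, T.coord y x ≠ 0 → 0 < r x) :
    (fun x => T.coord y x * r x) ∈ T.Adm := by
  refine T.mem_of_support _ (T.coord_mem y) _ (fun x => ?_) fun x hx => by simp [hx]
  by_cases h : T.coord y x = 0
  · simp [h]
  · exact mul_nonneg (T.nonneg _ (T.coord_mem y) x) (hr x h).le

theorem coord_rescale {y : Fin m → ℝ} (hr : ∀ x, T.coord y x ≠ 0 → 0 < r x) :
    T.coord (T.rescale r y) = fun x => T.coord y x * r x := T.coord_sum _ (coord_rescale_mem hr)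

theorem rescale_rescale {y : Fin m → ℝ} (hr : ∀ x, T.coord y x ≠ 0 → 0 < r x) :
    T.rescale (fun x => (r x)⁻¹) (T.rescale r y) = y := by
  rw [rescale, coord_rescale hr]
  conv_rhs => rw [← T.sum_coord y]
  refine Finset.sum_congr rfl fun x _ => ?_
  by_cases h : T.coord y x = 0
  · simp [h]
  · rw [mul_assoc, mul_inv_cancel₀ (hr x h).ne', mul_one]

theorem zero_mem_adm : (0 : T.Ray → ℝ) ∈ T.Adm :=
  T.mem_of_support _ (T.coord_mem 0) _ (fun _ => le_rfl) fun _ _ => rfl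

theorem coord_zero : T.coord 0 = 0 := by
  have := T.coord_sum 0 zero_mem_adm
  simpa using this

theorem vec_ne_zero {y : Fin m → ℝ} {x : T.Ray} (h : T.coord y x ≠ 0) : T.vec x ≠ 0 := by
  classical
  intro hx
  have h1 : (Pi.single x 1 : T.Ray → ℝ) ∈ T.Adm := by
    refine T.mem_of_support _ (T.coord_mem y) _ (fun z => ?_) fun z hz => ?_
    · by_cases hz : z = x
      · subst hz; simp
      · simp [hz]
    · have : z ≠ x := by rintro rfl; exact h hz
      simp [this]
  have h2 := T.coord_sum _ h1
  have h3 : ∑ z, (Pi.single x 1 : T.Ray → ℝ) z • T.vec z = 0 := by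
    simp [Pi.single_apply, hx]
  rw [h3, coord_zero] at h2
  have := congrFun h2 x
  simp at this

/-- Two positive germs of PL functions which vanish at the origin only differ by a PL
homeomorphism. -/
theorem exists_isPLChart_comp_eq {g s : (Fin m → ℝ) → ℝ} (hg : IsSel id g 0) (hs : IsSel id s 0)
    (hg0 : g 0 = 0) (hs0 : s 0 = 0) (hgp : ∀ᶠ y in 𝓝 0, y ≠ 0 → 0 < g y)
    (hsp : ∀ᶠ y in 𝓝 0, y ≠ 0 → 0 < s y) :
    ∃ f f' : (Fin m → ℝ) → Fin m → ℝ, IsPLChart f f' 0 ∧ f 0 = 0 ∧ ∀ᶠ y in 𝓝 0, s (f y) = g y := by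
  obtain ⟨S, hS, hgS⟩ := exists_linear_of_isSel hg hg0
  obtain ⟨S', hS', hsS⟩ := exists_linear_of_isSel hs hs0
  obtain ⟨T, hT⟩ := exists_forall_nonCrossing (hS.union hS')
  obtain ⟨ε₁, h1, hg1⟩ := hgS T fun a ha => hT a (Or.inl ha)
  obtain ⟨ε₂, h2, hs1⟩ := hsS T fun a ha => hT a (Or.inr ha)
  have hsmul : ∀ x, ∀ᶠ δ : ℝ in 𝓝 0, (δ • T.vec x ≠ 0 → 0 < g (δ • T.vec x)) ∧
      (δ • T.vec x ≠ 0 → 0 < s (δ • T.vec x)) := by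
    intro x
    have : Tendsto (fun δ : ℝ => δ • T.vec x) (𝓝 0) (𝓝 0) := by
      have : Continuous fun δ : ℝ => δ • T.vec x := by fun_prop
      simpa using this.tendsto 0
    exact this.eventually (hgp.and hsp)
  -- One scale at which both germs are positive on the scaled non-zero generators and linear on the
  -- scaled cones.
  obtain ⟨δ, hδ, hδ0, hδ1⟩ := (((eventually_all.2 hsmul).filter_mono
    nhdsWithin_le_nhds).and (Ioc_mem_nhdsGT (lt_min h1 h2))).exists
  have hpos : ∀ y x, T.coord y x ≠ 0 → 0 < g (δ • T.vec x) / s (δ • T.vec x) := by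
    intro y x hx
    have := smul_ne_zero hδ0.ne' (vec_ne_zero hx)
    exact div_pos ((hδ x).1 this) ((hδ x).2 this)
  have hpos' : ∀ y x, T.coord y x ≠ 0 → 0 < (g (δ • T.vec x) / s (δ • T.vec x))⁻¹ := fun y x hx =>
    inv_pos.2 (hpos y x hx)
  -- On each cone both germs are linear and determined by their values at the generators, so
  -- multiplying each generator by the quotient of these values converts one germ into the other.
  refine ⟨T.rescale fun x => g (δ • T.vec x) / s (δ • T.vec x),
    T.rescale fun x => (g (δ • T.vec x) / s (δ • T.vec x))⁻¹,
    ⟨Eventually.of_forall fun y => ⟨isPLMapAt_rescale y, rescale_rescale (hpos y)⟩,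
      Eventually.of_forall fun y => ⟨isPLMapAt_rescale y, ?_⟩⟩, ?_, ?_⟩
  · have := rescale_rescale (hpos' y)
    simpa only [inv_inv] using this
  · simp [rescale, coord_zero]
  · have e1 : ∀ᶠ y in 𝓝 (0 : Fin m → ℝ), ∀ x, T.coord y x ≤ δ ∧
        T.coord y x * (g (δ • T.vec x) / s (δ • T.vec x)) ≤ δ := by
      refine eventually_all.2 fun x => Filter.Eventually.and ?_ ?_
      · have := (T.isSel_coord x 0).continuousAt.eventually (Iio_mem_nhds
          (show T.coord 0 x < δ by rw [coord_zero]; exact hδ0))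
        filter_upwards [this] with y hy using le_of_lt hy
      · have := ((T.isSel_coord x 0).mul_const (g (δ • T.vec x) / s (δ • T.vec x))).continuousAt.eventually
          (Iio_mem_nhds (show T.coord 0 x * (g (δ • T.vec x) / s (δ • T.vec x)) < δ by
            rw [coord_zero]; simpa using hδ0))
        filter_upwards [this] with y hy using le_of_lt hy
    filter_upwards [e1] with y hy
    have e2 := hg1 δ ⟨hδ0, hδ1.trans (min_le_left _ _)⟩ _ (T.coord_mem y) fun x => (hy x).1
    rw [T.sum_coord] at e2
    rw [e2, rescale, hs1 δ ⟨hδ0, hδ1.trans (min_le_right _ _)⟩ _ (coord_rescale_mem (hpos y))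
      fun x => (hy x).2]
    refine Finset.sum_congr rfl fun x _ => ?_
    by_cases h : T.coord y x = 0
    · simp [h]
    · have := (hδ x).2 (smul_ne_zero hδ0.ne' (vec_ne_zero h))
      field_simp

/-- The gauge of the simplex spanned by the generators of the standard fan. -/
noncomputable def stdGauge (y : Fin m → ℝ) : ℝ := ∑ j, stdCoord y j

theorem isSel_stdGauge (y : Fin m → ℝ) : IsSel id (stdGauge : (Fin m → ℝ) → ℝ) y :=
  IsSel.sum _ fun j _ => isSel_stdCoord j y

theorem stdGauge_nonneg (y : Fin m → ℝ) : 0 ≤ stdGauge y := Finset.sum_nonneg fun j _ => stdCoord_nonneg y j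

theorem stdVec_zero : stdVec (0 : Fin (m + 1) → ℝ) = 0 := by funext l; simp [stdVec]

theorem stdGauge_stdVec {d : Fin (m + 1) → ℝ} (h : ∀ j, 0 ≤ d j) (h0 : ∃ j, d j = 0) :
    stdGauge (stdVec d) = ∑ j, d j := by rw [stdGauge, stdCoord_stdVec h h0]

theorem stdGauge_eq_zero_iff {y : Fin m → ℝ} : stdGauge y = 0 ↔ y = 0 := by
  constructor
  · intro h
    rw [stdGauge, Finset.sum_eq_zero_iff_of_nonneg fun j _ => stdCoord_nonneg y j] at h
    rw [← stdVec_stdCoord y, ← stdVec_zero]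
    exact congrArg _ (funext fun j => h j (Finset.mem_univ j))
  · rintro rfl
    rw [← stdVec_zero, stdGauge_stdVec (d := 0) (fun _ => le_rfl) ⟨0, rfl⟩]
    simp

theorem stdGauge_pos {y : Fin m → ℝ} (h : y ≠ 0) : 0 < stdGauge y :=
  (stdGauge_nonneg y).lt_of_ne fun h' => h (stdGauge_eq_zero_iff.1 h'.symm)

theorem continuous_stdGauge : Continuous (stdGauge : (Fin m → ℝ) → ℝ) :=
  continuous_iff_continuousAt.2 fun y => (isSel_stdGauge y).continuousAt

theorem stdVec_smul (t : ℝ) (d : Fin (m + 1) → ℝ) : stdVec (t • d) = t • stdVec d := by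
  funext l
  simp only [stdVec, Pi.smul_apply, smul_eq_mul]
  ring

theorem stdCoord_smul {t : ℝ} (ht : 0 ≤ t) (y : Fin m → ℝ) : stdCoord (t • y) = t • stdCoord y := by
  conv_lhs => rw [← stdVec_stdCoord y, ← stdVec_smul]
  obtain ⟨j, hj⟩ := exists_stdCoord_eq_zero y
  exact stdCoord_stdVec (fun j => mul_nonneg ht (stdCoord_nonneg y j)) ⟨j, by simp [hj]⟩

theorem stdGauge_smul {t : ℝ} (ht : 0 ≤ t) (y : Fin m → ℝ) : stdGauge (t • y) = t * stdGauge y := by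
  simp [stdGauge, stdCoord_smul ht, Finset.mul_sum]

end SimplicialFan

/-! ### Links of vertices -/

namespace FacePairing

open SimplicialFan

variable {k n : ℕ} {P : FacePairing k n}

variable (P) in
/-- The link of a vertex. -/
def link (v : P.Space) : Set P.Space := {z | P.tau z = 1 ∧ P.rad 0 z = v}

/-- The condition `P.rad 0 z = v` is closed because `P.rad 0` is locally constant where `tau ≤ 1`.
-/
theorem isCompact_setOf_rad_zero_eq (v : P.Space) : IsCompact {z | P.tau z ≤ 1 ∧ P.rad 0 z = v} := by
  have hg1 := one_lt_starRadius (K := Fin (n + 1))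
  refine IsClosed.isCompact ?_
  rw [← isOpen_compl_iff, isOpen_iff_mem_nhds]
  intro z hz
  rcases lt_or_ge 1 (P.tau z) with h | h
  · filter_upwards [continuous_tau.continuousAt.eventually (Ioi_mem_nhds h)] with u hu h'
    exact absurd hu (not_lt.2 h'.1)
  · filter_upwards [eventually_rad_zero_eq (h.trans_lt hg1)] with u hu h'
    exact hz ⟨h, hu.symm.trans h'.2⟩

/-- Outside a neighbourhood of `v`, on the compact cone belonging to `v`, the function `tau` is
bounded below by a positive constant. -/
theorem exists_forall_mem_of_mem_nhds {v : P.Space} {N : Set P.Space} (hN : N ∈ 𝓝 v) :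
    ∃ ε > 0, ∀ z, P.tau z < ε → P.rad 0 z = v → z ∈ N := by
  have hC : IsCompact ({z | P.tau z ≤ 1 ∧ P.rad 0 z = v} \ interior N) :=
    (isCompact_setOf_rad_zero_eq v).diff isOpen_interior
  have hpos : ∀ z ∈ {z | P.tau z ≤ 1 ∧ P.rad 0 z = v} \ interior N, 0 < P.tau z := by
    rintro z ⟨⟨-, h⟩, h'⟩
    rw [tau_pos_iff]
    intro hz
    rw [rad_of_mem_vertices hz] at h
    exact h' (h ▸ mem_interior_iff_mem_nhds.2 hN)
  obtain ⟨ε, hε, h⟩ : ∃ ε > 0, ∀ z ∈ {z | P.tau z ≤ 1 ∧ P.rad 0 z = v} \ interior N, ε ≤ P.tau z := by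
    rcases ({z | P.tau z ≤ 1 ∧ P.rad 0 z = v} \ interior N).eq_empty_or_nonempty with he | he
    · exact ⟨1, one_pos, by simp [he]⟩
    · obtain ⟨z, hz, hmin⟩ := hC.exists_isMinOn he continuous_tau.continuousOn
      exact ⟨P.tau z, hpos z hz, fun u hu => hmin hu⟩
  refine ⟨min ε 1, lt_min hε one_pos, fun z hz hv => ?_⟩
  by_contra hzN
  have := h z ⟨⟨(hz.trans_le (min_le_right _ _)).le, hv⟩, fun hz' => hzN (interior_subset hz')⟩
  exact absurd (hz.trans_le (min_le_left _ _)) (not_lt.2 this)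

theorem eventually_rad_zero_eq_of_mem_vertices {v : P.Space} (hv : v ∈ P.vertices) :
    ∀ᶠ z in 𝓝 v, P.rad 0 z = v ∧ (z ≠ v → 0 < P.tau z) := by
  have h0 := tau_eq_zero_iff.2 hv
  filter_upwards [eventually_rad_zero_eq (h0.trans_lt starRadius_pos)] with z hz
  rw [rad_of_mem_vertices hv] at hz
  refine ⟨hz, fun hne => tau_pos_iff.2 fun hz' => hne ?_⟩
  rw [← hz, rad_of_mem_vertices hz']

/-- A chart around a vertex which takes the dilatations of the link to dilatations of the boundary
of a simplex. -/
theorem exists_isPLChart_stdGauge {v : P.Space} (hv : v ∈ P.vertices) {f : P.Space → Fin n → ℝ}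
    {g : (Fin n → ℝ) → P.Space} (h : IsPLChart f g v) :
    ∃ e r, IsPLChart (e : P.Space → Fin n → ℝ) r v ∧ e v = 0 ∧ ∀ᶠ z in 𝓝 v, stdGauge (e z) = P.tau z := by
  have h0 := tau_eq_zero_iff.2 hv
  have hch : IsPLChart (fun z => f z + -f v) (fun y => g (y - -f v)) v :=
    (isPLChart_add_const (-f v) (f v)).comp h
  set f₁ : P.Space → Fin n → ℝ := fun z => f z + -f v with hf₁
  set g₁ : (Fin n → ℝ) → P.Space := fun y => g (y - -f v)
  have hf0 : f₁ v = 0 := by simp [hf₁]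
  have hg0 : g₁ 0 = v := by rw [← hf0, hch.left_inv]
  have hsymm : IsPLChart g₁ f₁ 0 := by have := hch.symm; rwa [hf0] at this
  have hsel : IsSel id (fun y => P.tau (g₁ y)) 0 :=
    plAt_iff_isSel.1 (hsymm.isPLMapAt.2 P.tau (plAt_tau _))
  obtain ⟨e, e', h1, h2, h3⟩ := exists_isPLChart_comp_eq hsel (isSel_stdGauge 0) (by
    rw [hg0, h0]) (stdGauge_eq_zero_iff.2 rfl) (by
    have h4 : ∀ᶠ z in 𝓝 (g₁ 0), P.rad 0 z = v ∧ (z ≠ v → 0 < P.tau z) := by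
      rw [hg0]; exact eventually_rad_zero_eq_of_mem_vertices hv
    filter_upwards [hsymm.isPLMapAt.1.eventually h4, hsymm.1] with y h5 h6 hy
    refine h5.2 fun h7 => hy ?_
    rw [← h6.2, h7, hf0]) (Eventually.of_forall fun y hy => stdGauge_pos hy)
  have h1' : IsPLChart e e' (f₁ v) := by rwa [hf0]
  refine ⟨_, _, h1'.comp hch, by rw [hf0, h2], ?_⟩
  have h4 : ∀ᶠ y in 𝓝 (f₁ v), stdGauge (e y) = P.tau (g₁ y) := by rwa [hf0]
  filter_upwards [hch.isPLMapAt.1.eventually h4, hch.1] with z h5 h6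
  rw [h5, h6.2]

theorem rad_inv_rad {t : ℝ} (ht : 0 < t) (ht1 : t ≤ 1) {z : P.Space} (hz : P.tau z = 1) :
    P.rad t⁻¹ (P.rad t z) = z := by
  have hg1 := one_lt_starRadius (K := Fin (n + 1))
  rw [rad_rad (inv_nonneg.2 ht.le) ht.le (by rwa [hz]) (by rw [hz]; linarith)
    (by rwa [inv_mul_cancel₀ ht.ne', hz, one_mul]), inv_mul_cancel₀ ht.ne', rad_one]

/-- Dilate the link into a chart in which `tau` is the gauge of a simplex. Its image is the level
set of the gauge, a scaled copy of the boundary of a simplex. -/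
theorem plHomeomorphic_link {v : P.Space} (hv : v ∈ P.vertices) {f : P.Space → Fin n → ℝ}
    {g : (Fin n → ℝ) → P.Space} (h : IsPLChart f g v) {B : Type*} [TopologicalSpace B] [PLStructure B]
    {i : B → P.Space} (hi : IsPLEmbedding i) (hr : range i = P.link v) : PLHomeomorphic B (PLSphere n) := by
  have hg1 := one_lt_starRadius (K := Fin (n + 1))
  obtain ⟨e, r, h1, h2, h3⟩ := exists_isPLChart_stdGauge hv h
  have hr0 : r 0 = v := by rw [← h2, h1.left_inv]
  obtain ⟨ε, hε, hε'⟩ := exists_forall_mem_of_mem_nhds (h1.1.and h3)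
  have h4 : ∀ᶠ y in 𝓝 (0 : Fin n → ℝ), (IsPLMapAt r y ∧ e (r y) = y) ∧
      stdGauge (e (r y)) = P.tau (r y) ∧ P.rad 0 (r y) = v := by
    have h5 := h1.symm
    have h6 := h1.2
    rw [h2] at h5 h6
    have h7 : ∀ᶠ z in 𝓝 (r 0), stdGauge (e z) = P.tau z ∧ P.rad 0 z = v ∧ (z ≠ v → 0 < P.tau z) := by
      rw [hr0]
      exact h3.and (eventually_rad_zero_eq_of_mem_vertices hv)
    filter_upwards [h6, h5.isPLMapAt.1.eventually h7] with y h8 h9 using ⟨h8, h9.1, h9.2.1⟩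
  obtain ⟨ρ, hρ, hball⟩ := Metric.nhds_basis_closedBall.eventually_iff.1 h4
  -- The bound `ε` keeps the dilated link in the domain of the chart, and `ρ` keeps the scaled
  -- simplex boundary in the domain of its inverse.
  obtain ⟨t, ht, ht0, ht1⟩ : ∃ t : ℝ, t < ε ∧ 0 < t ∧ t < min 1 ρ := by
    obtain ⟨t, h5, h6⟩ := exists_between (lt_min hε (lt_min one_pos hρ))
    exact ⟨t, h6.trans_le (min_le_left _ _), h5, h6.trans_le (min_le_right _ _)⟩
  have htle : t ≤ 1 := (ht1.trans_le (min_le_left _ _)).le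
  -- the dilatation of the link
  have hlink : ∀ z ∈ P.link v, (IsPLMapAt (P.rad t) z ∧ P.tau (P.rad t z) = t) ∧
      (IsPLMapAt e (P.rad t z) ∧ r (e (P.rad t z)) = P.rad t z) ∧ stdGauge (e (P.rad t z)) = t := by
    rintro z ⟨hz1, hz2⟩
    have a1 : P.tau z < starRadius (Fin (n + 1)) := by rwa [hz1]
    have a2 : t * P.tau z < starRadius (Fin (n + 1)) := by rw [hz1]; linarith
    have a3 : P.tau (P.rad t z) = t := by rw [tau_rad ht0.le a1 a2, hz1, mul_one]
    have a4 := hε' (P.rad t z) (by rwa [a3]) (by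
      rw [rad_rad le_rfl ht0.le a1 a2 (by simpa using starRadius_pos), zero_mul, hz2])
    exact ⟨⟨isPLMapAt_rad ht0.le a1 a2, a3⟩, a4.1, a4.2.trans a3⟩
  have hsph : ∀ x : PLSphere n, (IsPLMapAt r (t • stdVec x.1) ∧ e (r (t • stdVec x.1)) = t • stdVec x.1) ∧
      P.tau (r (t • stdVec x.1)) = t ∧ P.rad 0 (r (t • stdVec x.1)) = v := by
    intro x
    have b1 : ‖stdVec x.1‖ ≤ 1 := by
      rw [pi_norm_le_iff_of_nonneg zero_le_one]
      intro l
      have c1 : ∀ j, x.1 j ≤ 1 := fun j => x.2.1.2 ▸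
        Finset.single_le_sum (fun j _ => x.2.1.1 j) (Finset.mem_univ j)
      have c2 := x.2.1.1
      simp only [stdVec, Real.norm_eq_abs, abs_le]
      constructor
      · linarith [c1 0, c2 l.succ]
      · linarith [c1 l.succ, c2 0]
    obtain ⟨b2, b3, b4⟩ := hball (x := t • stdVec x.1) (by
      rw [mem_closedBall_zero_iff, norm_smul, Real.norm_of_nonneg ht0.le]
      have := mul_le_mul_of_nonneg_left b1 ht0.le
      linarith [ht1.trans_le (min_le_right 1 ρ)])
    refine ⟨b2, ?_, b4⟩
    rw [← b3, b2.2, stdGauge_smul ht0.le, stdGauge_stdVec x.2.1.1 x.2.2, x.2.1.2, mul_one]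
  have hrad : ∀ x : PLSphere n, IsPLMapAt (P.rad t⁻¹) (r (t • stdVec x.1)) ∧
      P.rad t⁻¹ (r (t • stdVec x.1)) ∈ P.link v ∧
      P.rad t (P.rad t⁻¹ (r (t • stdVec x.1))) = r (t • stdVec x.1) := by
    intro x
    obtain ⟨-, b1, b2⟩ := hsph x
    have hti := inv_nonneg.2 ht0.le
    have a1 : P.tau (r (t • stdVec x.1)) < starRadius (Fin (n + 1)) := by rw [b1]; linarith
    have a2 : t⁻¹ * P.tau (r (t • stdVec x.1)) < starRadius (Fin (n + 1)) := by
      rwa [b1, inv_mul_cancel₀ ht0.ne']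
    refine ⟨isPLMapAt_rad hti a1 a2, ⟨?_, ?_⟩, ?_⟩
    · rw [tau_rad hti a1 a2, b1, inv_mul_cancel₀ ht0.ne']
    · rw [rad_rad le_rfl hti a1 a2 (by simpa using starRadius_pos), zero_mul, b2]
    · rw [rad_rad ht0.le hti a1 a2 (by rwa [mul_inv_cancel₀ ht0.ne', one_mul]),
        mul_inv_cancel₀ ht0.ne', rad_one]
  have hil : ∀ b, i b ∈ P.link v := fun b => hr ▸ mem_range_self b
  have hf : ∀ z ∈ P.link v, t⁻¹ • stdCoord (e (P.rad t z)) ∈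
      {x : Fin (n + 1) → ℝ | x ∈ stdSimplex ℝ (Fin (n + 1)) ∧ ∃ i, x i = 0} := by
    intro z hz
    refine ⟨⟨fun j => mul_nonneg (inv_nonneg.2 ht0.le) (stdCoord_nonneg _ j), ?_⟩, ?_⟩
    · have := (hlink z hz).2.2
      simp only [Pi.smul_apply, smul_eq_mul, ← Finset.mul_sum]
      rw [stdGauge] at this
      rw [this, inv_mul_cancel₀ ht0.ne']
    · obtain ⟨j, hj⟩ := exists_stdCoord_eq_zero (e (P.rad t z))
      exact ⟨j, by simp [hj]⟩
  refine PLHomeomorphic.of_ambient hi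
    (isPLEmbedding_val fun x : Fin (n + 1) → ℝ => x ∈ stdSimplex ℝ (Fin (n + 1)) ∧ ∃ i, x i = 0)
    (fun z => t⁻¹ • stdCoord (e (P.rad t z))) (fun x => P.rad t⁻¹ (r (t • stdVec x)))
    (fun b => ?_) (fun x => ?_) (fun b => ⟨⟨_, hf _ (hil b)⟩, rfl⟩)
    (fun x => hr.ge (hrad x).2.1) (fun b => ?_) (fun x => ?_)
  · have h5 := hlink _ (hil b)
    have h6 : IsPLMapAt (fun y : Fin n → ℝ => t⁻¹ • stdCoord y) (e (P.rad t (i b))) :=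
      isPLMapAt_pi fun j => (isSel_stdCoord j _).const_mul _
    exact IsPLMapAt.comp (f := fun z => e (P.rad t z)) h6 (h5.2.1.1.comp h5.1.1)
  · have h6 : IsPLMapAt (fun y : Fin (n + 1) → ℝ => t • stdVec y) x.1 :=
      isPLMapAt_pi fun l => ((IsSel.coord (j := id) continuous_id l.succ _).sub
        (IsSel.coord (j := id) continuous_id 0 _)).const_mul _
    exact IsPLMapAt.comp (f := fun y : Fin (n + 1) → ℝ => r (t • stdVec y)) (hrad x).1
      (IsPLMapAt.comp (f := fun y : Fin (n + 1) → ℝ => t • stdVec y) (hsph x).1.1 h6)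
  · have h5 := hlink _ (hil b)
    rw [stdVec_smul, stdVec_stdCoord, smul_smul, mul_inv_cancel₀ ht0.ne', one_smul, h5.2.1.2,
      rad_inv_rad ht0 htle (hil b).1]
  · rw [(hrad x).2.2, (hsph x).1.2, stdCoord_smul ht0.le, smul_smul, inv_mul_cancel₀ ht0.ne', one_smul,
      stdCoord_stdVec x.2.1.1 x.2.2]

end FacePairing

/-! ### Connectedness of links -/

namespace FacePairing

variable {k n : ℕ} {P : FacePairing k n}

variable (P) in
/-- The part of the link of a vertex that lies in the `i`-th simplex, near its vertex `j`. -/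
def linkPiece (i : Fin k) (j : Fin (n + 1)) : Set P.Space :=
  {z | ∃ x : stdSimplex ℝ (Fin (n + 1)), gam j x.1 = 1 ∧ P.pt _ i x = z}

theorem linkPiece_subset (i : Fin k) (j : Fin (n + 1)) :
    P.linkPiece i j ⊆ P.link (P.pt _ i ⟨Pi.single j 1, single_mem_stdSimplex ℝ j⟩) := by
  rintro z ⟨x, hx, rfl⟩
  have h : gam j x.1 < starRadius (Fin (n + 1)) := by rw [hx]; exact one_lt_starRadius
  exact ⟨by rw [tau_pt_of_lt h, hx], rad_zero_pt h⟩

theorem exists_mem_linkPiece_of_mem_link {v z : P.Space} (h : z ∈ P.link v) :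
    ∃ i j, z ∈ P.linkPiece i j ∧ P.pt _ i ⟨Pi.single j 1, single_mem_stdSimplex ℝ j⟩ = v := by
  obtain ⟨h1, h2⟩ := h
  obtain ⟨i, x, j, h3, h4, h5⟩ := exists_pt_of_tau_lt (h1.trans_lt one_lt_starRadius)
  rw [← h3, rad_zero_pt h4] at h2
  exact ⟨i, j, ⟨x, h5.trans h1, h3⟩, h2⟩

theorem single_add_inv_gam_smul {x : Fin (n + 1) → ℝ} (hx : x ∈ stdSimplex ℝ (Fin (n + 1)))
    {j : Fin (n + 1)} (hj : x j = 0) :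
    Pi.single j 1 + (gam j x)⁻¹ • (x - Pi.single j 1) ∈ stdSimplex ℝ (Fin (n + 1)) ∧
      gam j (Pi.single j 1 + (gam j x)⁻¹ • (x - Pi.single j 1)) = 1 := by
  have h1 : 1 ≤ gam j x := by have := one_sub_le_gam hx j; linarith
  have h0 : 0 < gam j x := by linarith
  constructor
  · have := (convex_stdSimplex ℝ (Fin (n + 1))).add_smul_sub_mem (single_mem_stdSimplex ℝ j) hx
      (t := (gam j x)⁻¹) ⟨inv_nonneg.2 h0.le, inv_le_one_of_one_le₀ h1⟩
    exact this
  · rw [gam_smul j x (inv_nonneg.2 h0.le), inv_mul_cancel₀ h0.ne']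

/-- The piece is the image of the opposite facet, which is convex, under the radial projection from
the vertex. -/
theorem isPreconnected_linkPiece (i : Fin k) (j : Fin (n + 1)) : IsPreconnected (P.linkPiece i j) := by
  let F : Set (Fin (n + 1) → ℝ) := {x | x ∈ stdSimplex ℝ (Fin (n + 1)) ∧ x j = 0}
  have hF : Convex ℝ F := by
    intro x hx y hy s t hs ht hst
    refine ⟨convex_stdSimplex ℝ _ hx.1 hy.1 hs ht hst, ?_⟩
    simp [hx.2, hy.2]
  let c : F → P.Space := fun x => P.pt _ i ⟨_, (single_add_inv_gam_smul x.2.1 x.2.2).1⟩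
  have hc : Continuous c := by
    refine (continuous_pt i).comp (Continuous.subtype_mk ?_ _)
    have h1 : Continuous fun x : F => (gam j x.1)⁻¹ := by
      refine ((continuous_gam j).comp continuous_subtype_val).inv₀ fun x => ?_
      have := one_sub_le_gam x.2.1 j
      rw [x.2.2] at this
      exact (by linarith : (0 : ℝ) < gam j x.1).ne'
    fun_prop
  have : PreconnectedSpace F := Subtype.preconnectedSpace hF.isPreconnected
  have hr : P.linkPiece i j = range c := by
    ext z
    constructor
    · rintro ⟨x, hx, rfl⟩
      have h1 : x.1 j < 1 := by
        refine lt_of_le_of_ne (x.2.2 ▸ Finset.single_le_sum (fun l _ => x.2.1 l) (Finset.mem_univ j))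
          fun h => ?_
        rw [eq_single_of_apply_eq_one x.2 h.ge, gam_single] at hx
        exact zero_ne_one hx
      have h2 : 0 < 1 - x.1 j := by linarith
      -- The point where the ray from the vertex `j` through `x` meets the opposite facet.
      let y : Fin (n + 1) → ℝ := Pi.single j 1 + (1 - x.1 j)⁻¹ • (x.1 - Pi.single j 1)
      have hyj : y j = 0 := by
        simp only [y, Pi.add_apply, Pi.single_eq_same, Pi.smul_apply, Pi.sub_apply, smul_eq_mul]
        field_simp
        ring
      have hy : y ∈ stdSimplex ℝ (Fin (n + 1)) := by
        refine ⟨fun l => ?_, ?_⟩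
        · by_cases hl : l = j
          · rw [hl, hyj]
          · simpa [y, hl] using mul_nonneg (inv_nonneg.2 h2.le) (x.2.1 l)
        · simp [y, Finset.sum_add_distrib, ← Finset.mul_sum, Finset.sum_sub_distrib, x.2.2]
      refine ⟨⟨y, hy, hyj⟩, congrArg (P.pt _ i) (Subtype.ext ?_)⟩
      have hgy : gam j y = (1 - x.1 j)⁻¹ := by
        rw [gam_smul j x.1 (inv_nonneg.2 h2.le), hx, mul_one]
      change Pi.single j 1 + (gam j y)⁻¹ • (y - Pi.single j 1) = x.1
      rw [hgy, inv_inv, add_sub_cancel_left, smul_smul,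
        mul_inv_cancel₀ h2.ne', one_smul, add_sub_cancel]
    · rintro ⟨x, rfl⟩
      exact ⟨⟨_, (single_add_inv_gam_smul x.2.1 x.2.2).1⟩, (single_add_inv_gam_smul x.2.1 x.2.2).2, rfl⟩
  rw [hr]
  exact isPreconnected_range hc

/-- For `n ≥ 2` there is a vertex `l` other than `j` and `v`; the edge from `j` to `l` lies in the
facet opposite `v` if `v ≠ j` and contains a point with `gam j` equal to one. -/
theorem exists_gam_eq_one_face (hn : 2 ≤ n) {j v : Fin (n + 1)} :
    ∃ x : stdSimplex ℝ (Fin (n + 1)), gam j x.1 = 1 ∧ (v ≠ j → x.1 v = 0) := by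
  obtain ⟨l, hl⟩ : ∃ l, l ∉ ({j, v} : Finset (Fin (n + 1))) := by
    by_contra! h
    have h1 := Finset.card_le_card (show (Finset.univ : Finset (Fin (n + 1))) ⊆ {j, v} from fun l _ => h l)
    have h2 := Finset.card_le_two (a := j) (b := v)
    simp at h1
    omega
  simp only [Finset.mem_insert, Finset.mem_singleton, not_or] at hl
  have h1 := single_add_inv_gam_smul (single_mem_stdSimplex ℝ l) (j := j)
    (Pi.single_eq_of_ne (Ne.symm hl.1) 1)
  refine ⟨⟨_, h1.1⟩, h1.2, fun hv => ?_⟩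
  simp [hv, Ne.symm hl.2]

/-- If two vertices are identified by the glueing of a facet, their link pieces share a point of
this facet, so their union is connected; longer chains are treated by induction. Both directions are
stated together so that symmetry can be handled in the induction. -/
theorem linkPiece_joined (hn : 2 ≤ n) {p q : (_ : Fin k) × stdSimplex ℝ (Fin (n + 1))}
    (h : Relation.EqvGen (P.Glued (stdSimplex ℝ (Fin (n + 1)))) p q) {S : Set P.Space}
    (hS : P.link (Quot.mk _ p) = S) :
    (∀ j, p.2.1 = Pi.single j 1 → ∃ j', q.2.1 = Pi.single j' 1 ∧
      ∃ t ⊆ S, IsPreconnected t ∧ P.linkPiece p.1 j ⊆ t ∧ P.linkPiece q.1 j' ⊆ t) ∧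
    ∀ j, q.2.1 = Pi.single j 1 → ∃ j', p.2.1 = Pi.single j' 1 ∧
      ∃ t ⊆ S, IsPreconnected t ∧ P.linkPiece q.1 j ⊆ t ∧ P.linkPiece p.1 j' ⊆ t := by
  have hpiece : ∀ (r : (_ : Fin k) × stdSimplex ℝ (Fin (n + 1))) j, r.2.1 = Pi.single j 1 →
      P.link (Quot.mk _ r) = S → P.linkPiece r.1 j ⊆ S := by
    rintro ⟨i, x⟩ j (hr : x.1 = _) rfl
    have := linkPiece_subset (P := P) i j
    convert! this using 2
    exact congrArg (P.pt _ i) (Subtype.ext hr)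
  have hglue : ∀ p q : (_ : Fin k) × stdSimplex ℝ (Fin (n + 1)), P.Glued _ p q →
      P.link (Quot.mk _ p) = S → ∀ j, p.2.1 = Pi.single j 1 → ∃ j', q.2.1 = Pi.single j' 1 ∧
      ∃ t ⊆ S, IsPreconnected t ∧ P.linkPiece p.1 j ⊆ t ∧ P.linkPiece q.1 j' ⊆ t := by
    rintro p q ⟨v, hv, hq1, hq2⟩ hS j hj
    set σ := P.vertexMap (p.1, v) with hσ
    have hvj : v ≠ j := by
      rintro rfl
      rw [hj, Pi.single_eq_same] at hv
      exact one_ne_zero hv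
    have hqj : q.2.1 = Pi.single (σ j) 1 := by
      funext w
      have := hq2 (σ.symm w)
      rw [σ.apply_symm_apply] at this
      rw [this, hj]
      simp only [Pi.single_apply, Equiv.symm_apply_eq]
    have hSq : P.link (Quot.mk _ q) = S := by
      rw [← hS]
      exact congrArg P.link (Quot.sound ⟨v, hv, hq1, hq2⟩).symm
    obtain ⟨x, hx1, hx2⟩ := exists_gam_eq_one_face hn (j := j) (v := v)
    have hx' : x.1 ∘ σ.symm ∈ stdSimplex ℝ (Fin (n + 1)) := permInvariant_stdSimplex _ σ _ x.2
    have hglued : P.pt _ p.1 x = P.pt _ q.1 ⟨x.1 ∘ σ.symm, hx'⟩ :=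
      Quot.sound ⟨v, hx2 hvj, hq1, fun w => by simp [hσ]⟩
    refine ⟨σ j, hqj, P.linkPiece p.1 j ∪ P.linkPiece q.1 (σ j),
      union_subset (hpiece p j hj hS) (hpiece q _ hqj hSq), ?_, subset_union_left, subset_union_right⟩
    refine (isPreconnected_linkPiece p.1 j).union (P.pt _ p.1 x) ⟨x, hx1, rfl⟩
      ⟨_, ?_, hglued.symm⟩ (isPreconnected_linkPiece q.1 (σ j))
    exact (gam_comp_symm σ j x.1).trans hx1
  induction h with
  | rel p q h =>
    refine ⟨hglue p q h hS, hglue q p h.symm ?_⟩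
    rw [← hS]
    exact congrArg P.link (Quot.sound h).symm
  | refl p =>
    have : ∀ j, p.2.1 = Pi.single j 1 → ∃ j', p.2.1 = Pi.single j' 1 ∧
        ∃ t ⊆ S, IsPreconnected t ∧ P.linkPiece p.1 j ⊆ t ∧ P.linkPiece p.1 j' ⊆ t :=
      fun j hj => ⟨j, hj, _, hpiece p j hj hS, isPreconnected_linkPiece _ _, Subset.rfl, Subset.rfl⟩
    exact ⟨this, this⟩
  | symm p q h ih =>
    have := ih (by rw [← hS]; exact congrArg P.link (Quot.eqvGen_sound h))
    exact ⟨this.2, this.1⟩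
  | trans p q r h1 h2 ih1 ih2 =>
    have a1 := ih1 hS
    have a2 := ih2 (by rw [← hS]; exact congrArg P.link (Quot.eqvGen_sound h1).symm)
    have key : ∀ {p q r : (_ : Fin k) × stdSimplex ℝ (Fin (n + 1))},
        (∀ j, p.2.1 = Pi.single j 1 → ∃ j', q.2.1 = Pi.single j' 1 ∧
          ∃ t ⊆ S, IsPreconnected t ∧ P.linkPiece p.1 j ⊆ t ∧ P.linkPiece q.1 j' ⊆ t) →
        (∀ j, q.2.1 = Pi.single j 1 → ∃ j', r.2.1 = Pi.single j' 1 ∧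
          ∃ t ⊆ S, IsPreconnected t ∧ P.linkPiece q.1 j ⊆ t ∧ P.linkPiece r.1 j' ⊆ t) →
        ∀ j, p.2.1 = Pi.single j 1 → ∃ j', r.2.1 = Pi.single j' 1 ∧
          ∃ t ⊆ S, IsPreconnected t ∧ P.linkPiece p.1 j ⊆ t ∧ P.linkPiece r.1 j' ⊆ t := by
      intro p q r b1 b2 j hj
      obtain ⟨j', hj', t, ht, ht', c1, c2⟩ := b1 j hj
      obtain ⟨j'', hj'', s, hs, hs', c3, c4⟩ := b2 j' hj'
      obtain ⟨x, hx, -⟩ := exists_gam_eq_one_face hn (j := j') (v := j')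
      exact ⟨j'', hj'', t ∪ s, union_subset ht hs, ht'.union (P.pt _ q.1 x) (c2 ⟨x, hx, rfl⟩)
        (c3 ⟨x, hx, rfl⟩) hs', c1.trans subset_union_left, c4.trans subset_union_right⟩
    exact ⟨key a1.1 a2.1, key a2.2 a1.2⟩

theorem isPreconnected_link (hn : 2 ≤ n) (v : P.Space) : IsPreconnected (P.link v) := by
  refine isPreconnected_of_forall_pair fun z hz z' hz' => ?_
  obtain ⟨i, j, h1, h2⟩ := exists_mem_linkPiece_of_mem_link hz
  obtain ⟨i', j', h3, h4⟩ := exists_mem_linkPiece_of_mem_link hz'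
  obtain ⟨l, hl, t, ht, ht', c1, c2⟩ := (linkPiece_joined (P := P) hn
    (p := ⟨i, ⟨Pi.single j 1, single_mem_stdSimplex ℝ j⟩⟩)
    (q := ⟨i', ⟨Pi.single j' 1, single_mem_stdSimplex ℝ j'⟩⟩)
    (Quot.eqvGen_exact (h2.trans h4.symm)) (congrArg P.link h2)).1 j rfl
  have : j' = l := by
    by_contra h
    have := congrFun hl j'
    simp [h] at this
  subst this
  exact ⟨t, ht, c1 h1, c2 h3, ht'⟩

/-- The components of the space of the points on the links of the vertices are the links. -/
theorem range_connectedComponent (hn : 2 ≤ n) {B : Type*} [TopologicalSpace B] {i : B → P.Space}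
    (hi : IsEmbedding i) (hr : range i = {z | P.tau z = 1}) (b : B) :
    range (fun c : connectedComponent b => i c.1) = P.link (P.rad 0 (i b)) := by
  have hi1 : ∀ b, P.tau (i b) = 1 := fun b => hr.le (mem_range_self b)
  have hloc : IsLocallyConstant fun b => P.rad 0 (i b) := by
    rw [IsLocallyConstant.iff_eventually_eq]
    intro b
    exact hi.continuous.continuousAt.eventually
      (eventually_rad_zero_eq (by rw [hi1]; exact one_lt_starRadius))
  apply Subset.antisymm
  · rintro _ ⟨c, rfl⟩
    exact ⟨hi1 _, hloc.apply_eq_of_isPreconnected isPreconnected_connectedComponent c.2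
      mem_connectedComponent⟩
  · have h1 : i '' (i ⁻¹' P.link (P.rad 0 (i b))) = P.link (P.rad 0 (i b)) := by
      refine image_preimage_eq_of_subset ?_
      rw [hr]
      exact fun z hz => hz.1
    have h2 : IsPreconnected (i ⁻¹' P.link (P.rad 0 (i b))) := by
      rw [← hi.isInducing.isPreconnected_image, h1]
      exact isPreconnected_link hn _
    have h3 := h2.subset_connectedComponent (x := b) ⟨hi1 b, rfl⟩
    intro z hz
    rw [← h1] at hz
    obtain ⟨c, hc, rfl⟩ := hz
    exact ⟨⟨c, h3 hc⟩, rfl⟩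

end FacePairing

/-! ### Cones over links -/

/-- By compactness, finitely many local families of candidates suffice for all of `K`. -/
theorem exists_finite_selection {Z ι : Type*} [TopologicalSpace Z] {j : Z → ι → ℝ} {K : Set Z}
    (hK : IsCompact K) {u : Z → ℝ}
    (h : ∀ z ∈ K, ∃ F, IsSel j F z ∧ ∀ᶠ z' in 𝓝 z, z' ∈ K → u z' = F z') :
    ∃ S : Set ((ι → ℝ) →ᵃ[ℝ] ℝ), S.Finite ∧ ∀ z ∈ K, ∃ a ∈ S, u z = a (j z) := by
  refine hK.induction_on (p := fun s => ∃ S : Set ((ι → ℝ) →ᵃ[ℝ] ℝ), S.Finite ∧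
    ∀ z ∈ s, ∃ a ∈ S, u z = a (j z)) ⟨∅, finite_empty, by simp⟩ ?_ ?_ ?_
  · rintro s t hst ⟨S, hS, H⟩
    exact ⟨S, hS, fun z hz => H z (hst hz)⟩
  · rintro s t ⟨S, hS, H⟩ ⟨S', hS', H'⟩
    refine ⟨S ∪ S', hS.union hS', ?_⟩
    rintro z (hz | hz)
    · obtain ⟨a, ha, h⟩ := H z hz
      exact ⟨a, Or.inl ha, h⟩
    · obtain ⟨a, ha, h⟩ := H' z hz
      exact ⟨a, Or.inr ha, h⟩
  · intro z hz
    obtain ⟨F, ⟨S, hS, hF⟩, hu⟩ := h z hz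
    refine ⟨{z' | ∃ a ∈ S, u z' = a (j z')}, ?_, S, hS, fun z hz => hz⟩
    rw [mem_nhdsWithin_iff_eventually]
    filter_upwards [hF, hu] with y h1 h2 h3
    obtain ⟨a, ha, h4⟩ := h1.2
    exact ⟨a, ha, (h2 h3).trans h4⟩

namespace FacePairing

open SimplicialFan

variable {k n : ℕ} {P : FacePairing k n}

theorem continuousAt_of_plAt {f : P.Space → ℝ} {z : P.Space} (h : PLAt f z) : ContinuousAt f z :=
  (continuousAt_iff_pt (permInvariant_stdSimplex _)).2 fun i x hx =>
    (plAt_space_iff.1 h i x hx).continuousAt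

theorem isPLMapAt_of_plAt {m : ℕ} {f : P.Space → Fin m → ℝ} {z : P.Space}
    (h : ∀ l, PLAt (fun u => f u l) z) : IsPLMapAt f z := by
  refine ⟨continuousAt_pi.2 fun l => continuousAt_of_plAt (h l), fun g hg => plAt_space_iff.2 ?_⟩
  rintro i x rfl
  exact IsSel.comp_pi (fun l => isSel_comp_pt (h l)) (plAt_iff_isSel.1 hg)

/-- The lifts at which `f` fails to be PL form a closed set, whose image under the closed projection
misses `z`. -/
theorem eventually_plAt {f : P.Space → ℝ} {z : P.Space} (h : PLAt f z) : ∀ᶠ u in 𝓝 z, PLAt f u := by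
  let C : Set ((_ : Fin k) × stdSimplex ℝ (Fin (n + 1))) :=
    {p | ¬IsSel Subtype.val (fun x => f (P.pt _ p.1 x)) p.2}
  have hC : IsClosed C := by
    rw [← isOpen_compl_iff, isOpen_sigma_iff]
    intro i
    rw [isOpen_iff_mem_nhds]
    intro x hx
    have hx' : IsSel Subtype.val (fun x => f (P.pt _ i x)) x := not_not.1 hx
    filter_upwards [hx'.eventually] with x' hx'
    exact not_not.2 hx'
  have hq := isClosedMap_quot_mk (P := P) (permInvariant_stdSimplex (n + 1)) C hC
  have hz : z ∈ (Quot.mk (P.Glued (stdSimplex ℝ (Fin (n + 1)))) '' C)ᶜ := by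
    rintro ⟨⟨i, x⟩, hp, hx⟩
    exact hp (plAt_space_iff.1 h i x hx)
  filter_upwards [hq.isOpen_compl.mem_nhds hz] with u hu
  refine plAt_space_iff.2 fun i x hx => ?_
  by_contra h'
  exact hu ⟨⟨i, x⟩, h', hx⟩

theorem eventually_rad_homogeneous {f : P.Space → ℝ} {v : P.Space} (hv : v ∈ P.vertices) (h : PLAt f v) :
    ∀ᶠ z in 𝓝 v, ∀ t ∈ Icc (0 : ℝ) 1, f (P.rad t z) = f v + t * (f z - f v) := by
  rw [eventually_nhds_iff_pt (permInvariant_stdSimplex _)]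
  rintro i x rfl
  have h0 : minGam x.1 = 0 := tau_eq_zero_iff.2 hv
  obtain ⟨j, hj⟩ := minGam_lt_iff.1 (h0.trans_lt starRadius_pos)
  rw [minGam_eq x.2 hj, gam_eq_zero_iff x.2] at h0
  filter_upwards [(isSel_comp_pt h).homogeneous (convex_stdSimplex ℝ (Fin (n + 1))),
    ((continuous_gam j).comp continuous_subtype_val).continuousAt.eventually (Iio_mem_nhds hj)]
    with x' h1 h2 t ht
  have h3 : gam j x'.1 < starRadius (Fin (n + 1)) := h2
  have h4 : t * gam j x'.1 < starRadius (Fin (n + 1)) :=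
    (mul_le_of_le_one_left (gam_nonneg j _) ht.2).trans_lt h3
  rw [rad_pt ht.1 i x' h3 h4]
  exact h1 _ t ht (by rw [h0])

variable (P) in
/-- A PL homeomorphism from the link of `v` to the boundary of a simplex, as a map which is defined
on the whole space. -/
structure LinkChart (v : P.Space) where
  toFun : P.Space → Fin (n + 1) → ℝ
  mem : ∀ z ∈ P.link v, toFun z ∈ stdSimplex ℝ (Fin (n + 1)) ∧ ∃ l, toFun z l = 0
  injOn : InjOn toFun (P.link v)
  surjOn : ∀ x ∈ stdSimplex ℝ (Fin (n + 1)), (∃ l, x l = 0) → ∃ z ∈ P.link v, toFun z = x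
  plAt : ∀ z ∈ P.link v, ∀ l, ∃ f, PLAt f z ∧ ∀ᶠ u in 𝓝 z, u ∈ P.link v → toFun u l = f u

theorem nonempty_linkChart {v : P.Space} {B : Type*} [TopologicalSpace B] [PLStructure B]
    {i : B → P.Space} (hi : IsPLEmbedding i) (hr : range i = P.link v)
    (hB : PLHomeomorphic B (PLSphere n)) (hne : Nonempty B) : Nonempty (P.LinkChart v) := by
  obtain ⟨H, h1, -⟩ := hB
  have hl := Function.leftInverse_invFun hi.isEmbedding.injective
  have hval : ∀ b, (H (Function.invFun i (i b))).1 = (H b).1 := fun b => by rw [hl]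
  refine ⟨⟨fun z => (H (Function.invFun i z)).1, fun z _ => (H _).2, ?_, ?_, ?_⟩⟩
  · intro z hz z' hz' h
    rw [← hr] at hz hz'
    obtain ⟨b, rfl⟩ := hz
    obtain ⟨b', rfl⟩ := hz'
    simp only [hval] at h
    rw [H.injective (Subtype.ext h)]
  · intro x hx hx0
    exact ⟨i (H.symm ⟨x, hx, hx0⟩), hr ▸ mem_range_self _, by simp only [hval, H.apply_symm_apply]⟩
  · intro z hz l
    rw [← hr] at hz
    obtain ⟨b, rfl⟩ := hz
    have h2 : IsPLMapAt (fun b => (H b).1) b := IsPLMapAt.comp (f := H)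
      ((isPLEmbedding_val fun x : Fin (n + 1) → ℝ =>
        x ∈ stdSimplex ℝ (Fin (n + 1)) ∧ ∃ i, x i = 0).isPLMapAt (H b)) (h1 b)
    obtain ⟨f, hf, hf'⟩ := (hi.plAt_iff _ _).1 (h2.plAt_apply l)
    refine ⟨f, hf, ?_⟩
    have hf'' : ∀ᶠ b' in 𝓝 b, (H b').1 l = f (i b') := hf'
    rw [hi.isEmbedding.nhds_eq_comap, eventually_comap] at hf''
    filter_upwards [hf''] with u hu hul
    rw [← hr] at hul
    obtain ⟨b', rfl⟩ := hul
    rw [hval]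
    exact hu b' rfl

namespace LinkChart

variable {v : P.Space} (c : P.LinkChart v)

/-- The cone over the map `c`. -/
noncomputable def cone (z : P.Space) : Fin (n + 1) → ℝ := P.tau z • c.toFun (P.rad (P.tau z)⁻¹ z)

variable {z : P.Space}

theorem rad_inv_mem_link (h1 : P.tau z < starRadius (Fin (n + 1))) (h0 : 0 < P.tau z)
    (hv : P.rad 0 z = v) : P.rad (P.tau z)⁻¹ z ∈ P.link v := by
  have h2 : (P.tau z)⁻¹ * P.tau z < starRadius (Fin (n + 1)) := by
    rw [inv_mul_cancel₀ h0.ne']; exact one_lt_starRadius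
  refine ⟨by rw [tau_rad (inv_nonneg.2 h0.le) h1 h2, inv_mul_cancel₀ h0.ne'], ?_⟩
  rw [rad_rad le_rfl (inv_nonneg.2 h0.le) h1 h2 (by simpa using starRadius_pos), zero_mul, hv]

/-- On the compact piece of the link finitely many candidates suffice. Coning a candidate `a` gives
`γ * a (e + γ⁻¹ • (x - e)) = γ * a e + (a x - a e)`, which is PL up to and including the vertex `e`.
-/
theorem plAt_cone (h1 : P.tau z < starRadius (Fin (n + 1))) (hv : P.rad 0 z = v) (l : Fin (n + 1)) :
    PLAt (fun z => c.cone z l) z := by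
  refine plAt_space_iff.2 ?_
  rintro i x rfl
  obtain ⟨j, hj⟩ := minGam_lt_iff.1 h1
  rw [rad_zero_pt hj] at hv
  let Δ := stdSimplex ℝ (Fin (n + 1))
  let γ : Δ → ℝ := fun x => gam j x.1
  have hγc : Continuous γ := (continuous_gam j).comp continuous_subtype_val
  have hγ0 : ∀ x, 0 ≤ γ x := fun x => gam_nonneg j _
  let s : Δ → Fin (n + 1) → ℝ := fun x => Pi.single j 1 + (γ x)⁻¹ • (x.1 - Pi.single j 1)
  have hs : ∀ x, 0 < γ x → γ x < starRadius (Fin (n + 1)) → ∃ hm : s x ∈ Δ,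
      P.rad (P.tau (P.pt _ i x))⁻¹ (P.pt _ i x) = P.pt _ i ⟨s x, hm⟩ ∧ gam j (s x) = 1 := by
    intro x h0 hx
    have h3 : (γ x)⁻¹ * gam j x.1 < starRadius (Fin (n + 1)) := by
      rw [inv_mul_cancel₀ h0.ne']; exact one_lt_starRadius
    refine ⟨single_add_smul_mem x.2 (inv_nonneg.2 h0.le) hx h3, ?_, ?_⟩
    · rw [tau_pt_of_lt hx, rad_pt (inv_nonneg.2 h0.le) i x hx h3]
    · simp only [s]
      rw [gam_smul j x.1 (inv_nonneg.2 h0.le)]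
      exact inv_mul_cancel₀ h0.ne'
  have hlink : ∀ x : Δ, gam j x.1 = 1 → P.pt _ i x ∈ P.link v := fun x hx => by
    rw [← hv]
    exact linkPiece_subset i j ⟨x, hx, rfl⟩
  have hK : IsCompact {x : Δ | gam j x.1 = 1} := (isClosed_eq hγc continuous_const).isCompact
  obtain ⟨S, hS, hSu⟩ := exists_finite_selection (j := Subtype.val) hK
    (u := fun x => c.toFun (P.pt _ i x) l) (by
      intro x hx
      obtain ⟨f, hf, hf'⟩ := c.plAt _ (hlink x hx) l
      exact ⟨_, isSel_comp_pt hf, by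
        filter_upwards [(continuous_pt i).continuousAt.eventually hf'] with x' h3 h4
        exact h3 (hlink x' h4)⟩)
  let F : ((Fin (n + 1) → ℝ) →ᵃ[ℝ] ℝ) → Δ → ℝ := fun a x =>
    γ x * a (Pi.single j 1) + (a x.1 - a (Pi.single j 1))
  have hF : ∀ a x, IsSel Subtype.val (F a) x := fun a x =>
    ((isSel_gam (isSel_coord_stdSimplex x) j).mul_const _).add
      ((IsSel.affine continuous_subtype_val a x).sub (IsSel.const _ x))
  -- The candidate `0` is added for the vertex itself, where the cone vanishes.
  have hFsel : ∀ x, γ x < starRadius (Fin (n + 1)) → ∃ a ∈ insert 0 S, c.cone (P.pt _ i x) l = F a x := by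
    intro x hx
    rcases (hγ0 x).eq_or_lt with h0 | h0
    · refine ⟨0, mem_insert _ _, ?_⟩
      have : P.tau (P.pt _ i x) = 0 := (tau_pt_of_lt hx).trans h0.symm
      simp [cone, this, F]
    · obtain ⟨hm, h3, h4⟩ := hs x h0 hx
      obtain ⟨a, ha, h5⟩ := hSu ⟨s x, hm⟩ h4
      refine ⟨a, mem_insert_of_mem _ ha, ?_⟩
      change P.tau (P.pt _ i x) * c.toFun (P.rad (P.tau (P.pt _ i x))⁻¹ (P.pt _ i x)) l = _
      rw [h3, h5, tau_pt_of_lt hx]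
      simp only [s, affine_add_smul_sub, F]
      change γ x * _ = _
      field_simp
  refine IsSel.of_selection (F := F) (hS.insert 0) (fun a _ => hF a x) ?_
  filter_upwards [hγc.continuousAt.eventually (Iio_mem_nhds hj), hγc.continuousAt.eventually_lt
    continuousAt_const hj |>.eventually_nhds] with x hx hx'
  refine ⟨?_, hFsel x hx⟩
  -- Continuity: at the vertex all coned candidates vanish; elsewhere the cone is locally the
  -- product of `γ` with a PL function composed with a continuous radial projection.
  rcases (hγ0 x).eq_or_lt with h0 | h0
  · have hF0 : ∀ a, F a x = 0 := by
      intro a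
      simp only [F, ← h0, (gam_eq_zero_iff x.2).1 h0.symm]
      ring
    obtain ⟨a, -, ha⟩ := hFsel x hx
    rw [ContinuousAt, ha, hF0]
    intro U hU
    have h3 : ∀ᶠ x' in 𝓝 x, ∀ a ∈ insert 0 S, F a x' ∈ U := by
      refine (eventually_all_finite (hS.insert 0)).2 fun a _ => (hF a x).continuousAt ?_
      rwa [hF0]
    rw [mem_map]
    filter_upwards [h3, hx'] with x' h4 h5
    obtain ⟨a, ha, h6⟩ := hFsel x' h5
    rw [mem_preimage, h6]
    exact h4 a ha
  · obtain ⟨hm, h3, h4⟩ := hs x h0 hx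
    obtain ⟨f, hf, hf'⟩ := c.plAt _ (hlink ⟨s x, hm⟩ h4) l
    have hsc : ContinuousAt s x := by
      have : ContinuousAt (fun x => (γ x)⁻¹) x := hγc.continuousAt.inv₀ h0.ne'
      exact continuousAt_const.add (this.smul (continuous_subtype_val.sub continuous_const).continuousAt)
    have hrc : Tendsto (fun x => P.rad (P.tau (P.pt _ i x))⁻¹ (P.pt _ i x)) (𝓝 x)
        (𝓝 (P.pt _ i ⟨s x, hm⟩)) := by
      intro U hU
      rw [mem_map]
      have hev : ∀ᶠ x' in 𝓝 x, ∀ h : s x' ∈ stdSimplex ℝ (Fin (n + 1)), P.pt _ i ⟨s x', h⟩ ∈ U :=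
        eventually_mk_mem (A := stdSimplex ℝ (Fin (n + 1))) (x := ⟨s x, hm⟩) hsc rfl
          ((continuous_pt i).continuousAt.preimage_mem_nhds hU)
      filter_upwards [hev, hx',
        hγc.continuousAt.eventually (Ioi_mem_nhds h0)] with x' h5 h6 h7
      obtain ⟨hm', h8, -⟩ := hs x' h7 h6
      rw [mem_preimage, h8]
      exact h5 hm'
    have h5 : ContinuousAt (fun x => γ x * f (P.rad (P.tau (P.pt _ i x))⁻¹ (P.pt _ i x))) x := by
      refine hγc.continuousAt.mul ?_
      have := (continuousAt_of_plAt hf).tendsto.comp hrc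
      rw [ContinuousAt, h3]
      exact this
    refine h5.congr ?_
    filter_upwards [hrc.eventually hf', hx', hγc.continuousAt.eventually (Ioi_mem_nhds h0)] with x' h6 h7 h8
    obtain ⟨hm', h9, h10⟩ := hs x' h8 h7
    rw [← h6 (by rw [h9]; exact hlink ⟨s x', hm'⟩ h10)]
    change _ = P.tau (P.pt _ i x') * _
    rw [tau_pt_of_lt h7]

end LinkChart

end FacePairing

/-! ### Charts around vertices -/

namespace FacePairing

open SimplicialFan

variable {k n : ℕ} {P : FacePairing k n}

namespace LinkChart

variable {v : P.Space} (c : P.LinkChart v) {z z' : P.Space}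

/-- The map to `ℝ^n` that is given by the cone over `c`. -/
noncomputable def chart (z : P.Space) : Fin n → ℝ := stdVec (c.cone z)

theorem isPLMapAt_chart (h1 : P.tau z < starRadius (Fin (n + 1))) (hv : P.rad 0 z = v) :
    IsPLMapAt c.chart z := by
  refine isPLMapAt_of_plAt fun l => plAt_space_iff.2 ?_
  rintro i x rfl
  exact (isSel_comp_pt (c.plAt_cone h1 hv l.succ)).sub (isSel_comp_pt (c.plAt_cone h1 hv 0))

theorem cone_mem (h1 : P.tau z < starRadius (Fin (n + 1))) (hv : P.rad 0 z = v) :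
    (∀ l, 0 ≤ c.cone z l) ∧ (∃ l, c.cone z l = 0) ∧ ∑ l, c.cone z l = P.tau z := by
  rcases (tau_nonneg z).eq_or_lt with h0 | h0
  · simp [cone, ← h0]
  · obtain ⟨h2, l, h3⟩ := c.mem _ (rad_inv_mem_link h1 h0 hv)
    refine ⟨fun l => mul_nonneg h0.le (h2.1 l), ⟨l, by simp [cone, h3]⟩, ?_⟩
    simp only [cone, Pi.smul_apply, smul_eq_mul, ← Finset.mul_sum, h2.2, mul_one]

theorem stdCoord_chart (h1 : P.tau z < starRadius (Fin (n + 1))) (hv : P.rad 0 z = v) :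
    stdCoord (c.chart z) = c.cone z :=
  stdCoord_stdVec (c.cone_mem h1 hv).1 (c.cone_mem h1 hv).2.1

theorem stdGauge_chart (h1 : P.tau z < starRadius (Fin (n + 1))) (hv : P.rad 0 z = v) :
    stdGauge (c.chart z) = P.tau z := by
  rw [stdGauge, c.stdCoord_chart h1 hv, (c.cone_mem h1 hv).2.2]

theorem chart_injOn (h1 : P.tau z < starRadius (Fin (n + 1))) (hv : P.rad 0 z = v)
    (h1' : P.tau z' < starRadius (Fin (n + 1))) (hv' : P.rad 0 z' = v) (h : c.chart z = c.chart z') :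
    z = z' := by
  have ht : P.tau z = P.tau z' := by rw [← c.stdGauge_chart h1 hv, h, c.stdGauge_chart h1' hv']
  rcases (tau_nonneg z).eq_or_lt with h0 | h0
  · have e : ∀ {z : P.Space}, 0 = P.tau z → P.rad 0 z = v → z = v := fun h0 hv => by
      rw [← hv, rad_of_mem_vertices (tau_eq_zero_iff.1 h0.symm)]
    rw [e h0 hv, e (h0.trans ht) hv']
  · have h2 : c.cone z = c.cone z' := by rw [← c.stdCoord_chart h1 hv, h, c.stdCoord_chart h1' hv']
    have h3 : c.toFun (P.rad (P.tau z)⁻¹ z) = c.toFun (P.rad (P.tau z)⁻¹ z') := by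
      refine smul_right_injective _ h0.ne' ?_
      simp only [cone, ← ht] at h2
      exact h2
    have h4 := c.injOn (rad_inv_mem_link h1 h0 hv)
      (ht ▸ rad_inv_mem_link h1' (h0.trans_eq ht) hv') h3
    have e : ∀ {z' : P.Space}, P.tau z' = P.tau z → P.rad (P.tau z) (P.rad (P.tau z)⁻¹ z') = z' := by
      intro z' hz'
      rw [rad_rad h0.le (inv_nonneg.2 h0.le) (by rwa [hz']) (by
        rw [hz', inv_mul_cancel₀ h0.ne']; exact one_lt_starRadius)
        (by rwa [mul_inv_cancel₀ h0.ne', one_mul, hz']), mul_inv_cancel₀ h0.ne', rad_one]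
    rw [← e rfl, h4, e ht.symm]

theorem chart_rad {t : ℝ} (ht : 0 < t) (h1 : P.tau z < starRadius (Fin (n + 1)))
    (h2 : t * P.tau z < starRadius (Fin (n + 1))) : c.chart (P.rad t z) = t • c.chart z := by
  rw [chart, chart, ← stdVec_smul, cone, cone, tau_rad ht.le h1 h2, smul_smul]
  rcases (tau_nonneg z).eq_or_lt with h0 | h0
  · simp [← h0]
  · rw [rad_rad (inv_nonneg.2 (mul_pos ht h0).le) ht.le h1 h2]
    · congr 4
      field_simp
    · have : (t * P.tau z)⁻¹ * t * P.tau z = 1 := by field_simp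
      rw [this]
      exact one_lt_starRadius

theorem exists_chart_eq (hv : v ∈ P.vertices) {y : Fin n → ℝ} (hy : stdGauge y < starRadius (Fin (n + 1))) :
    ∃ z, P.tau z < starRadius (Fin (n + 1)) ∧ P.rad 0 z = v ∧ c.chart z = y := by
  rcases eq_or_ne y 0 with rfl | h0
  · have h1 := tau_eq_zero_iff.2 hv
    refine ⟨v, h1.trans_lt starRadius_pos, rad_of_mem_vertices hv 0, ?_⟩
    simp [chart, cone, h1, stdVec_zero]
  · have hpos := stdGauge_pos h0
    obtain ⟨j, hj⟩ := exists_stdCoord_eq_zero y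
    obtain ⟨z, hz, hzx⟩ := c.surjOn ((stdGauge y)⁻¹ • stdCoord y)
      ⟨fun l => mul_nonneg (inv_nonneg.2 hpos.le) (stdCoord_nonneg _ _), by
        simp only [Pi.smul_apply, smul_eq_mul, ← Finset.mul_sum]
        exact inv_mul_cancel₀ hpos.ne'⟩ ⟨j, by simp [hj]⟩
    have h1 : P.tau z < starRadius (Fin (n + 1)) := hz.1.trans_lt one_lt_starRadius
    have h2 : stdGauge y * P.tau z < starRadius (Fin (n + 1)) := by rwa [hz.1, mul_one]
    refine ⟨P.rad (stdGauge y) z, by rwa [tau_rad hpos.le h1 h2],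
      by rw [rad_rad le_rfl hpos.le h1 h2 (by simpa using starRadius_pos), zero_mul, hz.2], ?_⟩
    rw [c.chart_rad hpos h1 h2, chart, cone, hz.1, inv_one, rad_one, one_smul, hzx, stdVec_smul,
      smul_smul, mul_inv_cancel₀ hpos.ne', one_smul, stdVec_stdCoord]

theorem _root_.SimplicialFan.isCompact_stdGauge_eq (m : ℕ) (ε : ℝ) :
    IsCompact {y : Fin m → ℝ | stdGauge y = ε} := by
  refine Metric.isCompact_of_isClosed_isBounded (isClosed_eq continuous_stdGauge continuous_const) ?_
  refine (Metric.isBounded_closedBall (x := (0 : Fin m → ℝ)) (r := ε)).subset ?_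
  rintro y rfl
  rw [mem_closedBall_zero_iff, pi_norm_le_iff_of_nonneg (stdGauge_nonneg y)]
  intro l
  have h0 := stdCoord_nonneg y
  have h1 : ∀ j, stdCoord y j ≤ stdGauge y := fun j =>
    Finset.single_le_sum (fun j _ => h0 j) (Finset.mem_univ j)
  have h2 : y l = stdCoord y l.succ - stdCoord y 0 := (congrFun (stdVec_stdCoord y) l).symm
  rw [Real.norm_eq_abs, abs_le]
  constructor
  · linarith [h1 0, h0 l.succ]
  · linarith [h1 l.succ, h0 0]

/-- The coned map is PL with a set-theoretic inverse `r` on the unit ball of the gauge, and only `r`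
requires work: continuity comes from compactness, piecewise linearity off the vertex from charts of
`X^*` and `isSel_of_inverse`, and at the vertex from homogeneity. -/
theorem exists_isPLChart (c : P.LinkChart v) (hv : v ∈ P.vertices)
    (hX : ∀ z : P.Space, 0 < P.tau z → ∃ (f : P.Space → Fin n → ℝ) (g : (Fin n → ℝ) → P.Space),
      IsPLChart f g z) :
    ∃ (f : P.Space → Fin n → ℝ) (g : (Fin n → ℝ) → P.Space), IsPLChart f g v := by
  have hg1 := one_lt_starRadius (K := Fin (n + 1))
  have hτv := tau_eq_zero_iff.2 hv
  have hex : ∀ y : Fin n → ℝ, ∃ z, stdGauge y < 1 → (P.tau z = stdGauge y ∧ P.rad 0 z = v) ∧ c.chart z = y := by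
    intro y
    by_cases hy : stdGauge y < 1
    · obtain ⟨z, h1, h2, rfl⟩ := c.exists_chart_eq hv (hy.trans hg1)
      exact ⟨z, fun _ => ⟨⟨(c.stdGauge_chart h1 h2).symm, h2⟩, rfl⟩⟩
    · exact ⟨v, fun h => absurd h hy⟩
  choose r hr using hex
  have hrτ : ∀ y, stdGauge y < 1 → P.tau (r y) < starRadius (Fin (n + 1)) := fun y hy => by
    rw [(hr y hy).1.1]; exact hy.trans hg1
  have hopen : IsOpen {y : Fin n → ℝ | stdGauge y < 1} := isOpen_lt continuous_stdGauge continuous_const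
  have hinv : ∀ z, P.tau z < 1 → P.rad 0 z = v → r (c.chart z) = z := by
    intro z hz hz'
    have h1 : stdGauge (c.chart z) < 1 := by rwa [c.stdGauge_chart (hz.trans hg1) hz']
    exact c.chart_injOn (hrτ _ h1) (hr _ h1).1.2 (hz.trans hg1) hz' (hr _ h1).2
  -- The part of the compact cone outside an open set has compact, hence closed, image under the
  -- chart.
  have hrc : ∀ y, stdGauge y < 1 → ContinuousAt r y := by
    intro y hy U hU
    rw [mem_map]
    have hK := (isCompact_setOf_rad_zero_eq v).diff (isOpen_interior (s := U))
    have hcl : IsClosed (c.chart '' ({z | P.tau z ≤ 1 ∧ P.rad 0 z = v} \ interior U)) := by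
      refine (hK.image_of_continuousOn fun z hz => ?_).isClosed
      exact (c.isPLMapAt_chart (hz.1.1.trans_lt hg1) hz.1.2).1.continuousWithinAt
    have hy' : y ∈ (c.chart '' ({z | P.tau z ≤ 1 ∧ P.rad 0 z = v} \ interior U))ᶜ := by
      rintro ⟨z, ⟨⟨h1, h2⟩, h3⟩, rfl⟩
      rw [c.stdGauge_chart (h1.trans_lt hg1) h2] at hy
      rw [hinv z hy h2] at hU
      exact h3 (mem_interior_iff_mem_nhds.2 hU)
    filter_upwards [hcl.isOpen_compl.mem_nhds hy', hopen.mem_nhds hy] with y' h1 h2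
    by_contra h3
    refine h1 ⟨r y', ⟨⟨?_, (hr y' h2).1.2⟩, fun h4 => h3 (show r y' ∈ U from interior_subset h4)⟩, (hr y' h2).2⟩
    rw [(hr y' h2).1.1]
    exact le_of_lt h2
  have hrpl : ∀ y, stdGauge y < 1 → y ≠ 0 → IsPLMapAt r y := by
    intro y hy hy0
    have hpos : 0 < P.tau (r y) := by rw [(hr y hy).1.1]; exact stdGauge_pos hy0
    obtain ⟨f, g, hfg⟩ := hX _ hpos
    have e0 : c.chart (g (f (r y))) = y := by rw [hfg.left_inv, (hr y hy).2]
    have h1 : IsPLMapAt (fun p => c.chart (g p)) (f (r y)) := by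
      refine IsPLMapAt.comp ?_ hfg.symm.isPLMapAt
      rw [hfg.left_inv]
      exact c.isPLMapAt_chart (hrτ y hy) (hr y hy).1.2
    have h2 := isSel_of_inverse (f := fun p => c.chart (g p)) (g := fun q => f (r q)) (p := f (r y))
      (fun l => isSel_of_isPLMapAt h1 l) (by
        rw [e0]
        filter_upwards [hopen.mem_nhds hy, (hrc y hy).eventually hfg.1] with q h3 h4
        exact ⟨ContinuousAt.comp (f := r) h4.1.1 (hrc q h3), by rw [h4.2, (hr q h3).2]⟩)
      (by rw [e0])
    rw [e0] at h2
    have h3 : IsPLMapAt (fun q => g (f (r q))) y :=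
      IsPLMapAt.comp (f := fun q => f (r q)) hfg.symm.isPLMapAt (isPLMapAt_pi h2)
    refine h3.congr ?_
    filter_upwards [(hrc y hy).eventually hfg.1] with q h4 using h4.2
  have hr0 : r 0 = v := by
    have h1 : stdGauge (0 : Fin n → ℝ) = 0 := stdGauge_eq_zero_iff.2 rfl
    obtain ⟨⟨h2, h3⟩, -⟩ := hr 0 (by rw [h1]; exact one_pos)
    rw [← h3, rad_of_mem_vertices (tau_eq_zero_iff.1 (h2.trans h1))]
  have h01 : stdGauge (0 : Fin n → ℝ) < 1 := by rw [stdGauge_eq_zero_iff.2 rfl]; exact one_pos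
  -- Near `v` a PL function `G` is affine along dilatations, so `G ∘ r` is determined by its values
  -- on one level set of the gauge, where finitely many candidates suffice.
  have hrpl0 : IsPLMapAt r 0 := by
    refine ⟨hrc 0 h01, fun G hG => plAt_iff_isSel.2 ?_⟩
    rw [hr0] at hG
    obtain ⟨ε, hε, hε'⟩ := exists_forall_mem_of_mem_nhds
      ((eventually_plAt hG).and (eventually_rad_homogeneous hv hG))
    obtain ⟨δ, hδ, hδ'⟩ := exists_between (lt_min hε one_pos)
    have hδε := hδ'.trans_le (min_le_left _ _)
    have hδ1 := hδ'.trans_le (min_le_right _ _)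
    have hgood : ∀ y : Fin n → ℝ, stdGauge y ≤ δ → PLAt G (r y) ∧
        ∀ t ∈ Icc (0 : ℝ) 1, G (P.rad t (r y)) = G v + t * (G (r y) - G v) := by
      intro y hy
      have h1 := hr y (hy.trans_lt hδ1)
      exact hε' (r y) (by rw [h1.1.1]; exact hy.trans_lt hδε) h1.1.2
    obtain ⟨S, hS, hSu⟩ := exists_finite_selection (j := id) (isCompact_stdGauge_eq n δ)
      (u := fun y => G (r y)) (by
        intro y (hy : stdGauge y = δ)
        have hy0 : y ≠ 0 := by
          rintro rfl
          rw [stdGauge_eq_zero_iff.2 rfl] at hy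
          exact hδ.ne hy
        refine ⟨_, plAt_iff_isSel.1 ((hrpl y (by rwa [hy]) hy0).2 G (hgood y hy.le).1), ?_⟩
        exact Eventually.of_forall fun _ _ => rfl)
    -- With `t = stdGauge y / δ`, the expression is `G v + t * (a (t⁻¹ • y) - G v)` after expanding
    -- the affine function `a`. The added candidate `0` serves the point `y = 0`.
    refine IsSel.of_selection (hS.insert 0)
      (F := fun a y => G v + (stdGauge y * δ⁻¹) * (a 0 - G v) + (a y - a 0)) (fun a _ => ?_) ?_
    · exact ((IsSel.const _ _).add (((isSel_stdGauge 0).mul_const _).mul_const _)).add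
        ((IsSel.affine (j := id) continuous_id a 0).sub (IsSel.const _ 0))
    · have hδ0 : ∀ᶠ y in 𝓝 (0 : Fin n → ℝ), stdGauge y < δ :=
        continuous_stdGauge.continuousAt.eventually (Iio_mem_nhds (by
          rwa [stdGauge_eq_zero_iff.2 rfl]))
      filter_upwards [hδ0] with y hy
      have hy1 : stdGauge y < 1 := hy.trans hδ1
      refine ⟨ContinuousAt.comp (f := r) (continuousAt_of_plAt (hgood y hy.le).1) (hrc y hy1), ?_⟩
      rcases eq_or_ne y 0 with rfl | hy0
      · refine ⟨0, mem_insert _ _, ?_⟩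
        simp [hr0, stdGauge_eq_zero_iff.2 rfl]
      have hpos := stdGauge_pos hy0
      set t := stdGauge y * δ⁻¹ with ht
      have ht0 : 0 < t := mul_pos hpos (inv_pos.2 hδ)
      have ht1 : t ≤ 1 := by
        rw [ht, ← div_eq_mul_inv, div_le_one hδ]
        exact hy.le
      have hgy : stdGauge (t⁻¹ • y) = δ := by
        rw [stdGauge_smul (inv_nonneg.2 ht0.le), ht]
        field_simp
      have hy' : stdGauge (t⁻¹ • y) < 1 := by rwa [hgy]
      obtain ⟨a, ha, h1⟩ := hSu (t⁻¹ • y) hgy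
      refine ⟨a, mem_insert_of_mem _ ha, ?_⟩
      obtain ⟨⟨h2, h3⟩, h4⟩ := hr _ hy'
      have h5 : t * P.tau (r (t⁻¹ • y)) < 1 := by
        rw [h2, hgy]
        exact (mul_le_of_le_one_left hδ.le ht1).trans_lt hδ1
      have h6 : r y = P.rad t (r (t⁻¹ • y)) := by
        have h7 := c.chart_rad ht0 (hrτ _ hy') (h5.trans hg1)
        rw [h4, smul_smul, mul_inv_cancel₀ ht0.ne', one_smul] at h7
        refine (congrArg r h7.symm).trans (hinv _ ?_ ?_)
        · rwa [tau_rad ht0.le (hrτ _ hy') (h5.trans hg1)]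
        · rw [rad_rad le_rfl ht0.le (hrτ _ hy') (h5.trans hg1) (by simpa using starRadius_pos),
            zero_mul, h3]
      change G (r y) = _
      rw [h6, (hgood _ hgy.le).2 t ⟨ht0.le, ht1⟩, h1]
      have h7 : a (t⁻¹ • y) = a 0 + t⁻¹ * (a y - a 0) := by
        have := affine_add_smul_sub a 0 y t⁻¹
        simpa using this
      change _ + t * (a (t⁻¹ • y) - G v) = _
      rw [h7]
      field_simp
      ring
  refine ⟨c.chart, r, ?_, ?_⟩
  · filter_upwards [eventually_rad_zero_eq_of_mem_vertices hv,
      continuous_tau.continuousAt.eventually (Iio_mem_nhds (hτv.trans_lt one_pos))] with z h1 h2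
    exact ⟨c.isPLMapAt_chart (lt_trans h2 hg1) h1.1, hinv z h2 h1.1⟩
  · have e0 : c.chart v = 0 := by simp [chart, cone, hτv, stdVec_zero]
    rw [e0]
    filter_upwards [hopen.mem_nhds h01] with y hy
    refine ⟨?_, (hr y hy).2⟩
    rcases eq_or_ne y 0 with rfl | hy0
    · exact hrpl0
    · exact hrpl y hy hy0

end LinkChart

end FacePairing

/-! ### Boundary components and the main theorem -/

namespace FacePairing

variable {k n : ℕ} {P : FacePairing k n}

theorem link_nonempty (hn : 2 ≤ n) {v : P.Space} (hv : v ∈ P.vertices) : (P.link v).Nonempty := by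
  obtain ⟨⟨i, j⟩, rfl⟩ := hv
  obtain ⟨x, hx, -⟩ := exists_gam_eq_one_face hn (j := j) (v := j)
  exact ⟨_, linkPiece_subset i j ⟨x, hx, rfl⟩⟩

variable [NeZero n]

theorem isPLEmbedding_trunc_plBoundary :
    IsPLEmbedding fun y : plBoundary n P.TruncatedSpace => P.trunc y.1 :=
  isPLEmbedding_trunc.comp (isPLEmbedding_val fun y => y ∈ plBoundary n P.TruncatedSpace)

theorem range_trunc_plBoundary (h : IsPLManifold n P.PuncturedSpace) :
    range (fun y : plBoundary n P.TruncatedSpace => P.trunc y.1) = {z | P.tau z = 1} := by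
  ext z
  constructor
  · rintro ⟨y, rfl⟩
    exact (plBoundary_truncatedSpace h).le y.2
  · intro (hz : P.tau z = 1)
    obtain ⟨y, rfl⟩ := exists_trunc_eq hz.ge
    exact ⟨⟨y, by rw [plBoundary_truncatedSpace h]; exact hz⟩, rfl⟩

/-- Components of the boundary are links of vertices. A chart at a vertex makes its link a sphere,
and a spherical link is coned off to a chart at the vertex. -/
theorem isClosedPLManifold_space_iff (hn : 2 ≤ n) : IsClosedPLManifold n P.Space ↔
    IsCompactPLManifoldWithBoundary n P.TruncatedSpace ∧
      ∀ x : ↥(plBoundary n P.TruncatedSpace), PLHomeomorphic ↥(connectedComponent x) (PLSphere n) := by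
  have hemb : ∀ x : plBoundary n P.TruncatedSpace,
      IsPLEmbedding fun c : connectedComponent x => P.trunc c.1.1 := fun x =>
    isPLEmbedding_trunc_plBoundary.comp (isPLEmbedding_val fun c => c ∈ connectedComponent x)
  constructor
  · rintro ⟨-, -, -, hX⟩
    have hX' := fun z => exists_isPLLocalHomeo_iff.1 (hX z)
    have hM : IsPLManifold n P.PuncturedSpace := isPLManifold_puncturedSpace_iff.2 fun z _ => hX' z
    refine ⟨isCompactPLManifoldWithBoundary_truncatedSpace hM, fun x => ?_⟩
    have hx : P.tau (P.trunc x.1) = 1 := (range_trunc_plBoundary hM).le (mem_range_self x)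
    obtain ⟨f, g, h⟩ := hX' (P.rad 0 (P.trunc x.1))
    exact plHomeomorphic_link (rad_zero_mem_vertices (hx.trans_lt one_lt_starRadius)) h (hemb x)
      (range_connectedComponent hn isPLEmbedding_trunc_plBoundary.isEmbedding
        (range_trunc_plBoundary hM) x)
  · rintro ⟨hT, hS⟩
    have hM := isPLManifold_puncturedSpace_of_truncatedSpace hT
    have hX := isPLManifold_puncturedSpace_iff.1 hM
    refine ⟨inferInstance, inferInstance, inferInstance, fun z => exists_isPLLocalHomeo_iff.2 ?_⟩
    by_cases hz : z ∈ P.vertices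
    · obtain ⟨u, hu⟩ := link_nonempty hn hz
      obtain ⟨x, rfl⟩ := (range_trunc_plBoundary hM).ge hu.1
      have hr := range_connectedComponent hn isPLEmbedding_trunc_plBoundary.isEmbedding
        (range_trunc_plBoundary hM) x
      rw [show P.rad 0 (P.trunc x.1) = z from hu.2] at hr
      obtain ⟨c⟩ := nonempty_linkChart (hemb x) hr (hS x) ⟨⟨x, mem_connectedComponent⟩⟩
      exact c.exists_isPLChart hz hX
    · exact hX z (tau_pos_iff.2 hz)

end FacePairing

theorem mainTheorem5 (n : ℕ) [NeZero n] (k : ℕ) (P : FacePairing k n) :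
    ((IsOpenPLManifold n P.PuncturedSpace ↔
        IsCompactPLManifoldWithBoundary n P.TruncatedSpace) ∧
      (IsCompactPLManifoldWithBoundary n P.TruncatedSpace →
        PLHomeomorphic P.PuncturedSpace ↥(plBoundary n P.TruncatedSpace)ᶜ)) ∧
    (2 ≤ n →
      (IsClosedPLManifold n P.Space ↔
        IsCompactPLManifoldWithBoundary n P.TruncatedSpace ∧
          ∀ x : ↥(plBoundary n P.TruncatedSpace),
            PLHomeomorphic ↥(connectedComponent x) (PLSphere n))) := by
  refine ⟨⟨?_, fun h => ?_⟩, fun hn => FacePairing.isClosedPLManifold_space_iff hn⟩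
  · rw [FacePairing.isOpenPLManifold_puncturedSpace_iff,
      FacePairing.isPLManifold_puncturedSpace_iff_truncatedSpace]
  · exact FacePairing.plHomeomorphic_compl_plBoundary
      (FacePairing.isPLManifold_puncturedSpace_of_truncatedSpace h)
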